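/- Let $F$ be a compact connected oriented surface of genus $g$ with $r\ge 0$ boundary components such that $3g-3+r>0$, and let $\mathsf k\neq 0$ be a commutative ring containing $\mathbb Q$. Let $\mathfrak C(F)$ be the set of isotopy classes of closed $1$-dimensional submanifolds of the interior of $F$ without inessential components. For a link diagram $D$ on $F$ put $$\langle D\rangle=\sum_{\sigma}(-t)^{\zeta(\sigma)-\iota(\sigma)}(-t^2-t^{-2})^{\mu(\sigma)}D(\sigma),\qquad t=e^h,$$ where $\sigma$ runs over the Kauffman states of $D$ (a marker $0$ or $\infty$ at every crossing), $\zeta(\sigma)$ and $\iota(\sigma)$ are the numbers of $0$- and $\infty$-markers, $\mu(\sigma)$ is the number of inessential circles of the smoothed diagram, and $D(\sigma)\in\mathfrak C(F)$ consists of its essential circles. Write $\langle D\rangle_j\in\mathsf k\mathfrak C(F)$ for the coefficient of $h^j$. For curve systems $\alpha,\beta$ let $\alpha\triangleright\beta$ be a diagram with $\alpha$ lying over $\beta$, and let $\lambda_j$ be the $\mathsf k$-bilinear maps on $\mathsf k\mathfrak C(F)$ with $\lambda_j(\alpha,\beta)=\langle\alpha\triangleright\beta\rangle_j$. The product of the algebra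 $A=\mathsf k\mathfrak C(F)$ is $\lambda_0$. Differential operators on $A$ are meant in the sense of Grothendieck: those of order $\le 0$ are the multiplications by elements of $A$, and $f\in\mathrm{End}_{\mathsf k}(A)$ has order $\le p+1$ if $fa-af$ has order $\le p$ for all $a\in A$. (1) There is $\gamma\in\mathfrak C(F)$ such that $\lambda_2(\gamma,\cdot)$ is not a differential operator of order $\le 2$, and there is $\gamma\in\mathfrak C(F)$ such that $\lambda_2(\cdot,\gamma)$ is not a differential operator of order $\le 2$. (2) The obstruction is the loop correction term. Let $\varphi_j(i)$ be the coefficient of $h^{2j}$ in $(-e^{2h}-e^{-2h})^i$. For a diagram $D$ with $c$ crossings that consists of a closed $1$-submanifold lying over another one, and a set $C$ of its crossings, put $$\varphi_1(D)=(-1)^{c}\sum_\sigma\varphi_1(\mu(\sigma))D(\sigma),\qquad \Phi(D,C)=(-1)^{c}\sum_\sigma\Big(\sum_{T\subseteq C,\,|T|=2}(-1)^{\iota(\sigma|_T)}+\tfrac12|C|\Big)\varphi_0(\mu(\sigma))D(\sigma),$$ so that $\Phi(D,C)$ is $\varphi_0\chi_{P_2}[D,C]$ with $P_2=w^2-zw+z^2+\frac12(w+z)$.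 (a) $\langle D\rangle_2=\Phi(D,C)+\varphi_1(D)$ for every such $D$, with $C$ the set of all crossings of $D$. (b) If the components of the lower submanifold of $D$ are distributed over three parts, and $C_S$ is the set of crossings of the upper submanifold with the parts in $S\subseteq\{1,2,3\}$, then $\sum_{S}(-1)^{|S|}\Phi(D,C_S)=0$. (So the first term satisfies the commutator condition of order $\le 2$ on diagrams.) (c) There are a curve system $\gamma$ and a curve system $N$ whose components are distributed over three parts, with $N_S$ the union of the parts in $S\subseteq\{1,2,3\}$, and diagrams $\gamma\triangleright N_S$, such that $$\sum_{S}(-1)^{|S|}\,N_{S^c}\cdot\varphi_1(\gamma\triangleright N_S)\neq 0.$$ (So the loop correction term does not satisfy the commutator condition: the commutators of $\varphi_1(\gamma\triangleright\,\cdot\,)$ with elements of $A$ are not all of order $\le 1$.) -/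

import Mathlib

open scoped PowerSeries

/-! ## Surfaces

A compact connected oriented surface is presented as an oriented polygon whose sides, numbered
counterclockwise, are glued in pairs in an orientation compatible way (side `s` is glued to the
side `glue s` with reversed direction), with an open disc removed around each vertex that is marked
as a hole.  Corner `s` of the polygon is the initial point of side `s`. -/

structure PolygonSurface where
  sides : ℕ
  glue : Fin sides → Fin sides
  glue_glue : ∀ s, glue (glue s) = s
  glue_ne : ∀ s, glue s ≠ s
  hole : Fin sides → Prop
  hole_turn : ∀ s, hole (finRotate sides (glue s)) ↔ hole s

namespace PolygonSurface

variable (F : PolygonSurface)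

/-- The initial point of side `s` is glued to the end point of side `glue s`, that is, to the corner
following it.  The orbits of `turn` are the vertices of the glued surface. -/
def turn (s : Fin F.sides) : Fin F.sides := finRotate F.sides (F.glue s)

/-- The two corners are the same point of the glued surface. -/
def SameVertex (c d : Fin F.sides) : Prop := ∃ j : ℕ, F.turn^[j] c = d

end PolygonSurface

/-- The side that is glued to the side number `i` of the polygon with boundary word
`a₁ b₁ a₁⁻¹ b₁⁻¹ ⋯ a_g b_g a_g⁻¹ b_g⁻¹ c₁ c₁⁻¹ ⋯ c_r c_r⁻¹`. -/
def standardGlue (g i : ℕ) : ℕ :=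
  if i < 4 * g then (if i % 4 < 2 then i + 2 else i - 2)
  else (if i % 2 = 0 then i + 1 else i - 1)

theorem standardGlue_lt {g r i : ℕ} (h : i < 4 * g + 2 * r) :
    standardGlue g i < 4 * g + 2 * r := by
  unfold standardGlue; split_ifs <;> omega

theorem standardGlue_standardGlue (g i : ℕ) : standardGlue g (standardGlue g i) = i := by
  unfold standardGlue; split_ifs <;> omega

theorem standardGlue_ne (g i : ℕ) : standardGlue g i ≠ i := by
  unfold standardGlue; split_ifs <;> omega

theorem finRotate_val {n : ℕ} (i : Fin n) :
    (finRotate n i).val = if i.val + 1 = n then 0 else i.val + 1 := by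
  cases n with
  | zero => exact i.elim0
  | succ n =>
    rw [coe_finRotate]
    simp only [Fin.ext_iff, Fin.val_last, Nat.add_right_cancel_iff]

/-- The compact connected oriented surface of genus `g` with `r` boundary components: the polygon
with boundary word `a₁ b₁ a₁⁻¹ b₁⁻¹ ⋯ a_g b_g a_g⁻¹ b_g⁻¹ c₁ c₁⁻¹ ⋯ c_r c_r⁻¹`, with an
open disc removed around each of the `r` vertices between `c_j` and `c_j⁻¹`.  All the other corners
are one ordinary point of the surface. -/
def standardSurface (g r : ℕ) : PolygonSurface where
  sides := 4 * g + 2 * r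
  glue s := ⟨standardGlue g s.val, standardGlue_lt s.isLt⟩
  glue_glue s := Fin.ext (standardGlue_standardGlue g s.val)
  glue_ne s h := standardGlue_ne g s.val (congrArg Fin.val h)
  hole s := 4 * g ≤ s.val ∧ s.val % 2 = 1
  hole_turn s := by
    obtain ⟨i, hi⟩ := s
    rw [finRotate_val]
    dsimp only [standardGlue]
    split_ifs <;> first | omega | (simp only [and_false, false_iff]; omega)

/-! ## Curves and diagrams in normal position -/

/-- The number of points in which a curve or a diagram meets each side. -/
structure StrandCount (F : PolygonSurface) where
  num : Fin F.sides → ℕ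
  num_glue : ∀ s, num (F.glue s) = num s

namespace StrandCount

variable {F : PolygonSurface}

/-- The boundary points on the polygon: the `i`-th point of side `s`, counted counterclockwise. -/
abbrev Point (m : StrandCount F) : Type := Σ s : Fin F.sides, Fin (m.num s)

/-- The point on the glued side which is the same point of the surface. -/
def flip (m : StrandCount F) (p : m.Point) : m.Point :=
  ⟨F.glue p.1, Fin.cast (m.num_glue p.1).symm (Fin.rev p.2)⟩

/-- The order of the points along the boundary of the polygon, beginning at corner `0`. -/
def Before (m : StrandCount F) (p q : m.Point) : Prop :=
  p.1 < q.1 ∨ (p.1 = q.1 ∧ p.2.val < q.2.val)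

/-- The three points are distinct and met in this cyclic order, counterclockwise. -/
def Cyc (m : StrandCount F) (p q r : m.Point) : Prop :=
  (m.Before p q ∧ m.Before q r) ∨ (m.Before q r ∧ m.Before r p) ∨ (m.Before r p ∧ m.Before p q)

/-- Injections of point sets that keep the sides, the order along them and the gluing. -/
def IsEmb (m m' : StrandCount F) (e : m.Point → m'.Point) : Prop :=
  (∀ p q, m.Before p q → m'.Before (e p) (e q)) ∧ (∀ p, (e p).1 = p.1) ∧
    ∀ p, e (m.flip p) = m'.flip (e p)

end StrandCount

/-- A generic closed immersed one-manifold on the surface which is transverse to the sides and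
consists of straight chords in the (convex) polygon. -/
structure ChordDiagram (F : PolygonSurface) where
  count : StrandCount F
  chord : count.Point → count.Point
  chord_chord : ∀ p, chord (chord p) = p
  chord_ne : ∀ p, chord p ≠ p

namespace ChordDiagram

variable {F : PolygonSurface}

abbrev Point (D : ChordDiagram F) : Type := D.count.Point

/-- The chords at `p` and at `q` cross, and `p, q, chord p, chord q` is their counterclockwise
order. -/
def Cross (D : ChordDiagram F) (p q : D.Point) : Prop :=
  D.count.Cyc p q (D.chord p) ∧ D.count.Cyc (D.chord p) (D.chord q) p

/-- `e` identifies `K` with a union of components of `D`. -/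
def IsSubEmb (K D : ChordDiagram F) (e : K.Point → D.Point) : Prop :=
  K.count.IsEmb D.count e ∧ ∀ p, e (K.chord p) = D.chord (e p)

end ChordDiagram

/-- Closed embedded one-manifolds (in normal position, each component meeting the sides). -/
structure Curves (F : PolygonSurface) extends ChordDiagram F where
  noncrossing : ∀ p q, ¬ toChordDiagram.Cross p q

namespace Curves

variable {F : PolygonSurface}

/-- `D'` results from `D` by pulling a strand of `D` back across a side: the chord from `p` to the
next point `q` on the same side is removed, and the strands which continue it beyond that side are
joined. -/
def Finger (D D' : Curves F) : Prop :=
  ∃ p q : D.Point, p.1 = q.1 ∧ q.2.val = p.2.val + 1 ∧ D.chord p = q ∧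
    D.chord (D.count.flip p) ≠ D.count.flip q ∧
    ∃ e : D'.Point → D.Point, D'.count.IsEmb D.count e ∧
      Set.range e = {p, q, D.count.flip p, D.count.flip q}ᶜ ∧
      ∀ x, (D.chord (e x) = D.count.flip p → e (D'.chord x) = D.chord (D.count.flip q)) ∧
        (D.chord (e x) = D.count.flip q → e (D'.chord x) = D.chord (D.count.flip p)) ∧
        (D.chord (e x) ≠ D.count.flip p → D.chord (e x) ≠ D.count.flip q →
          e (D'.chord x) = D.chord (e x))

/-- `D'` results from `D` by sliding a strand across an ordinary vertex: the chord from `x` to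
`y`, which faces the corner `c`, is pushed over the vertex and then runs around it on the other
side, crossing all the edges at the vertex next to it.  Here `n d` is the new point next to the
corner `d`, on side `d`. -/
def Slide (D D' : Curves F) : Prop :=
  ∃ (c : Fin F.sides) (x y : D.Point) (e : D.Point → D'.Point) (n : Fin F.sides → D'.Point),
    ¬ F.hole c ∧ D.chord x = y ∧ D.count.IsEmb D'.count e ∧
    (∀ d, F.SameVertex c d → (n d).1 = d ∧ (n d).2.val = 0) ∧
    (∀ d d', F.SameVertex c d → F.SameVertex c d' → n d ≠ D'.count.flip (n d')) ∧
    (Set.range e)ᶜ = {p | ∃ d, F.SameVertex c d ∧ (p = n d ∨ p = D'.count.flip (n d))} ∧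
    (∀ z, z ≠ x → z ≠ y → D'.chord (e z) = e (D.chord z)) ∧
    (∀ d, F.SameVertex c d → F.turn d ≠ c → D'.chord (n (F.turn d)) = D'.count.flip (n d)) ∧
    D'.chord (n c) = e y ∧
    (∀ d, F.SameVertex c d → F.turn d = c → D'.chord (D'.count.flip (n d)) = e x)

/-- Isotopy on the surface: the equivalence relation generated by pulling strands across sides and
sliding strands across ordinary vertices. -/
def Isotopic : Curves F → Curves F → Prop :=
  Relation.EqvGen fun D D' => Finger D D' ∨ Slide D D'

/-- A small circle around an interior point of an edge. -/
def IsSmallCircle (D : Curves F) : Prop :=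
  ∃ p q : D.Point, p.1 = q.1 ∧ D.chord p = q ∧
    D.chord (D.count.flip p) = D.count.flip q ∧
    ∀ x : D.Point, x = p ∨ x = q ∨ x = D.count.flip p ∨ x = D.count.flip q

/-- The curve is a single circle that bounds a disc. -/
def Inessential (D : Curves F) : Prop := ∃ O : Curves F, O.IsSmallCircle ∧ Isotopic D O

end Curves

/-- Closed embedded one-manifolds without inessential components. -/
structure CurveSystem (F : PolygonSurface) extends Curves F where
  essential : ∀ (K : Curves F) (e : K.Point → toCurves.Point),
    K.toChordDiagram.IsSubEmb toCurves.toChordDiagram e → ¬ K.Inessential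

namespace CurveSystem

variable {F : PolygonSurface}

instance isotopy (F : PolygonSurface) : Setoid (CurveSystem F) where
  r A B := Curves.Isotopic A.toCurves B.toCurves
  iseqv :=
    { refl := fun A => Relation.EqvGen.refl A.toCurves
      symm := fun h => Relation.EqvGen.symm _ _ h
      trans := fun h h' => Relation.EqvGen.trans _ _ _ h h' }

end CurveSystem

/-- The set of isotopy classes of curve systems. -/
abbrev CurveClass (F : PolygonSurface) : Type := Quotient (CurveSystem.isotopy F)

/-- The free module on the isotopy classes of curve systems. -/
abbrev CurveModule (k : Type*) [CommRing k] (F : PolygonSurface) : Type _ := CurveClass F →₀ k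

/-- Two-layer link diagrams: an embedded one-manifold (the points with `top`) lying over another
embedded one-manifold (the points without). -/
structure Layered (F : PolygonSurface) extends ChordDiagram F where
  top : count.Point → Prop
  top_chord : ∀ p, top (chord p) ↔ top p
  top_flip : ∀ p, top (count.flip p) ↔ top p
  noncrossing : ∀ p q, (top p ↔ top q) → ¬ toChordDiagram.Cross p q

namespace Layered

variable {F : PolygonSurface}

/-- `D` is a diagram `A ▷ B`, obtained by superimposing `A` and `B` with `A` over `B`. -/
def IsOverlay (D : Layered F) (A B : CurveSystem F) : Prop :=
  ∃ (a : A.Point → D.Point) (b : B.Point → D.Point),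
    A.toChordDiagram.IsSubEmb D.toChordDiagram a ∧
    B.toChordDiagram.IsSubEmb D.toChordDiagram b ∧
    Set.range a = {p | D.top p} ∧ Set.range b = {p | ¬ D.top p}

/-! ## Kauffman states -/

/-- A crossing has four germs of strands.  The pair `(p, q)` with `p, q, chord p, chord q` in
counterclockwise order is the germ which points towards `p` at the crossing of the chords of `p` and
`q`. -/
abbrev Germ (D : Layered F) : Type :=
  {x : D.Point × D.Point // D.toChordDiagram.Cross x.1 x.2}

/-- `h` is the germ of the same crossing that follows `g` counterclockwise. -/
def IsNext (D : Layered F) (g h : D.Germ) : Prop := h.1 = (g.1.2, D.chord g.1.1)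

/-- `h` is the germ of the same crossing opposite to `g`. -/
def IsOpposite (D : Layered F) (g h : D.Germ) : Prop := h.1 = (D.chord g.1.1, D.chord g.1.2)

/-- Of the four germs of a crossing, exactly two are on the upper strand, and of these exactly one
points to the earlier end of its chord; it represents the crossing. -/
abbrev Crossing (D : Layered F) : Type :=
  {g : D.Germ // D.top g.1.1 ∧ D.count.Before g.1.1 (D.chord g.1.1)}

noncomputable instance (D : Layered F) : Fintype D.Crossing := Fintype.ofFinite _

/-- Kauffman states: the marker is `∞` for `true` and `0` for `false`. -/
abbrev State (D : Layered F) : Type := D.Crossing → Bool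

noncomputable instance (D : Layered F) : Fintype D.State := Fintype.ofFinite _

/-- The arcs in the polygon which remain after smoothing the crossings by the state, as adjacencies
between boundary points of the polygon and germs of crossings. -/
inductive Adj (D : Layered F) (σ : D.State) : D.Point ⊕ D.Germ → D.Point ⊕ D.Germ → Prop
  /-- A chord without crossings. -/
  | bare (p : D.Point) (h : ∀ g : D.Germ, g.1.1 ≠ p) : Adj D σ (.inl p) (.inl (D.chord p))
  /-- The segment from a boundary point to the first crossing on its chord. -/
  | first (g : D.Germ) (h : ∀ w : D.Germ, w.1.1 = g.1.1 → ¬ D.count.Cyc g.1.1 w.1.2 g.1.2) :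
      Adj D σ (.inl g.1.1) (.inr g)
  /-- The segment between two consecutive crossings: `g` and `l` point to the same boundary point,
  `l` is at the crossing that is nearer to it, and `h` is the germ opposite to `l`. -/
  | segment (g l h : D.Germ) (hl : l.1.1 = g.1.1) (hc : D.count.Cyc g.1.1 l.1.2 g.1.2)
      (hn : ∀ w : D.Germ, w.1.1 = g.1.1 →
        ¬ (D.count.Cyc g.1.1 l.1.2 w.1.2 ∧ D.count.Cyc g.1.1 w.1.2 g.1.2))
      (hh : D.IsOpposite l h) : Adj D σ (.inr g) (.inr h)
  /-- The `∞`-smoothing joins the upper germs to the next germs counterclockwise. -/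
  | infinity (c : D.Crossing) (g h : D.Germ) (hσ : σ c = true)
      (hg : g = c.1 ∨ D.IsOpposite c.1 g) (hh : D.IsNext g h) : Adj D σ (.inr g) (.inr h)
  /-- The `0`-smoothing joins the upper germs to the next germs clockwise. -/
  | zero (c : D.Crossing) (g h : D.Germ) (hσ : σ c = false)
      (hg : g = c.1 ∨ D.IsOpposite c.1 g) (hh : D.IsNext h g) : Adj D σ (.inr g) (.inr h)

/-- Lying on the same smoothed arc (or closed loop) in the polygon. -/
def Joined (D : Layered F) (σ : D.State) : D.Point ⊕ D.Germ → D.Point ⊕ D.Germ → Prop :=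
  Relation.EqvGen (D.Adj σ)

/-- Lying on the same component of the smoothed diagram on the surface. -/
def componentSetoid (D : Layered F) (σ : D.State) : Setoid (D.Point ⊕ D.Germ) :=
  Relation.EqvGen.setoid fun v w =>
    D.Adj σ v w ∨ ∃ p, v = .inl p ∧ w = .inl (D.count.flip p)

/-- The circles of the smoothed diagram. -/
abbrev Component (D : Layered F) (σ : D.State) : Type := Quotient (D.componentSetoid σ)

/-- The component on which a boundary point lies. -/
def componentOf (D : Layered F) (σ : D.State) (p : D.Point) : D.Component σ :=
  Quotient.mk (D.componentSetoid σ) (.inl p)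

/-- `e` identifies the curves `K` with a union of circles of the smoothed diagram. -/
def IsSmoothedEmb (D : Layered F) (σ : D.State) (K : Curves F) (e : K.Point → D.Point) : Prop :=
  K.count.IsEmb D.count e ∧ ∀ p, D.Joined σ (.inl (e p)) (.inl (e (K.chord p)))

/-- The circle bounds a disc: it stays inside the polygon, or it is an inessential curve. -/
def InessentialComponent (D : Layered F) (σ : D.State) (c : D.Component σ) : Prop :=
  (∀ p, D.componentOf σ p ≠ c) ∨
    ∃ (K : Curves F) (e : K.Point → D.Point), D.IsSmoothedEmb σ K e ∧
      Set.range e = {p | D.componentOf σ p = c} ∧ K.Inessential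

/-- The number of inessential circles of the smoothed diagram. -/
noncomputable def mu (D : Layered F) (σ : D.State) : ℕ :=
  Nat.card {c : D.Component σ // D.InessentialComponent σ c}

/-- The curve system consists of the essential circles of the smoothed diagram. -/
def IsEssentialPart (D : Layered F) (σ : D.State) (S : CurveSystem F) : Prop :=
  ∃ e : S.Point → D.Point, D.IsSmoothedEmb σ S.toCurves e ∧
    Set.range e = {p | ¬ D.InessentialComponent σ (D.componentOf σ p)}

open Classical in
/-- The class `D(σ)` of the essential circles of the smoothed diagram, as a basis element. -/
noncomputable def resolved (k : Type*) [CommRing k] (D : Layered F) (σ : D.State) :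
    CurveModule k F :=
  if h : ∃ S : CurveSystem F, D.IsEssentialPart σ S then
    Finsupp.single (Quotient.mk (CurveSystem.isotopy F) h.choose) 1 else 0

/-- The number of `0`-markers. -/
noncomputable def zeta (D : Layered F) (σ : D.State) : ℕ :=
  (Finset.univ.filter fun c => σ c = false).card

/-- The number of `∞`-markers. -/
noncomputable def iota (D : Layered F) (σ : D.State) : ℕ :=
  (Finset.univ.filter fun c => σ c = true).card

end Layered

/-! ## The bracket and the star product -/

/-- The power series `t = e^h`. -/
noncomputable def tSeries (k : Type*) [CommRing k] [Algebra ℚ k] : k⟦X⟧ := PowerSeries.exp k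

/-- The power series `t⁻¹ = e^{-h}`. -/
noncomputable def tInvSeries (k : Type*) [CommRing k] [Algebra ℚ k] : k⟦X⟧ :=
  PowerSeries.evalNegHom (PowerSeries.exp k)

/-- The value `-t² - t⁻²` of an inessential circle. -/
noncomputable def loopSeries (k : Type*) [CommRing k] [Algebra ℚ k] : k⟦X⟧ :=
  -(tSeries k) ^ 2 - (tInvSeries k) ^ 2

/-- `φ_j(i)` is the coefficient of `h^{2j}` in `(-t² - t⁻²)^i`. -/
noncomputable def loopCoeff (k : Type*) [CommRing k] [Algebra ℚ k] (j i : ℕ) : k :=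
  PowerSeries.coeff (2 * j) (loopSeries k ^ i)

namespace Layered

variable {F : PolygonSurface} (k : Type*) [CommRing k] [Algebra ℚ k]

/-- The coefficient of `h^j` in the Kauffman bracket
`∑_σ (-t)^{ζ(σ) - ι(σ)} (-t² - t⁻²)^{μ(σ)} D(σ)`. -/
noncomputable def bracket (j : ℕ) (D : Layered F) : CurveModule k F :=
  ∑ σ : D.State, PowerSeries.coeff j
    ((-tSeries k) ^ D.zeta σ * (-tInvSeries k) ^ D.iota σ * loopSeries k ^ D.mu σ) •
      D.resolved k σ

/-- The loop correction term `φ_1(D)`. -/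
noncomputable def loopTerm (D : Layered F) : CurveModule k F :=
  (-1 : k) ^ Fintype.card D.Crossing •
    ∑ σ : D.State, loopCoeff k 1 (D.mu σ) • D.resolved k σ

/-- The term `φ_0 χ_P [D, C]` with `P = (w² - zw + z²) + (w + z)/2`, for a set `C` of crossings:
each state on a two-element set `T ⊆ C` has the weight `(-1)^{number of ∞-markers}`, each state on a
one-element set the weight `1/2`, and then the remaining crossings are smoothed in all ways. -/
noncomputable def principalTerm (D : Layered F) (C : Finset D.Crossing) : CurveModule k F :=
  (-1 : k) ^ Fintype.card D.Crossing •
    ∑ σ : D.State,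
      (((∑ T ∈ C.powersetCard 2, (-1 : k) ^ (T.filter fun c => σ c = true).card) +
        ∑ _T ∈ C.powersetCard 1, algebraMap ℚ k (1 / 2)) * loopCoeff k 0 (D.mu σ)) •
        D.resolved k σ

end Layered

/-- The number of points in which the curves meet the sides. -/
def CurveSystem.size {F : PolygonSurface} (A : CurveSystem F) : ℕ := Fintype.card A.Point

/-- `D` is a diagram `α ▷ β`, formed from representatives of the two classes that meet the sides in
as few points as possible.  The bracket of `α ▷ β` does not depend on the choice of
representatives; the minimality only makes the choice more definite. -/
def IsProductDiagram {F : PolygonSurface} (α β : CurveClass F) (D : Layered F) : Prop :=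
  ∃ A B : CurveSystem F,
    Quotient.mk (CurveSystem.isotopy F) A = α ∧ Quotient.mk (CurveSystem.isotopy F) B = β ∧
    (∀ A' : CurveSystem F, Quotient.mk (CurveSystem.isotopy F) A' = α → A.size ≤ A'.size) ∧
    (∀ B' : CurveSystem F, Quotient.mk (CurveSystem.isotopy F) B' = β → B.size ≤ B'.size) ∧
    D.IsOverlay A B

open Classical in
/-- The coefficient of `h^j` in `α ⋆ β = ⟨α ▷ β⟩`. -/
noncomputable def starCoeff (k : Type*) [CommRing k] [Algebra ℚ k] {F : PolygonSurface} (j : ℕ)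
    (α β : CurveClass F) : CurveModule k F :=
  if h : ∃ D : Layered F, IsProductDiagram α β D then h.choose.bracket k j else 0

/-- The bilinear maps `λ_j` with `α ⋆ β = ∑_j λ_j(α, β) h^j`. -/
noncomputable def starLambda (k : Type*) [CommRing k] [Algebra ℚ k] (F : PolygonSurface) (j : ℕ) :
    CurveModule k F →ₗ[k] CurveModule k F →ₗ[k] CurveModule k F :=
  Finsupp.linearCombination k fun α => Finsupp.linearCombination k fun β => starCoeff k j α β

/-- The basis element of a curve system. -/
noncomputable def CurveSystem.toModule (k : Type*) [CommRing k] {F : PolygonSurface}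
    (A : CurveSystem F) : CurveModule k F :=
  Finsupp.single (Quotient.mk (CurveSystem.isotopy F) A) 1

/-! ## Differential operators -/

/-- The differential operators of order at most `p` on a module `A` with the multiplication `mul`:
those of order at most `0` are the multiplications by elements of `A`, and `f` has order at most
`p + 1` if all commutators `fa - af` with multiplications have order at most `p`. -/
def IsDiffOp {k A : Type*} [CommRing k] [AddCommGroup A] [Module k A] (mul : A →ₗ[k] A →ₗ[k] A) :
    ℕ → (A →ₗ[k] A) → Prop
  | 0, f => ∃ a, f = mul a
  | p + 1, f => ∀ a, IsDiffOp mul p (f ∘ₗ mul a - mul a ∘ₗ f)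

/-- `N univ` is a curve system with its components distributed over three disjoint parts, and `N S`
is the union of the parts with index in `S`. -/
def IsThreePartFamily {F : PolygonSurface} (N : Finset (Fin 3) → CurveSystem F) : Prop :=
  ∃ color : (N Finset.univ).Point → Fin 3,
    (∀ p, color ((N Finset.univ).chord p) = color p) ∧
    (∀ p, color ((N Finset.univ).count.flip p) = color p) ∧
    ∀ S, ∃ e : (N S).Point → (N Finset.univ).Point,
      (N S).toChordDiagram.IsSubEmb (N Finset.univ).toChordDiagram e ∧
        Set.range e = {p | color p ∈ S}

open Classical in
/-- The crossings of a two-layer diagram at which the lower strand has its color in `S`. -/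
noncomputable def Layered.crossingsOn {F : PolygonSurface} (D : Layered F)
    (color : D.Point → Fin 3) (S : Finset (Fin 3)) : Finset D.Crossing :=
  Finset.univ.filter fun c => color c.1.1.2 ∈ S

/-! The proof evaluates everything at the trivial character, which sends a curve system with `n`
components to `(-2)^n`. At `h = 0` an inessential circle has the value `-2` too, so a state goes to
`(-2)` to the number of all its circles. Of the three ways to join four ends of a one-manifold in
pairs, two give the same number of circles and the third gives one more, so the three values add up
to zero (`Alternating.sum_three_joins`). Resolving all crossings with this relation
(`Layered.sum_states`) shows that the character is multiplicative for `λ_0`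
(`trivialCharacter_mul`).

The positive statements are computations with coefficients. In degree two a state contributes
`(-1)^c ((ζ - ι)²/2 · φ_0 + φ_1)`. Since the signs of markers have square one, half the square of
their sum over `C` is the weight in `Φ(D, C)`. The sum of the signs is additive over the three
parts, and third differences of a quadratic function vanish.

For the negative statements one takes a curve system `γ` and parallel curves `b n` with `b 1 · b n =
b (n + 1)`. If `λ_2(γ, ·)` had order at most two, its double commutator with `b 1` would be
multiplication by some `z`. Under the character, the values `F n` of `λ_2(γ, b n)` would satisfy `F
(n+2) + 4 F (n+1) + 4 F n = ε(z) (-2)^n`, hence `F 3 + 6 F 2 + 12 F 1 + 8 F 0 = 0`. But `F n = 4 n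
(-2)^n + 2 M n`, where `M n` sums `μ(σ) (-2)^(number of circles)` over the states. The first summand
satisfies the relation, while `M` takes the values `0, 0, 4, -8` in positive genus and `0, 0, -16,
32` in genus zero and violates it. The alternating sum of loop correction terms in the last
statement has, up to sign, the same value at the character (`TestCurves.not_isDiffOp`,
`TestCurves.sum_loopTerm_ne_zero`).

What remains is to know `M n` for every diagram that the choice in the star product may select. A
coloring of regions modulo two shows that smoothed arcs do not cross (`Layered.mate_noncrossing`),
so the circles of a state are curves in normal position. A circle is inessential if and only if it
has a section in a flat bundle whose holonomies across the sides it meets are distinct free letters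
(`StateTable.Models.inessential_iff`): sections are invariant under isotopy, and a longest value of
a section exposes a strand that returns to its side and can be pulled back. Suitable holonomies
bound the number of points of each component from below and thereby determine the shortest
representatives. Their finitely many superpositions are encoded by numbers and evaluated. -/

/-! ## Orders of boundary points -/

namespace StrandCount

variable {F : PolygonSurface}

/-- A numbering of the boundary points which increases along the boundary. -/
def pos (m : StrandCount F) (p : m.Point) : ℕ := p.1.val * (∑ s, m.num s + 1) + p.2.val

theorem val_lt_bound (m : StrandCount F) (p : m.Point) : p.2.val < ∑ s, m.num s + 1 :=
  lt_of_lt_of_le p.2.isLt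
    ((Finset.single_le_sum (f := m.num) (fun _ _ => Nat.zero_le _) (Finset.mem_univ p.1)).trans
      (Nat.le_succ _))

/-- The numbering turns linear and cyclic order of boundary points into inequalities of natural
numbers, so that later planar arguments reduce to linear arithmetic. -/
theorem before_iff (m : StrandCount F) (p q : m.Point) : m.Before p q ↔ m.pos p < m.pos q := by
  have hp := m.val_lt_bound p
  have hq := m.val_lt_bound q
  unfold pos Before
  rw [Fin.lt_def]
  generalize ∑ s, m.num s + 1 = B at *
  rw [Fin.ext_iff]
  rcases lt_trichotomy p.1.val q.1.val with h | h | h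
  · refine iff_of_true (Or.inl h) ?_
    have := Nat.mul_le_mul_right B (Nat.succ_le_of_lt h)
    rw [Nat.succ_mul] at this
    omega
  · rw [h]
    omega
  · refine iff_of_false (by omega) ?_
    have := Nat.mul_le_mul_right B (Nat.succ_le_of_lt h)
    rw [Nat.succ_mul] at this
    omega

theorem pos_injective (m : StrandCount F) : Function.Injective m.pos := by
  intro p q h
  have h1 := (m.before_iff p q).not.2 (by omega)
  have h2 := (m.before_iff q p).not.2 (by omega)
  obtain ⟨s, i⟩ := p
  obtain ⟨s', i'⟩ := q
  unfold Before at h1 h2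
  push Not at h1 h2
  obtain rfl : s = s' := le_antisymm h2.1 h1.1
  have : i = i' := Fin.ext (by have a := h1.2 rfl; have b := h2.2 rfl; simp only at a b; omega)
  rw [this]

theorem pos_inj (m : StrandCount F) {p q : m.Point} : m.pos p = m.pos q ↔ p = q :=
  m.pos_injective.eq_iff

theorem cyc_iff (m : StrandCount F) (p q r : m.Point) : m.Cyc p q r ↔
    (m.pos p < m.pos q ∧ m.pos q < m.pos r) ∨ (m.pos q < m.pos r ∧ m.pos r < m.pos p) ∨
      (m.pos r < m.pos p ∧ m.pos p < m.pos q) := by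
  simp only [Cyc, before_iff]

theorem flip_snd_val (m : StrandCount F) (p : m.Point) :
    (m.flip p).2.val = m.num p.1 - (p.2.val + 1) := by
  simp [flip, Fin.val_rev]

theorem flip_flip (m : StrandCount F) (p : m.Point) : m.flip (m.flip p) = p := by
  obtain ⟨s, i⟩ := p
  have key : ∀ (t : Fin F.sides) (h : t = s) (j : Fin (m.num t)), j.val = i.val →
      (⟨t, j⟩ : m.Point) = ⟨s, i⟩ := by
    rintro t rfl j hj
    rw [Fin.ext hj]
  refine key _ (F.glue_glue s) _ ?_
  have h1 := m.num_glue s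
  have h2 := i.isLt
  change (m.flip (m.flip ⟨s, i⟩)).2.val = i.val
  rw [flip_snd_val, flip_snd_val]
  change m.num (F.glue s) - (m.num s - (i.val + 1) + 1) = i.val
  omega

theorem flip_injective (m : StrandCount F) : Function.Injective m.flip :=
  Function.LeftInverse.injective m.flip_flip

theorem flip_fst (m : StrandCount F) (p : m.Point) : (m.flip p).1 = F.glue p.1 := rfl

theorem flip_ne (m : StrandCount F) (p : m.Point) : m.flip p ≠ p := fun h =>
  F.glue_ne p.1 (congrArg Sigma.fst h)

namespace IsEmb

variable {m m' m'' : StrandCount F} {e : m.Point → m'.Point}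

theorem before_iff (h : m.IsEmb m' e) (p q : m.Point) :
    m'.Before (e p) (e q) ↔ m.Before p q := by
  refine ⟨fun hb => ?_, h.1 p q⟩
  by_contra hn
  rcases lt_trichotomy (m.pos p) (m.pos q) with hl | hl | hl
  · exact hn ((m.before_iff _ _).2 hl)
  · rw [m.pos_inj.1 hl, m'.before_iff] at hb
    omega
  · have := h.1 _ _ ((m.before_iff _ _).2 hl)
    rw [m'.before_iff] at this hb
    omega

theorem pos_lt_iff (h : m.IsEmb m' e) (p q : m.Point) :
    m'.pos (e p) < m'.pos (e q) ↔ m.pos p < m.pos q := by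
  rw [← m'.before_iff, h.before_iff, m.before_iff]

theorem injective (h : m.IsEmb m' e) : Function.Injective e := by
  intro p q hpq
  have h1 := h.pos_lt_iff p q
  have h2 := h.pos_lt_iff q p
  rw [hpq] at h1 h2
  exact m.pos_inj.1 (by omega)

theorem cyc_iff (h : m.IsEmb m' e) (p q r : m.Point) :
    m'.Cyc (e p) (e q) (e r) ↔ m.Cyc p q r := by
  simp only [StrandCount.cyc_iff, h.pos_lt_iff]

theorem comp {e' : m'.Point → m''.Point} (h' : m'.IsEmb m'' e') (h : m.IsEmb m' e) :
    m.IsEmb m'' (e' ∘ e) :=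
  ⟨fun p q hpq => h'.1 _ _ (h.1 _ _ hpq), fun p => (h'.2.1 _).trans (h.2.1 p),
    fun p => by simp only [Function.comp, h.2.2, h'.2.2]⟩

end IsEmb

open Classical in
/-- The indices of the points on a side which belong to a set. -/
noncomputable def indices (m : StrandCount F) (R : Set m.Point) (s : Fin F.sides) :
    Finset (Fin (m.num s)) := Finset.univ.filter fun i => (⟨s, i⟩ : m.Point) ∈ R

theorem mem_indices (m : StrandCount F) {R : Set m.Point} {s : Fin F.sides} {i : Fin (m.num s)} :
    i ∈ m.indices R s ↔ (⟨s, i⟩ : m.Point) ∈ R := by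
  simp [indices]

theorem flip_mk_mem (m : StrandCount F) {R : Set m.Point} (hR : ∀ p ∈ R, m.flip p ∈ R)
    (p : m.Point) : m.flip p ∈ R ↔ p ∈ R :=
  ⟨fun h => by simpa only [flip_flip] using hR _ h, hR p⟩

theorem card_indices_glue (m : StrandCount F) {R : Set m.Point} (hR : ∀ p ∈ R, m.flip p ∈ R)
    (s : Fin F.sides) : (m.indices R (F.glue s)).card = (m.indices R s).card := by
  symm
  refine Finset.card_bij (fun i _ => Fin.cast (m.num_glue s).symm (Fin.rev i)) ?_ ?_ ?_
  · intro i hi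
    rw [mem_indices] at hi ⊢
    exact hR _ hi
  · intro i _ j _ h
    simpa using h
  · intro j hj
    refine ⟨Fin.rev (Fin.cast (m.num_glue s) j), ?_, ?_⟩
    · rw [mem_indices] at hj ⊢
      have := (m.flip_mk_mem hR ⟨s, Fin.rev (Fin.cast (m.num_glue s) j)⟩).1
      apply this
      have : m.flip ⟨s, Fin.rev (Fin.cast (m.num_glue s) j)⟩ = ⟨F.glue s, j⟩ := by
        simp [flip, Fin.rev_rev]
      rwa [this]
    · simp [Fin.rev_rev]

/-- The points of a set which is closed under the gluing form a strand count of their own. -/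
noncomputable def restrict (m : StrandCount F) (R : Set m.Point) (hR : ∀ p ∈ R, m.flip p ∈ R) :
    StrandCount F where
  num s := (m.indices R s).card
  num_glue s := m.card_indices_glue hR s

/-- The inclusion of the points of a set which is closed under the gluing. -/
noncomputable def incl (m : StrandCount F) (R : Set m.Point) (hR : ∀ p ∈ R, m.flip p ∈ R)
    (p : (m.restrict R hR).Point) : m.Point :=
  ⟨p.1, (m.indices R p.1).orderEmbOfFin rfl p.2⟩

theorem range_incl (m : StrandCount F) (R : Set m.Point) (hR : ∀ p ∈ R, m.flip p ∈ R) :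
    Set.range (m.incl R hR) = R := by
  ext ⟨s, i⟩
  constructor
  · rintro ⟨p, hp⟩
    rw [← hp]
    exact m.mem_indices.1 (Finset.orderEmbOfFin_mem (m.indices R p.1) rfl p.2)
  · intro h
    have hi : i ∈ Set.range ((m.indices R s).orderEmbOfFin rfl) := by
      rw [Finset.range_orderEmbOfFin]
      exact m.mem_indices.2 h
    obtain ⟨j, hj⟩ := hi
    exact ⟨⟨s, j⟩, by simp only [incl, hj]⟩

/-- Conjugating an increasing enumeration by the two reversals gives an increasing enumeration
again, and there is only one. This makes the inclusion of a subset commute with the gluing, which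
reverses the sides. -/
theorem orderEmbOfFin_rev {n n' : ℕ} {S : Finset (Fin n)} {S' : Finset (Fin n')} (hn : n' = n)
    (hS : ∀ i, Fin.cast hn.symm (Fin.rev i) ∈ S' ↔ i ∈ S) {k : ℕ} (h : S.card = k)
    (h' : S'.card = k) (i : Fin k) :
    S'.orderEmbOfFin h' (Fin.rev i) = Fin.cast hn.symm (Fin.rev (S.orderEmbOfFin h i)) := by
  subst hn
  have hf : (fun i : Fin k => Fin.rev (S.orderEmbOfFin h (Fin.rev i))) = S'.orderEmbOfFin h' := by
    apply Finset.orderEmbOfFin_unique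
    · intro x
      exact (hS _).2 (Finset.orderEmbOfFin_mem _ _ _)
    · intro x y hxy
      simpa using hxy
  rw [← hf]
  simp

theorem isEmb_incl (m : StrandCount F) (R : Set m.Point) (hR : ∀ p ∈ R, m.flip p ∈ R) :
    (m.restrict R hR).IsEmb m (m.incl R hR) := by
  refine ⟨?_, fun p => rfl, ?_⟩
  · rintro ⟨s, i⟩ ⟨s', i'⟩ (h | ⟨h, h'⟩)
    · exact Or.inl h
    · simp only at h
      subst h
      refine Or.inr ⟨rfl, ?_⟩
      exact ((m.indices R s).orderEmbOfFin rfl).strictMono h'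
  · rintro ⟨s, i⟩
    simp only [incl, flip, Sigma.mk.injEq, heq_eq_eq, true_and]
    have := orderEmbOfFin_rev (m.num_glue s) (S := m.indices R s) (S' := m.indices R (F.glue s))
      (fun i => by
        rw [mem_indices, mem_indices]
        exact m.flip_mk_mem hR ⟨s, i⟩) rfl (m.card_indices_glue hR s) i
    rw [← this]
    rfl

end StrandCount

/-! ## Germs of crossings -/

/-- The cyclic order of three numbers. -/
abbrev CycNat (x y z : ℕ) : Prop := (x < y ∧ y < z) ∨ (y < z ∧ z < x) ∨ (z < x ∧ x < y)

namespace ChordDiagram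

variable {F : PolygonSurface} (D : ChordDiagram F)

/-- The position of a point along the boundary. -/
abbrev pos (p : D.Point) : ℕ := D.count.pos p

theorem chord_injective : Function.Injective D.chord :=
  Function.LeftInverse.injective D.chord_chord

theorem pos_inj {p q : D.Point} : D.pos p = D.pos q ↔ p = q := D.count.pos_inj

theorem cross_iff (p q : D.Point) : D.Cross p q ↔
    CycNat (D.pos p) (D.pos q) (D.pos (D.chord p)) ∧
      CycNat (D.pos (D.chord p)) (D.pos (D.chord q)) (D.pos p) := by
  simp only [Cross, StrandCount.cyc_iff]

variable {D}

theorem Cross.next {p q : D.Point} (h : D.Cross p q) : D.Cross q (D.chord p) := by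
  rw [cross_iff] at h ⊢
  rw [D.chord_chord]
  unfold CycNat at *
  omega

theorem Cross.opposite {p q : D.Point} (h : D.Cross p q) : D.Cross (D.chord p) (D.chord q) :=
  h.next.next

theorem Cross.prev {p q : D.Point} (h : D.Cross p q) : D.Cross (D.chord q) p := by
  simpa [D.chord_chord] using h.next.next.next

end ChordDiagram

namespace Layered

variable {F : PolygonSurface} {D : Layered F}

theorem top_ne_of_cross {p q : D.Point} (h : D.toChordDiagram.Cross p q) : ¬ (D.top p ↔ D.top q) :=
  fun hn => D.noncrossing p q hn h

namespace Germ

/-- The following germ at the same crossing, counterclockwise. -/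
def next (g : D.Germ) : D.Germ := ⟨(g.1.2, D.chord g.1.1), g.2.next⟩

/-- The opposite germ at the same crossing. -/
def opp (g : D.Germ) : D.Germ := ⟨(D.chord g.1.1, D.chord g.1.2), g.2.opposite⟩

/-- The preceding germ at the same crossing, counterclockwise. -/
def prev (g : D.Germ) : D.Germ := ⟨(D.chord g.1.2, g.1.1), g.2.prev⟩

theorem ext {g h : D.Germ} (h1 : g.1.1 = h.1.1) (h2 : g.1.2 = h.1.2) : g = h :=
  Subtype.ext (Prod.ext h1 h2)

@[simp] theorem next_next (g : D.Germ) : g.next.next = g.opp := rfl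

@[simp] theorem next_prev (g : D.Germ) : g.next.prev = g :=
  ext (D.chord_chord _) rfl

@[simp] theorem prev_next (g : D.Germ) : g.prev.next = g :=
  ext rfl (D.chord_chord _)

@[simp] theorem opp_opp (g : D.Germ) : g.opp.opp = g :=
  ext (D.chord_chord _) (D.chord_chord _)

theorem opp_next (g : D.Germ) : g.opp.next = g.prev :=
  ext rfl (D.chord_chord _)

theorem opp_prev (g : D.Germ) : g.opp.prev = g.next :=
  ext (D.chord_chord _) rfl

theorem next_opp (g : D.Germ) : g.next.opp = g.prev :=
  ext rfl (D.chord_chord _)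

theorem prev_prev (g : D.Germ) : g.prev.prev = g.opp := rfl

/-- Crossings occur only between different layers, so the germs around a crossing alternate between
upper and lower strand. -/
theorem top_snd (g : D.Germ) : D.top g.1.2 ↔ ¬ D.top g.1.1 := by
  have := top_ne_of_cross g.2
  tauto

theorem top_next (g : D.Germ) : D.top g.next.1.1 ↔ ¬ D.top g.1.1 := g.top_snd

theorem top_opp (g : D.Germ) : D.top g.opp.1.1 ↔ D.top g.1.1 := D.top_chord _

theorem top_prev (g : D.Germ) : D.top g.prev.1.1 ↔ ¬ D.top g.1.1 := by
  rw [← next_opp, top_opp, top_next]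

theorem opp_ne (g : D.Germ) : g.opp ≠ g := fun h =>
  D.chord_ne g.1.1 (congrArg (fun g => g.1.1) h)

theorem next_ne (g : D.Germ) : g.next ≠ g := fun h => by
  have := g.top_next
  rw [h] at this
  tauto

theorem prev_ne (g : D.Germ) : g.prev ≠ g := fun h => by
  have := g.top_prev
  rw [h] at this
  tauto

theorem next_ne_prev (g : D.Germ) : g.next ≠ g.prev := fun h =>
  g.next.opp_ne (by rw [next_opp, h])

end Germ

/-- The germ `l` points to the same boundary point as `g` and its crossing is nearer to it. -/
def Nearer (D : Layered F) (l g : D.Germ) : Prop := l.1.1 = g.1.1 ∧ D.count.Cyc g.1.1 l.1.2 g.1.2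

theorem nearer_iff (l g : D.Germ) : D.Nearer l g ↔ l.1.1 = g.1.1 ∧
    CycNat (D.pos g.1.1) (D.pos l.1.2) (D.pos g.1.2) := by
  simp only [Nearer, StrandCount.cyc_iff]

theorem Nearer.trans {l g w : D.Germ} (h : D.Nearer l g) (h' : D.Nearer g w) : D.Nearer l w := by
  rw [nearer_iff] at *
  refine ⟨h.1.trans h'.1, ?_⟩
  have h2 := h.2
  have h3 := h'.2
  rw [h'.1] at h2
  unfold CycNat at *
  omega

theorem Nearer.irrefl (g : D.Germ) : ¬ D.Nearer g g := by
  rw [nearer_iff]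
  unfold CycNat
  omega

theorem Germ.pos_ne (g : D.Germ) : D.pos g.1.1 ≠ D.pos g.1.2 := by
  have := (D.cross_iff _ _).1 g.2
  unfold CycNat at this
  omega

theorem nearer_trichotomy {l g : D.Germ} (h : l.1.1 = g.1.1) :
    D.Nearer l g ∨ l = g ∨ D.Nearer g l := by
  rw [nearer_iff, nearer_iff, h]
  have h1 := g.pos_ne
  have h2 := l.pos_ne
  rw [h] at h2
  by_cases h3 : D.pos l.1.2 = D.pos g.1.2
  · exact Or.inr (Or.inl (Germ.ext h (D.pos_inj.1 h3)))
  · simp only [true_and]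
    unfold CycNat
    omega

/-- Reversing a chord reverses the order of the crossings along it. -/
theorem Nearer.opp {l g : D.Germ} (h : D.Nearer l g) : D.Nearer g.opp l.opp := by
  have hn := h
  rw [nearer_iff] at *
  refine ⟨congrArg D.chord h.1.symm, ?_⟩
  have hg := (D.cross_iff _ _).1 g.2
  have hl := (D.cross_iff _ _).1 l.2
  -- The two chords that cross the common chord lie in the same layer and do not cross each other;
  -- without this their end points would not determine the order of the crossings.
  have ht : D.top l.1.2 ↔ D.top g.1.2 := by rw [l.top_snd, g.top_snd, h.1]
  have h1 := (D.cross_iff _ _).not.1 (D.noncrossing l.1.2 g.1.2 ht)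
  have h2 := h.2
  have hne : D.pos (D.chord l.1.2) ≠ D.pos (D.chord g.1.2) := fun he => by
    have := D.chord_injective (D.pos_inj.1 he)
    rw [this] at h2
    unfold CycNat at h2
    omega
  rw [h.1] at hl
  change CycNat (D.pos (D.chord l.1.1)) (D.pos (D.chord g.1.2)) (D.pos (D.chord l.1.2))
  rw [h.1]
  unfold CycNat at *
  omega

instance (D : Layered F) : Finite D.Germ := Subtype.finite

theorem wellFounded_nearer (D : Layered F) : WellFounded (D.Nearer) := by
  have : IsTrans D.Germ D.Nearer := ⟨fun _ _ _ h h' => h.trans h'⟩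
  have : Std.Irrefl D.Nearer := ⟨Nearer.irrefl⟩
  exact Finite.wellFounded_of_trans_of_irrefl _

theorem wellFounded_farther (D : Layered F) : WellFounded (fun l g => D.Nearer g l) := by
  have : IsTrans D.Germ (fun l g => D.Nearer g l) := ⟨fun _ _ _ h h' => h'.trans h⟩
  have : Std.Irrefl (fun l g => D.Nearer g l) := ⟨Nearer.irrefl⟩
  exact Finite.wellFounded_of_trans_of_irrefl _

/-! ## Strands -/

/-- The vertices of the smoothed diagram. -/
abbrev Vertex (D : Layered F) : Type := D.Point ⊕ D.Germ

/-- Adjacency along a strand in the polygon, without passing a crossing. -/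
inductive StrandAdj (D : Layered F) : D.Vertex → D.Vertex → Prop
  | bare (p : D.Point) (h : ∀ g : D.Germ, g.1.1 ≠ p) : StrandAdj D (.inl p) (.inl (D.chord p))
  | first (g : D.Germ) (h : ∀ w, ¬ D.Nearer w g) : StrandAdj D (.inl g.1.1) (.inr g)
  | last (g : D.Germ) (h : ∀ w, ¬ D.Nearer w g) : StrandAdj D (.inr g) (.inl g.1.1)
  | segment (g l : D.Germ) (h : D.Nearer l g) (hn : ∀ w, D.Nearer l w → ¬ D.Nearer w g) :
      StrandAdj D (.inr g) (.inr l.opp)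

theorem StrandAdj.symm {v w : D.Vertex} (h : D.StrandAdj v w) : D.StrandAdj w v := by
  cases h with
  | bare p h =>
    have h' : ∀ g : D.Germ, g.1.1 ≠ D.chord p := fun g hg => h g.opp (by
      change D.chord g.1.1 = p
      rw [hg, D.chord_chord])
    simpa [D.chord_chord] using StrandAdj.bare (D.chord p) h'
  | first g h => exact .last g h
  | last g h => exact .first g h
  | segment g l h hn =>
    have := StrandAdj.segment l.opp g.opp h.opp fun w hw hw' => by
      have h1 := hw.opp
      have h2 := hw'.opp
      rw [Germ.opp_opp] at h1 h2
      exact hn _ h2 h1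
    simpa using this

theorem StrandAdj.unique {v w w' : D.Vertex} (h : D.StrandAdj v w) (h' : D.StrandAdj v w') :
    w = w' := by
  cases h with
  | bare p h =>
    cases h' with
    | bare _ h' => rfl
    | first g h' => exact absurd rfl (h g)
  | first g h =>
    generalize hp : g.1.1 = p at h'
    cases h' with
    | bare _ h' => exact absurd hp (h' g)
    | first g' h' =>
      rcases nearer_trichotomy hp with hh | hh | hh
      · exact absurd hh (h' _)
      · rw [hh]
      · exact absurd hh (h _)
  | last g h =>
    cases h' with
    | last _ h' => rfl
    | segment _ l hl hn => exact absurd hl (h _)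
  | segment g l hl hn =>
    cases h' with
    | last _ h' => exact absurd hl (h' _)
    | segment _ l' hl' hn' =>
      rcases nearer_trichotomy (hl.1.trans hl'.1.symm) with hh | hh | hh
      · exact absurd hl' (hn _ hh)
      · rw [hh]
      · exact absurd hl (hn' _ hh)

/-- The neighbour of a boundary point is the nearest crossing on its chord. The neighbour of a germ
is the farthest among the crossings that are nearer to its end point. Both exist by finiteness. -/
theorem exists_strandAdj (v : D.Vertex) : ∃ w, D.StrandAdj v w := by
  rcases v with p | g
  · by_cases h : ∃ g : D.Germ, g.1.1 = p
    · obtain ⟨g, hg, hmin⟩ := D.wellFounded_nearer.has_min {g | g.1.1 = p} h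
      have hg' : g.1.1 = p := hg
      subst hg'
      exact ⟨_, .first g fun w hw => hmin w hw.1 hw⟩
    · push Not at h
      exact ⟨_, .bare p h⟩
  · by_cases h : ∃ l, D.Nearer l g
    · obtain ⟨l, hl, hmin⟩ := D.wellFounded_farther.has_min {l | D.Nearer l g} h
      exact ⟨_, .segment g l hl fun w hw hw' => hmin w hw' hw⟩
    · push Not at h
      exact ⟨_, .last g h⟩

/-- The other end of the strand segment. -/
noncomputable def strand (D : Layered F) (v : D.Vertex) : D.Vertex := (exists_strandAdj v).choose

theorem strandAdj_strand (v : D.Vertex) : D.StrandAdj v (D.strand v) :=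
  (exists_strandAdj v).choose_spec

theorem strandAdj_iff {v w : D.Vertex} : D.StrandAdj v w ↔ D.strand v = w :=
  ⟨fun h => (strandAdj_strand v).unique h, fun h => h ▸ strandAdj_strand v⟩

@[simp] theorem strand_strand (v : D.Vertex) : D.strand (D.strand v) = v :=
  strandAdj_iff.1 (strandAdj_strand v).symm

theorem strand_ne (v : D.Vertex) : D.strand v ≠ v := by
  intro h
  have := strandAdj_strand v
  rw [h] at this
  generalize hw : v = w at this
  nth_rw 1 [← hw] at this
  cases this with
  | bare p h => exact D.chord_ne p (by simpa using hw.symm)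
  | first g h => simp at hw
  | last g h => simp at hw
  | segment g l hl hn =>
    have h1 : l.opp.1.1 = g.1.1 := by rw [Sum.inr.inj hw]
    exact D.chord_ne g.1.1 (by rw [← hl.1]; exact h1.trans hl.1.symm)

/-! ## Smoothings -/

open Classical in
/-- The crossing to which a germ belongs. -/
noncomputable def crossingOf (D : Layered F) (g : D.Germ) : D.Crossing :=
  if ht : D.top g.1.1 then
    if hb : D.count.Before g.1.1 (D.chord g.1.1) then ⟨g, ht, hb⟩
    else ⟨g.opp, g.top_opp.2 ht, by
      rw [StrandCount.before_iff] at hb ⊢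
      have := D.pos_inj.not.2 (D.chord_ne g.1.1)
      change D.pos (D.chord g.1.1) < D.pos (D.chord (D.chord g.1.1))
      rw [D.chord_chord]
      change ¬ (D.pos _ < D.pos _) at hb
      omega⟩
  else
    if hb : D.count.Before g.next.1.1 (D.chord g.next.1.1) then ⟨g.next, g.top_next.2 ht, hb⟩
    else ⟨g.next.opp, g.next.top_opp.2 (g.top_next.2 ht), by
      rw [StrandCount.before_iff] at hb ⊢
      have := D.pos_inj.not.2 (D.chord_ne g.next.1.1)
      change D.pos (D.chord g.next.1.1) < D.pos (D.chord (D.chord g.next.1.1))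
      rw [D.chord_chord]
      change ¬ (D.pos _ < D.pos _) at hb
      omega⟩

theorem before_opp (g : D.Germ) : D.count.Before g.opp.1.1 (D.chord g.opp.1.1) ↔
    ¬ D.count.Before g.1.1 (D.chord g.1.1) := by
  have := D.pos_inj.not.2 (D.chord_ne g.1.1)
  change D.count.Before (D.chord g.1.1) (D.chord (D.chord g.1.1)) ↔ _
  rw [StrandCount.before_iff, StrandCount.before_iff, D.chord_chord]
  change D.pos _ < D.pos _ ↔ ¬ D.pos _ < D.pos _
  omega

theorem crossingOf_crossing (c : D.Crossing) : D.crossingOf c.1 = c := by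
  unfold crossingOf
  rw [dif_pos c.2.1, dif_pos c.2.2]

theorem crossingOf_opp_of_top (g : D.Germ) (h : D.top g.1.1) :
    D.crossingOf g.opp = D.crossingOf g := by
  unfold crossingOf
  rw [dif_pos h, dif_pos (g.top_opp.2 h)]
  by_cases hb : D.count.Before g.1.1 (D.chord g.1.1)
  · rw [dif_pos hb, dif_neg (by rw [before_opp]; exact not_not.2 hb)]
    exact Subtype.ext g.opp_opp
  · rw [dif_neg hb, dif_pos ((before_opp g).2 hb)]

theorem crossingOf_of_not_top (g : D.Germ) (h : ¬ D.top g.1.1) :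
    D.crossingOf g = D.crossingOf g.next := by
  conv_lhs => unfold crossingOf
  conv_rhs => unfold crossingOf
  rw [dif_neg h, dif_pos (g.top_next.2 h)]

@[simp] theorem crossingOf_next (g : D.Germ) : D.crossingOf g.next = D.crossingOf g := by
  by_cases h : D.top g.1.1
  · rw [crossingOf_of_not_top g.next (by rw [Germ.top_next]; exact not_not.2 h), Germ.next_next,
      crossingOf_opp_of_top g h]
  · exact (crossingOf_of_not_top g h).symm

@[simp] theorem crossingOf_opp (g : D.Germ) : D.crossingOf g.opp = D.crossingOf g := by
  rw [← Germ.next_next, crossingOf_next, crossingOf_next]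

@[simp] theorem crossingOf_prev (g : D.Germ) : D.crossingOf g.prev = D.crossingOf g := by
  rw [← Germ.next_opp, crossingOf_opp, crossingOf_next]

theorem eq_or_of_crossingOf_eq {g : D.Germ} {c : D.Crossing} (h : D.crossingOf g = c) :
    g = c.1 ∨ g = c.1.next ∨ g = c.1.opp ∨ g = c.1.prev := by
  subst h
  unfold crossingOf
  split_ifs with h1 h2 h2
  · exact Or.inl rfl
  · exact Or.inr (Or.inr (Or.inl (Germ.opp_opp g).symm))
  · exact Or.inr (Or.inr (Or.inr (Germ.next_prev g).symm))
  · refine Or.inr (Or.inl ?_)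
    change g = g.next.opp.next
    rw [Germ.opp_next, Germ.next_prev]

open Classical in
/-- The germ to which a germ is joined when its crossing is smoothed (`∞` for `some true`, `0` for
`some false`) or left as it is (for `none`). -/
noncomputable def smooth (τ : D.Crossing → Option Bool) (g : D.Germ) : D.Germ :=
  match τ (D.crossingOf g) with
  | none => g.opp
  | some b => if (D.top g.1.1 ↔ b = true) then g.next else g.prev

theorem smooth_none {τ : D.Crossing → Option Bool} {g : D.Germ} (h : τ (D.crossingOf g) = none) :
    smooth τ g = g.opp := by
  unfold smooth
  rw [h]

theorem smooth_next {τ : D.Crossing → Option Bool} {g : D.Germ} {b : Bool}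
    (h : τ (D.crossingOf g) = some b) (hb : D.top g.1.1 ↔ b = true) : smooth τ g = g.next := by
  unfold smooth
  rw [h]
  exact if_pos hb

theorem smooth_prev {τ : D.Crossing → Option Bool} {g : D.Germ} {b : Bool}
    (h : τ (D.crossingOf g) = some b) (hb : ¬ (D.top g.1.1 ↔ b = true)) : smooth τ g = g.prev := by
  unfold smooth
  rw [h]
  exact if_neg hb

theorem crossingOf_smooth (τ : D.Crossing → Option Bool) (g : D.Germ) :
    D.crossingOf (smooth τ g) = D.crossingOf g := by
  cases h : τ (D.crossingOf g) with
  | none => rw [smooth_none h, crossingOf_opp]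
  | some b =>
    by_cases hb : D.top g.1.1 ↔ b = true
    · rw [smooth_next h hb, crossingOf_next]
    · rw [smooth_prev h hb, crossingOf_prev]

@[simp] theorem smooth_smooth (τ : D.Crossing → Option Bool) (g : D.Germ) :
    smooth τ (smooth τ g) = g := by
  cases h : τ (D.crossingOf g) with
  | none => rw [smooth_none h, smooth_none (by rwa [crossingOf_opp]), Germ.opp_opp]
  | some b =>
    by_cases hb : D.top g.1.1 ↔ b = true
    · rw [smooth_next h hb, smooth_prev (by rwa [crossingOf_next])
        (by rw [Germ.top_next]; tauto), Germ.next_prev]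
    · rw [smooth_prev h hb, smooth_next (by rwa [crossingOf_prev])
        (by rw [Germ.top_prev]; tauto), Germ.prev_next]

theorem smooth_ne (τ : D.Crossing → Option Bool) (g : D.Germ) : smooth τ g ≠ g := by
  cases h : τ (D.crossingOf g) with
  | none => rw [smooth_none h]; exact g.opp_ne
  | some b =>
    by_cases hb : D.top g.1.1 ↔ b = true
    · rw [smooth_next h hb]; exact g.next_ne
    · rw [smooth_prev h hb]; exact g.prev_ne

theorem smooth_congr {τ τ' : D.Crossing → Option Bool} {g : D.Germ}
    (h : τ (D.crossingOf g) = τ' (D.crossingOf g)) : smooth τ g = smooth τ' g := by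
  unfold smooth
  rw [h]

/-- The partial smoothing given by a Kauffman state. -/
abbrev State.full (σ : D.State) : D.Crossing → Option Bool := fun c => some (σ c)

/-- Passage through a crossing in the smoothed diagram, in the polygon; boundary points are fixed. -/
noncomputable def innerTurn (τ : D.Crossing → Option Bool) : D.Vertex → D.Vertex
  | .inl p => .inl p
  | .inr g => .inr (smooth τ g)

/-- Passage through a crossing or a side in the smoothed diagram. -/
noncomputable def outerTurn (τ : D.Crossing → Option Bool) : D.Vertex → D.Vertex
  | .inl p => .inl (D.count.flip p)
  | .inr g => .inr (smooth τ g)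

theorem innerTurn_innerTurn (τ : D.Crossing → Option Bool) (v : D.Vertex) :
    innerTurn τ (innerTurn τ v) = v := by
  rcases v with p | g <;> simp [innerTurn]

theorem outerTurn_outerTurn (τ : D.Crossing → Option Bool) (v : D.Vertex) :
    outerTurn τ (outerTurn τ v) = v := by
  rcases v with p | g <;> simp [outerTurn, StrandCount.flip_flip]

/-! ## Adjacency in the smoothed diagram -/

/-- Together with `adj_smooth` and `Adj.strand_or_turn` this replaces the inductive adjacency by two
involutions, so that arcs and circles of a state become their orbits. -/
theorem adj_of_strandAdj (σ : D.State) {v w : D.Vertex} (h : D.StrandAdj v w) :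
    D.Adj σ v w ∨ D.Adj σ w v := by
  cases h with
  | bare p h => exact Or.inl (.bare p h)
  | first g h => exact Or.inl (.first g fun w hw hc => h w ⟨hw, hc⟩)
  | last g h => exact Or.inr (.first g fun w hw hc => h w ⟨hw, hc⟩)
  | segment g l hl hn =>
    refine Or.inl (.segment g l l.opp hl.1 hl.2 (fun w hw hc => ?_) rfl)
    refine hn w ⟨hl.1.trans hw.symm, ?_⟩ ⟨hw, hc.2⟩
    rw [hw]
    exact hc.1

theorem adj_smooth (σ : D.State) (g : D.Germ) :
    D.Adj σ (.inr g) (.inr (smooth σ.full g)) ∨ D.Adj σ (.inr (smooth σ.full g)) (.inr g) := by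
  set c := D.crossingOf g with hc
  have hup : ∀ u : D.Germ, D.crossingOf u = c → D.top u.1.1 → u = c.1 ∨ D.IsOpposite c.1 u := by
    intro u hu ht
    rcases eq_or_of_crossingOf_eq hu with h | h | h | h
    · exact Or.inl h
    · rw [h, Germ.top_next] at ht
      exact absurd c.2.1 ht
    · exact Or.inr (congrArg Subtype.val h)
    · rw [h, Germ.top_prev] at ht
      exact absurd c.2.1 ht
  by_cases ht : D.top g.1.1
  · left
    cases hσ : σ c with
    | true =>
      rw [smooth_next (b := true) (by simp [hσ, ← hc]) (by simp [ht])]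
      exact .infinity c g _ hσ (hup g hc.symm ht) rfl
    | false =>
      rw [smooth_prev (b := false) (by simp [hσ, ← hc]) (by simp [ht])]
      exact .zero c g _ hσ (hup g hc.symm ht) (congrArg Subtype.val g.prev_next.symm)
  · right
    cases hσ : σ c with
    | true =>
      rw [smooth_prev (b := true) (by simp [hσ, ← hc]) (by simp [ht])]
      exact .infinity c _ g hσ (hup _ (by rw [crossingOf_prev, hc]) (g.top_prev.2 ht))
        (congrArg Subtype.val g.prev_next.symm)
    | false =>
      rw [smooth_next (b := false) (by simp [hσ, ← hc]) (by simp [ht])]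
      exact .zero c _ g hσ (hup _ (by rw [crossingOf_next, hc]) (g.top_next.2 ht)) rfl

theorem Adj.strand_or_turn {σ : D.State} {v w : D.Vertex} (h : D.Adj σ v w) :
    w = D.strand v ∨ w = innerTurn σ.full v := by
  have hup : ∀ (c : D.Crossing) (g : D.Germ), g = c.1 ∨ D.IsOpposite c.1 g →
      D.crossingOf g = c ∧ D.top g.1.1 := by
    rintro c g (rfl | h)
    · exact ⟨crossingOf_crossing c, c.2.1⟩
    · have : g = c.1.opp := Subtype.ext h
      rw [this, crossingOf_opp, Germ.top_opp]
      exact ⟨crossingOf_crossing c, c.2.1⟩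
  cases h with
  | bare p h => exact Or.inl (strandAdj_iff.1 (.bare p h)).symm
  | first g h => exact Or.inl (strandAdj_iff.1 (.first g fun w hw => h w hw.1 hw.2)).symm
  | segment g l h hl hc hn hh =>
    left
    have : h = l.opp := Subtype.ext hh
    rw [this]
    refine (strandAdj_iff.1 (.segment g l ⟨hl, hc⟩ fun w hw hw' => ?_)).symm
    refine hn w hw'.1 ⟨?_, hw'.2⟩
    rw [← hw'.1]
    exact hw.2
  | infinity c g h hσ hg hh =>
    right
    obtain ⟨h1, h2⟩ := hup c g hg
    have : h = g.next := Subtype.ext hh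
    rw [this]
    exact congrArg Sum.inr (smooth_next (b := true) (by simp [h1, hσ]) (by simp [h2])).symm
  | zero c g h hσ hg hh =>
    right
    obtain ⟨h1, h2⟩ := hup c g hg
    have : h = g.prev := by
      rw [show g = h.next from Subtype.ext hh, Germ.next_prev]
    rw [this]
    exact congrArg Sum.inr (smooth_prev (b := false) (by simp [h1, hσ]) (by simp [h2])).symm

theorem joined_strand (σ : D.State) (v : D.Vertex) : D.Joined σ v (D.strand v) := by
  rcases adj_of_strandAdj σ (strandAdj_strand v) with h | h
  · exact .rel _ _ h
  · exact .symm _ _ (.rel _ _ h)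

theorem joined_innerTurn (σ : D.State) (v : D.Vertex) : D.Joined σ v (innerTurn σ.full v) := by
  rcases v with p | g
  · exact .refl _
  · rcases adj_smooth σ g with h | h
    · exact .rel _ _ h
    · exact .symm _ _ (.rel _ _ h)

end Layered

/-! ## Orbits of two involutions -/

/-- The relation generated by two maps. -/
def Alternating {V : Type*} (s t : V → V) : V → V → Prop :=
  Relation.EqvGen fun v w => w = s v ∨ w = t v

namespace Alternating

variable {V : Type*} {s t : V → V}

theorem left (v : V) : Alternating s t v (s v) := .rel _ _ (Or.inl rfl)

theorem right (v : V) : Alternating s t v (t v) := .rel _ _ (Or.inr rfl)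

theorem refl (v : V) : Alternating s t v v := Relation.EqvGen.refl v

theorem symm {v w : V} (h : Alternating s t v w) : Alternating s t w v := Relation.EqvGen.symm _ _ h

theorem trans {v w u : V} (h : Alternating s t v w) (h' : Alternating s t w u) :
    Alternating s t v u := Relation.EqvGen.trans _ _ _ h h'

/-- Applied to `Prop`-valued functions, this is the induction principle along an orbit: a property
preserved by two involutions spreads over the orbit. -/
theorem map_eq {X : Type*} {f : V → X} (hs : ∀ v, f (s v) = f v) (ht : ∀ v, f (t v) = f v) {v w : V}
    (h : Alternating s t v w) : f v = f w := by
  induction h with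
  | rel v w h =>
    rcases h with rfl | rfl
    · exact (hs v).symm
    · exact (ht v).symm
  | refl => rfl
  | symm _ _ _ ih => exact ih.symm
  | trans _ _ _ _ _ ih ih' => exact ih.trans ih'

/-- The composition of the two involutions. -/
def rotation (hs : ∀ v, s (s v) = v) (ht : ∀ v, t (t v) = v) : Equiv.Perm V where
  toFun v := t (s v)
  invFun v := s (t v)
  left_inv v := by simp [hs, ht]
  right_inv v := by simp [hs, ht]

/-- The dihedral relation: each of the two involutions inverts their product. -/
theorem rotation_zpow_t (hs : ∀ v, s (s v) = v) (ht : ∀ v, t (t v) = v) (v : V) (k : ℤ) :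
    t ((rotation hs ht ^ k) v) = (rotation hs ht ^ (-k)) (t v) := by
  have h1 : ∀ v, t (rotation hs ht v) = (rotation hs ht)⁻¹ (t v) := fun v => by
    change t (t (s v)) = s (t (t v))
    rw [ht, ht]
  have h2 : ∀ v, t ((rotation hs ht)⁻¹ v) = rotation hs ht (t v) := fun v => by
    change t (s (t v)) = t (s (t v))
    rfl
  induction k with
  | zero => simp
  | succ n ih =>
    rw [add_comm, zpow_add, Equiv.Perm.mul_apply, zpow_one, h1, ih, neg_add, zpow_add, zpow_neg_one,
      Equiv.Perm.mul_apply]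
  | pred n ih =>
    rw [sub_eq_neg_add, zpow_add, Equiv.Perm.mul_apply, zpow_neg_one, h2, ih, neg_add, neg_neg,
      zpow_add, neg_neg, zpow_one, Equiv.Perm.mul_apply]

/-- A reflection applied to a rotate of a fixed point is again a rotate of it, because the
reflection inverts the rotation and fixes the base point. Hence the rotations alone sweep out the
dihedral orbit. -/
theorem exists_zpow_of_fixed (hs : ∀ v, s (s v) = v) (ht : ∀ v, t (t v) = v) {e w : V} (he : t e = e) (h : Alternating s t e w) :
    ∃ k : ℤ, w = (rotation hs ht ^ k) e := by
  have key : ∀ v w : V, Alternating s t v w → ((∃ k : ℤ, v = (rotation hs ht ^ k) e) ↔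
      ∃ k : ℤ, w = (rotation hs ht ^ k) e) := by
    have hS : ∀ v, (∃ k : ℤ, v = (rotation hs ht ^ k) e) → ∃ k : ℤ, s v = (rotation hs ht ^ k) e := by
      rintro v ⟨k, rfl⟩
      refine ⟨-(1 + k), ?_⟩
      have h1 := rotation_zpow_t hs ht e (1 + k)
      rw [he] at h1
      rw [← h1, zpow_add, zpow_one, Equiv.Perm.mul_apply]
      change _ = t (t (s _))
      rw [ht]
    have hT : ∀ v, (∃ k : ℤ, v = (rotation hs ht ^ k) e) → ∃ k : ℤ, t v = (rotation hs ht ^ k) e := by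
      rintro v ⟨k, rfl⟩
      exact ⟨-k, by rw [rotation_zpow_t hs ht, he]⟩
    intro v w hvw
    have := map_eq (f := fun v => ∃ k : ℤ, v = (rotation hs ht ^ k) e)
      (fun v => propext ⟨fun h => by simpa [hs] using hS _ h, hS v⟩)
      (fun v => propext ⟨fun h => by simpa [ht] using hT _ h, hT v⟩) hvw
    exact iff_of_eq this
  exact (key e w h).1 ⟨0, rfl⟩

/-- An orbit of two involutions of a finite set, the first of them without fixed points, that
contains a fixed point of the second contains exactly two of them. -/
theorem exists_other_fixed [Finite V] (hs : ∀ v, s (s v) = v) (ht : ∀ v, t (t v) = v) 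
    (hne : ∀ v, s v ≠ v) {e : V} (he : t e = e) :
    ∃ e', e' ≠ e ∧ t e' = e' ∧ Alternating s t e e' ∧
      ∀ u, t u = u → Alternating s t e u → u = e ∨ u = e' := by
  set π := rotation hs ht with hπ
  have hmem : ∀ k : ℤ, Alternating s t e ((π ^ k) e) := by
    have h1 : ∀ v, Alternating s t v (π v) := fun v => (left v).trans (right (s v))
    have h2 : ∀ v, Alternating s t v (π⁻¹ v) := fun v => (right v).trans (left (t v))
    intro k
    induction k with
    | zero => exact refl _
    | succ n ih =>
      rw [add_comm, zpow_add, Equiv.Perm.mul_apply, zpow_one]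
      exact ih.trans (h1 _)
    | pred n ih =>
      rw [sub_eq_neg_add, zpow_add, Equiv.Perm.mul_apply, zpow_neg_one]
      exact ih.trans (h2 _)
  set n := Function.minimalPeriod π e with hn
  have hper : ∀ k : ℤ, (π ^ k) e = e ↔ (n : ℤ) ∣ k := fun k =>
    MulAction.zpow_smul_eq_iff_minimalPeriod_dvd (a := π) (b := e) (n := k)
  have hpos : 0 < n := Function.minimalPeriod_pos_of_mem_periodicPts
    (Function.Injective.mem_periodicPts π.injective e)
  -- By the dihedral relation `t` sends `π^k e` to `π^(-k) e`, so these are equal exactly when the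
  -- period divides `2k`.
  have hT : ∀ k : ℤ, t ((π ^ k) e) = (π ^ k) e ↔ (n : ℤ) ∣ 2 * k := by
    intro k
    have : (π ^ (2 * k)) e = (π ^ k) ((π ^ k) e) := by
      rw [two_mul, zpow_add, Equiv.Perm.mul_apply]
    rw [← hper, rotation_zpow_t hs ht, he, this, zpow_neg, Equiv.Perm.inv_eq_iff_eq, ← hπ, eq_comm]
  -- For an odd period `2m + 1` the point `π^m e` would be fixed by `s`. For an even period `2m` the
  -- second fixed point of `t` is `π^m e`.
  have heven : ∃ m : ℕ, n = 2 * m := by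
    rcases Nat.even_or_odd' n with ⟨m, hm | hm⟩
    · exact ⟨m, hm⟩
    · exfalso
      apply hne ((π ^ (m : ℤ)) e)
      have h1 := rotation_zpow_t hs ht e (1 + m)
      rw [he, zpow_add, zpow_one, Equiv.Perm.mul_apply] at h1
      change t (t (s _)) = _ at h1
      rw [ht] at h1
      rw [← hπ] at h1
      rw [h1]
      have h2 : (π ^ (n : ℤ)) e = e := (hper _).2 dvd_rfl
      have h3 : (n : ℤ) = (1 + m) + m := by rw [hm]; push_cast; ring
      rw [h3, zpow_add, Equiv.Perm.mul_apply] at h2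
      rw [zpow_neg, Equiv.Perm.inv_eq_iff_eq]
      exact h2.symm
  obtain ⟨m, hm⟩ := heven
  have hm0 : 0 < m := by omega
  refine ⟨(π ^ (m : ℤ)) e, ?_, ?_, hmem _, ?_⟩
  · intro h
    rw [hper] at h
    have := Int.le_of_dvd (by exact_mod_cast hm0) h
    omega
  · rw [hT, hm]
    push_cast
    exact dvd_rfl
  · intro u hu h
    obtain ⟨k, rfl⟩ := exists_zpow_of_fixed hs ht he h
    have h1 := (hT k).1 hu
    obtain ⟨j, hj⟩ := h1
    have hk : k = m * j := by
      rw [hm] at hj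
      push_cast at hj
      linarith
    rcases Int.even_or_odd' j with ⟨i, hi | hi⟩
    · left
      change (π ^ k) e = e
      rw [hper, hk, hi, hm]
      exact ⟨i, by push_cast; ring⟩
    · right
      change (π ^ k) e = _
      have : k = m + n * i := by rw [hk, hi, hm]; push_cast; ring
      rw [this, zpow_add, Equiv.Perm.mul_apply, (hper _).2 ⟨i, rfl⟩]

end Alternating

/-! ## Planarity of smoothings -/

namespace Layered

variable {F : PolygonSurface} {D : Layered F}

theorem joined_iff (σ : D.State) (v w : D.Vertex) :
    D.Joined σ v w ↔ Alternating D.strand (innerTurn σ.full) v w := by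
  constructor
  · intro h
    induction h with
    | rel v w h => exact .rel _ _ h.strand_or_turn
    | refl => exact .refl _
    | symm _ _ _ ih => exact ih.symm
    | trans _ _ _ _ _ ih ih' => exact ih.trans ih'
  · intro h
    induction h with
    | rel v w h =>
      rcases h with rfl | rfl
      · exact joined_strand σ v
      · exact joined_innerTurn σ v
    | refl => exact .refl _
    | symm _ _ _ ih => exact .symm _ _ ih
    | trans _ _ _ _ _ ih ih' => exact .trans _ _ _ ih ih'

/-- Chords of one layer do not cross, so both ends are on the same side. If `u` is itself an end of
the chord at `a`, both sides of the equivalence are false. -/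
theorem not_cross_cyc {a u : D.Point} (h : D.top u ↔ D.top a) :
    CycNat (D.pos a) (D.pos u) (D.pos (D.chord a)) ↔
      CycNat (D.pos a) (D.pos (D.chord u)) (D.pos (D.chord a)) := by
  have h1 := (D.cross_iff _ _).not.1 (D.noncrossing a u h.symm)
  have h2 := (D.cross_iff _ _).not.1 (D.noncrossing a (D.chord u) (by rw [D.top_chord, h]))
  rw [D.chord_chord] at h2
  have h3 : D.pos u = D.pos a ↔ D.pos (D.chord u) = D.pos (D.chord a) := by
    rw [D.pos_inj, D.pos_inj, D.chord_injective.eq_iff]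
  have h4 : D.pos u = D.pos (D.chord a) ↔ D.pos (D.chord u) = D.pos a := by
    rw [D.pos_inj, D.pos_inj]
    exact ⟨fun h => by rw [h, D.chord_chord], fun h => by rw [← h, D.chord_chord]⟩
  have h5 := D.pos_inj.not.2 (D.chord_ne a)
  unfold CycNat at *
  omega

theorem pos_ne_of_top {a u : D.Point} (h : ¬ (D.top u ↔ D.top a)) : D.pos u ≠ D.pos a := fun he => by
  rw [D.pos_inj] at he
  exact h (by rw [he])

/-- A chord that misses the chord at `a` lies on one side of it. -/
theorem cyc_of_not_cross {a u : D.Point} (h : ¬ (D.top u ↔ D.top a))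
    (h1 : ¬ D.toChordDiagram.Cross u a) (h2 : ¬ D.toChordDiagram.Cross u (D.chord a)) :
    CycNat (D.pos a) (D.pos u) (D.pos (D.chord a)) ↔
      CycNat (D.pos a) (D.pos (D.chord u)) (D.pos (D.chord a)) := by
  rw [D.cross_iff] at h1 h2
  rw [D.chord_chord] at h2
  have n1 := pos_ne_of_top h
  have n2 : D.pos u ≠ D.pos (D.chord a) := pos_ne_of_top (by rwa [D.top_chord])
  have n3 : D.pos (D.chord u) ≠ D.pos a := pos_ne_of_top (by rwa [D.top_chord])
  have n4 : D.pos (D.chord u) ≠ D.pos (D.chord a) := pos_ne_of_top (by rwa [D.top_chord, D.top_chord])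
  have n5 := D.pos_inj.not.2 (D.chord_ne a)
  have n6 := D.pos_inj.not.2 (D.chord_ne u)
  unfold CycNat at *
  omega

/-- The counterclockwise order in a germ determines which end of the crossing chord is recorded, so
the two ends of one chord cannot both be recorded with the same directed chord. -/
theorem snd_ne_chord_snd {w g : D.Germ} (h : w.1.1 = g.1.1) : w.1.2 ≠ D.chord g.1.2 := by
  intro he
  have h1 := (D.cross_iff _ _).1 w.2
  have h2 := (D.cross_iff _ _).1 g.2
  rw [h, he, D.chord_chord] at h1
  unfold CycNat at *
  omega

/-- The point is an end of the chord at `a`. -/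
def OnChord (a x : D.Point) : Prop := x = a ∨ x = D.chord a

theorem onChord_chord {a x : D.Point} : OnChord a (D.chord x) ↔ OnChord a x := by
  unfold OnChord
  rw [D.chord_injective.eq_iff]
  constructor
  · rintro (h | h)
    · exact Or.inr (by rw [← h, D.chord_chord])
    · exact Or.inl h
  · rintro (h | h)
    · exact Or.inr h
    · exact Or.inl (by rw [h, D.chord_chord])

/-- Straight chords cross at most once. -/
theorem germ_eq_of_onChord {a : D.Point} {w g : D.Germ} (h : w.1.1 = g.1.1)
    (hw : OnChord a w.1.2) (hg : OnChord a g.1.2) : w = g := by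
  refine Germ.ext h ?_
  have h1 := snd_ne_chord_snd h
  have h2 := snd_ne_chord_snd h.symm
  rcases hw with hw | hw <;> rcases hg with hg | hg
  · rw [hw, hg]
  · rw [hw, hg] at h2; exact absurd rfl h2
  · rw [hw, hg] at h1; exact absurd rfl h1
  · rw [hw, hg]

/-- The position of a point, counted from another one. -/
def relPos (D : Layered F) (a x : D.Point) : ℕ :=
  if D.pos a ≤ D.pos x then D.pos x - D.pos a else D.pos x + (∑ y, (D.pos y + 1)) - D.pos a

/-- Cutting the boundary open at `a` keeps the cyclic order and puts `a` at zero; lying on a given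
side of the chord at `a` then becomes a single inequality. -/
theorem cycNat_relPos (a x y z : D.Point) : CycNat (D.pos x) (D.pos y) (D.pos z) ↔
    CycNat (D.relPos a x) (D.relPos a y) (D.relPos a z) := by
  have hb : ∀ x, D.pos x + 1 ≤ ∑ y, (D.pos y + 1) := fun x =>
    Finset.single_le_sum (f := fun y => D.pos y + 1) (fun _ _ => Nat.zero_le _) (Finset.mem_univ x)
  have h0 := hb a
  have h1 := hb x
  have h2 := hb y
  have h3 := hb z
  unfold relPos
  generalize ∑ y, (D.pos y + 1) = M at *
  unfold CycNat
  split_ifs <;> omega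

theorem relPos_self (a : D.Point) : D.relPos a a = 0 := by simp [relPos]

theorem relPos_inj (a : D.Point) {x y : D.Point} : D.relPos a x = D.relPos a y ↔ x = y := by
  refine ⟨fun h => ?_, fun h => by rw [h]⟩
  have hb : ∀ x, D.pos x + 1 ≤ ∑ y, (D.pos y + 1) := fun x =>
    Finset.single_le_sum (f := fun y => D.pos y + 1) (fun _ _ => Nat.zero_le _) (Finset.mem_univ x)
  have h0 := hb a
  have h1 := hb x
  have h2 := hb y
  apply D.pos_inj.1
  unfold relPos at h
  split_ifs at h <;> omega

theorem cycNat_zero_left {x y : ℕ} (h : 0 < x) : CycNat 0 x y ↔ x < y := by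
  unfold CycNat; omega

theorem cycNat_zero_middle {x y : ℕ} (h : 0 < y) : CycNat x 0 y ↔ y < x := by
  unfold CycNat; omega

/-- If a chord through `u` misses the chord at `a` on the way from `u` to the crossing with `v`, then
`u` and `v` lie on the same side of the chord at `a`. -/
theorem cyc_iff_of_nearer {a : D.Point} (g : D.Germ) (h : D.top g.1.2 ↔ D.top a)
    (hv : ¬ OnChord a g.1.2) (h1 : ∀ w : D.Germ, D.Nearer w g → ¬ OnChord a w.1.2) :
    CycNat (D.pos a) (D.pos g.1.1) (D.pos (D.chord a)) ↔
      CycNat (D.pos a) (D.pos g.1.2) (D.pos (D.chord a)) := by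
  obtain ⟨⟨u, v⟩, hg⟩ := g
  simp only at *
  have k1 : ¬ (D.toChordDiagram.Cross u a ∧ D.count.Cyc u a v) := fun hw =>
    h1 ⟨(u, a), hw.1⟩ ⟨rfl, hw.2⟩ (Or.inl rfl)
  have k2 : ¬ (D.toChordDiagram.Cross u (D.chord a) ∧ D.count.Cyc u (D.chord a) v) := fun hw =>
    h1 ⟨(u, D.chord a), hw.1⟩ ⟨rfl, hw.2⟩ (Or.inr rfl)
  have hua : ¬ (D.top u ↔ D.top a) := by
    have := top_ne_of_cross hg
    tauto
  have hne : ∀ {x y : D.Point}, ¬ (D.top x ↔ D.top y) → D.relPos a x ≠ D.relPos a y :=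
    fun h he => h (by rw [(relPos_inj a).1 he])
  have n1 := hne hua
  have n2 : D.relPos a u ≠ D.relPos a (D.chord a) := hne (by rwa [D.top_chord])
  have n3 : D.relPos a (D.chord u) ≠ D.relPos a a := hne (by rwa [D.top_chord])
  have n4 : D.relPos a (D.chord u) ≠ D.relPos a (D.chord a) := hne (by rwa [D.top_chord, D.top_chord])
  have n7 := (relPos_inj a).not.2 (not_or.1 hv).1
  have n8 := (relPos_inj a).not.2 (not_or.1 hv).2
  have n9 := not_cross_cyc (D := D) h
  have n10 := (relPos_inj a).not.2 (not_or.1 (onChord_chord.not.2 hv)).1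
  have n11 := (relPos_inj a).not.2 (not_or.1 (onChord_chord.not.2 hv)).2
  have n12 := (relPos_inj a).not.2 (D.chord_ne a)
  rw [D.cross_iff, StrandCount.cyc_iff] at k1 k2
  rw [D.chord_chord] at k2
  rw [D.cross_iff] at hg
  change ¬ (_ ∧ CycNat (D.pos u) (D.pos a) (D.pos v)) at k1
  change ¬ (_ ∧ CycNat (D.pos u) (D.pos (D.chord a)) (D.pos v)) at k2
  simp only [cycNat_relPos a] at k1 k2 hg n9 ⊢
  rw [relPos_self] at *
  generalize D.relPos a u = u at *
  generalize D.relPos a v = v at *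
  generalize D.relPos a (D.chord a) = A at *
  generalize D.relPos a (D.chord _) = U at *
  generalize D.relPos a (D.chord _) = V at *
  have p1 : 0 < u := Nat.pos_of_ne_zero n1
  have p2 : 0 < U := Nat.pos_of_ne_zero n3
  have p3 : 0 < v := Nat.pos_of_ne_zero n7
  have p4 : 0 < V := Nat.pos_of_ne_zero n10
  have p5 : 0 < A := Nat.pos_of_ne_zero n12
  simp only [cycNat_zero_left, cycNat_zero_middle, p1, p2, p3, p4, p5] at *
  unfold CycNat at *
  omega

theorem cyc_iff_of_farther {a : D.Point} (g : D.Germ) (h : D.top g.1.2 ↔ D.top a)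
    (hv : ¬ OnChord a g.1.2) (h1 : ∀ w : D.Germ, D.Nearer g w → ¬ OnChord a w.1.2) :
    CycNat (D.pos a) (D.pos (D.chord g.1.1)) (D.pos (D.chord a)) ↔
      CycNat (D.pos a) (D.pos g.1.2) (D.pos (D.chord a)) := by
  rw [not_cross_cyc h]
  refine cyc_iff_of_nearer g.opp (by rw [← h]; exact D.top_chord _) (onChord_chord.not.2 hv) ?_
  intro w hw
  have hw' := hw.opp
  rw [Germ.opp_opp] at hw'
  exact fun hc => h1 _ hw' (onChord_chord.2 hc)

open Classical in
/-- The boundary point by which the side of a chord on which a vertex lies is decided. -/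
noncomputable def sidePoint (a : D.Point) : D.Vertex → D.Point
  | .inl u => u
  -- If the chord of the germ is in the layer of `a`, it misses the chord at `a` and its own end
  -- decides. If the germ sits on the chord at `a` itself, the end to which it points decides.
  -- Otherwise the crossing lies on a chord in the layer of `a`, which stays on one side, so an end
  -- of that chord decides.
  | .inr g => if (D.top g.1.1 ↔ D.top a) ∨ OnChord a g.1.2 then g.1.1 else g.1.2

/-- The vertex (or rather the strand next to it) lies to the left of the chord which points to
`a`. -/
def LeftOf (a : D.Point) (v : D.Vertex) : Prop :=
  CycNat (D.pos a) (D.pos (sidePoint a v)) (D.pos (D.chord a))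

/-- A strand segment has no crossing in its interior, so it stays on one side of the chord at `a`. A
germ on that chord is attributed to the side into which it points. -/
theorem leftOf_strandAdj (a : D.Point) {v w : D.Vertex} (h : D.StrandAdj v w) :
    LeftOf a v ↔ LeftOf a w := by
  have hfirst : ∀ g : D.Germ, (∀ w, ¬ D.Nearer w g) →
      (LeftOf a (.inl g.1.1) ↔ LeftOf a (.inr g)) := by
    intro g hn
    unfold LeftOf
    simp only [sidePoint]
    split_ifs with hc
    · rfl
    · have := g.top_snd
      have hc' : ¬ OnChord a g.1.2 := fun h => hc (Or.inr h)
      exact cyc_iff_of_nearer g (by tauto) hc' fun w hw => absurd hw (hn w)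
  cases h with
  | bare p h =>
    unfold LeftOf
    simp only [sidePoint]
    by_cases ht : D.top p ↔ D.top a
    · exact not_cross_cyc ht
    · exact cyc_of_not_cross ht (fun hc => h ⟨(p, a), hc⟩ rfl) (fun hc => h ⟨(p, D.chord a), hc⟩ rfl)
  | first g h => exact hfirst g h
  | last g h => exact (hfirst g h).symm
  | segment g l hl hn =>
    have t1 := l.top_opp
    have t5 : D.top l.1.1 ↔ D.top g.1.1 := by rw [hl.1]
    have hopp : l.opp.1.1 = D.chord g.1.1 := congrArg D.chord hl.1
    unfold LeftOf
    simp only [sidePoint]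
    by_cases ht : D.top g.1.1 ↔ D.top a
    · rw [if_pos (Or.inl ht), if_pos (Or.inl (t1.trans (t5.trans ht))), hopp]
      exact not_cross_cyc ht
    · have hno : ¬ (D.top l.opp.1.1 ↔ D.top a) := fun h => ht (t5.symm.trans (t1.symm.trans h))
      have hv : ∀ w : D.Germ, w.1.1 = g.1.1 → (D.top w.1.2 ↔ D.top a) := fun w hw => by
        have := w.top_snd
        rw [hw] at this
        tauto
      have hflip : CycNat (D.pos a) (D.pos l.opp.1.2) (D.pos (D.chord a)) ↔
          CycNat (D.pos a) (D.pos l.1.2) (D.pos (D.chord a)) := (not_cross_cyc (hv l hl.1)).symm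
      have hiff : OnChord a l.opp.1.2 ↔ OnChord a l.1.2 := onChord_chord
      by_cases hg : OnChord a g.1.2
      · have hnl : ∀ w, D.Nearer w g → ¬ OnChord a w.1.2 := fun w hw hc =>
          Nearer.irrefl g (by rwa [germ_eq_of_onChord hw.1 hc hg] at hw)
        have h1 : ¬ ((D.top l.opp.1.1 ↔ D.top a) ∨ OnChord a l.opp.1.2) :=
          not_or.2 ⟨hno, hiff.not.2 (hnl l hl)⟩
        rw [if_pos (Or.inr hg), if_neg h1, hflip, ← hl.1]
        exact cyc_iff_of_nearer l (hv l hl.1) (hnl l hl) fun w hw => hnl w (hw.trans hl)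
      · have h2 : ¬ ((D.top g.1.1 ↔ D.top a) ∨ OnChord a g.1.2) := not_or.2 ⟨ht, hg⟩
        rw [if_neg h2]
        by_cases hla : OnChord a l.1.2
        · rw [if_pos (Or.inr (hiff.2 hla)), hopp]
          refine (cyc_iff_of_farther g (hv g rfl) hg fun w hw hc => ?_).symm
          have hlw := hl.trans hw
          rw [germ_eq_of_onChord hlw.1 hla hc] at hlw
          exact Nearer.irrefl _ hlw
        · have h1 : ¬ ((D.top l.opp.1.1 ↔ D.top a) ∨ OnChord a l.opp.1.2) := 
            not_or.2 ⟨hno, hiff.not.2 hla⟩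
          rw [if_neg h1, hflip]
          -- If the chord at `a` is crossed beyond the nearer end of the segment, the segment lies
          -- on the side of the far end point; otherwise it lies on the side of the near one.
          by_cases hcr : ∃ w : D.Germ, D.Nearer w l ∧ OnChord a w.1.2
          · obtain ⟨w, hw, hwa⟩ := hcr
            have hfar : ∀ u : D.Germ, u.1.1 = g.1.1 → D.Nearer w u →
                ∀ w', D.Nearer u w' → ¬ OnChord a w'.1.2 := fun u hu hwu w' hw' hc => by
              have h3 := hwu.trans hw'
              rw [germ_eq_of_onChord h3.1 hwa hc] at h3
              exact Nearer.irrefl _ h3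
            rw [← cyc_iff_of_farther g (hv g rfl) hg (hfar g rfl (hw.trans hl)),
              ← cyc_iff_of_farther l (hv l hl.1) hla (hfar l hl.1 hw), hl.1]
          · push Not at hcr
            rw [← cyc_iff_of_nearer g (hv g rfl) hg ?_, ← cyc_iff_of_nearer l (hv l hl.1) hla hcr, hl.1]
            intro w hw hc
            rcases nearer_trichotomy (hw.1.trans hl.1.symm) with hh | hh | hh
            · exact hcr w hh hc
            · rw [hh] at hc
              exact hla hc
            · exact hn w hh hw

end Layered

/-! ### Coloring the regions of a smoothed diagram modulo two. -/

namespace Layered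

variable {F : PolygonSurface} {D : Layered F}

noncomputable instance (D : Layered F) : Fintype D.Germ := Fintype.ofFinite _

/-- The counterclockwise rotation of the germs at the crossings. -/
def nextEquiv (D : Layered F) : D.Germ ≃ D.Germ where
  toFun := Germ.next
  invFun := Germ.prev
  left_inv := Germ.next_prev
  right_inv := Germ.prev_next

theorem sidePoint_fst {a : D.Point} {g : D.Germ} (h : (D.top g.1.1 ↔ D.top a) ∨ OnChord a g.1.2) :
    sidePoint a (.inr g) = g.1.1 := if_pos h

theorem sidePoint_snd {a : D.Point} {g : D.Germ} (h : ¬ (D.top g.1.1 ↔ D.top a))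
    (h' : ¬ OnChord a g.1.2) : sidePoint a (.inr g) = g.1.2 := if_neg (not_or.2 ⟨h, h'⟩)

/-- The crossing is not on the chord at `a`, so all its germs are on one side. Smoothing such a
crossing does not leave the side. -/
theorem leftOf_next {a : D.Point} {g : D.Germ} (h1 : ¬ OnChord a g.1.1) (h2 : ¬ OnChord a g.1.2) :
    LeftOf a (.inr g) ↔ LeftOf a (.inr g.next) := by
  have h3 : ¬ OnChord a g.next.1.2 := onChord_chord.not.2 h1
  have ht := g.top_next
  unfold LeftOf
  by_cases hu : D.top g.1.1 ↔ D.top a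
  · rw [sidePoint_fst (Or.inl hu), sidePoint_snd (by tauto) h3]
    exact not_cross_cyc hu
  · rw [sidePoint_snd hu h2, sidePoint_fst (Or.inl (by tauto))]
    rfl

/-- A function on the vertices with values modulo two that is invariant under the strands and the
smoothings of a state, such as the indicator function of an orbit. -/
structure Invariant (σ : D.State) (x : D.Vertex → ZMod 2) : Prop where
  strand : ∀ v, x (D.strand v) = x v
  smooth : ∀ g, x (.inr (smooth σ.full g)) = x (.inr g)

namespace Invariant

variable {σ : D.State} {x : D.Vertex → ZMod 2}

theorem smooth_cases (σ : D.State) (g : D.Germ) :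
    (Layered.smooth σ.full g = g.next ∧ Layered.smooth σ.full g.opp = g.prev) ∨
      (Layered.smooth σ.full g = g.prev ∧ Layered.smooth σ.full g.opp = g.next) := by
  by_cases h : D.top g.1.1 ↔ σ (D.crossingOf g) = true
  · left
    rw [smooth_next (b := σ (D.crossingOf g)) rfl h, smooth_next (b := σ (D.crossingOf g))
      (by rw [crossingOf_opp]) (by rwa [Germ.top_opp]), Germ.opp_next]
    exact ⟨rfl, rfl⟩
  · right
    rw [smooth_prev (b := σ (D.crossingOf g)) rfl h, smooth_prev (b := σ (D.crossingOf g))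
      (by rw [crossingOf_opp]) (by rwa [Germ.top_opp]), Germ.opp_prev]
    exact ⟨rfl, rfl⟩

/-- A smoothing joins the four germs of a crossing in two pairs with equal values, which cancel
modulo two. -/
theorem add_germs (hx : Invariant σ x) (g : D.Germ) :
    x (.inr g) + x (.inr g.next) + x (.inr g.opp) + x (.inr g.prev) = 0 := by
  have h1 := hx.smooth g
  have h2 := hx.smooth g.opp
  rcases smooth_cases σ g with ⟨h3, h4⟩ | ⟨h3, h4⟩ <;> rw [h3] at h1 <;> rw [h4] at h2 <;>
    rw [h1, h2] <;> ring_nf <;> rw [show (2 : ZMod 2) = 0 from rfl] <;> ring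

/-- `strand` is an involution without fixed points that preserves both the values and the region, so
the terms cancel in pairs. `sum_germs` is the same argument for the smoothing. -/
theorem sum_strand (hx : Invariant σ x) (S : D.Vertex → Prop) [DecidablePred S]
    (hS : ∀ v, S v ↔ S (D.strand v)) :
    ∑ p : D.Point, (if S (.inl p) then x (.inl p) else 0) +
      ∑ g : D.Germ, (if S (.inr g) then x (.inr g) else 0) = 0 := by
  rw [← Fintype.sum_sum_type (fun v => if S v then x v else 0)]
  refine Finset.sum_involution (fun v _ => D.strand v) ?_ ?_ ?_ ?_
  · intro v _
    rw [hx.strand]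
    simp only [← hS v]
    exact CharTwo.add_self_eq_zero _
  · intro v _ _
    exact strand_ne v
  · intro v _
    exact Finset.mem_univ _
  · intro v _
    exact strand_strand v

theorem sum_germs (hx : Invariant σ x) (S : D.Germ → Prop) [DecidablePred S]
    (hS : ∀ g, S g → S (Layered.smooth σ.full g)) :
    ∑ g : D.Germ, (if S g then x (.inr g) else 0) = 0 := by
  refine Finset.sum_involution (fun g _ => Layered.smooth σ.full g) ?_ ?_ ?_ ?_
  · intro g _
    have : S (Layered.smooth σ.full g) ↔ S g := ⟨fun h => by simpa using hS _ h, hS g⟩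
    rw [hx.smooth]
    simp only [this]
    exact CharTwo.add_self_eq_zero _
  · intro g _ _
    exact smooth_ne _ g
  · intro g _
    exact Finset.mem_univ _
  · intro g _
    exact smooth_smooth _ g

theorem sum_points (hx : Invariant σ x) : ∑ p : D.Point, x (.inl p) = 0 := by
  have h1 := hx.sum_strand (fun _ => True) (fun _ => Iff.rfl)
  have h2 := hx.sum_germs (fun _ => True) (fun _ h => h)
  simp only [if_true] at h1 h2
  rwa [h2, add_zero] at h1

/-- The number of ends at or before a point. -/
noncomputable def upTo (x : D.Vertex → ZMod 2) (a : D.Point) : ZMod 2 :=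
  ∑ p : D.Point, if D.pos p ≤ D.pos a then x (.inl p) else 0

/-- The number of ends before a point. -/
noncomputable def below (x : D.Vertex → ZMod 2) (a : D.Point) : ZMod 2 :=
  ∑ p : D.Point, if D.pos p < D.pos a then x (.inl p) else 0

theorem upTo_add_below (x : D.Vertex → ZMod 2) (a : D.Point) : upTo x a + below x a = x (.inl a) := by
  unfold upTo below
  rw [← Finset.sum_add_distrib, Finset.sum_eq_single a]
  · simp
  · intro p _ hp
    have := D.pos_inj.not.2 hp
    split_ifs
    · exact CharTwo.add_self_eq_zero _
    · omega
    · omega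
    · exact add_zero _
  · intro h
    exact absurd (Finset.mem_univ a) h

open Classical in
theorem sum_between (hx : Invariant σ x) {a b : D.Point} (hab : a ≠ b) :
    ∑ p : D.Point, (if CycNat (D.pos a) (D.pos p) (D.pos b) then x (.inl p) else 0) =
      upTo x a + below x b := by
  have hne := D.pos_inj.not.2 hab
  unfold upTo below
  by_cases hlt : D.pos a < D.pos b
  · rw [← Finset.sum_add_distrib]
    refine Finset.sum_congr rfl fun p _ => ?_
    unfold CycNat
    split_ifs <;> first | (exfalso; omega) | simp [CharTwo.add_self_eq_zero]
  -- The cyclic interval runs through corner `0`. It is compared with the complementary points,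
  -- since the sum over all points vanishes.
  · refine Eq.trans ?_ (add_zero _)
    refine Eq.trans ?_ (congrArg _ hx.sum_points)
    rw [← Finset.sum_add_distrib, ← Finset.sum_add_distrib]
    refine Finset.sum_congr rfl fun p _ => ?_
    unfold CycNat
    split_ifs <;> first | (exfalso; omega) | simp [CharTwo.add_self_eq_zero]

open Classical in
/-- The color to the left of a germ. -/
noncomputable def leftColor (x : D.Vertex → ZMod 2) (g : D.Germ) : ZMod 2 :=
  -- Looking towards the boundary point, the points up to and including it give the color on its
  -- left. On the way in to the crossing, the left color changes at each passed crossing by the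
  -- value of the germ that leaves to the left, which is `w.next`.
  upTo x g.1.1 + ∑ w : D.Germ, if D.Nearer w g then x (.inr w.next) else 0

open Classical in
/-- The color to the right of a germ. -/
noncomputable def rightColor (x : D.Vertex → ZMod 2) (g : D.Germ) : ZMod 2 :=
  below x g.1.1 + ∑ w : D.Germ, if D.Nearer w g then x (.inr w.prev) else 0

theorem smooth_closed {g : D.Germ} {S : D.Germ → Prop} (h1 : S g.next) (h2 : S g.prev) :
    S (Layered.smooth σ.full g) := by
  rcases smooth_cases σ g with ⟨h, _⟩ | ⟨h, _⟩ <;> rw [h] <;> assumption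

theorem leftOf_prev {a : D.Point} {g : D.Germ} (h1 : ¬ OnChord a g.1.1) (h2 : ¬ OnChord a g.1.2) :
    LeftOf a (.inr g) ↔ LeftOf a (.inr g.prev) := by
  have := leftOf_next (g := g.prev) (a := a) (onChord_chord.not.2 h2) h1
  rw [Germ.prev_next] at this
  exact this.symm

theorem not_leftOf_of_onChord {a : D.Point} {g : D.Germ} (h : OnChord a g.1.1) :
    ¬ LeftOf a (.inr g) := by
  have ht : D.top g.1.1 ↔ D.top a := by
    rcases h with h | h <;> rw [h]
    exact D.top_chord a
  unfold LeftOf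
  rw [sidePoint_fst (Or.inl ht)]
  rcases h with h | h <;> rw [h] <;> unfold CycNat <;> omega

theorem not_leftOf_of_snd {a : D.Point} {g : D.Germ} (h : g.1.2 = a) : ¬ LeftOf a (.inr g) := by
  have hc := (D.cross_iff _ _).1 g.2
  unfold LeftOf
  rw [sidePoint_fst (Or.inr (Or.inl h))]
  rw [h] at hc
  unfold CycNat at *
  omega

/-- A chord without crossings cuts off a half of the polygon that is closed under strands and
smoothings, so an even number of ends of the curve lie in it. -/
theorem sum_leftOf (hx : Invariant σ x) {a : D.Point} (ha : ∀ g : D.Germ, g.1.1 ≠ a) : upTo x a + below x (D.chord a) = 0 := by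
  classical
  have ha' : ∀ g : D.Germ, ¬ OnChord a g.1.1 := by
    rintro g (h | h)
    · exact ha g h
    · exact ha g.opp (by change D.chord g.1.1 = a; rw [h, D.chord_chord])
  have ha2 : ∀ g : D.Germ, ¬ OnChord a g.1.2 := fun g => ha' g.next
  rw [← hx.sum_between (D.chord_ne a).symm]
  have h := hx.sum_strand (LeftOf a) (fun v => leftOf_strandAdj a (strandAdj_strand v))
  have h2 := hx.sum_germs (fun g => LeftOf a (.inr g)) (fun g hg =>
    smooth_closed (S := fun g => LeftOf a (.inr g)) ((leftOf_next (ha' g) (ha2 g)).1 hg)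
      ((leftOf_prev (ha' g) (ha2 g)).1 hg))
  rw [h2, add_zero] at h
  refine Eq.trans (Finset.sum_congr rfl fun p _ => ?_) h
  exact if_congr Iff.rfl rfl rfl

/-- The chords from `b` and from `w` both cross the chord from `a` and do not cross each other. Then
`w` crosses nearer to `a` than `b` does exactly when it lies in the sector between `a` and `b`. -/
theorem sector_left {a A b B w W : ℕ} (h1 : CycNat a b A ∧ CycNat A B a)
    (h2 : CycNat a w A ∧ CycNat A W a) (h3 : ¬ (CycNat w b W ∧ CycNat W B w))
    (h4 : ¬ (CycNat b w B ∧ CycNat B W b)) (h5 : w = b ↔ W = B) :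
    (CycNat a w A ∧ CycNat B w b) ↔ CycNat a w b := by
  have e : ∀ {x y z : ℕ}, CycNat x y z → x ≠ y ∧ y ≠ z ∧ z ≠ x := by
    intro x y z h; unfold CycNat at h; omega
  obtain ⟨p1, p2⟩ := h1
  obtain ⟨p3, p4⟩ := h2
  have := e p1
  have := e p3
  unfold CycNat at *
  rcases p1 with p1 | p1 | p1 <;> rcases p3 with p3 | p3 | p3 <;> try omega

theorem sector_right {a A b B w W : ℕ} (h1 : CycNat a b A ∧ CycNat A B a)
    (h2 : CycNat b w B ∧ CycNat B W b) (h3 : ¬ (CycNat w a W ∧ CycNat W A w))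
    (h4 : ¬ (CycNat a w A ∧ CycNat A W a)) (h5 : W = a ↔ w = A) :
    (CycNat a W A ∧ CycNat B W b) ↔ CycNat b w A := by
  have e : ∀ {x y z : ℕ}, CycNat x y z → x ≠ y ∧ y ≠ z ∧ z ≠ x := by
    intro x y z h; unfold CycNat at h; omega
  obtain ⟨p1, p2⟩ := h1
  obtain ⟨p3, p4⟩ := h2
  have := e p1
  have := e p3
  unfold CycNat at *
  rcases p1 with p1 | p1 | p1 <;> rcases p3 with p3 | p3 | p3 <;> try omega

/-- Both germs which bound a sector at a crossing see the same color there. -/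
theorem leftColor_eq_rightColor_next (hx : Invariant σ x) (g : D.Germ) : leftColor x g = rightColor x g.next := by
  classical
  obtain ⟨⟨a, b⟩, hg⟩ := g
  set g : D.Germ := ⟨(a, b), hg⟩ with hgdef
  have htg : D.top b ↔ ¬ D.top a := g.top_snd
  have hcg := (D.cross_iff a b).1 hg
  -- The sector of the polygon between `a` and `b` is the part to the left of both directed chords.
  -- The values at all vertices in the sector sum to zero, and evaluating this sum proves the claim.
  set S : D.Vertex → Prop := fun v => LeftOf a v ∧ LeftOf (D.chord b) v with hS
  have h0 := hx.sum_strand S (fun v => and_congr (leftOf_strandAdj a (strandAdj_strand v))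
    (leftOf_strandAdj (D.chord b) (strandAdj_strand v)))
  have hpts : ∀ p : D.Point, S (.inl p) ↔ CycNat (D.pos a) (D.pos p) (D.pos b) := by
    intro p
    simp only [hS, LeftOf, sidePoint]
    rw [D.chord_chord]
    unfold CycNat at *
    omega
  have hab : a ≠ b := fun h => by rw [h] at htg; tauto
  simp only [hpts] at h0
  rw [hx.sum_between hab] at h0
  -- Germs in the sector either lie on one of the two bounding chords and point inwards, or belong
  -- to crossings in the interior. The latter are paired by the smoothing and cancel.
  have hsplit : ∀ l : D.Germ, (if S (.inr l) then x (.inr l) else 0) =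
      (if S (.inr l) ∧ l.1.2 = D.chord a then x (.inr l) else 0) +
      (if S (.inr l) ∧ l.1.2 = b then x (.inr l) else 0) +
      (if S (.inr l) ∧ ¬ OnChord a l.1.2 ∧ ¬ OnChord (D.chord b) l.1.2 then x (.inr l) else 0) := by
    intro l
    by_cases hl : S (.inr l)
    · have e1 : OnChord a l.1.2 ↔ l.1.2 = D.chord a := by
        refine ⟨fun h => h.resolve_left fun h => not_leftOf_of_snd h hl.1, Or.inr⟩
      have e2 : OnChord (D.chord b) l.1.2 ↔ l.1.2 = b := by
        unfold OnChord
        rw [D.chord_chord]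
        exact ⟨fun h => h.resolve_left fun h => not_leftOf_of_snd h hl.2, Or.inr⟩
      have e3 : ¬ (l.1.2 = D.chord a ∧ l.1.2 = b) := fun h => by
        have := D.top_chord a
        rw [← h.1, h.2] at this
        tauto
      simp only [hl, true_and, e1, e2]
      by_cases q1 : l.1.2 = D.chord a <;> by_cases q2 : l.1.2 = b
      · exact absurd ⟨q1, q2⟩ e3
      all_goals simp [q1, q2]
      · intro h; exact absurd h (by rw [← q1]; exact q2)
      · intro h; exact absurd h (by rw [← q2]; exact q1)
    · simp [hl]
  have hthird : ∑ l : D.Germ, (if S (.inr l) ∧ ¬ OnChord a l.1.2 ∧ ¬ OnChord (D.chord b) l.1.2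
      then x (.inr l) else 0) = 0 := by
    refine hx.sum_germs (fun l => S (.inr l) ∧ ¬ OnChord a l.1.2 ∧ ¬ OnChord (D.chord b) l.1.2) ?_
    rintro l ⟨⟨hl1, hl2⟩, hn1, hn2⟩
    have m1 : ¬ OnChord a l.1.1 := fun h => not_leftOf_of_onChord h hl1
    have m2 : ¬ OnChord (D.chord b) l.1.1 := fun h => not_leftOf_of_onChord h hl2
    refine smooth_closed
      (S := fun l => S (.inr l) ∧ ¬ OnChord a l.1.2 ∧ ¬ OnChord (D.chord b) l.1.2) ⟨⟨?_, ?_⟩, ?_, ?_⟩ ⟨⟨?_, ?_⟩, ?_, ?_⟩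
    · exact (leftOf_next m1 hn1).1 hl1
    · exact (leftOf_next m2 hn2).1 hl2
    · exact onChord_chord.not.2 m1
    · exact onChord_chord.not.2 m2
    · exact (leftOf_prev m1 hn1).1 hl1
    · exact (leftOf_prev m2 hn2).1 hl2
    · exact m1
    · exact m2
  -- Inward germs on the chord of `a` are the left neighbours of the germs between the crossing and
  -- `a`, which are the terms of `leftColor`. The other bounding chord gives the terms of
  -- `rightColor` in `hsecond`.
  have hfirst : ∑ l : D.Germ, (if S (.inr l) ∧ l.1.2 = D.chord a then x (.inr l) else 0) =
      ∑ w : D.Germ, if D.Nearer w g then x (.inr w.next) else 0 := by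
    rw [← Equiv.sum_comp D.nextEquiv]
    refine Finset.sum_congr rfl fun w _ => ?_
    change (if S (.inr w.next) ∧ w.next.1.2 = D.chord a then x (.inr w.next) else 0) = _
    refine if_congr ?_ rfl rfl
    rw [nearer_iff]
    change (S (.inr w.next) ∧ D.chord w.1.1 = D.chord a) ↔
      w.1.1 = a ∧ CycNat (D.pos a) (D.pos w.1.2) (D.pos b)
    rw [D.chord_injective.eq_iff, and_comm]
    refine and_congr_right fun hw => ?_
    have htw := w.top_snd
    rw [hw] at htw
    have hcw := (D.cross_iff _ _).1 w.2
    have hnc := (D.cross_iff _ _).not.1 (D.noncrossing w.1.2 b (htw.trans htg.symm))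
    have hnc2 := (D.cross_iff _ _).not.1 (D.noncrossing b w.1.2 (htg.trans htw.symm))
    have hpb : D.pos w.1.2 = D.pos b ↔ D.pos (D.chord w.1.2) = D.pos (D.chord b) := by
      rw [D.pos_inj, D.pos_inj, D.chord_injective.eq_iff]
    have htb : D.top w.1.2 ↔ D.top (D.chord b) := by rw [D.top_chord]; exact htw.trans htg.symm
    have e1 : sidePoint a (.inr w.next) = w.1.2 :=
      sidePoint_fst (Or.inr (Or.inr (congrArg D.chord hw)))
    have e2 : sidePoint (D.chord b) (.inr w.next) = w.1.2 := sidePoint_fst (Or.inl htb)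
    simp only [hS, LeftOf]
    rw [e1, e2, D.chord_chord]
    rw [hw] at hcw
    exact sector_left hcg hcw hnc hnc2 hpb
  have hsecond : ∑ l : D.Germ, (if S (.inr l) ∧ l.1.2 = b then x (.inr l) else 0) =
      ∑ w : D.Germ, if D.Nearer w g.next then x (.inr w.prev) else 0 := by
    rw [← Equiv.sum_comp D.nextEquiv.symm]
    refine Finset.sum_congr rfl fun w _ => ?_
    change (if S (.inr w.prev) ∧ w.prev.1.2 = b then x (.inr w.prev) else 0) = _
    refine if_congr ?_ rfl rfl
    rw [nearer_iff]
    change (S (.inr w.prev) ∧ w.1.1 = b) ↔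
      w.1.1 = b ∧ CycNat (D.pos b) (D.pos w.1.2) (D.pos (D.chord a))
    rw [and_comm]
    refine and_congr_right fun hw => ?_
    have htw := w.top_snd
    rw [hw] at htw
    have hcw := (D.cross_iff _ _).1 w.2
    have htwa : D.top w.1.2 ↔ D.top a := by rw [htw, htg, not_not]
    have hnc := (D.cross_iff _ _).not.1 (D.noncrossing w.1.2 a htwa)
    have hnc2 := (D.cross_iff _ _).not.1 (D.noncrossing a w.1.2 htwa.symm)
    have hpb : D.pos (D.chord w.1.2) = D.pos a ↔ D.pos w.1.2 = D.pos (D.chord a) := by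
      rw [D.pos_inj, D.pos_inj]
      exact ⟨fun h => by rw [← h, D.chord_chord], fun h => by rw [h, D.chord_chord]⟩
    have htb : D.top (D.chord w.1.2) ↔ D.top a := by rw [D.top_chord]; exact htwa
    have e1 : sidePoint a (.inr w.prev) = D.chord w.1.2 := sidePoint_fst (Or.inl htb)
    have e2 : sidePoint (D.chord b) (.inr w.prev) = D.chord w.1.2 :=
      sidePoint_fst (Or.inr (Or.inr (by rw [D.chord_chord]; exact hw)))
    simp only [hS, LeftOf]
    rw [e1, e2, D.chord_chord]
    rw [hw] at hcw
    exact sector_right hcg hcw hnc hnc2 hpb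
  rw [Finset.sum_congr rfl fun l _ => hsplit l, Finset.sum_add_distrib, Finset.sum_add_distrib,
    hthird, hfirst, hsecond, add_zero] at h0
  unfold leftColor rightColor
  change upTo x a + _ = below x b + _
  rw [← sub_eq_zero, CharTwo.sub_eq_add]
  refine Eq.trans ?_ h0
  abel

open Classical in
theorem sum_nearer_succ {g l : D.Germ} (hl : D.Nearer l g)
    (hn : ∀ w, D.Nearer l w → ¬ D.Nearer w g) (f : D.Germ → ZMod 2) :
    (∑ w : D.Germ, if D.Nearer w g then f w else 0) =
      (∑ w : D.Germ, if D.Nearer w l then f w else 0) + f l := by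
  have : f l = ∑ w : D.Germ, if w = l then f w else 0 := by simp
  rw [this, ← Finset.sum_add_distrib]
  refine Finset.sum_congr rfl fun w _ => ?_
  by_cases hwl : w = l
  · subst hwl
    simp [hl, Nearer.irrefl]
  · by_cases hw : D.Nearer w l
    · simp [hw, hwl, hw.trans hl]
    · have : ¬ D.Nearer w g := fun h => by
        rcases nearer_trichotomy (h.1.trans hl.1.symm) with h' | h' | h'
        · exact hw h'
        · exact hwl h'
        · exact hn _ h' h
      simp [hw, hwl, this]

open Classical in
/-- The colors on both sides of a germ differ if and only if the germ belongs to the curve. -/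
theorem leftColor_add_rightColor (hx : Invariant σ x) (g : D.Germ) : leftColor x g + rightColor x g = x (.inr g) := by
  induction g using D.wellFounded_nearer.induction with
  | _ g ih =>
    have hs := strandAdj_strand (.inr g : D.Vertex)
    have hxs := hx.strand (.inr g)
    generalize D.strand (.inr g) = v at hs hxs
    cases hs with
    | last _ hn =>
      unfold leftColor rightColor
      simp only [hn, if_false, Finset.sum_const_zero, add_zero]
      rw [upTo_add_below, ← hxs]
    | segment _ l hl hn =>
      have ih' := ih l hl
      unfold leftColor rightColor at ih' ⊢
      rw [sum_nearer_succ hl hn, sum_nearer_succ hl hn, ← hl.1, ← hxs]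
      have h4 := hx.add_germs l
      generalize x (.inr l) = q1 at *
      generalize x (.inr l.next) = q2 at *
      generalize x (.inr l.opp) = q3 at *
      generalize x (.inr l.prev) = q4 at *
      generalize (∑ w : D.Germ, if D.Nearer w l then x (.inr w.next) else 0) = s1 at *
      generalize (∑ w : D.Germ, if D.Nearer w l then x (.inr w.prev) else 0) = s2 at *
      generalize upTo x l.1.1 = u1 at *
      generalize below x l.1.1 = u2 at *
      have h5 : q3 = q1 + q2 + q4 := by
        rw [← sub_eq_zero, CharTwo.sub_eq_add, ← h4]; abel
      rw [h5, ← ih']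
      abel

/-- A segment seen from its other end has left and right exchanged. -/
theorem leftColor_segment (hx : Invariant σ x) {g l : D.Germ} (hl : D.Nearer l g)
    (hn : ∀ w, D.Nearer l w → ¬ D.Nearer w g) : leftColor x g = rightColor x l.opp := by
  have h1 := hx.leftColor_eq_rightColor_next l
  have h2 := hx.leftColor_eq_rightColor_next l.next
  have h3 := hx.leftColor_add_rightColor l.next
  have h4 : leftColor x g = leftColor x l + x (.inr l.next) := by
    unfold leftColor
    rw [sum_nearer_succ hl hn, hl.1, add_assoc]
  rw [h4, h1, ← h3, Germ.next_next] at *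
  rw [← h2, add_comm (leftColor x l.next), ← add_assoc, CharTwo.add_self_eq_zero, zero_add]

/-- The color of a vertex that does not lie on the curve. -/
noncomputable def color (x : D.Vertex → ZMod 2) : D.Vertex → ZMod 2
  | .inl p => upTo x p
  | .inr g => leftColor x g

theorem leftColor_eq_rightColor (hx : Invariant σ x) {g : D.Germ} (h : x (.inr g) = 0) : leftColor x g = rightColor x g := by
  have := hx.leftColor_add_rightColor g
  rw [h] at this
  rwa [← sub_eq_zero, CharTwo.sub_eq_add]

/-- Off the curve the colors on both sides of a strand agree, so there is one color, and it is
carried along the strand. With `color_innerTurn` it is constant on every other arc of the smoothed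
diagram. -/
theorem color_strand (hx : Invariant σ x) (v : D.Vertex) (h : x v = 0) : color x v = color x (D.strand v) := by
  classical
  have hs := strandAdj_strand v
  have hxs := hx.strand v
  rw [h] at hxs
  generalize D.strand v = w at *
  cases hs with
  | bare p hn =>
    have h1 := hx.sum_leftOf hn
    have h2 := upTo_add_below x (D.chord p)
    rw [hxs] at h2
    change upTo x p = upTo x (D.chord p)
    generalize upTo x p = q1 at *
    generalize upTo x (D.chord p) = q2 at *
    generalize below x (D.chord p) = q3 at *
    clear hxs h
    revert q1 q2 q3
    decide
  | first g hn =>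
    change upTo x g.1.1 = leftColor x g
    unfold leftColor
    simp only [hn, if_false, Finset.sum_const_zero, add_zero]
  | last g hn =>
    change leftColor x g = upTo x g.1.1
    unfold leftColor
    simp only [hn, if_false, Finset.sum_const_zero, add_zero]
  | segment g l hl hn =>
    change leftColor x g = leftColor x l.opp
    rw [hx.leftColor_segment hl hn, hx.leftColor_eq_rightColor hxs]

theorem color_innerTurn (hx : Invariant σ x) (v : D.Vertex) (h : x v = 0) :
    color x v = color x (innerTurn σ.full v) := by
  rcases v with p | g
  · rfl
  · have hxs := hx.smooth g
    rw [h] at hxs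
    change leftColor x g = leftColor x (Layered.smooth σ.full g)
    rcases smooth_cases σ g with ⟨h1, -⟩ | ⟨h1, -⟩
    · rw [h1] at hxs ⊢
      rw [hx.leftColor_eq_rightColor_next, hx.leftColor_eq_rightColor hxs]
    · rw [h1] at hxs ⊢
      rw [hx.leftColor_eq_rightColor h, hx.leftColor_eq_rightColor_next g.prev, Germ.prev_next]

end Invariant

/-- The two ends of the smoothed arcs. -/
theorem exists_mate (σ : D.State) (p : D.Point) : ∃ p' : D.Point, p' ≠ p ∧
    D.Joined σ (.inl p) (.inl p') ∧ ∀ q, D.Joined σ (.inl p) (.inl q) → q = p ∨ q = p' := by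
  obtain ⟨e', h1, h2, h3, h4⟩ := Alternating.exists_other_fixed (s := D.strand)
    (t := innerTurn σ.full) strand_strand (innerTurn_innerTurn σ.full) strand_ne
    (e := .inl p) rfl
  rcases e' with p' | g
  · refine ⟨p', fun h => h1 (by rw [h]), (joined_iff σ _ _).2 h3, fun q hq => ?_⟩
    rcases h4 (.inl q) rfl ((joined_iff σ _ _).1 hq) with h | h
    · exact Or.inl (Sum.inl.inj h)
    · exact Or.inr (Sum.inl.inj h)
  · exact absurd (Sum.inr.inj h2) (smooth_ne _ g)

/-- The other end of the smoothed arc in the polygon which begins at a boundary point. -/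
noncomputable def mate (σ : D.State) (p : D.Point) : D.Point := (exists_mate σ p).choose

theorem mate_ne (σ : D.State) (p : D.Point) : mate σ p ≠ p := (exists_mate σ p).choose_spec.1

theorem joined_mate (σ : D.State) (p : D.Point) : D.Joined σ (.inl p) (.inl (mate σ p)) :=
  (exists_mate σ p).choose_spec.2.1

theorem eq_or_eq_mate {σ : D.State} {p q : D.Point} (h : D.Joined σ (.inl p) (.inl q)) :
    q = p ∨ q = mate σ p := (exists_mate σ p).choose_spec.2.2 q h

@[simp] theorem mate_mate (σ : D.State) (p : D.Point) : mate σ (mate σ p) = p := by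
  rcases eq_or_eq_mate (Relation.EqvGen.symm _ _ (joined_mate σ p)) with h | h
  · exact absurd h.symm (mate_ne σ p)
  · exact h.symm

/-- The smoothed arcs do not cross. -/
theorem mate_noncrossing (σ : D.State) {p q : D.Point} (h1 : D.pos p < D.pos q)
    (h2 : D.pos q < D.pos (mate σ p)) : D.pos p < D.pos (mate σ q) ∧
      D.pos (mate σ q) < D.pos (mate σ p) := by
  classical
  have hne : q ≠ p ∧ q ≠ mate σ p := ⟨fun h => by rw [h] at h1; omega, fun h => by rw [h] at h2; omega⟩
  -- The indicator of the smoothed arc through `p`. Its coloring is the pair of regions into which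
  -- this arc divides the polygon.
  set x : D.Vertex → ZMod 2 := fun v => if D.Joined σ (.inl p) v then 1 else 0 with hxdef
  have hx : Invariant σ x := by
    have key : ∀ v w, D.Joined σ v w → x w = x v := fun v w h => by
      have : D.Joined σ (.inl p) w ↔ D.Joined σ (.inl p) v :=
        ⟨fun h' => .trans _ _ _ h' (.symm _ _ h), fun h' => .trans _ _ _ h' h⟩
      simp only [hxdef, this]
    exact ⟨fun v => key _ _ (joined_strand σ v), fun g => key _ _ (joined_innerTurn σ (.inr g))⟩
  have hxp : ∀ r : D.Point, x (.inl r) = if r = p ∨ r = mate σ p then 1 else 0 := by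
    intro r
    have : D.Joined σ (.inl p) (.inl r) ↔ r = p ∨ r = mate σ p :=
      ⟨eq_or_eq_mate, by rintro (rfl | rfl); exacts [.refl _, joined_mate σ p]⟩
    simp only [hxdef, this]
  have hup : ∀ r : D.Point, Invariant.upTo x r = (if D.pos p ≤ D.pos r then 1 else 0) +
      if D.pos (mate σ p) ≤ D.pos r then 1 else 0 := by
    intro r
    have hpm := mate_ne σ p
    unfold Invariant.upTo
    have : ∀ s : D.Point, (if D.pos s ≤ D.pos r then x (.inl s) else 0) =
        (if s = p then (if D.pos p ≤ D.pos r then 1 else 0) else 0) +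
          if s = mate σ p then (if D.pos (mate σ p) ≤ D.pos r then 1 else 0) else 0 := by
      intro s
      rw [hxp]
      by_cases hs : s = p
      · subst hs
        simp [hpm.symm]
      · by_cases hs' : s = mate σ p
        · subst hs'
          simp [hpm]
        · simp [hs, hs']
    rw [Finset.sum_congr rfl fun s _ => this s, Finset.sum_add_distrib]
    simp
  have hconst : ∀ v w, D.Joined σ v w → x v = 0 →
      Invariant.color x v = Invariant.color x w := by
    intro v w h hv
    have := Alternating.map_eq (s := D.strand) (t := innerTurn σ.full)
      -- `none` stands for the vertices on the arc of `p`, where no single color exists.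
      (f := fun v => if x v = 0 then some (Invariant.color x v) else none) (fun v => by
        by_cases hv : x v = 0
        · simp only [hx.strand, hv, if_true, ← hx.color_strand v hv]
        · simp only [hx.strand, hv, if_false]) (fun v => by
        have hxt : x (innerTurn σ.full v) = x v := by
          rcases v with r | g
          · rfl
          · exact hx.smooth g
        by_cases hv : x v = 0
        · simp only [hxt, hv, if_true, ← hx.color_innerTurn v hv]
        · simp only [hxt, hv, if_false]) ((joined_iff σ v w).1 h)
    simp only [hv, if_true] at this
    split_ifs at this
    exact Option.some.inj this
  have hq0 : x (.inl q) = 0 := by rw [hxp, if_neg (by tauto)]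
  -- The arc from `q` keeps its color, and by `hup` this color records whether exactly one end of
  -- the arc of `p` has been passed. As this holds at `q`, it holds at the other end of its arc.
  have hcol := hconst _ _ (joined_mate σ q) hq0
  change Invariant.upTo x q = Invariant.upTo x (mate σ q) at hcol
  rw [hup, hup, if_pos h1.le, if_neg (by omega)] at hcol
  have hmq : D.pos (mate σ q) ≠ D.pos p := fun h => by
    rw [D.pos_inj] at h
    exact hne.2 (by rw [← h, mate_mate])
  have hmq' : D.pos (mate σ q) ≠ D.pos (mate σ p) := fun h => by
    rw [D.pos_inj] at h
    exact hne.1 (by rw [← mate_mate σ q, h, mate_mate])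
  by_cases c1 : D.pos p ≤ D.pos (mate σ q) <;> by_cases c2 : D.pos (mate σ p) ≤ D.pos (mate σ q)
  · rw [if_pos c1, if_pos c2] at hcol
    exact absurd hcol (by decide)
  · omega
  · omega
  · rw [if_neg c1, if_neg c2] at hcol
    exact absurd hcol (by decide)

end Layered

/-! ## Sections of flat bundles over curves -/

/-- A flat bundle over the surface: the elements by which the fibres are identified across the
sides, with trivial holonomy around the ordinary vertices. -/
structure Holonomy (F : PolygonSurface) (G : Type*) [Group G] where
  side : Fin F.sides → G
  side_glue : ∀ s, side (F.glue s) = (side s)⁻¹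
  corner : Fin F.sides → G
  corner_turn : ∀ c, ¬ F.hole c → corner (F.turn c) = side c * corner c

/-- The trivial bundle. -/
def Holonomy.trivial (F : PolygonSurface) (G : Type*) [Group G] : Holonomy F G where
  side _ := 1
  side_glue _ := inv_one.symm
  corner _ := 1
  corner_turn _ _ := (one_mul 1).symm

namespace ChordDiagram

variable {F : PolygonSurface} {G X : Type*} [Group G] [MulAction G X]

/-- Locally constant sections over the curves. -/
structure IsSection (D : ChordDiagram F) (ρ : Holonomy F G) (h : D.Point → X) : Prop where
  chord : ∀ p, h (D.chord p) = h p
  flip : ∀ p, h (D.count.flip p) = ρ.side p.1 • h p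

/-- The points are on the same component. -/
def Linked (D : ChordDiagram F) : D.Point → D.Point → Prop := Alternating D.chord D.count.flip

/-- Lying on the same component. -/
def linkedSetoid (D : ChordDiagram F) : Setoid D.Point where
  r := D.Linked
  iseqv := ⟨Alternating.refl, Alternating.symm, Alternating.trans⟩

/-- The components. -/
abbrev Comp (D : ChordDiagram F) : Type := Quotient D.linkedSetoid

instance (D : ChordDiagram F) : Finite D.Comp := Quotient.finite _

/-- The number of components. -/
noncomputable def numComp (D : ChordDiagram F) : ℕ := Nat.card D.Comp

theorem IsSection.congr_linked {D : ChordDiagram F} {ρ : Holonomy F G} {h h' : D.Point → X}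
    (hs : D.IsSection ρ h) (hs' : D.IsSection ρ h') {p q : D.Point} (hpq : D.Linked p q) :
    h p = h' p ↔ h q = h' q :=
  iff_of_eq <| hpq.map_eq (f := fun p => h p = h' p) (fun v => by rw [hs.chord, hs'.chord])
    (fun v => by rw [hs.flip, hs'.flip, (MulAction.injective _).eq_iff])

/-- Sections of a trivial bundle are functions on the set of components. -/
def trivialSectionEquiv (D : ChordDiagram F) :
    {h : D.Point → G // D.IsSection (Holonomy.trivial F G) h} ≃ (D.Comp → G) where
  toFun h := fun c => Quotient.lift h.1 (fun _ _ hab => Alternating.map_eq h.2.chord (fun p => by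
    rw [h.2.flip]
    exact one_smul G _) hab) c
  invFun f := ⟨fun p => f (Quotient.mk _ p),
    ⟨fun p => congrArg f (Quotient.sound (Alternating.symm (.left p))), fun p => by
      refine Eq.trans ?_ (one_smul G _).symm
      exact congrArg f (Quotient.sound (Alternating.symm (.right p)))⟩⟩
  left_inv _ := rfl
  right_inv f := funext fun c => Quotient.inductionOn c fun _ => rfl

/-- Sections of the trivial bundle with group of order two are counted by a power of two, so the
invariance of sections under isotopy gives the invariance of the number of components. -/
theorem pow_numComp (D : ChordDiagram F) : 2 ^ D.numComp = Nat.card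
    {h : D.Point → Multiplicative (ZMod 2) //
      D.IsSection (Holonomy.trivial F (Multiplicative (ZMod 2))) h} := by
  rw [Nat.card_congr D.trivialSectionEquiv, Nat.card_fun]
  congr 1
  rw [Nat.card_eq_fintype_card]
  rfl

end ChordDiagram

/-! ### Invariance of sections under isotopy. -/

namespace Curves

variable {F : PolygonSurface} {G X : Type*} [Group G] [MulAction G X]

/-- Restriction to the remaining points is a bijection: the values on the removed finger are the
value of the joined strand and its transport across the side. -/
theorem Finger.bijective_sections {D D' : Curves F} (hf : D.Finger D') (ρ : Holonomy F G) :
    Nonempty ({h : D.Point → X // D.IsSection ρ h} ≃ {h : D'.Point → X // D'.IsSection ρ h}) := by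
  classical
  obtain ⟨p, q, hpq, -, hcp, hne, e, he, hr, hD⟩ := hf
  have hinj := he.injective
  have hcq : D.chord q = p := by rw [← hcp, D.chord_chord]
  have hmem : ∀ z, z ∈ Set.range e ↔ z ≠ p ∧ z ≠ q ∧ z ≠ D.count.flip p ∧ z ≠ D.count.flip q := by
    intro z
    rw [hr]
    simp only [Set.mem_compl_iff, Set.mem_insert_iff, Set.mem_singleton_iff, not_or]
  have hfp : D.count.flip p ≠ p := D.count.flip_ne p
  have hfq : D.count.flip q ≠ q := D.count.flip_ne q
  have hfpq : D.count.flip p ≠ q := fun h => F.glue_ne p.1 (by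
    rw [← D.count.flip_fst, h, hpq])
  have hfqp : D.count.flip q ≠ p := fun h => F.glue_ne q.1 (by
    rw [← D.count.flip_fst, h, hpq])
  have hpneq : q ≠ p := by rw [← hcp]; exact D.chord_ne p
  have hff : D.count.flip q ≠ D.count.flip p := fun h => hpneq (D.count.flip_injective h)
  obtain ⟨xp, hxp⟩ : D.chord (D.count.flip p) ∈ Set.range e := by
    refine (hmem _).2 ⟨fun h => hfpq ?_, fun h => hfp ?_, D.chord_ne _, hne⟩
    · exact (D.chord_chord _).symm.trans ((congrArg D.chord h).trans hcp)
    · exact (D.chord_chord _).symm.trans ((congrArg D.chord h).trans hcq)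
  have hxq : e (D'.chord xp) = D.chord (D.count.flip q) :=
    (hD xp).1 (by rw [hxp, D.chord_chord])
  have hside : ∀ {h : D.Point → X}, D.IsSection ρ h → ∀ z,
      h z = ρ.side (F.glue z.1) • h (D.count.flip z) := by
    intro h hs z
    have := hs.flip (D.count.flip z)
    rwa [D.count.flip_flip] at this
  refine ⟨Equiv.ofBijective (fun h => ⟨h.1 ∘ e, ⟨fun x => ?_, fun x => ?_⟩⟩) ⟨?_, ?_⟩⟩
  · simp only [Function.comp]
    by_cases h1 : D.chord (e x) = D.count.flip p
    · rw [(hD x).1 h1, h.2.chord, ← h.2.chord (e x), h1, h.2.flip, h.2.flip, hpq, ← hcp, h.2.chord]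
    · by_cases h2 : D.chord (e x) = D.count.flip q
      · rw [(hD x).2.1 h2, h.2.chord, ← h.2.chord (e x), h2, h.2.flip, h.2.flip, hpq, ← hcp,
          h.2.chord]
      · rw [(hD x).2.2 h1 h2, h.2.chord]
  · simp only [Function.comp, he.2.2, h.2.flip, he.2.1]
  · intro h h' hh
    have key : ∀ x, h.1 (e x) = h'.1 (e x) := fun x => congrFun (congrArg Subtype.val hh) x
    have k1 : h.1 (D.count.flip p) = h'.1 (D.count.flip p) := by
      rw [← h.2.chord, ← h'.2.chord, ← hxp, key]
    have k2 : h.1 (D.count.flip q) = h'.1 (D.count.flip q) := by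
      rw [← h.2.chord, ← h'.2.chord, ← hxq, key]
    refine Subtype.ext (funext fun z => ?_)
    by_cases hz : z ∈ Set.range e
    · obtain ⟨x, rfl⟩ := hz
      exact key x
    · rw [hmem] at hz
      by_cases h1 : z = D.count.flip p
      · rw [h1, k1]
      · by_cases h2 : z = D.count.flip q
        · rw [h2, k2]
        · by_cases h3 : z = p
          · rw [hside h.2, hside h'.2, h3, k1]
          · have h4 : z = q := by tauto
            rw [hside h.2, hside h'.2, h4, k2]
  · rintro ⟨h', hs'⟩
    set v := h' xp with hv
    have hv' : h' (D'.chord xp) = v := hs'.chord xp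
    -- The value `v` of the joined strand is kept at the two outer points, and its transport across
    -- the side is taken at `p` and `q`.
    set w : D.Point → X := fun z => if z = D.count.flip p ∨ z = D.count.flip q then v
      else ρ.side (F.glue p.1) • v with hw
    set h : D.Point → X := Function.extend e h' w with hh
    have he1 : ∀ x, h (e x) = h' x := fun x => hinj.extend_apply h' w x
    have he2 : ∀ z, z ∉ Set.range e → h z = w z := fun z hz =>
      Function.extend_apply' h' w z (fun ⟨a, ha⟩ => hz ⟨a, ha⟩)
    have kp : h p = ρ.side (F.glue p.1) • v := by
      rw [he2 p (by rw [hmem]; tauto), hw]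
      exact if_neg (by tauto)
    have kq : h q = ρ.side (F.glue p.1) • v := by
      rw [he2 q (by rw [hmem]; tauto), hw]
      exact if_neg (by tauto)
    have kfp : h (D.count.flip p) = v := by
      rw [he2 _ (by rw [hmem]; tauto), hw]
      exact if_pos (Or.inl rfl)
    have kfq : h (D.count.flip q) = v := by
      rw [he2 _ (by rw [hmem]; tauto), hw]
      exact if_pos (Or.inr rfl)
    have hcase : ∀ z, z ∈ Set.range e ∨ z = p ∨ z = q ∨ z = D.count.flip p ∨ z = D.count.flip q := by
      intro z
      have := hmem z
      tauto
    refine ⟨⟨h, fun z => ?_, fun z => ?_⟩, Subtype.ext (funext he1)⟩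
    · rcases hcase z with ⟨x, rfl⟩ | rfl | rfl | rfl | rfl
      · by_cases h1 : D.chord (e x) = D.count.flip p
        · have : x = xp := hinj (by rw [hxp, ← h1, D.chord_chord])
          rw [h1, kfp, he1, this]
        · by_cases h2 : D.chord (e x) = D.count.flip q
          · have : x = D'.chord xp := hinj (by rw [hxq, ← h2, D.chord_chord])
            rw [h2, kfq, he1, this, hv']
          · rw [← (hD x).2.2 h1 h2, he1, he1, hs'.chord]
      · rw [hcp, kp, kq]
      · rw [hcq, kp, kq]
      · rw [← hxp, he1, kfp]
      · rw [← hxq, he1, kfq, hv']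
    · have hcancel : ∀ x : X, ρ.side p.1 • ρ.side (F.glue p.1) • x = x := fun x => by
        rw [ρ.side_glue, smul_inv_smul]
      rcases hcase z with ⟨x, rfl⟩ | rfl | rfl | rfl | rfl
      · rw [← he.2.2, he1, he1, hs'.flip, he.2.1]
      · rw [kfp, kp, hcancel]
      · rw [kfq, kq, ← hpq, hcancel]
      · rw [D.count.flip_flip, kp, kfp, D.count.flip_fst]
      · rw [D.count.flip_flip, kq, kfq, D.count.flip_fst, hpq]

theorem not_hole_of_sameVertex {c d : Fin F.sides} (hc : ¬ F.hole c) (h : F.SameVertex c d) :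
    ¬ F.hole d := by
  obtain ⟨j, rfl⟩ := h
  induction j with
  | zero => exact hc
  | succ j ih =>
    rw [Function.iterate_succ_apply']
    exact (F.hole_turn _).not.2 ih

/-- The arc around the vertex crosses each edge there once. The corner elements of the bundle
transport a value around the vertex, and because the holonomy there is trivial the value comes back
unchanged; so a section extends uniquely over the new arc. -/
theorem Slide.bijective_sections {D D' : Curves F} (hf : D.Slide D') (ρ : Holonomy F G) :
    Nonempty ({h : D.Point → X // D.IsSection ρ h} ≃ {h : D'.Point → X // D'.IsSection ρ h}) := by
  classical
  obtain ⟨c, x, y, e, n, hc, hxy, he, hn, hnf, hr, hz, hturn, hy, hlast⟩ := hf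
  have hinj := he.injective
  have hyx : D.chord y = x := by rw [← hxy, D.chord_chord]
  have hcc : F.SameVertex c c := ⟨0, rfl⟩
  have hnext : ∀ d, F.SameVertex c d → F.SameVertex c (F.turn d) := by
    rintro d ⟨j, rfl⟩
    exact ⟨j + 1, Function.iterate_succ_apply' _ _ _⟩
  obtain ⟨d0, hd0, hd0c⟩ : ∃ d, F.SameVertex c d ∧ F.turn d = c := by
    have hperm : Function.Injective F.turn := fun a b hab => by
      have := (finRotate F.sides).injective hab
      rw [← F.glue_glue a, this, F.glue_glue]
    obtain ⟨j, hj, hjc⟩ := Function.Injective.mem_periodicPts hperm c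
    refine ⟨F.turn^[j - 1] c, ⟨j - 1, rfl⟩, ?_⟩
    rw [← Function.iterate_succ_apply' F.turn]
    have : (j - 1).succ = j := Nat.succ_pred_eq_of_pos hj
    rw [this]
    exact hjc
  have hcase : ∀ z, z ∈ Set.range e ∨ ∃ d, F.SameVertex c d ∧ (z = n d ∨ z = D'.count.flip (n d)) := by
    intro z
    by_cases h : z ∈ Set.range e
    · exact Or.inl h
    · right
      have : z ∈ (Set.range e)ᶜ := h
      rwa [hr] at this
  have hnr : ∀ d, F.SameVertex c d → n d ∉ Set.range e ∧ D'.count.flip (n d) ∉ Set.range e := by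
    intro d hd
    constructor
    · have : n d ∈ (Set.range e)ᶜ := by rw [hr]; exact ⟨d, hd, Or.inl rfl⟩
      exact this
    · have : D'.count.flip (n d) ∈ (Set.range e)ᶜ := by rw [hr]; exact ⟨d, hd, Or.inr rfl⟩
      exact this
  have hvalues : ∀ {h : D'.Point → X}, D'.IsSection ρ h → ∀ d, F.SameVertex c d →
      h (n d) = (ρ.corner d * (ρ.corner c)⁻¹) • h (e y) := by
    rintro h hs d ⟨j, rfl⟩
    induction j with
    | zero =>
      simp only [Function.iterate_zero, id]
      rw [mul_inv_cancel, one_smul, ← hy, hs.chord]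
    | succ j ih =>
      rw [Function.iterate_succ_apply']
      have hv : F.SameVertex c (F.turn^[j] c) := ⟨j, rfl⟩
      by_cases hcl : F.turn (F.turn^[j] c) = c
      · rw [hcl, mul_inv_cancel, one_smul, ← hy, hs.chord]
      · rw [← hs.chord, hturn _ hv hcl, hs.flip, ih, (hn _ hv).1,
          ρ.corner_turn _ (not_hole_of_sameVertex hc hv), mul_assoc, smul_smul]
  -- The last corner `d0` before `c` closes the circuit around the vertex; `corner_turn` at `d0`
  -- cancels the accumulated factor.
  have hends : ∀ {h : D'.Point → X}, D'.IsSection ρ h → h (e x) = h (e y) := by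
    intro h hs
    rw [← hlast d0 hd0 hd0c, hs.chord, hs.flip, hvalues hs d0 hd0, (hn _ hd0).1, ← mul_smul,
      ← mul_assoc, ← ρ.corner_turn _ (not_hole_of_sameVertex hc hd0), hd0c, mul_inv_cancel, one_smul]
  refine ⟨Equiv.symm <| Equiv.ofBijective (fun h => ⟨h.1 ∘ e, ⟨fun z => ?_, fun z => ?_⟩⟩) ⟨?_, ?_⟩⟩
  · simp only [Function.comp]
    by_cases h1 : z = x
    · rw [h1, hxy, hends h.2]
    · by_cases h2 : z = y
      · rw [h2, hyx, hends h.2]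
      · rw [← hz z h1 h2, h.2.chord]
  · simp only [Function.comp, he.2.2, h.2.flip, he.2.1]
  · intro h h' hh
    have key : ∀ x, h.1 (e x) = h'.1 (e x) := fun x => congrFun (congrArg Subtype.val hh) x
    refine Subtype.ext (funext fun z => ?_)
    rcases hcase z with ⟨x, rfl⟩ | ⟨d, hd, rfl | rfl⟩
    · exact key x
    · rw [hvalues h.2 d hd, hvalues h'.2 d hd, key]
    · rw [h.2.flip, h'.2.flip, hvalues h.2 d hd, hvalues h'.2 d hd, key]
  · rintro ⟨h', hs'⟩
    set u : Fin F.sides → X := fun d => (ρ.corner d * (ρ.corner c)⁻¹) • h' y with hu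
    set w : D'.Point → X := fun z => if z = n z.1 ∧ F.SameVertex c z.1 then u z.1
      else ρ.side (F.glue z.1) • u (F.glue z.1) with hw
    set h : D'.Point → X := Function.extend e h' w with hh
    have he1 : ∀ x, h (e x) = h' x := fun x => hinj.extend_apply h' w x
    have he2 : ∀ z, z ∉ Set.range e → h z = w z := fun z hz =>
      Function.extend_apply' h' w z (fun ⟨a, ha⟩ => hz ⟨a, ha⟩)
    have kn : ∀ d, F.SameVertex c d → h (n d) = u d := by
      intro d hd
      rw [he2 _ (hnr d hd).1, hw]
      have := (hn d hd).1
      simp only [this]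
      exact if_pos ⟨trivial, hd⟩
    have kf : ∀ d, F.SameVertex c d → h (D'.count.flip (n d)) = ρ.side d • u d := by
      intro d hd
      rw [he2 _ (hnr d hd).2, hw]
      have hs : (D'.count.flip (n d)).1 = F.glue d := by rw [D'.count.flip_fst, (hn d hd).1]
      simp only [hs, F.glue_glue]
      refine if_neg fun hcon => ?_
      exact hnf _ _ hcon.2 hd hcon.1.symm
    have uturn : ∀ d, F.SameVertex c d → u (F.turn d) = ρ.side d • u d := by
      intro d hd
      simp only [hu]
      rw [ρ.corner_turn _ (not_hole_of_sameVertex hc hd), mul_assoc, mul_smul]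
    have uc : u c = h' y := by simp only [hu, mul_inv_cancel, one_smul]
    have hxy' : h' x = h' y := by rw [← hxy, hs'.chord]
    have hlast' : ∀ d, F.SameVertex c d → F.turn d = c → D'.chord (e x) = D'.count.flip (n d) := by
      intro d hd hdc
      rw [← hlast d hd hdc, D'.chord_chord]
    refine ⟨⟨h, fun z => ?_, fun z => ?_⟩, Subtype.ext (funext he1)⟩
    · rcases hcase z with ⟨z, rfl⟩ | ⟨d, hd, rfl | rfl⟩
      · by_cases h1 : z = x
        · rw [h1, hlast' d0 hd0 hd0c, kf _ hd0, ← uturn _ hd0, hd0c, uc, he1, hxy']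
        · by_cases h2 : z = y
          · rw [h2, ← hy, D'.chord_chord, kn c hcc, uc, hy, he1]
          · rw [hz z h1 h2, he1, he1, hs'.chord]
      · by_cases h1 : d = c
        · rw [h1, hy, kn c hcc, uc, he1]
        · obtain ⟨j, rfl⟩ := hd
          cases j with
          | zero => exact absurd rfl h1
          | succ j =>
            rw [Function.iterate_succ_apply'] at h1 ⊢
            have hv : F.SameVertex c (F.turn^[j] c) := ⟨j, rfl⟩
            rw [hturn _ hv h1, kf _ hv, kn _ (hnext _ hv), uturn _ hv]
      · by_cases h1 : F.turn d = c
        · rw [hlast _ hd h1, he1, kf _ hd, ← uturn _ hd, h1, uc, hxy']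
        · rw [← hturn _ hd h1, D'.chord_chord, kn _ (hnext _ hd), hturn _ hd h1, kf _ hd, uturn _ hd]
    · rcases hcase z with ⟨z, rfl⟩ | ⟨d, hd, rfl | rfl⟩
      · rw [← he.2.2, he1, he1, hs'.flip, he.2.1]
      · rw [kf _ hd, kn _ hd, (hn _ hd).1]
      · rw [D'.count.flip_flip, kf _ hd, kn _ hd, D'.count.flip_fst, (hn _ hd).1, ρ.side_glue,
          inv_smul_smul]

/-- Isotopic curves have the same sections. -/
theorem Isotopic.sections {D D' : Curves F} (hi : D.Isotopic D') (ρ : Holonomy F G) :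
    Nonempty ({h : D.Point → X // D.IsSection ρ h} ≃ {h : D'.Point → X // D'.IsSection ρ h}) := by
  induction hi with
  | rel D D' h =>
    rcases h with h | h
    · exact h.bijective_sections ρ
    · exact h.bijective_sections ρ
  | refl => exact ⟨Equiv.refl _⟩
  | symm _ _ _ ih => exact ih.map Equiv.symm
  | trans _ _ _ _ _ ih ih' => exact ih.elim fun a => ih'.map fun b => a.trans b

theorem Isotopic.numComp_eq {D D' : Curves F} (hi : D.Isotopic D') : D.numComp = D'.numComp := by
  apply Nat.pow_right_injective (le_refl 2)
  change 2 ^ _ = 2 ^ _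
  rw [ChordDiagram.pow_numComp, ChordDiagram.pow_numComp]
  exact Nat.card_congr (hi.sections _).some

theorem IsSmallCircle.exists_section {D : Curves F} (hD : D.IsSmallCircle) (ρ : Holonomy F G) :
    ∃ h : D.Point → G, D.IsSection ρ h := by
  classical
  obtain ⟨p, q, hpq, hcp, hcf, hall⟩ := hD
  have hcq : D.chord q = p := by rw [← hcp, D.chord_chord]
  have hcf' : D.chord (D.count.flip q) = D.count.flip p := by rw [← hcf, D.chord_chord]
  have hne := F.glue_ne p.1
  have hs : ∀ {a b : D.Point}, a.1 = b.1 → (if a.1 = p.1 then (1 : G) else ρ.side p.1) =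
    if b.1 = p.1 then 1 else ρ.side p.1 := by
    intro a b h; rw [h]
  have hfs : (D.count.flip p).1 = (D.count.flip q).1 := by
    rw [D.count.flip_fst, D.count.flip_fst, hpq]
  refine ⟨fun z => if z.1 = p.1 then 1 else ρ.side p.1, fun z => ?_, fun z => ?_⟩
  · rcases hall z with rfl | rfl | rfl | rfl
    · rw [hcp]; exact hs hpq.symm
    · rw [hcq]; exact hs hpq
    · rw [hcf]; exact hs hfs.symm
    · rw [hcf']; exact hs hfs
  · have key : ∀ z : D.Point, z.1 = p.1 ∨ z.1 = F.glue p.1 := by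
      intro z
      rcases hall z with rfl | rfl | rfl | rfl
      · exact Or.inl rfl
      · exact Or.inl hpq.symm
      · exact Or.inr rfl
      · exact Or.inr (by rw [D.count.flip_fst, hpq])
    rw [D.count.flip_fst]
    rcases key z with h | h
    · rw [h, if_neg hne, if_pos rfl, smul_eq_mul, mul_one]
    · rw [h, F.glue_glue, if_pos rfl, if_neg hne, ρ.side_glue, smul_eq_mul, inv_mul_cancel]

/-- The easy half of the criterion for inessential curves: a flat bundle has trivial holonomy along
the boundary of a disc. It holds for every group. -/
theorem Inessential.exists_section {D : Curves F} (hD : D.Inessential) (ρ : Holonomy F G) :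
    ∃ h : D.Point → G, D.IsSection ρ h := by
  obtain ⟨O, hO, hi⟩ := hD
  obtain ⟨h, hs⟩ := hO.exists_section ρ
  exact ⟨_, ((hi.sections ρ).some.symm ⟨h, hs⟩).2⟩

theorem numComp_eq_one_iff {D : ChordDiagram F} :
    D.numComp = 1 ↔ Nonempty D.Point ∧ ∀ p q, D.Linked p q := by
  unfold ChordDiagram.numComp
  rw [Nat.card_eq_one_iff_unique]
  constructor
  · rintro ⟨h1, ⟨c⟩⟩
    refine ⟨⟨c.out⟩, fun p q => ?_⟩
    exact Quotient.exact (Subsingleton.elim (Quotient.mk D.linkedSetoid p) (Quotient.mk _ q))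
  · rintro ⟨⟨p⟩, h⟩
    refine ⟨⟨fun a b => ?_⟩, ⟨Quotient.mk _ p⟩⟩
    induction a using Quotient.inductionOn
    induction b using Quotient.inductionOn
    exact Quotient.sound (h _ _)

theorem IsSmallCircle.numComp_eq_one {D : Curves F} (hD : D.IsSmallCircle) : D.numComp = 1 := by
  obtain ⟨p, q, hpq, hcp, hcf, hall⟩ := hD
  have h1 : ∀ z, D.Linked p z := by
    intro z
    have a1 : D.Linked p q := by rw [← hcp]; exact .left p
    rcases hall z with rfl | rfl | rfl | rfl
    · exact .refl _
    · exact a1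
    · exact .right _
    · exact a1.trans (.right _)
  exact numComp_eq_one_iff.2 ⟨⟨p⟩, fun a b => (h1 a).symm.trans (h1 b)⟩

theorem Inessential.numComp_eq_one {D : Curves F} (hD : D.Inessential) : D.numComp = 1 := by
  obtain ⟨O, hO, hi⟩ := hD
  rw [hi.numComp_eq, hO.numComp_eq_one]

end Curves

/-! ### Pulling back strands that return to their side. -/

namespace Curves

variable {F : PolygonSurface}

/-- A noncrossing pairing of a set of boundary points which is closed under the gluing is a curve. -/
theorem exists_of_pairing (m : StrandCount F) (R : Set m.Point) (hR : ∀ p ∈ R, m.flip p ∈ R)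
    (f : m.Point → m.Point) (hf : ∀ p ∈ R, f p ∈ R) (hff : ∀ p ∈ R, f (f p) = p)
    (hne : ∀ p ∈ R, f p ≠ p)
    (hx : ∀ p ∈ R, ∀ q ∈ R, ¬ (m.Cyc p q (f p) ∧ m.Cyc (f p) (f q) p)) :
    ∃ (K : Curves F) (e : K.Point → m.Point), K.count.IsEmb m e ∧ Set.range e = R ∧
      ∀ p, e (K.chord p) = f (e p) := by
  have he := m.isEmb_incl R hR
  have hrange := Set.ext_iff.1 (m.range_incl R hR)
  have hmem : ∀ p, m.incl R hR p ∈ R := fun p => (hrange _).1 ⟨p, rfl⟩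
  have hex : ∀ p, ∃ q, m.incl R hR q = f (m.incl R hR p) := fun p => (hrange _).2 (hf _ (hmem p))
  choose c hc using hex
  refine ⟨⟨⟨m.restrict R hR, c, fun p => he.injective ?_, fun p h => ?_⟩, fun p q h => ?_⟩,
    m.incl R hR, he, m.range_incl R hR, hc⟩
  · rw [hc, hc, hff _ (hmem p)]
  · exact hne _ (hmem p) (by rw [← hc, h])
  · refine hx _ (hmem p) _ (hmem q) ?_
    rw [← hc, ← hc]
    exact ⟨(he.cyc_iff _ _ _).2 h.1, (he.cyc_iff _ _ _).2 h.2⟩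

/-- `P` and `Q` are neighbours on the boundary, so a chord that misses both `uP` and `vQ` cannot
separate `u` from `v`. -/
theorem cycNat_join {u v P Q w W : ℕ} (hPQ : P = Q + 1) (h1 : w ≠ P) (h2 : w ≠ Q) (h3 : W ≠ P)
    (h4 : W ≠ Q) (h5 : u ≠ P) (h6 : v ≠ Q) (h7 : u ≠ Q) (h8 : v ≠ P)
    (k1 : ¬ (CycNat u w P ∧ CycNat P W u)) (k2 : ¬ (CycNat u W P ∧ CycNat P w u))
    (k3 : ¬ (CycNat v w Q ∧ CycNat Q W v)) (k4 : ¬ (CycNat v W Q ∧ CycNat Q w v)) :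
    ¬ (CycNat u w v ∧ CycNat v W u) := by
  rintro ⟨h, h'⟩
  unfold CycNat at *
  rcases h with h | h | h <;> rcases h' with h' | h' | h' <;> omega

theorem pos_flip_adjacent (m : StrandCount F) {p q : m.Point} (hpq : p.1 = q.1)
    (hv : q.2.val = p.2.val + 1) : m.pos (m.flip p) = m.pos (m.flip q) + 1 := by
  have h1 := q.2.isLt
  have h2 : m.num p.1 = m.num q.1 := by rw [hpq]
  have h3 := m.flip_snd_val p
  have h4 := m.flip_snd_val q
  have h5 : (m.flip p).1.val * (∑ s, m.num s + 1) = (m.flip q).1.val * (∑ s, m.num s + 1) := by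
    rw [m.flip_fst, m.flip_fst, hpq]
  unfold StrandCount.pos
  omega

/-- A strand which runs from a side directly back to the same side can be pulled across it. -/
theorem exists_finger (D : Curves F) {p q : D.Point} (hpq : p.1 = q.1)
    (hv : q.2.val = p.2.val + 1) (hcp : D.chord p = q)
    (hne : D.chord (D.count.flip p) ≠ D.count.flip q) :
    ∃ D' : Curves F, D.Finger D' ∧ ∃ e : D'.Point → D.Point, Function.Injective e ∧
      (∀ x, (e x).1 = x.1) ∧ p ∉ Set.range e := by
  classical
  have hcq : D.chord q = p := by rw [← hcp, D.chord_chord]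
  have hfp : D.count.flip p ≠ p := D.count.flip_ne p
  have hfq : D.count.flip q ≠ q := D.count.flip_ne q
  have hfpq : D.count.flip p ≠ q := fun h => F.glue_ne p.1 (by
    rw [← D.count.flip_fst, h, hpq])
  have hfqp : D.count.flip q ≠ p := fun h => F.glue_ne q.1 (by
    rw [← D.count.flip_fst, h, hpq])
  have hpneq : q ≠ p := by rw [← hcp]; exact D.chord_ne p
  have hff : D.count.flip q ≠ D.count.flip p := fun h => hpneq (D.count.flip_injective h)
  set P := D.count.flip p with hP
  set Q := D.count.flip q with hQ
  have hPQ : D.pos P = D.pos Q + 1 := pos_flip_adjacent D.count hpq hv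
  have hcinv : ∀ {a b : D.Point}, D.chord a = b ↔ a = D.chord b := fun {a b} =>
    ⟨fun h => by rw [← h, D.chord_chord], fun h => by rw [h, D.chord_chord]⟩
  have hPp : D.chord P ≠ p := fun h => hfpq (by rw [hcinv.1 h, hcp])
  have hPq : D.chord P ≠ q := fun h => hfp (by rw [hcinv.1 h, hcq])
  have hQp : D.chord Q ≠ p := fun h => hfq (by rw [hcinv.1 h, hcp])
  have hQq : D.chord Q ≠ q := fun h => hfqp (by rw [hcinv.1 h, hcq])
  have hQP : D.chord Q ≠ P := fun h => hne (hcinv.1 h).symm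
  set R : Set D.Point := {p, q, P, Q}ᶜ with hRdef
  have hmem : ∀ z, z ∈ R ↔ z ≠ p ∧ z ≠ q ∧ z ≠ P ∧ z ≠ Q := by
    intro z
    simp only [hRdef, Set.mem_compl_iff, Set.mem_insert_iff, Set.mem_singleton_iff, not_or]
  have hflip : ∀ z ∈ R, D.count.flip z ∈ R := by
    intro z hz
    rw [hmem] at hz ⊢
    have e1 : ∀ {a b : D.Point}, D.count.flip a = b ↔ a = D.count.flip b := fun {a b} =>
      ⟨fun h => by rw [← h, D.count.flip_flip], fun h => by rw [h, D.count.flip_flip]⟩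
    refine ⟨fun h => hz.2.2.1 (e1.1 h), fun h => hz.2.2.2 (e1.1 h),
      fun h => hz.1 (D.count.flip_injective h), fun h => hz.2.1 (D.count.flip_injective h)⟩
  -- The new matching: the far ends of the two strands beyond the side are joined, and all other
  -- chords are kept.
  set f : D.Point → D.Point := fun z => if z = D.chord P then D.chord Q else
    if z = D.chord Q then D.chord P else D.chord z with hf
  have hPQc : D.chord P ≠ D.chord Q := fun h => hff.symm (D.chord_injective h)
  have f1 : f (D.chord P) = D.chord Q := if_pos rfl
  have f2 : f (D.chord Q) = D.chord P := by
    rw [hf]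
    exact (if_neg hPQc.symm).trans (if_pos rfl)
  have f3 : ∀ z, z ≠ D.chord P → z ≠ D.chord Q → f z = D.chord z := fun z h h' =>
    (if_neg h).trans (if_neg h')
  have hPR : D.chord P ∈ R := (hmem _).2 ⟨hPp, hPq, D.chord_ne P, hne⟩
  have hQR : D.chord Q ∈ R := (hmem _).2 ⟨hQp, hQq, hQP, D.chord_ne Q⟩
  have hchord : ∀ z ∈ R, z ≠ D.chord P → z ≠ D.chord Q → D.chord z ∈ R ∧
      D.chord z ≠ D.chord P ∧ D.chord z ≠ D.chord Q := by
    intro z hz h1 h2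
    rw [hmem] at hz ⊢
    refine ⟨⟨fun h => hz.2.1 ?_, fun h => hz.1 ?_, fun h => h1 (hcinv.1 h),
      fun h => h2 (hcinv.1 h)⟩, fun h => hz.2.2.1 (D.chord_injective h),
      fun h => hz.2.2.2 (D.chord_injective h)⟩
    · rw [hcinv.1 h, hcp]
    · rw [hcinv.1 h, hcq]
  -- the joined strand crosses no other strand
  have hjoin : ∀ w ∈ R, w ≠ D.chord P → w ≠ D.chord Q →
      ¬ (D.count.Cyc (D.chord P) w (D.chord Q) ∧ D.count.Cyc (D.chord Q) (D.chord w) (D.chord P)) := by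
    intro w hw h1 h2
    have hw' := hchord w hw h1 h2
    rw [hmem] at hw hw'
    have hpos : ∀ {a b : D.Point}, a ≠ b → D.pos a ≠ D.pos b := fun h => D.pos_inj.not.2 h
    have c1 := (D.cross_iff _ _).not.1 (D.noncrossing (D.chord P) w)
    have c2 := (D.cross_iff _ _).not.1 (D.noncrossing (D.chord P) (D.chord w))
    have c3 := (D.cross_iff _ _).not.1 (D.noncrossing (D.chord Q) w)
    have c4 := (D.cross_iff _ _).not.1 (D.noncrossing (D.chord Q) (D.chord w))
    simp only [D.chord_chord] at c1 c2 c3 c4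
    simp only [StrandCount.cyc_iff]
    exact cycNat_join hPQ (hpos hw.2.2.1) (hpos hw.2.2.2) (hpos hw'.1.2.2.1) (hpos hw'.1.2.2.2)
      (hpos (D.chord_ne P)) (hpos (D.chord_ne Q)) (hpos hne) (hpos hQP) c1 c2 c3 c4
  have hrot : ∀ {a b A B : D.Point}, (D.count.Cyc a b A ∧ D.count.Cyc A B a) →
      (D.count.Cyc b A B ∧ D.count.Cyc B a b) := by
    intro a b A B h
    simp only [StrandCount.cyc_iff] at *
    omega
  have hdist : ∀ {a b A B : D.Point}, (D.count.Cyc a b A ∧ D.count.Cyc A B a) → b ≠ a ∧ b ≠ A := by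
    intro a b A B h
    simp only [StrandCount.cyc_iff] at h
    constructor <;> rintro rfl <;> omega
  obtain ⟨D', e, he, hre, hc⟩ := exists_of_pairing D.count R hflip f
    (fun z hz => by
      by_cases h1 : z = D.chord P
      · rw [h1, f1]; exact hQR
      · by_cases h2 : z = D.chord Q
        · rw [h2, f2]; exact hPR
        · rw [f3 z h1 h2]; exact (hchord z hz h1 h2).1)
    (fun z hz => by
      by_cases h1 : z = D.chord P
      · rw [h1, f1, f2]
      · by_cases h2 : z = D.chord Q
        · rw [h2, f2, f1]
        · have := hchord z hz h1 h2
          rw [f3 z h1 h2, f3 _ this.2.1 this.2.2, D.chord_chord])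
    (fun z hz => by
      by_cases h1 : z = D.chord P
      · rw [h1, f1]; exact hPQc.symm
      · by_cases h2 : z = D.chord Q
        · rw [h2, f2]; exact hPQc
        · rw [f3 z h1 h2]; exact D.chord_ne z)
    (fun z hz w hw hzw => by
      have hd := hdist hzw
      by_cases h1 : z = D.chord P
      · rw [h1, f1] at hd hzw
        rw [f3 w hd.1 hd.2] at hzw
        exact hjoin w hw hd.1 hd.2 hzw
      · by_cases h2 : z = D.chord Q
        · rw [h2, f2] at hd hzw
          rw [f3 w hd.2 hd.1] at hzw
          have := hrot (hrot hzw)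
          refine hjoin (D.chord w) (hchord w hw hd.2 hd.1).1 (hchord w hw hd.2 hd.1).2.1
            (hchord w hw hd.2 hd.1).2.2 ?_
          rwa [D.chord_chord]
        · rw [f3 z h1 h2] at hzw
          have hz' := hchord z hz h1 h2
          by_cases h3 : w = D.chord P
          · rw [h3, f1] at hzw
            refine hjoin (D.chord z) hz'.1 hz'.2.1 hz'.2.2 ?_
            rw [D.chord_chord]
            exact hrot hzw
          · by_cases h4 : w = D.chord Q
            · rw [h4, f2] at hzw
              exact hjoin z hz h1 h2 (hrot (hrot (hrot hzw)))
            · rw [f3 w h3 h4] at hzw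
              exact D.noncrossing z w hzw)
  refine ⟨D', ⟨p, q, hpq, hv, hcp, hne, e, he, hre, fun x => ⟨fun h => ?_, fun h => ?_, fun h h' => ?_⟩⟩,
    e, he.injective, he.2.1, by rw [hre, hmem]; exact fun h => h.1 rfl⟩
  · rw [hc, hcinv.1 h, f1]
  · rw [hc, hcinv.1 h, f2]
  · rw [hc, f3 _ (fun hh => h (hcinv.2 hh)) (fun hh => h' (hcinv.2 hh))]

theorem pos_lt_iff_of_side (m : StrandCount F) {p q : m.Point} (h : p.1 = q.1) :
    m.pos p < m.pos q ↔ p.2.val < q.2.val := by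
  obtain ⟨s, i⟩ := p
  obtain ⟨t, j⟩ := q
  obtain rfl : s = t := h
  simp only [StrandCount.pos]
  omega

theorem eq_of_side (m : StrandCount F) {p q : m.Point} (h : p.1 = q.1) (hv : p.2.val = q.2.val) :
    p = q := by
  obtain ⟨s, i⟩ := p
  obtain ⟨t, j⟩ := q
  obtain rfl : s = t := h
  have hij : i = j := Fin.ext hv
  rw [hij]

theorem side_eq_of_between (m : StrandCount F) {p z q : m.Point} (hpq : p.1 = q.1)
    (h1 : m.Before p z) (h2 : m.Before z q) : z.1 = p.1 := by
  have h3 : p.1 ≤ z.1 := by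
    rcases h1 with h | h
    · exact h.le
    · exact h.1.le
  have h4 : z.1 ≤ q.1 := by
    rcases h2 with h | h
    · exact h.le
    · exact h.1.le
  exact le_antisymm (hpq ▸ h4) h3

/-- An innermost strand among those which run from a side directly back to it. -/
theorem exists_adjacent (D : Curves F) {p : D.Point} (hp : (D.chord p).1 = p.1) :
    ∃ p q : D.Point, p.1 = q.1 ∧ q.2.val = p.2.val + 1 ∧ D.chord p = q := by
  classical
  have hlt : ∀ {p q : D.Point}, p.1 = q.1 → (D.pos p < D.pos q ↔ p.2.val < q.2.val) :=
    fun h => pos_lt_iff_of_side D.count h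
  -- A returning chord with the least distance between its ends is innermost; the claim is that this
  -- distance is one.
  have hex : ∃ n : ℕ, ∃ p q : D.Point, p.1 = q.1 ∧ p.2.val + n = q.2.val ∧ 0 < n ∧ D.chord p = q := by
    have hne : p.2.val ≠ (D.chord p).2.val := fun h =>
      D.chord_ne p (eq_of_side D.count hp h.symm)
    rcases Nat.lt_or_ge p.2.val (D.chord p).2.val with h | h
    · exact ⟨_, p, D.chord p, hp.symm, Nat.add_sub_of_le h.le, by omega, rfl⟩
    · exact ⟨_, D.chord p, p, hp, Nat.add_sub_of_le h, by omega, D.chord_chord p⟩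
  obtain ⟨p, q, hpq, hn, hpos, hc⟩ := Nat.find_spec hex
  refine ⟨p, q, hpq, ?_, hc⟩
  by_contra hcon
  have hr : p.2.val + 1 < D.count.num p.1 := by
    have := q.2.isLt
    have h2 : D.count.num p.1 = D.count.num q.1 := by rw [hpq]
    omega
  -- If the ends were not neighbours, the chord at the point `r` next to `p` would be enclosed by
  -- the chord of `p`, so it would return to the same side at a smaller distance.
  set r : D.Point := ⟨p.1, ⟨p.2.val + 1, hr⟩⟩ with hrdef
  have hrv : r.2.val = p.2.val + 1 := rfl
  have h1 : D.pos p < D.pos r := (hlt (p := p) (q := r) rfl).2 (by omega)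
  have h2 : D.pos r < D.pos q := (hlt (p := r) (q := q) hpq).2 (by omega)
  have hx1 := (D.cross_iff _ _).not.1 (D.noncrossing p r)
  rw [hc] at hx1
  have n1 : D.pos (D.chord r) ≠ D.pos p := fun h => by
    have : r = q := by rw [← hc, ← D.pos_inj.1 h, D.chord_chord]
    rw [this] at h2
    omega
  have n2 : D.pos (D.chord r) ≠ D.pos q := fun h => by
    have : r = p := D.chord_injective (by rw [D.pos_inj.1 h, hc])
    rw [this] at h1
    omega
  have h3 : D.pos p < D.pos (D.chord r) ∧ D.pos (D.chord r) < D.pos q := by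
    unfold CycNat at hx1
    omega
  have hside : (D.chord r).1 = p.1 := side_eq_of_between D.count hpq
    ((D.count.before_iff _ _).2 h3.1) ((D.count.before_iff _ _).2 h3.2)
  have h4 : p.2.val < (D.chord r).2.val := (hlt hside.symm).1 h3.1
  have h5 : (D.chord r).2.val < q.2.val := (hlt (hside.trans hpq)).1 h3.2
  have h6 : (D.chord r).2.val ≠ r.2.val := fun h =>
    D.chord_ne r (eq_of_side D.count hside h)
  rcases Nat.lt_or_ge r.2.val (D.chord r).2.val with h | h
  · refine Nat.find_min hex (m := (D.chord r).2.val - r.2.val) (by omega)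
      ⟨r, D.chord r, hside.symm, Nat.add_sub_of_le h.le, by omega, rfl⟩
  · refine Nat.find_min hex (m := r.2.val - (D.chord r).2.val) (by omega)
      ⟨D.chord r, r, hside, Nat.add_sub_of_le h, by omega, D.chord_chord r⟩

theorem card_lt_of_embedding {D D' : Curves F} {e : D'.Point → D.Point} (he : Function.Injective e)
    {p : D.Point} (hp : p ∉ Set.range e) : Fintype.card D'.Point < Fintype.card D.Point :=
  Fintype.card_lt_of_injective_of_notMem e he hp

theorem isSmallCircle_of_connected {D : Curves F} (hD : D.numComp = 1) {p q : D.Point}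
    (hpq : p.1 = q.1) (hc : D.chord p = q) (hf : D.chord (D.count.flip p) = D.count.flip q) :
    D.IsSmallCircle := by
  refine ⟨p, q, hpq, hc, hf, fun x => ?_⟩
  have hcq : D.chord q = p := by rw [← hc, D.chord_chord]
  have hfq : D.chord (D.count.flip q) = D.count.flip p := by rw [← hf, D.chord_chord]
  set f : D.Point → Prop := fun x => x = p ∨ x = q ∨ x = D.count.flip p ∨ x = D.count.flip q with hfd
  have h1 : ∀ z, f z → f (D.chord z) := by
    rintro z (rfl | rfl | rfl | rfl)
    · exact Or.inr (Or.inl hc)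
    · exact Or.inl hcq
    · exact Or.inr (Or.inr (Or.inr hf))
    · exact Or.inr (Or.inr (Or.inl hfq))
  have h2 : ∀ z, f z → f (D.count.flip z) := by
    rintro z (rfl | rfl | rfl | rfl)
    · exact Or.inr (Or.inr (Or.inl rfl))
    · exact Or.inr (Or.inr (Or.inr rfl))
    · exact Or.inl (D.count.flip_flip _)
    · exact Or.inr (Or.inl (D.count.flip_flip _))
  have := Alternating.map_eq (f := f) (fun z => propext ⟨fun h => by
      simpa [D.chord_chord] using h1 _ h, h1 z⟩) (fun z => propext ⟨fun h => by
      simpa [D.count.flip_flip] using h2 _ h, h2 z⟩) ((numComp_eq_one_iff.1 hD).2 p x)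
  exact (iff_of_eq this).1 (Or.inl rfl)

/-- Multiplying a reduced word by a letter either cancels its first letter or makes it longer. -/
theorem toWord_mk_mul {α : Type*} [DecidableEq α] (l : α × Bool) (w : FreeGroup α)
    (h : (FreeGroup.mk [l] * w).toWord.length ≤ w.toWord.length) :
    ∃ t, w.toWord = (l.1, !l.2) :: t := by
  have h1 : (FreeGroup.mk [l] * w).toWord = FreeGroup.reduce (l :: w.toWord) := by
    conv_lhs => rw [← FreeGroup.mk_toWord (x := w)]
    rw [FreeGroup.mul_mk, FreeGroup.toWord_mk]
    rfl
  rw [h1, FreeGroup.reduce.cons, FreeGroup.reduce_toWord] at h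
  cases hw : w.toWord with
  | nil => rw [hw] at h; simp at h
  | cons x t =>
    rw [hw] at h
    simp only at h
    split_ifs at h with hx
    · refine ⟨t, ?_⟩
      congr 1
      refine Prod.ext hx.1.symm ?_
      rw [hx.2, Bool.not_not]
    · simp at h

/-- Over curves with a section in a free group, some strand runs directly back to its side. -/
theorem exists_chord_same_side {α : Type*} {D : Curves F} (ρ : Holonomy F (FreeGroup α))
    (letter : Fin F.sides → α × Bool) (h1 : ∀ p : D.Point, ρ.side p.1 = FreeGroup.mk [letter p.1])
    (h2 : ∀ p q : D.Point, letter p.1 = letter q.1 → p.1 = q.1) [Nonempty D.Point]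
    {h : D.Point → FreeGroup α} (hs : D.IsSection ρ h) : ∃ p : D.Point, (D.chord p).1 = p.1 := by
  classical
  -- At a value of greatest word length, crossing the side at either end of the chord cannot
  -- lengthen the word and therefore cancels its first letter. Both ends carry the same value, so
  -- their letters agree and hence their sides.
  obtain ⟨p, hp⟩ := Finite.exists_max fun p : D.Point => (h p).toWord.length
  refine ⟨p, h2 _ _ ?_⟩
  have key : ∀ q : D.Point, h q = h p → ∃ t, (h p).toWord = ((letter q.1).1, !(letter q.1).2) :: t := by
    intro q hq
    apply toWord_mk_mul
    have := hs.flip q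
    rw [h1, smul_eq_mul, hq] at this
    rw [← this]
    exact hp _
  obtain ⟨t, ht⟩ := key p rfl
  obtain ⟨t', ht'⟩ := key (D.chord p) (hs.chord p)
  rw [ht] at ht'
  injection ht' with h3 h4
  injection h3 with h5 h6
  exact Prod.ext h5.symm (by simpa using h6.symm)

/-- A circle is inessential if it has a section in a free group on the sides which it meets. -/
theorem inessential_of_section {α : Type*} (ρ : Holonomy F (FreeGroup α))
    (letter : Fin F.sides → α × Bool) : ∀ (D : Curves F), D.numComp = 1 →
    (∀ p : D.Point, ρ.side p.1 = FreeGroup.mk [letter p.1]) →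
    (∀ p q : D.Point, letter p.1 = letter q.1 → p.1 = q.1) →
    (∃ h : D.Point → FreeGroup α, D.IsSection ρ h) → D.Inessential := by
  intro D
  induction hn : Fintype.card D.Point using Nat.strong_induction_on generalizing D with
  | _ n ih =>
    rintro hD h1 h2 ⟨h, hs⟩
    have hne : Nonempty D.Point := (numComp_eq_one_iff.1 hD).1
    obtain ⟨p, hp⟩ := exists_chord_same_side ρ letter h1 h2 hs
    obtain ⟨p, q, hpq, hv, hc⟩ := D.exists_adjacent hp
    -- Either the strand beyond the side returns as well, and the connected curve is the small
    -- circle, or the strand is pulled back. Then the number of points drops and the section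
    -- persists, so induction applies.
    by_cases hf : D.chord (D.count.flip p) = D.count.flip q
    · exact ⟨D, isSmallCircle_of_connected hD hpq hc hf, .refl _⟩
    · obtain ⟨D', hD', e, he, hes, hep⟩ := D.exists_finger hpq hv hc hf
      have hi : D.Isotopic D' := .rel _ _ (Or.inl hD')
      have hcard := card_lt_of_embedding he hep
      obtain ⟨O, hO, hiO⟩ := ih _ (by rw [← hn]; exact hcard) D' rfl (by rw [← hi.numComp_eq, hD])
        (fun p => by rw [← hes, h1]) (fun p q => by rw [← hes p, ← hes q]; exact h2 _ _)
        ⟨_, ((hi.sections ρ).some ⟨h, hs⟩).2⟩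
      exact ⟨O, hO, .trans _ _ _ hi hiO⟩

end Curves

/-! ## The circles of a smoothed diagram -/

namespace Layered

variable {F : PolygonSurface} {D : Layered F} {σ : D.State}

theorem componentSetoid_iff (v w : D.Vertex) :
    (D.componentSetoid σ) v w ↔ Alternating D.strand (outerTurn σ.full) v w := by
  constructor
  · intro h
    change Relation.EqvGen _ v w at h
    induction h with
    | rel v w h =>
      rcases h with h | ⟨p, rfl, rfl⟩
      · rcases h.strand_or_turn with rfl | rfl
        · exact .left v
        · rcases v with p | g
          · exact .refl _
          · exact .right (Sum.inr g)
      · exact .right (Sum.inl p)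
    | refl => exact .refl _
    | symm _ _ _ ih => exact ih.symm
    | trans _ _ _ _ _ ih ih' => exact ih.trans ih'
  · intro h
    change Relation.EqvGen _ v w
    induction h with
    | rel v w h =>
      rcases h with rfl | rfl
      · rcases adj_of_strandAdj σ (strandAdj_strand v) with h | h
        · exact .rel _ _ (Or.inl h)
        · exact .symm _ _ (.rel _ _ (Or.inl h))
      · rcases v with p | g
        · exact .rel _ _ (Or.inr ⟨p, rfl, rfl⟩)
        · rcases adj_smooth σ g with h | h
          · exact .rel _ _ (Or.inl h)
          · exact .symm _ _ (.rel _ _ (Or.inl h))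
    | refl => exact .refl _
    | symm _ _ _ ih => exact .symm _ _ ih
    | trans _ _ _ _ _ ih ih' => exact .trans _ _ _ ih ih'

theorem componentOf_eq_of_joined {p q : D.Point} (h : D.Joined σ (.inl p) (.inl q)) :
    D.componentOf σ p = D.componentOf σ q := by
  refine Quotient.sound ((componentSetoid_iff _ _).2 ?_)
  rw [joined_iff] at h
  exact Alternating.map_eq (f := fun v => Alternating D.strand (outerTurn σ.full) (.inl p) v)
    (fun v => propext ⟨fun h => by simpa using h.trans (.left _), fun h => h.trans (.left _)⟩)
    (fun v => by
      rcases v with p' | g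
      · rfl
      · exact propext ⟨fun h => by
          have := h.trans (.right _)
          simpa [innerTurn, outerTurn] using this,
          fun h => h.trans (.right (Sum.inr g))⟩) h ▸ .refl _

@[simp] theorem componentOf_mate (p : D.Point) :
    D.componentOf σ (mate σ p) = D.componentOf σ p :=
  (componentOf_eq_of_joined (joined_mate σ p)).symm

@[simp] theorem componentOf_flip (p : D.Point) :
    D.componentOf σ (D.count.flip p) = D.componentOf σ p := by
  refine Quotient.sound ((componentSetoid_iff _ _).2 ?_)
  exact (Alternating.right (Sum.inl p)).symm

/-- Circles that meet the sides can be followed on boundary points alone, alternating between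
smoothed arcs and the gluing. -/
theorem componentOf_eq_iff (p q : D.Point) : D.componentOf σ p = D.componentOf σ q ↔
    Alternating (mate σ) D.count.flip p q := by
  constructor
  · intro h
    have h := (componentSetoid_iff (σ := σ) _ _).1 (Quotient.exact h)
    set f : D.Vertex → Prop := fun v => ∃ r, D.Joined σ (.inl r) v ∧
      Alternating (mate σ) D.count.flip p r with hf
    have hstrand : ∀ v, f v → f (D.strand v) := fun v ⟨r, h1, h2⟩ =>
      ⟨r, .trans _ _ _ h1 (joined_strand σ v), h2⟩
    have hturn : ∀ v, f v → f (outerTurn σ.full v) := by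
      rintro (p' | g) ⟨r, h1, h2⟩
      · refine ⟨D.count.flip p', .refl _, ?_⟩
        rcases eq_or_eq_mate h1 with rfl | rfl
        · exact h2.trans (.right _)
        · exact (h2.trans (.left _)).trans (.right _)
      · exact ⟨r, .trans _ _ _ h1 (joined_innerTurn σ (.inr g)), h2⟩
    have := h.map_eq (f := f)
      (fun v => propext ⟨fun h => by simpa using hstrand _ h, hstrand v⟩)
      (fun v => propext ⟨fun h => by simpa [outerTurn_outerTurn] using hturn _ h, hturn v⟩)
    obtain ⟨r, h1, h2⟩ := (iff_of_eq this).1 ⟨p, .refl _, .refl _⟩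
    rcases eq_or_eq_mate h1 with rfl | rfl
    · exact h2
    · exact h2.trans (.left _)
  · exact fun h => h.map_eq (f := D.componentOf σ) componentOf_mate componentOf_flip

theorem isSmoothedEmb_iff {K : Curves F} {e : K.Point → D.Point} :
    D.IsSmoothedEmb σ K e ↔ K.count.IsEmb D.count e ∧ ∀ p, e (K.chord p) = mate σ (e p) := by
  refine and_congr_right fun he => forall_congr' fun p => ⟨fun h => ?_, fun h => ?_⟩
  · rcases eq_or_eq_mate h with h | h
    · exact absurd (he.injective h) (K.chord_ne p)
    · exact h
  · rw [h]
    exact joined_mate σ _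

/-- Some of the circles of a smoothed diagram form a closed curve in normal position. -/
theorem exists_smoothedEmb (σ : D.State) (R : Set D.Point) (hR : ∀ p ∈ R, D.count.flip p ∈ R)
    (hR' : ∀ p ∈ R, mate σ p ∈ R) :
    ∃ (K : Curves F) (e : K.Point → D.Point), D.IsSmoothedEmb σ K e ∧ Set.range e = R := by
  obtain ⟨K, e, he, hr, hc⟩ := Curves.exists_of_pairing D.count R hR (mate σ) hR'
    (fun p _ => mate_mate σ p) (fun p _ => mate_ne σ p) (by
      rintro p - q - ⟨h1, h2⟩
      rw [StrandCount.cyc_iff] at h1 h2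
      have n1 := mate_noncrossing σ (p := p) (q := q)
      have n2 := mate_noncrossing σ (p := mate σ p) (q := mate σ q)
      have n3 := mate_noncrossing σ (p := p) (q := mate σ q)
      have n4 := mate_noncrossing σ (p := mate σ p) (q := q)
      simp only [mate_mate] at n1 n2 n3 n4
      change D.pos _ < D.pos _ ∧ D.pos _ < D.pos _ ∨ D.pos _ < D.pos _ ∧ D.pos _ < D.pos _ ∨
        D.pos _ < D.pos _ ∧ D.pos _ < D.pos _ at h1 h2
      omega)
  exact ⟨K, e, isSmoothedEmb_iff.2 ⟨he, hc⟩, hr⟩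

theorem linked_iff_componentOf_eq {K : Curves F} {e : K.Point → D.Point}
    (he : D.IsSmoothedEmb σ K e) (p q : K.Point) :
    K.Linked p q ↔ D.componentOf σ (e p) = D.componentOf σ (e q) := by
  have hc := (isSmoothedEmb_iff.1 he).2
  constructor
  · exact fun h => h.map_eq (f := fun p => D.componentOf σ (e p))
      (fun v => by rw [hc, componentOf_mate]) (fun v => by rw [he.1.2.2, componentOf_flip])
  · intro h
    rw [componentOf_eq_iff] at h
    set f : D.Point → Prop := fun z => ∃ x, e x = z ∧ K.Linked p x with hf
    have h1 : ∀ z, f z → f (mate σ z) := by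
      rintro _ ⟨x, rfl, hx⟩
      exact ⟨_, hc x, hx.trans (.left x)⟩
    have h2 : ∀ z, f z → f (D.count.flip z) := by
      rintro _ ⟨x, rfl, hx⟩
      exact ⟨_, he.1.2.2 x, hx.trans (.right x)⟩
    have := h.map_eq (f := f)
      (fun v => propext ⟨fun h => by simpa using h1 _ h, h1 v⟩)
      (fun v => propext ⟨fun h => by simpa [StrandCount.flip_flip] using h2 _ h, h2 v⟩)
    obtain ⟨x, hx, hl⟩ := (iff_of_eq this).1 ⟨p, rfl, .refl _⟩
    rwa [← he.1.injective hx]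

/-- Since smoothed arcs do not cross, the essential circles form a curve system; the default value
in `resolved` is therefore never taken. -/
theorem exists_isEssentialPart (D : Layered F) (σ : D.State) :
    ∃ S : CurveSystem F, D.IsEssentialPart σ S := by
  obtain ⟨S, e, he, hr⟩ := exists_smoothedEmb σ
    {p | ¬ D.InessentialComponent σ (D.componentOf σ p)} (fun p hp => by
      change ¬ _
      rwa [componentOf_flip]) (fun p hp => by
      change ¬ _
      rwa [componentOf_mate])
  refine ⟨⟨S, fun K e' he' hK => ?_⟩, e, he, hr⟩
  obtain ⟨⟨x⟩, hl⟩ := Curves.numComp_eq_one_iff.1 hK.numComp_eq_one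
  have hc := (isSmoothedEmb_iff.1 he).2
  have hee : D.IsSmoothedEmb σ K (e ∘ e') := isSmoothedEmb_iff.2
    ⟨he.1.comp he'.1, fun p => by simp only [Function.comp, he'.2, hc]⟩
  have hx : e (e' x) ∈ {p | ¬ D.InessentialComponent σ (D.componentOf σ p)} := by
    rw [← hr]
    exact ⟨_, rfl⟩
  -- An inessential part of the curve system is connected, so it is a whole circle of the smoothed
  -- diagram. That circle would be inessential, contrary to the choice of the points.
  refine hx (Or.inr ⟨K, e ∘ e', hee, ?_, hK⟩)
  ext z
  constructor
  · rintro ⟨y, rfl⟩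
    exact ((linked_iff_componentOf_eq hee _ _).1 (hl x y)).symm
  · intro hz
    have hz' : D.componentOf σ z = D.componentOf σ (e (e' x)) := hz
    have : z ∈ {p | ¬ D.InessentialComponent σ (D.componentOf σ p)} := by
      change ¬ _
      rw [hz']
      exact hx
    rw [← hr] at this
    obtain ⟨y, rfl⟩ := this
    have hlink := (linked_iff_componentOf_eq he _ _).2 hz'.symm
    set f : S.Point → Prop := fun z => z ∈ Set.range e' with hf
    have h1 : ∀ z, f z → f (S.chord z) := by
      rintro _ ⟨x, rfl⟩
      exact ⟨_, he'.2 x⟩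
    have h2 : ∀ z, f z → f (S.count.flip z) := by
      rintro _ ⟨x, rfl⟩
      exact ⟨_, he'.1.2.2 x⟩
    have := hlink.map_eq (f := f)
      (fun v => propext ⟨fun h => by simpa [S.chord_chord] using h1 _ h, h1 v⟩)
      (fun v => propext ⟨fun h => by simpa [StrandCount.flip_flip] using h2 _ h, h2 v⟩)
    obtain ⟨w, rfl⟩ := (iff_of_eq this).1 ⟨x, rfl⟩
    exact ⟨w, rfl⟩

instance (D : Layered F) (σ : D.State) : Finite (D.Component σ) := Quotient.finite _

theorem IsEssentialPart.mu_add_numComp {S : CurveSystem F} (hS : D.IsEssentialPart σ S) :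
    D.mu σ + S.numComp = Nat.card (D.Component σ) := by
  classical
  obtain ⟨e, he, hr⟩ := hS
  have hmem : ∀ p, (¬ D.InessentialComponent σ (D.componentOf σ p)) ↔ p ∈ Set.range e := fun p => by
    rw [hr]
    rfl
  have heq : S.numComp = Nat.card {c : D.Component σ // ¬ D.InessentialComponent σ c} := by
    refine Nat.card_eq_of_bijective (fun c => Quotient.lift (s := S.linkedSetoid)
      (fun p => (⟨D.componentOf σ (e p), (hmem _).2 ⟨p, rfl⟩⟩ :
        {c : D.Component σ // ¬ D.InessentialComponent σ c}))
      (fun p q h => Subtype.ext ((linked_iff_componentOf_eq he p q).1 h)) c) ⟨?_, ?_⟩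
    · intro a b
      induction a using Quotient.inductionOn with | _ a
      induction b using Quotient.inductionOn with | _ b
      intro h
      exact Quotient.sound ((linked_iff_componentOf_eq he a b).2 (congrArg Subtype.val h))
    · rintro ⟨c, hc⟩
      have : ∃ p, D.componentOf σ p = c := by
        by_contra hcon
        push Not at hcon
        exact hc (Or.inl hcon)
      obtain ⟨p, rfl⟩ := this
      obtain ⟨x, rfl⟩ := (hmem p).1 hc
      exact ⟨Quotient.mk _ x, rfl⟩
  rw [heq, mu, ← Nat.card_sum]
  exact Nat.card_congr (Equiv.sumCompl _)

end Layered

/-! ## The character of the trivial representation -/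

/-- The number of components of an isotopy class. -/
noncomputable def CurveClass.numComp {F : PolygonSurface} (c : CurveClass F) : ℕ :=
  Quotient.lift (s := CurveSystem.isotopy F) (fun A => A.numComp)
    (fun _ _ h => Curves.Isotopic.numComp_eq h) c

/-- The value of a curve system at the trivial representation: every component has the value
`-2`. -/
noncomputable def trivialCharacter (k : Type*) [CommRing k] (F : PolygonSurface) :
    CurveModule k F →ₗ[k] k :=
  Finsupp.linearCombination k fun c : CurveClass F => (-2 : k) ^ c.numComp

namespace Layered

variable {F : PolygonSurface} (k : Type*) [CommRing k]

theorem trivialCharacter_single (c : CurveClass F) :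
    trivialCharacter k F (Finsupp.single c 1) = (-2) ^ c.numComp := by
  rw [trivialCharacter, Finsupp.linearCombination_single, one_smul]

theorem resolved_eq (D : Layered F) (σ : D.State) : ∃ S : CurveSystem F, D.IsEssentialPart σ S ∧
    D.resolved k σ = Finsupp.single (Quotient.mk (CurveSystem.isotopy F) S) 1 :=
  ⟨_, (D.exists_isEssentialPart σ).choose_spec, dif_pos (D.exists_isEssentialPart σ)⟩

/-- Inessential circles contribute `-2` through the loop factor and essential ones through the
character, so only the total number of circles matters. -/
theorem trivialCharacter_resolved (D : Layered F) (σ : D.State) :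
    (-2) ^ D.mu σ * trivialCharacter k F (D.resolved k σ) = (-2) ^ Nat.card (D.Component σ) := by
  obtain ⟨S, hS, h⟩ := D.resolved_eq k σ
  rw [h, trivialCharacter_single, ← hS.mu_add_numComp, pow_add]
  rfl

end Layered

/-! ## The skein relation for the numbers of components -/

namespace Alternating

variable {V : Type*}

/-- The equivalence relation generated by two maps. -/
def setoid (s t : V → V) : Setoid V where
  r := Alternating s t
  iseqv := ⟨refl, symm, trans⟩

/-- The functions modulo two that are invariant under two maps. -/
def invariants (s t : V → V) : Submodule (ZMod 2) (V → ZMod 2) where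
  carrier := {h | (∀ v, h (s v) = h v) ∧ ∀ v, h (t v) = h v}
  add_mem' {a b} ha hb := ⟨fun v => by simp only [Pi.add_apply, ha.1, hb.1],
    fun v => by simp only [Pi.add_apply, ha.2, hb.2]⟩
  zero_mem' := ⟨fun _ => rfl, fun _ => rfl⟩
  smul_mem' c a ha := ⟨fun v => by simp only [Pi.smul_apply, ha.1],
    fun v => by simp only [Pi.smul_apply, ha.2]⟩

/-- Invariant functions are functions on the set of orbits. -/
def invariantsEquiv (s t : V → V) :
    invariants s t ≃ₗ[ZMod 2] (Quotient (setoid s t) → ZMod 2) where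
  toFun h c := Quotient.lift (s := setoid s t) h.1 (fun _ _ hab => map_eq h.2.1 h.2.2 hab) c
  map_add' _ _ := funext fun c => Quotient.inductionOn c fun _ => rfl
  map_smul' _ _ := funext fun c => Quotient.inductionOn c fun _ => rfl
  invFun f := ⟨fun v => f (Quotient.mk _ v),
    fun v => congrArg f (Quotient.sound (s := setoid s t) (left v).symm),
    fun v => congrArg f (Quotient.sound (s := setoid s t) (right v).symm)⟩
  left_inv _ := rfl
  right_inv f := funext fun c => Quotient.inductionOn c fun _ => rfl

variable {s t t' : V → V}

/-- The number of orbits of two maps. -/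
noncomputable def numOrbits (s t : V → V) : ℕ := Nat.card (Quotient (setoid s t))

theorem finrank_invariants [Finite V] (s t : V → V) :
    Module.finrank (ZMod 2) (invariants s t) = numOrbits s t := by
  classical
  have : Finite (Quotient (setoid s t)) := Quotient.finite _
  have := Fintype.ofFinite (Quotient (setoid s t))
  rw [(invariantsEquiv s t).finrank_eq, Module.finrank_fintype_fun_eq_card, numOrbits,
    Nat.card_eq_fintype_card]

/-- The number of orbits is the dimension of the space of invariant functions modulo two. One
further linear equation that does not hold identically lowers it by one. -/
theorem numOrbits_succ [Finite V] {x y : V}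
    (h : ∀ f, f ∈ invariants s t' ↔ f ∈ invariants s t ∧ f x = f y)
    (hne : ∃ f ∈ invariants s t, f x ≠ f y) : numOrbits s t' + 1 = numOrbits s t := by
  rw [← finrank_invariants, ← finrank_invariants]
  set φ : Module.Dual (ZMod 2) (invariants s t) :=
    (LinearMap.proj (R := ZMod 2) (φ := fun _ : V => ZMod 2) x - LinearMap.proj y).comp
      (invariants s t).subtype with hφ
  have hval : ∀ f, φ f = f.1 x - f.1 y := fun f => rfl
  have hφ0 : φ ≠ 0 := by
    obtain ⟨f, hf, hxy⟩ := hne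
    intro h0
    have := hval ⟨f, hf⟩
    rw [h0] at this
    exact hxy (sub_eq_zero.1 this.symm)
  rw [← Module.Dual.finrank_ker_add_one_of_ne_zero hφ0]
  congr 1
  refine LinearEquiv.finrank_eq ?_
  exact
    { toFun := fun f => ⟨⟨f.1, ((h _).1 f.2).1⟩, by
        rw [LinearMap.mem_ker, hval]
        exact sub_eq_zero.2 ((h _).1 f.2).2⟩
      map_add' := fun _ _ => rfl
      map_smul' := fun _ _ => rfl
      invFun := fun f => ⟨f.1.1, (h _).2 ⟨f.1.2, sub_eq_zero.1 ((hval _).symm.trans f.2)⟩⟩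
      left_inv := fun _ => rfl
      right_inv := fun _ => rfl }

/-- Off four points the map is the given one, and it exchanges `a` with `b` and `c` with `d`. -/
structure Joins (t₀ t : V → V) (a b c d : V) : Prop where
  left : t a = b
  left' : t b = a
  right : t c = d
  right' : t d = c
  off : ∀ v, v ≠ a → v ≠ b → v ≠ c → v ≠ d → t v = t₀ v

theorem Joins.mem_iff {t₀ t : V → V} {a b c d : V} (h : Joins t₀ t a b c d) (ha : t₀ a = a)
    (hb : t₀ b = b) (hc : t₀ c = c) (hd : t₀ d = d) (f : V → ZMod 2) :
    f ∈ invariants s t ↔ f ∈ invariants s t₀ ∧ f a = f b ∧ f c = f d := by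
  constructor
  · rintro ⟨h1, h2⟩
    refine ⟨⟨h1, fun v => ?_⟩, ?_, ?_⟩
    · by_cases va : v = a
      · rw [va, ha]
      by_cases vb : v = b
      · rw [vb, hb]
      by_cases vc : v = c
      · rw [vc, hc]
      by_cases vd : v = d
      · rw [vd, hd]
      rw [← h.off v va vb vc vd, h2]
    · rw [← h2 a, h.left]
    · rw [← h2 c, h.right]
  · rintro ⟨⟨h1, h2⟩, h3, h4⟩
    refine ⟨h1, fun v => ?_⟩
    by_cases va : v = a
    · rw [va, h.left, h3]
    by_cases vb : v = b
    · rw [vb, h.left', h3]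
    by_cases vc : v = c
    · rw [vc, h.right, h4]
    by_cases vd : v = d
    · rw [vd, h.right', h4]
    rw [h.off v va vb vc vd, h2]

/-- With the four ends left open, the arcs run from `a` to `b` and from `c` to `d`. Joining along
the arcs closes two circles and either other joining closes only one, and `(-2)^(n+1) + 2 (-2)^n =
0`. -/
theorem sum_of_joined [Finite V] {t₀ t₁ t₂ t₃ : V → V} {a b c d : V} (h1 : Joins t₀ t₁ a b c d)
    (h2 : Joins t₀ t₂ a c b d) (h3 : Joins t₀ t₃ a d b c) (ha : t₀ a = a) (hb : t₀ b = b)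
    (hc : t₀ c = c) (hd : t₀ d = d) (hab : Alternating s t₀ a b) (hcd : Alternating s t₀ c d)
    (hac : ¬ Alternating s t₀ a c) :
    (-2 : ℤ) ^ numOrbits s t₁ + (-2) ^ numOrbits s t₂ + (-2) ^ numOrbits s t₃ = 0 := by
  classical
  have hW : ∀ f, f ∈ invariants s t₀ → f a = f b ∧ f c = f d := fun f hf =>
    ⟨map_eq hf.1 hf.2 hab, map_eq hf.1 hf.2 hcd⟩
  have e1 : ∀ f, f ∈ invariants s t₁ ↔ f ∈ invariants s t₀ := fun f => by
    rw [h1.mem_iff ha hb hc hd]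
    exact ⟨fun h => h.1, fun h => ⟨h, hW f h⟩⟩
  set u : V → ZMod 2 := fun v => if Alternating s t₀ a v then 1 else 0 with hu
  have hmem : u ∈ invariants s t₁ := by
    rw [e1]
    have key : ∀ v w, Alternating s t₀ v w → u w = u v := fun v w h => by
      have : Alternating s t₀ a w ↔ Alternating s t₀ a v :=
        ⟨fun h' => h'.trans h.symm, fun h' => h'.trans h⟩
      simp only [hu, this]
    exact ⟨fun v => key _ _ (.left v), fun v => key _ _ (.right v)⟩
  have hua : u a = 1 := if_pos (refl a)
  have huc : u c = 0 := if_neg hac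
  have hud : u d = 0 := if_neg fun h => hac (h.trans hcd.symm)
  have n2 : numOrbits s t₂ + 1 = numOrbits s t₁ := by
    refine numOrbits_succ (x := a) (y := c) (fun f => ?_) ⟨u, hmem, by rw [hua, huc]; decide⟩
    rw [h2.mem_iff ha hc hb hd, e1]
    refine and_congr_right fun hf => ⟨fun h => h.1, fun h => ⟨h, ?_⟩⟩
    rw [← (hW f hf).1, h, (hW f hf).2]
  have n3 : numOrbits s t₃ + 1 = numOrbits s t₁ := by
    refine numOrbits_succ (x := a) (y := d) (fun f => ?_) ⟨u, hmem, by rw [hua, hud]; decide⟩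
    rw [h3.mem_iff ha hd hb hc, e1]
    refine and_congr_right fun hf => ⟨fun h => h.1, fun h => ⟨h, ?_⟩⟩
    rw [← (hW f hf).1, h, (hW f hf).2]
  have : numOrbits s t₃ = numOrbits s t₂ := by omega
  rw [← n2, this, pow_succ]
  ring

theorem Joins.swap {t₀ t : V → V} {a b c d : V} (h : Joins t₀ t a b c d) : Joins t₀ t a b d c :=
  ⟨h.left, h.left', h.right', h.right, fun v h1 h2 h3 h4 => h.off v h1 h2 h4 h3⟩

/-- The three ways to join four ends of a one-manifold in pairs: in two of them the number of
circles is the same, and in the third it is larger by one. -/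
theorem sum_three_joins [Finite V] {t₀ t₁ t₂ t₃ : V → V} {a b c d : V} (hs : ∀ v, s (s v) = v)
    (hne : ∀ v, s v ≠ v) (ht : ∀ v, t₀ (t₀ v) = v) (h1 : Joins t₀ t₁ a b c d)
    (h2 : Joins t₀ t₂ a c b d) (h3 : Joins t₀ t₃ a d b c)
    (hfix : ∀ v, t₀ v = v ↔ v = a ∨ v = b ∨ v = c ∨ v = d)
    (hab : a ≠ b) (hac : a ≠ c) (had : a ≠ d) (hbc : b ≠ c) (hbd : b ≠ d) (hcd : c ≠ d) :
    (-2 : ℤ) ^ numOrbits s t₁ + (-2) ^ numOrbits s t₂ + (-2) ^ numOrbits s t₃ = 0 := by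
  have ha : t₀ a = a := (hfix a).2 (Or.inl rfl)
  have hb : t₀ b = b := (hfix b).2 (Or.inr (Or.inl rfl))
  have hc : t₀ c = c := (hfix c).2 (Or.inr (Or.inr (Or.inl rfl)))
  have hd : t₀ d = d := (hfix d).2 (Or.inr (Or.inr (Or.inr rfl)))
  -- the partners of `a` and of one of the remaining ends
  obtain ⟨a', q1, q2, q3, q4⟩ := exists_other_fixed hs ht hne ha
  have second : ∀ x y z, t₀ y = y → t₀ z = z → a ≠ y → a ≠ z → x ≠ y → x ≠ z → y ≠ z → a' = x →
      (∀ v, t₀ v = v → v = a ∨ v = x ∨ v = y ∨ v = z) →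
      Alternating s t₀ a x ∧ Alternating s t₀ y z ∧ ¬ Alternating s t₀ a y := by
    rintro x y z hy hz way waz wxy wxz wyz rfl hall
    have hnay : ¬ Alternating s t₀ a y := fun h => by
      rcases q4 y hy h with h | h
      · exact way h.symm
      · exact wxy h.symm
    obtain ⟨y', r1, r2, r3, -⟩ := exists_other_fixed hs ht hne hy
    refine ⟨q3, ?_, hnay⟩
    rcases hall y' r2 with rfl | rfl | rfl | rfl
    · exact absurd r3.symm hnay
    · exact absurd (q3.trans r3.symm) hnay
    · exact absurd rfl r1
    · exact r3
  rcases (hfix a').1 q2 with h | h | h | h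
  · exact absurd h q1
  · obtain ⟨w1, w2, w3⟩ := second b c d hc hd hac had hbc hbd hcd h fun v hv => (hfix v).1 hv
    exact sum_of_joined h1 h2 h3 ha hb hc hd w1 w2 w3
  · obtain ⟨w1, w2, w3⟩ := second c b d hb hd hab had hbc.symm hcd hbd h fun v hv => by
      have := (hfix v).1 hv; tauto
    have := sum_of_joined h2 h1 h3.swap ha hc hb hd w1 w2 w3
    rw [← this]; ring
  · obtain ⟨w1, w2, w3⟩ := second d b c hb hc hab hac hbd.symm hcd.symm hbc h fun v hv => by
      have := (hfix v).1 hv; tauto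
    have := sum_of_joined h3 h1.swap h2.swap ha hd hb hc w1 w2 w3
    rw [← this]; ring

end Alternating

namespace Layered

variable {F : PolygonSurface} {D : Layered F}

/-- The number of components of a partially smoothed diagram. -/
noncomputable def numCircles (τ : D.Crossing → Option Bool) : ℕ :=
  Alternating.numOrbits D.strand (outerTurn τ)

theorem card_component (σ : D.State) : Nat.card (D.Component σ) = numCircles σ.full := by
  refine Nat.card_congr (Quotient.congr (Equiv.refl _) fun v w => ?_)
  exact componentSetoid_iff v w

open Classical in
/-- The skein relation. -/
theorem sum_update (τ : D.Crossing → Option Bool) (c : D.Crossing) :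
    (-2 : ℤ) ^ numCircles (Function.update τ c (some true)) +
      (-2) ^ numCircles (Function.update τ c none) +
      (-2) ^ numCircles (Function.update τ c (some false)) = 0 := by
  -- The passage in which the four germs of the crossing `c` are left as free ends. The `∞`-marker,
  -- the unsmoothed crossing and the `0`-marker are the three ways to join them.
  set t₀ : D.Vertex → D.Vertex := fun v => match v with
    | .inl p => .inl (D.count.flip p)
    | .inr g => if D.crossingOf g = c then .inr g else .inr (smooth τ g) with ht₀
  have hgerm : ∀ g : D.Germ, D.crossingOf g = c ↔ g = c.1 ∨ g = c.1.next ∨ g = c.1.opp ∨ g = c.1.prev := by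
    refine fun g => ⟨eq_or_of_crossingOf_eq, ?_⟩
    rintro (h | h | h | h) <;> rw [h]
    · exact crossingOf_crossing c
    · rw [crossingOf_next, crossingOf_crossing]
    · rw [crossingOf_opp, crossingOf_crossing]
    · rw [crossingOf_prev, crossingOf_crossing]
  have hoff : ∀ x (v : D.Vertex), v ≠ .inr c.1 → v ≠ .inr c.1.next → v ≠ .inr c.1.opp →
      v ≠ .inr c.1.prev → outerTurn (Function.update τ c x) v = t₀ v := by
    rintro x (p | g) h1 h2 h3 h4
    · rfl
    · have hg : D.crossingOf g ≠ c := fun h => by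
        rcases (hgerm g).1 h with h | h | h | h <;> rw [h] at h1 h2 h3 h4 <;> tauto
      simp only [ht₀, if_neg hg, outerTurn]
      rw [smooth_congr (τ' := τ)]
      rw [Function.update_of_ne hg]
  have hat : ∀ x (g : D.Germ), D.crossingOf g = c → Function.update τ c x (D.crossingOf g) = x :=
    fun x g h => by rw [h, Function.update_self]
  have n0 : D.crossingOf c.1 = c := crossingOf_crossing c
  have n1 : D.crossingOf c.1.next = c := by rw [crossingOf_next, n0]
  have n2 : D.crossingOf c.1.opp = c := by rw [crossingOf_opp, n0]
  have n3 : D.crossingOf c.1.prev = c := by rw [crossingOf_prev, n0]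
  have t0 : D.top c.1.1.1 := c.2.1
  have t1 : ¬ D.top c.1.next.1.1 := by rw [Germ.top_next]; exact not_not.2 t0
  have t2 : D.top c.1.opp.1.1 := by rw [Germ.top_opp]; exact t0
  have t3 : ¬ D.top c.1.prev.1.1 := by rw [Germ.top_prev]; exact not_not.2 t0
  have e1 : c.1.opp.next = c.1.prev := Germ.opp_next _
  have e2 : c.1.prev.next = c.1 := Germ.prev_next _
  have e3 : c.1.opp.prev = c.1.next := Germ.opp_prev _
  have e4 : c.1.next.prev = c.1 := Germ.next_prev _
  have hinj : ∀ {g h : D.Germ}, g ≠ h → (Sum.inr g : D.Vertex) ≠ Sum.inr h := fun h h' =>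
    h (Sum.inr.inj h')
  have d01 := c.1.next_ne.symm
  have d02 := c.1.opp_ne.symm
  have d03 := c.1.prev_ne.symm
  have d12 : c.1.next ≠ c.1.opp := fun h => c.1.next.next_ne (by rw [Germ.next_next, ← h])
  have d13 := c.1.next_ne_prev
  have d23 : c.1.opp ≠ c.1.prev := fun h => c.1.opp.next_ne (by rw [e1, ← h])
  refine Alternating.sum_three_joins (t₀ := t₀) (a := .inr c.1) (b := .inr c.1.next)
    (c := .inr c.1.opp) (d := .inr c.1.prev) strand_strand strand_ne ?_ ⟨?_, ?_, ?_, ?_, hoff _⟩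
    ⟨?_, ?_, ?_, ?_, fun v h1 h2 h3 h4 => hoff _ v h1 h3 h2 h4⟩
    ⟨?_, ?_, ?_, ?_, fun v h1 h2 h3 h4 => hoff _ v h1 h3 h4 h2⟩ ?_ (hinj d01) (hinj d02) (hinj d03)
    (hinj d12) (hinj d13) (hinj d23)
  · rintro (p | g)
    · simp [ht₀, StrandCount.flip_flip]
    · by_cases h : D.crossingOf g = c
      · simp [ht₀, h]
      · simp [ht₀, h, crossingOf_smooth]
  · exact congrArg Sum.inr (smooth_next (hat _ _ n0) (by simp [t0]))
  · exact congrArg Sum.inr ((smooth_prev (hat _ _ n1) (by simp [t1])).trans e4)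
  · exact congrArg Sum.inr ((smooth_next (hat _ _ n2) (by simp [t2])).trans e1)
  · exact congrArg Sum.inr ((smooth_prev (hat _ _ n3) (by simp [t3])).trans (Germ.prev_prev _))
  · exact congrArg Sum.inr (smooth_none (hat _ _ n0))
  · exact congrArg Sum.inr ((smooth_none (hat _ _ n2)).trans (Germ.opp_opp _))
  · exact congrArg Sum.inr ((smooth_none (hat _ _ n1)).trans (Germ.next_opp _))
  · refine congrArg Sum.inr ((smooth_none (hat _ _ n3)).trans ?_)
    rw [← Germ.next_opp, Germ.opp_opp]
  · exact congrArg Sum.inr (smooth_prev (hat _ _ n0) (by simp [t0]))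
  · exact congrArg Sum.inr ((smooth_next (hat _ _ n3) (by simp [t3])).trans e2)
  · exact congrArg Sum.inr ((smooth_next (hat _ _ n1) (by simp [t1])).trans (Germ.next_next _))
  · exact congrArg Sum.inr ((smooth_prev (hat _ _ n2) (by simp [t2])).trans e3)
  · rintro (p | g)
    · simp [ht₀, D.count.flip_ne p]
    · simp only [ht₀, Sum.inr.injEq, ← hgerm]
      by_cases h : D.crossingOf g = c
      · simp [h]
      · simp [h, smooth_ne]

open Classical in
-- Reversing one marker is an involution of the set of states, so each state is counted twice.
theorem sum_flip_marker (c : D.Crossing) (f : D.State → ℤ) :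
    ∑ σ : D.State, (f (Function.update σ c true) + f (Function.update σ c false)) =
      2 * ∑ σ : D.State, f σ := by
  have h : ∑ σ : D.State, f (Function.update σ c (!σ c)) = ∑ σ : D.State, f σ := by
    refine Function.Involutive.bijective (fun σ => ?_) |>.sum_comp f
    simp
  have h2 : ∀ σ : D.State, f (Function.update σ c true) + f (Function.update σ c false) =
      f σ + f (Function.update σ c (!σ c)) := fun σ => by
    cases hσ : σ c with
    | true =>
      rw [Bool.not_true, ← hσ, Function.update_eq_self]
    | false =>
      rw [Bool.not_false, ← hσ, Function.update_eq_self, add_comm]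
  rw [Finset.sum_congr rfl fun σ _ => h2 σ, Finset.sum_add_distrib, h, two_mul]

open Classical in
/-- Resolving all crossings at the trivial character. -/
theorem sum_states (D : Layered F) : (-2 : ℤ) ^ numCircles (D := D) (fun _ => none) =
    (-1) ^ Fintype.card D.Crossing * ∑ σ : D.State, (-2) ^ Nat.card (D.Component σ) := by
  -- Only the crossings in `U` are smoothed. The sum in `key` still runs over all states, so markers
  -- outside `U` are counted redundantly. This is why a power of two is carried along and cancelled
  -- at the end.
  set τ : Finset D.Crossing → D.State → D.Crossing → Option Bool :=
    fun U σ c => if c ∈ U then some (σ c) else none with hτ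
  have key : ∀ U : Finset D.Crossing, (2 : ℤ) ^ Fintype.card D.Crossing *
      (-2) ^ numCircles (D := D) (fun _ => none) =
        (-2) ^ U.card * ∑ σ : D.State, (-2) ^ numCircles (τ U σ) := by
    intro U
    induction U using Finset.induction with
    | empty =>
      have : ∀ σ : D.State, τ ∅ σ = fun _ => none := fun σ => by
        funext c
        exact if_neg (Finset.notMem_empty c)
      have hcard : Finset.card (Finset.univ : Finset D.State) = 2 ^ Fintype.card D.Crossing := by
        rw [Finset.card_univ, ← Nat.card_eq_fintype_card, Nat.card_fun, Nat.card_eq_fintype_card,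
          Nat.card_eq_fintype_card, Fintype.card_bool]
      simp only [this, Finset.sum_const, hcard, Finset.card_empty, pow_zero, one_mul, nsmul_eq_mul]
      push_cast
      rfl
    | insert c U hc ih =>
      rw [ih, Finset.card_insert_of_notMem hc, pow_succ, mul_assoc]
      congr 1
      have h1 : ∀ σ : D.State, (-2 : ℤ) ^ numCircles (τ U σ) =
          -((-2) ^ numCircles (τ (insert c U) (Function.update σ c true)) +
            (-2) ^ numCircles (τ (insert c U) (Function.update σ c false))) := by
        intro σ
        have hn : τ U σ = Function.update (τ U σ) c none := by
          rw [Function.eq_update_iff]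
          exact ⟨if_neg hc, fun _ _ => rfl⟩
        have hb : ∀ b, Function.update (τ U σ) c (some b) =
            τ (insert c U) (Function.update σ c b) := by
          intro b
          funext x
          by_cases hx : x = c
          · rw [hx, Function.update_self]
            simp [hτ]
          · rw [Function.update_of_ne hx]
            simp [hτ, hx]
        have := sum_update (τ U σ) c
        rw [hb, hb, ← hn] at this
        linarith
      rw [Finset.sum_congr rfl fun σ _ => h1 σ, Finset.sum_neg_distrib,
        sum_flip_marker c fun σ => (-2) ^ numCircles (τ (insert c U) σ)]
      ring
  have h := key Finset.univ
  have hfull : ∀ σ : D.State, τ Finset.univ σ = σ.full := fun σ => by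
    funext c
    exact if_pos (Finset.mem_univ c)
  simp only [hfull, Finset.card_univ, ← card_component] at h
  have h2 : (-2 : ℤ) ^ Fintype.card D.Crossing =
      2 ^ Fintype.card D.Crossing * (-1) ^ Fintype.card D.Crossing := by
    rw [← mul_pow]
    norm_num
  rw [h2, mul_assoc] at h
  exact mul_left_cancel₀ (pow_ne_zero _ two_ne_zero) h

end Layered

/-! ## Unresolved diagrams -/

namespace Layered

variable {F : PolygonSurface} {D : Layered F}

/-- The boundary point to which a vertex points. -/
def direction : D.Vertex → D.Point
  | .inl p => p
  | .inr g => g.1.1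

/-- Without smoothing one passes straight through each crossing, so a germ belongs to the component
of the boundary point to which it points. -/
theorem alternating_direction (v : D.Vertex) :
    Alternating D.strand (outerTurn fun _ => none) v (.inl (direction v)) := by
  rcases v with p | g
  · exact .refl _
  · induction g using D.wellFounded_nearer.induction with
    | _ g ih =>
      have hs := strandAdj_strand (.inr g : D.Vertex)
      have h1 := Alternating.left (s := D.strand) (t := outerTurn fun _ => none) (.inr g : D.Vertex)
      generalize D.strand (.inr g) = v at hs h1
      cases hs with
      | last _ hn => exact h1
      | segment _ l hl hn =>
        have h2 := Alternating.right (s := D.strand) (t := outerTurn fun _ => none)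
          (.inr l.opp : D.Vertex)
        have h3 : outerTurn (fun _ => none) (.inr l.opp : D.Vertex) = .inr l := by
          rw [outerTurn, smooth_none rfl, Germ.opp_opp]
        rw [h3] at h2
        have h4 := ih l hl
        have h5 : direction (.inr l : D.Vertex) = direction (.inr g) := hl.1
        rw [h5] at h4
        exact (h1.trans h2).trans h4

theorem alternating_chord (p : D.Point) :
    Alternating D.strand (outerTurn fun _ => none) (.inl p : D.Vertex) (.inl (D.chord p)) := by
  by_cases h : ∃ g : D.Germ, g.1.1 = p
  · obtain ⟨g, rfl⟩ := h
    have h1 := alternating_direction (.inr g : D.Vertex)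
    have h2 := alternating_direction (.inr g.opp : D.Vertex)
    have h3 := Alternating.right (s := D.strand) (t := outerTurn fun _ => none)
      (.inr g : D.Vertex)
    have h4 : outerTurn (fun _ => none) (.inr g : D.Vertex) = .inr g.opp := by
      rw [outerTurn, smooth_none rfl]
    rw [h4] at h3
    exact (h1.symm.trans h3).trans h2
  · push Not at h
    have := strandAdj_iff.1 (StrandAdj.bare p h)
    rw [← this]
    exact .left _

theorem linked_direction_strand (v : D.Vertex) :
    D.Linked (direction v) (direction (D.strand v)) := by
  have hs := strandAdj_strand v
  generalize D.strand v = w at hs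
  cases hs with
  | bare p h => exact .left p
  | first g h => exact .refl _
  | last g h => exact .refl _
  | segment g l hl hn =>
    change D.Linked g.1.1 (D.chord l.1.1)
    rw [hl.1]
    exact .left _

theorem linked_direction_turn (v : D.Vertex) :
    D.Linked (direction v) (direction (outerTurn (fun _ => none) v)) := by
  rcases v with p | g
  · exact .right p
  · rw [outerTurn, smooth_none rfl]
    exact .left g.1.1

/-- The components of a diagram, seen as a diagram without smoothed crossings. -/
theorem numCircles_none (D : Layered F) : numCircles (D := D) (fun _ => none) = D.numComp := by
  refine (Nat.card_eq_of_bijective (fun c : D.Comp => Quotient.lift (s := D.linkedSetoid)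
    (fun p => (Quotient.mk (Alternating.setoid D.strand (outerTurn fun _ => none)) (.inl p)))
    (fun p q h => ?_) c) ⟨?_, ?_⟩).symm
  · exact Alternating.map_eq
      (f := fun p => Quotient.mk (Alternating.setoid D.strand (outerTurn fun _ => none)) (.inl p))
      (fun v => (Quotient.sound (alternating_chord v)).symm)
      (fun v => (Quotient.sound (s := Alternating.setoid D.strand (outerTurn fun _ => none))
        (Alternating.right (Sum.inl v))).symm) h
  · intro a b
    induction a using Quotient.inductionOn with | _ a
    induction b using Quotient.inductionOn with | _ b
    intro h
    have h : Alternating D.strand (outerTurn fun _ => none) (.inl a : D.Vertex) (.inl b) :=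
      Quotient.exact h
    exact h.map_eq (f := fun v => (Quotient.mk D.linkedSetoid (direction v)))
      (fun v => (Quotient.sound (s := D.linkedSetoid) (linked_direction_strand v)).symm)
      (fun v => (Quotient.sound (s := D.linkedSetoid) (linked_direction_turn v)).symm)
  · intro c
    induction c using Quotient.inductionOn with | _ v
    exact ⟨Quotient.mk _ (direction v), (Quotient.sound
      (s := Alternating.setoid D.strand (outerTurn fun _ => none)) (alternating_direction v)).symm⟩

end Layered

namespace ChordDiagram

variable {F : PolygonSurface} {D K : ChordDiagram F}

theorem linked_iff_of_isSubEmb {e : K.Point → D.Point} (he : K.IsSubEmb D e) (p q : K.Point) :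
    D.Linked (e p) (e q) ↔ K.Linked p q := by
  constructor
  · intro h
    set f : D.Point → Prop := fun z => ∃ x, e x = z ∧ K.Linked p x with hf
    have h1 : ∀ z, f z → f (D.chord z) := by
      rintro _ ⟨x, rfl, hx⟩
      exact ⟨_, he.2 x, hx.trans (.left x)⟩
    have h2 : ∀ z, f z → f (D.count.flip z) := by
      rintro _ ⟨x, rfl, hx⟩
      exact ⟨_, he.1.2.2 x, hx.trans (.right x)⟩
    have := h.map_eq (f := f)
      (fun v => propext ⟨fun h => by simpa [D.chord_chord] using h1 _ h, h1 v⟩)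
      (fun v => propext ⟨fun h => by simpa [StrandCount.flip_flip] using h2 _ h, h2 v⟩)
    obtain ⟨x, hx, hl⟩ := (iff_of_eq this).1 ⟨p, rfl, .refl _⟩
    rwa [← he.1.injective hx]
  · intro h
    have := h.map_eq (f := fun x => Quotient.mk D.linkedSetoid (e x))
      (fun v => by rw [he.2]; exact (Quotient.sound (s := D.linkedSetoid) (.left _)).symm)
      (fun v => by rw [he.1.2.2]; exact (Quotient.sound (s := D.linkedSetoid) (.right _)).symm)
    exact Quotient.exact this

end ChordDiagram

namespace Layered

variable {F : PolygonSurface} {D : Layered F}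

theorem IsOverlay.numComp_eq {A B : CurveSystem F} (h : D.IsOverlay A B) :
    D.numComp = A.numComp + B.numComp := by
  obtain ⟨a, b, ha, hb, hra, hrb⟩ := h
  have hta : ∀ x, D.top (a x) := fun x => by
    have : a x ∈ Set.range a := ⟨x, rfl⟩
    rwa [hra] at this
  have htb : ∀ x, ¬ D.top (b x) := fun x => by
    have : b x ∈ Set.range b := ⟨x, rfl⟩
    rwa [hrb] at this
  have htop : ∀ p q, D.Linked p q → (D.top p ↔ D.top q) := fun p q h =>
    iff_of_eq (h.map_eq (f := D.top) (fun v => propext (D.top_chord v))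
      fun v => propext (D.top_flip v))
  unfold ChordDiagram.numComp
  rw [← Nat.card_sum]
  refine (Nat.card_eq_of_bijective (Sum.elim
    (fun c : A.Comp => Quotient.lift (s := A.linkedSetoid) (fun p => Quotient.mk D.linkedSetoid (a p))
      (fun p q h => Quotient.sound (s := D.linkedSetoid) ((ChordDiagram.linked_iff_of_isSubEmb ha p q).2 h)) c)
    (fun c : B.Comp => Quotient.lift (s := B.linkedSetoid) (fun p => Quotient.mk D.linkedSetoid (b p))
      (fun p q h => Quotient.sound (s := D.linkedSetoid) ((ChordDiagram.linked_iff_of_isSubEmb hb p q).2 h)) c))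
    ⟨?_, ?_⟩).symm
  · rintro (x | x) (y | y) h <;> induction x using Quotient.inductionOn with | _ x <;>
      induction y using Quotient.inductionOn with | _ y
    · exact congrArg Sum.inl (Quotient.sound ((ChordDiagram.linked_iff_of_isSubEmb ha x y).1 (Quotient.exact h)))
    · exact absurd ((htop _ _ (Quotient.exact h)).1 (hta x)) (htb y)
    · exact absurd ((htop _ _ (Quotient.exact h)).2 (hta y)) (htb x)
    · exact congrArg Sum.inr (Quotient.sound ((ChordDiagram.linked_iff_of_isSubEmb hb x y).1 (Quotient.exact h)))
  · intro c
    induction c using Quotient.inductionOn with | _ p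
    by_cases hp : D.top p
    · have : p ∈ Set.range a := by rw [hra]; exact hp
      obtain ⟨x, rfl⟩ := this
      exact ⟨.inl (Quotient.mk _ x), rfl⟩
    · have : p ∈ Set.range b := by rw [hrb]; exact hp
      obtain ⟨x, rfl⟩ := this
      exact ⟨.inr (Quotient.mk _ x), rfl⟩

end Layered

/-! ## Superposition of curves -/

namespace StrandCount

variable {F : PolygonSurface}

/-- The points of two curves which are superimposed. -/
def add (m m' : StrandCount F) : StrandCount F where
  num s := m.num s + m'.num s
  num_glue s := by rw [m.num_glue, m'.num_glue]

/-- The points of the curve which comes first on one of any two glued sides. -/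
def addLeft (m m' : StrandCount F) (p : m.Point) : (m.add m').Point :=
  ⟨p.1, ⟨if p.1 < F.glue p.1 then p.2.val else m'.num p.1 + p.2.val, by
    have := p.2.isLt
    change _ < m.num p.1 + m'.num p.1
    split_ifs <;> omega⟩⟩

/-- The points of the curve which comes last on one of any two glued sides. -/
def addRight (m m' : StrandCount F) (p : m'.Point) : (m.add m').Point :=
  ⟨p.1, ⟨if p.1 < F.glue p.1 then m.num p.1 + p.2.val else p.2.val, by
    have := p.2.isLt
    change _ < m.num p.1 + m'.num p.1
    split_ifs <;> omega⟩⟩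

theorem isEmb_of_side {m m' : StrandCount F} {e : m.Point → m'.Point} (h1 : ∀ p, (e p).1 = p.1)
    (h2 : ∀ p q : m.Point, p.1 = q.1 → p.2.val < q.2.val → (e p).2.val < (e q).2.val)
    (h3 : ∀ p, (e (m.flip p)).2.val = (m'.flip (e p)).2.val) : m.IsEmb m' e := by
  refine ⟨fun p q h => ?_, h1, fun p => ?_⟩
  · rcases h with h | ⟨h, h'⟩
    · exact Or.inl (by rwa [h1, h1])
    · exact Or.inr ⟨by rw [h1, h1, h], h2 p q h h'⟩
  · exact Curves.eq_of_side m' (by rw [h1, flip_fst, flip_fst, h1]) (h3 p)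

theorem glue_lt_iff (s : Fin F.sides) : F.glue s < F.glue (F.glue s) ↔ ¬ s < F.glue s := by
  rw [F.glue_glue]
  have := F.glue_ne s
  rw [not_lt]
  exact ⟨le_of_lt, fun h => lt_of_le_of_ne h this⟩

theorem isEmb_addLeft (m m' : StrandCount F) : m.IsEmb (m.add m') (m.addLeft m') := by
  refine isEmb_of_side (fun p => rfl) (fun p q h h' => ?_) (fun p => ?_)
  · simp only [addLeft, h]
    split_ifs <;> omega
  · have h1 := p.2.isLt
    have h2 := m'.num_glue p.1
    rw [flip_snd_val]
    simp only [addLeft, flip_fst, glue_lt_iff]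
    rw [flip_snd_val]
    simp only [add]
    split_ifs <;> omega

theorem isEmb_addRight (m m' : StrandCount F) : m'.IsEmb (m.add m') (m.addRight m') := by
  refine isEmb_of_side (fun p => rfl) (fun p q h h' => ?_) (fun p => ?_)
  · simp only [addRight, h]
    split_ifs <;> omega
  · have h1 := p.2.isLt
    have h2 := m.num_glue p.1
    rw [flip_snd_val]
    simp only [addRight, flip_fst, glue_lt_iff]
    rw [flip_snd_val]
    simp only [add]
    split_ifs <;> omega

theorem bijective_add (m m' : StrandCount F) :
    Function.Bijective (Sum.elim (m.addLeft m') (m.addRight m')) := by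
  constructor
  · have hne : ∀ x y, m.addLeft m' x ≠ m.addRight m' y := by
      rintro ⟨s, i⟩ ⟨t, j⟩ h
      obtain rfl : s = t := congrArg Sigma.fst h
      simp only [addLeft, addRight, Sigma.mk.injEq, heq_eq_eq, true_and, Fin.mk.injEq] at h
      split_ifs at h <;> omega
    rintro (x | x) (y | y) h
    · exact congrArg Sum.inl ((isEmb_addLeft m m').injective h)
    · exact absurd h (hne x y)
    · exact absurd h.symm (hne y x)
    · exact congrArg Sum.inr ((isEmb_addRight m m').injective h)
  · rintro ⟨s, i⟩
    have hi : i.val < m.num s + m'.num s := i.isLt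
    by_cases hs : s < F.glue s
    · by_cases h : i.val < m.num s
      · refine ⟨.inl ⟨s, ⟨i.val, h⟩⟩, Curves.eq_of_side _ rfl ?_⟩
        simp [addLeft, hs]
      · refine ⟨.inr ⟨s, ⟨i.val - m.num s, by omega⟩⟩, Curves.eq_of_side _ rfl ?_⟩
        simp only [Sum.elim_inr, addRight, hs, if_true]
        omega
    · by_cases h : i.val < m'.num s
      · refine ⟨.inr ⟨s, ⟨i.val, h⟩⟩, Curves.eq_of_side _ rfl ?_⟩
        simp [addRight, hs]
      · refine ⟨.inl ⟨s, ⟨i.val - m'.num s, by omega⟩⟩, Curves.eq_of_side _ rfl ?_⟩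
        simp only [Sum.elim_inl, addLeft, hs, if_false]
        omega

end StrandCount

namespace Layered

variable {F : PolygonSurface}

/-- Any two curve systems can be superimposed. -/
theorem exists_isOverlay (A B : CurveSystem F) : ∃ D : Layered F, D.IsOverlay A B := by
  have hL := StrandCount.isEmb_addLeft A.count B.count
  have hR := StrandCount.isEmb_addRight A.count B.count
  set E : A.Point ⊕ B.Point ≃ (A.count.add B.count).Point :=
    Equiv.ofBijective _ (StrandCount.bijective_add A.count B.count) with hE
  have hEl : ∀ x, E (.inl x) = A.count.addLeft B.count x := fun x => rfl
  have hEr : ∀ x, E (.inr x) = A.count.addRight B.count x := fun x => rfl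
  have hflip : ∀ z, E.symm ((A.count.add B.count).flip (E z)) = Sum.map A.count.flip B.count.flip z := by
    rintro (x | x)
    · rw [Equiv.symm_apply_eq, hEl, Sum.map_inl, hEl, hL.2.2]
    · rw [Equiv.symm_apply_eq, hEr, Sum.map_inr, hEr, hR.2.2]
  refine ⟨{ count := A.count.add B.count
            chord := fun p => E (Sum.map A.chord B.chord (E.symm p))
            chord_chord := fun p => ?_
            chord_ne := fun p => ?_
            top := fun p => (E.symm p).isLeft = true
            top_chord := fun p => ?_
            top_flip := fun p => ?_
            noncrossing := fun p q h hc => ?_ },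
    A.count.addLeft B.count, A.count.addRight B.count, ⟨hL, fun p => ?_⟩, ⟨hR, fun p => ?_⟩, ?_, ?_⟩
  · rw [Equiv.symm_apply_apply, Sum.map_map, ← E.apply_symm_apply p, Equiv.symm_apply_apply]
    rcases E.symm p with x | x
    · simp [A.chord_chord]
    · simp [B.chord_chord]
  · rw [Ne, ← E.eq_symm_apply]
    rcases E.symm p with x | x
    · simpa using A.chord_ne x
    · simpa using B.chord_ne x
  · rw [Equiv.symm_apply_apply]
    rcases E.symm p with x | x <;> simp
  · obtain ⟨z, rfl⟩ := E.surjective p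
    rw [hflip, Equiv.symm_apply_apply]
    rcases z with x | x <;> simp
  · obtain ⟨z, rfl⟩ := E.surjective p
    obtain ⟨w, rfl⟩ := E.surjective q
    unfold ChordDiagram.Cross at hc
    simp only [Equiv.symm_apply_apply] at h hc
    rcases z with x | x <;> rcases w with y | y
    · simp only [Sum.map_inl, hEl, hL.cyc_iff] at hc
      exact A.noncrossing x y hc
    · simp at h
    · simp at h
    · simp only [Sum.map_inr, hEr, hR.cyc_iff] at hc
      exact B.noncrossing x y hc
  · change _ = E (Sum.map A.chord B.chord (E.symm (E (.inl p))))
    rw [Equiv.symm_apply_apply]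
    rfl
  · change _ = E (Sum.map A.chord B.chord (E.symm (E (.inr p))))
    rw [Equiv.symm_apply_apply]
    rfl
  · ext p
    obtain ⟨z, rfl⟩ := E.surjective p
    simp only [Set.mem_range, Set.mem_setOf_eq, Equiv.symm_apply_apply, ← hEl, E.injective.eq_iff]
    rcases z with x | x <;> simp
  · ext p
    obtain ⟨z, rfl⟩ := E.surjective p
    simp only [Set.mem_range, Set.mem_setOf_eq, Equiv.symm_apply_apply, ← hEr, E.injective.eq_iff]
    rcases z with x | x <;> simp

end Layered

theorem CurveClass.exists_minimal {F : PolygonSurface} (α : CurveClass F) :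
    ∃ A : CurveSystem F, Quotient.mk (CurveSystem.isotopy F) A = α ∧
      ∀ A' : CurveSystem F, Quotient.mk (CurveSystem.isotopy F) A' = α → A.size ≤ A'.size := by
  classical
  have hex : ∃ n : ℕ, ∃ A : CurveSystem F,
      Quotient.mk (CurveSystem.isotopy F) A = α ∧ A.size = n := by
    obtain ⟨A, hA⟩ := Quotient.exists_rep α
    exact ⟨A.size, A, hA, rfl⟩
  obtain ⟨A, hA, hn⟩ := Nat.find_spec hex
  exact ⟨A, hA, fun A' hA' => hn ▸ Nat.find_min' hex ⟨A', hA', rfl⟩⟩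

/-- Product diagrams exist, so the default value is not taken. One diagram serves for all `j`, but
it is an arbitrary one; later computations therefore have to cover all superpositions of shortest
representatives. -/
theorem exists_starCoeff (k : Type*) [CommRing k] [Algebra ℚ k] {F : PolygonSurface}
    (α β : CurveClass F) : ∃ D : Layered F, IsProductDiagram α β D ∧
      ∀ j, starCoeff k j α β = D.bracket k j := by
  have h : ∃ D : Layered F, IsProductDiagram α β D := by
    obtain ⟨A, hA, hA'⟩ := α.exists_minimal
    obtain ⟨B, hB, hB'⟩ := β.exists_minimal
    obtain ⟨D, hD⟩ := Layered.exists_isOverlay A B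
    exact ⟨D, A, B, hA, hB, hA', hB', hD⟩
  exact ⟨h.choose, h.choose_spec, fun j => dif_pos h⟩

/-! ## Coefficients of the bracket -/

section Coefficients

variable (k : Type*) [CommRing k] [Algebra ℚ k]

theorem coeff_one_mul_series (f g : k⟦X⟧) : PowerSeries.coeff 1 (f * g) =
    PowerSeries.coeff 0 f * PowerSeries.coeff 1 g + PowerSeries.coeff 1 f * PowerSeries.coeff 0 g := by
  rw [PowerSeries.coeff_mul, Finset.Nat.antidiagonal_succ]
  simp

theorem coeff_two_mul_series (f g : k⟦X⟧) : PowerSeries.coeff 2 (f * g) =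
    PowerSeries.coeff 0 f * PowerSeries.coeff 2 g + PowerSeries.coeff 1 f * PowerSeries.coeff 1 g +
      PowerSeries.coeff 2 f * PowerSeries.coeff 0 g := by
  rw [PowerSeries.coeff_mul, Finset.Nat.sum_antidiagonal_eq_sum_range_succ
    (fun i j => PowerSeries.coeff i f * PowerSeries.coeff j g), Finset.sum_range_succ,
    Finset.sum_range_succ, Finset.sum_range_one]

theorem coeff_zero_mul_series (f g : k⟦X⟧) : PowerSeries.coeff 0 (f * g) =
    PowerSeries.coeff 0 f * PowerSeries.coeff 0 g := by
  simp

/-- One half. -/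
noncomputable abbrev oneHalf : k := algebraMap ℚ k (1 / 2)

theorem two_mul_oneHalf : 2 * oneHalf k = 1 := by
  rw [oneHalf, ← map_ofNat (algebraMap ℚ k) 2, ← map_mul, mul_one_div_cancel two_ne_zero, map_one]

theorem coeff_tSeries : PowerSeries.coeff 0 (tSeries k) = 1 ∧ PowerSeries.coeff 1 (tSeries k) = 1 ∧
    PowerSeries.coeff 2 (tSeries k) = oneHalf k := by
  simp [tSeries, PowerSeries.coeff_exp, oneHalf]

theorem coeff_tInvSeries : PowerSeries.coeff 0 (tInvSeries k) = 1 ∧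
    PowerSeries.coeff 1 (tInvSeries k) = -1 ∧ PowerSeries.coeff 2 (tInvSeries k) = oneHalf k := by
  simp [tInvSeries, PowerSeries.evalNegHom, PowerSeries.coeff_exp, PowerSeries.coeff_rescale,
    oneHalf]

/-- Up to degree two, `f` is `-exp(e h)` with `e = ±1`, so its powers are those of `(-1)^n exp(n e
h)`. This treats `-t` and `-t⁻¹` together. -/
theorem coeff_pow_series {f : k⟦X⟧} {e : k} (he : e * e = 1) (h0 : PowerSeries.coeff 0 f = -1)
    (h1 : PowerSeries.coeff 1 f = -e) (h2 : PowerSeries.coeff 2 f = -oneHalf k) (n : ℕ) :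
    PowerSeries.coeff 0 (f ^ n) = (-1) ^ n ∧ PowerSeries.coeff 1 (f ^ n) = (-1) ^ n * (n * e) ∧
      PowerSeries.coeff 2 (f ^ n) = (-1) ^ n * (n ^ 2 * oneHalf k) := by
  induction n with
  | zero => simp [PowerSeries.coeff_one]
  | succ n ih =>
    obtain ⟨i0, i1, i2⟩ := ih
    have hh := two_mul_oneHalf k
    rw [pow_succ, coeff_zero_mul_series, coeff_one_mul_series, coeff_two_mul_series, i0, i1, i2, h0,
      h1, h2]
    push_cast
    refine ⟨by ring, by ring, ?_⟩
    linear_combination (-1 : k) ^ n * n * (hh - he)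

/-- The loop value is `-2 - 4h²` up to higher order, and `(-2)^i (1 + 2h²)^i` has the coefficient
`2i (-2)^i` in degree two. -/
theorem coeff_loopSeries_pow (i : ℕ) : PowerSeries.coeff 0 (loopSeries k ^ i) = (-2) ^ i ∧
    PowerSeries.coeff 1 (loopSeries k ^ i) = 0 ∧
    PowerSeries.coeff 2 (loopSeries k ^ i) = 2 * i * (-2) ^ i := by
  obtain ⟨a0, a1, a2⟩ := coeff_tSeries k
  obtain ⟨b0, b1, b2⟩ := coeff_tInvSeries k
  have hh := two_mul_oneHalf k
  have c0 : PowerSeries.coeff 0 (loopSeries k) = -2 := by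
    rw [loopSeries, map_sub, map_neg, pow_two, pow_two, coeff_zero_mul_series, coeff_zero_mul_series,
      a0, b0]
    ring
  have c1 : PowerSeries.coeff 1 (loopSeries k) = 0 := by
    rw [loopSeries, map_sub, map_neg, pow_two, pow_two, coeff_one_mul_series, coeff_one_mul_series,
      a0, b0, a1, b1]
    ring
  have c2 : PowerSeries.coeff 2 (loopSeries k) = -4 := by
    rw [loopSeries, map_sub, map_neg, pow_two, pow_two, coeff_two_mul_series, coeff_two_mul_series,
      a0, b0, a1, b1, a2, b2]
    linear_combination (-2 : k) * hh
  induction i with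
  | zero => simp [PowerSeries.coeff_one]
  | succ i ih =>
    obtain ⟨i0, i1, i2⟩ := ih
    rw [pow_succ, coeff_zero_mul_series, coeff_one_mul_series, coeff_two_mul_series, i0, i1, i2, c0,
      c1, c2]
    push_cast
    exact ⟨by ring, by ring, by ring⟩

theorem loopCoeff_zero (i : ℕ) : loopCoeff k 0 i = (-2) ^ i := (coeff_loopSeries_pow k i).1

theorem loopCoeff_one (i : ℕ) : loopCoeff k 1 i = 2 * i * (-2) ^ i := (coeff_loopSeries_pow k i).2.2

/-- The factor of the markers is `(-1)^(z+i) exp((z-i)h)`, and the loop factor has no term of degree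
one, so no mixed term appears. -/
theorem coeff_state (z i m : ℕ) :
    PowerSeries.coeff 0 ((-tSeries k) ^ z * (-tInvSeries k) ^ i * loopSeries k ^ m) =
      (-1) ^ (z + i) * loopCoeff k 0 m ∧
    PowerSeries.coeff 2 ((-tSeries k) ^ z * (-tInvSeries k) ^ i * loopSeries k ^ m) =
      (-1) ^ (z + i) * (((z : k) - i) ^ 2 * oneHalf k * loopCoeff k 0 m + loopCoeff k 1 m) := by
  obtain ⟨a0, a1, a2⟩ := coeff_tSeries k
  obtain ⟨b0, b1, b2⟩ := coeff_tInvSeries k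
  obtain ⟨p0, p1, p2⟩ := coeff_pow_series k (f := -tSeries k) (e := 1) (by ring)
    (by rw [map_neg, a0]) (by rw [map_neg, a1]) (by rw [map_neg, a2]) z
  obtain ⟨q0, q1, q2⟩ := coeff_pow_series k (f := -tInvSeries k) (e := -1) (by ring)
    (by rw [map_neg, b0]) (by rw [map_neg, b1]) (by rw [map_neg, b2]) i
  obtain ⟨r0, r1, r2⟩ := coeff_loopSeries_pow k m
  have hh := two_mul_oneHalf k
  rw [loopCoeff_zero, loopCoeff_one]
  simp only [coeff_zero_mul_series, coeff_one_mul_series, coeff_two_mul_series, p0, p1, p2, q0, q1,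
    q2, r0, r1, r2]
  refine ⟨by ring, ?_⟩
  rw [pow_add]
  linear_combination (-1 : k) ^ z * (-1) ^ i * (-2) ^ m * z * i * hh

end Coefficients

namespace Layered

variable {F : PolygonSurface} (k : Type*) [CommRing k] [Algebra ℚ k]

theorem zeta_add_iota (D : Layered F) (σ : D.State) :
    D.zeta σ + D.iota σ = Fintype.card D.Crossing := by
  have h := Finset.card_filter_add_card_filter_not (s := Finset.univ) fun c => σ c = false
  rw [Finset.card_univ] at h
  rw [← h]
  exact congrArg₂ _ rfl (congrArg Finset.card (Finset.filter_congr fun c _ => by simp))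

/-- The sign of a marker. -/
def markerSign (b : Bool) : k := if b then -1 else 1

theorem neg_one_pow_card (D : Layered F) (σ : D.State) (T : Finset D.Crossing) :
    (-1 : k) ^ (T.filter fun c => σ c = true).card = ∏ c ∈ T, markerSign k (σ c) := by
  simp only [markerSign]
  rw [Finset.prod_ite]
  simp

theorem sum_markerSign (D : Layered F) (σ : D.State) :
    ∑ c, markerSign k (σ c) = (D.zeta σ : k) - D.iota σ := by
  simp only [markerSign, zeta, iota]
  rw [Finset.sum_ite]
  simp
  ring

/-- The second elementary symmetric function of signs. -/
theorem sum_pairs {ι : Type*} [DecidableEq ι] (s : ι → k) (hs : ∀ c, s c * s c = 1) (C : Finset ι) :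
    ∑ T ∈ C.powersetCard 2, ∏ c ∈ T, s c + ∑ _T ∈ C.powersetCard 1, oneHalf k =
      (∑ c ∈ C, s c) ^ 2 * oneHalf k := by
  have hh := two_mul_oneHalf k
  have h1 : ∀ C : Finset ι, ∑ _T ∈ C.powersetCard 1, oneHalf k = C.card * oneHalf k := fun C => by
    rw [Finset.sum_const, Finset.card_powersetCard, Nat.choose_one_right, nsmul_eq_mul]
  rw [h1]
  induction C using Finset.induction with
  | empty =>
    have : Finset.powersetCard 2 (∅ : Finset ι) = ∅ := Finset.powersetCard_eq_empty.2 (by simp)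
    simp [this]
  | insert x C hx ih =>
    have hdisj : Disjoint (Finset.powersetCard 2 C) ((Finset.powersetCard 1 C).image (insert x)) := by
      rw [Finset.disjoint_left]
      intro T hT hT'
      obtain ⟨U, -, rfl⟩ := Finset.mem_image.1 hT'
      exact hx ((Finset.mem_powersetCard.1 hT).1 (Finset.mem_insert_self x U))
    have himg : ∑ T ∈ (Finset.powersetCard 1 C).image (insert x), ∏ c ∈ T, s c =
        s x * ∑ c ∈ C, s c := by
      rw [Finset.powersetCard_one, Finset.map_eq_image, Finset.image_image, Finset.sum_image,
        Finset.mul_sum]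
      · refine Finset.sum_congr rfl fun c hc => ?_
        have : x ∉ ({c} : Finset ι) := fun h => hx (by rw [Finset.mem_singleton.1 h]; exact hc)
        change ∏ c ∈ insert x {c}, s c = _
        rw [Finset.prod_insert this, Finset.prod_singleton]
      · intro a ha b hb hab
        have hab : (insert x {a} : Finset ι) = insert x {b} := hab
        have : a ∈ (insert x {b} : Finset ι) := by rw [← hab]; simp
        rcases Finset.mem_insert.1 this with h | h
        · exact absurd (h ▸ ha) hx
        · exact Finset.mem_singleton.1 h
    rw [Finset.powersetCard_succ_insert hx, Finset.sum_union hdisj, himg, Finset.sum_insert hx,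
      Finset.card_insert_of_notMem hx]
    push_cast
    linear_combination ih - hs x * oneHalf k - (s x * ∑ c ∈ C, s c) * hh

/-- Signs have square one, so the second elementary symmetric function plus half the number of signs
is half the square of their sum. -/
theorem principalTerm_eq (D : Layered F) (C : Finset D.Crossing) : D.principalTerm k C =
    (-1 : k) ^ Fintype.card D.Crossing • ∑ σ : D.State,
      ((∑ c ∈ C, markerSign k (σ c)) ^ 2 * oneHalf k * loopCoeff k 0 (D.mu σ)) •
        D.resolved k σ := by
  classical
  unfold principalTerm
  congr 1
  refine Finset.sum_congr rfl fun σ _ => ?_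
  congr 2
  rw [← sum_pairs k (fun c => markerSign k (σ c)) (fun c => by
    simp only [markerSign]
    split_ifs <;> ring) C]
  congr 1
  exact Finset.sum_congr rfl fun T _ => neg_one_pow_card k D σ T

/-- The second order term of the bracket. -/
theorem bracket_two (D : Layered F) :
    D.bracket k 2 = D.principalTerm k Finset.univ + D.loopTerm k := by
  rw [principalTerm_eq, loopTerm, ← smul_add, ← Finset.sum_add_distrib, bracket, Finset.smul_sum]
  refine Finset.sum_congr rfl fun σ _ => ?_
  rw [(coeff_state k _ _ _).2, zeta_add_iota, sum_markerSign, ← add_smul, smul_smul]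

/-- A third difference of a quadratic function vanishes. -/
theorem sum_subsets_sq (x : Fin 3 → k) :
    ∑ S : Finset (Fin 3), (-1 : k) ^ S.card * (∑ i ∈ S, x i) ^ 2 = 0 := by
  have h : (Finset.univ : Finset (Finset (Fin 3))) =
      {∅, {0}, {1}, {2}, {0, 1}, {0, 2}, {1, 2}, {0, 1, 2}} := by decide
  have hf : ∀ f : Finset (Fin 3) → k, ∑ S, f S = f ∅ + (f {0} + (f {1} + (f {2} + (f {0, 1} +
      (f {0, 2} + (f {1, 2} + f {0, 1, 2})))))) := by
    intro f
    rw [h]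
    repeat rw [Finset.sum_insert (by decide)]
    rw [Finset.sum_singleton]
  have c1 : ∀ a b : Fin 3, a ≠ b → ({a, b} : Finset (Fin 3)).card = 2 := fun a b h =>
    Finset.card_pair h
  have c2 : ({0, 1, 2} : Finset (Fin 3)).card = 3 := by decide
  rw [hf, c1 0 1 (by decide), c1 0 2 (by decide), c1 1 2 (by decide), c2,
    Finset.sum_pair (by decide), Finset.sum_pair (by decide), Finset.sum_pair (by decide),
    Finset.sum_insert (by decide), Finset.sum_pair (by decide)]
  simp only [Finset.card_empty, Finset.card_singleton, Finset.sum_empty, Finset.sum_singleton]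
  ring

/-- The principal term satisfies the commutator condition of order two. -/
theorem sum_principalTerm (D : Layered F) (color : D.Point → Fin 3) :
    ∑ S : Finset (Fin 3), (-1 : k) ^ S.card • D.principalTerm k (D.crossingsOn color S) = 0 := by
  classical
  -- For a fixed state the sum of signs over the crossings with colors in `S` is additive in `S`, so
  -- its square is a quadratic function of the indicator of `S`.
  have hx : ∀ (σ : D.State) (S : Finset (Fin 3)), ∑ c ∈ D.crossingsOn color S, markerSign k (σ c) =
      ∑ i ∈ S, ∑ c : D.Crossing, if color c.1.1.2 = i then markerSign k (σ c) else 0 := by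
    intro σ S
    rw [Finset.sum_comm, crossingsOn, Finset.sum_filter]
    refine Finset.sum_congr rfl fun c _ => ?_
    rw [Finset.sum_ite_eq]
  simp only [principalTerm_eq, hx]
  simp only [smul_comm _ ((-1 : k) ^ Fintype.card D.Crossing), ← Finset.smul_sum]
  simp only [Finset.smul_sum]
  rw [Finset.sum_comm]
  refine Finset.sum_eq_zero fun σ _ => ?_
  simp only [smul_smul, ← Finset.sum_smul]
  have := sum_subsets_sq k fun i => ∑ c : D.Crossing, if color c.1.1.2 = i then markerSign k (σ c) else 0
  rw [show (∑ S : Finset (Fin 3), _) = (-1 : k) ^ Fintype.card D.Crossing * (∑ S : Finset (Fin 3), (-1 : k) ^ S.card * (∑ i ∈ S, ∑ c : D.Crossing, if color c.1.1.2 = i then markerSign k (σ c) else 0) ^ 2) * (oneHalf k * loopCoeff k 0 (D.mu σ)) from ?_, this]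
  · simp
  · rw [Finset.mul_sum, Finset.sum_mul]
    refine Finset.sum_congr rfl fun S _ => ?_
    ring

/-- The sum over the states of the squares of the differences of the numbers of markers, at the
trivial character. -/
noncomputable def signSum (D : Layered F) : ℤ :=
  ∑ σ : D.State, ((D.zeta σ : ℤ) - D.iota σ) ^ 2 * (-2) ^ Nat.card (D.Component σ)

/-- The sum over the states of the numbers of inessential circles, at the trivial character. -/
noncomputable def loopSum (D : Layered F) : ℤ :=
  ∑ σ : D.State, (D.mu σ : ℤ) * (-2) ^ Nat.card (D.Component σ)

theorem trivialCharacter_loopTerm (D : Layered F) : trivialCharacter k F (D.loopTerm k) =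
    (-1) ^ Fintype.card D.Crossing * (2 * (D.loopSum : k)) := by
  rw [loopTerm, map_smul, map_sum, smul_eq_mul, loopSum, Int.cast_sum, Finset.mul_sum (a := 2)]
  congr 1
  refine Finset.sum_congr rfl fun σ _ => ?_
  rw [map_smul, smul_eq_mul, loopCoeff_one, mul_assoc, mul_assoc, trivialCharacter_resolved]
  push_cast
  ring

theorem trivialCharacter_bracket_two (D : Layered F) : trivialCharacter k F (D.bracket k 2) =
    (-1) ^ Fintype.card D.Crossing * (oneHalf k * (D.signSum : k) + 2 * (D.loopSum : k)) := by
  rw [bracket_two, map_add, trivialCharacter_loopTerm, mul_add, principalTerm_eq, map_smul, map_sum,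
    smul_eq_mul, signSum, Int.cast_sum, Finset.mul_sum (a := oneHalf k)]
  congr 2
  refine Finset.sum_congr rfl fun σ _ => ?_
  rw [map_smul, smul_eq_mul, loopCoeff_zero, mul_assoc, trivialCharacter_resolved, sum_markerSign]
  push_cast
  ring

theorem bracket_zero (D : Layered F) : D.bracket k 0 = (-1 : k) ^ Fintype.card D.Crossing •
    ∑ σ : D.State, (-2 : k) ^ D.mu σ • D.resolved k σ := by
  rw [bracket, Finset.smul_sum]
  refine Finset.sum_congr rfl fun σ _ => ?_
  rw [(coeff_state k _ _ _).1, zeta_add_iota, loopCoeff_zero, smul_smul]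

/-- The bracket at `h = 0` is the full resolution by the skein relation, which the character undoes,
leaving the components of the unresolved diagram. -/
theorem trivialCharacter_bracket_zero (D : Layered F) :
    trivialCharacter k F (D.bracket k 0) = (-2) ^ D.numComp := by
  have h := congrArg (Int.cast : ℤ → k) D.sum_states
  rw [numCircles_none] at h
  push_cast at h
  rw [h, bracket_zero, map_smul, map_sum, smul_eq_mul]
  congr 1
  refine Finset.sum_congr rfl fun σ _ => ?_
  rw [map_smul, smul_eq_mul, trivialCharacter_resolved]

end Layered

section Star

variable (k : Type*) [CommRing k] [Algebra ℚ k] {F : PolygonSurface}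

theorem starLambda_single (j : ℕ) (α β : CurveClass F) :
    starLambda k F j (Finsupp.single α 1) (Finsupp.single β 1) = starCoeff k j α β := by
  rw [starLambda, Finsupp.linearCombination_single, one_smul, Finsupp.linearCombination_single,
    one_smul]

/-- The trivial character is multiplicative. -/
theorem trivialCharacter_mul (u v : CurveModule k F) :
    trivialCharacter k F (starLambda k F 0 u v) = trivialCharacter k F u * trivialCharacter k F v := by
  induction u using Finsupp.induction_linear with
  | zero => simp
  | add a b ha hb => rw [map_add, LinearMap.add_apply, map_add, ha, hb, map_add, add_mul]
  | single α a =>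
    induction v using Finsupp.induction_linear with
    | zero => simp
    | add x y hx hy => rw [map_add, map_add, hx, hy, map_add, mul_add]
    | single β b =>
      rw [← Finsupp.smul_single_one α a, ← Finsupp.smul_single_one β b,
        map_smul (starLambda k F 0), LinearMap.smul_apply, map_smul, map_smul, map_smul, map_smul,
        map_smul, starLambda_single]
      obtain ⟨D, ⟨A, B, hA, hB, -, -, hD⟩, h⟩ := exists_starCoeff k α β
      rw [h, Layered.trivialCharacter_bracket_zero, hD.numComp_eq, Layered.trivialCharacter_single,
        Layered.trivialCharacter_single, pow_add, ← hA, ← hB]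
      simp only [smul_eq_mul, CurveClass.numComp, Quotient.lift_mk]
      ring

end Star

/-! ## Computation of the circles of a smoothed diagram -/

/-- Evaluation of a function at a number, in a form in which the number is evaluated first. -/
def forced {α : Type*} (n : ℕ) (f : ℕ → α) : α := Nat.rec (f 0) (fun m _ => f (m + 1)) n

theorem forced_eq {α : Type*} (n : ℕ) (f : ℕ → α) : forced n f = f n := by
  cases n <;> rfl

/-- The list of the values of an alternating walk from `x` to `x₀` with their holonomies, and the
holonomy of the whole walk. -/
def trace {G : Type*} [Group G] (s t : ℕ → ℕ) (w : ℕ → G) (x₀ : ℕ) :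
    ℕ → ℕ → G → List (ℕ × G) × Option G
  -- The number of steps is bounded in advance. An exhausted walk returns `none`, which `check`
  -- rejects, so no bound on the lengths of circles has to be proved.
  | 0, _, _ => ([], none)
  | n + 1, x, g => forced (s x) fun y => forced (t y) fun z =>
      bif z.beq x₀ then ([(x, g), (y, g)], some (w y * g))
      else ((x, g) :: (y, g) :: (trace s t w x₀ n z (w y * g)).1,
        (trace s t w x₀ n z (w y * g)).2)

/-- The set of the visited numbers, as a binary number. -/
def addVisited {G : Type*} (m : ℕ) : List (ℕ × G) → ℕ
  | [] => m
  | e :: l => forced (m ||| 2 ^ e.1) fun m => addVisited m l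

/-- The alternating walks from the given numbers which have not been visited before. -/
def cycles {G : Type*} [Group G] (s t : ℕ → ℕ) (w : ℕ → G) :
    List ℕ → ℕ → List (ℕ × List (ℕ × G) × Option G)
  | [], _ => []
  | x :: l, m => bif m.testBit x then cycles s t w l m
      else (x, trace s t w x 100 x 1) ::
        forced (addVisited m (trace s t w x 100 x 1).1) fun m => cycles s t w l m

theorem testBit_addVisited {G : Type*} (l : List (ℕ × G)) : ∀ (m x : ℕ),
    (addVisited m l).testBit x = true ↔ m.testBit x = true ∨ x ∈ l.map Prod.fst := by
  induction l with
  | nil => simp [addVisited]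
  | cons e l ih =>
    intro m x
    rw [addVisited, forced_eq, ih, Nat.testBit_or, Nat.testBit_two_pow]
    simp only [Bool.or_eq_true, decide_eq_true_eq, List.map_cons, List.mem_cons]
    rw [eq_comm (a := e.1)]
    tauto

section Trace

variable {G : Type*} [Group G] {s t : ℕ → ℕ} {w : ℕ → G} {x₀ : ℕ}

theorem trace_succ (n x : ℕ) (g : G) : trace s t w x₀ (n + 1) x g =
    if t (s x) = x₀ then ([(x, g), (s x, g)], some (w (s x) * g))
    else ((x, g) :: (s x, g) :: (trace s t w x₀ n (t (s x)) (w (s x) * g)).1,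
        (trace s t w x₀ n (t (s x)) (w (s x) * g)).2) := by
  rw [trace, forced_eq, forced_eq]
  by_cases h : t (s x) = x₀
  · rw [if_pos h, h, Nat.beq_refl, cond_true]
  · rw [if_neg h, show Nat.beq (t (s x)) x₀ = false from
      Bool.eq_false_iff.2 fun h' => h (Nat.eq_of_beq_eq_true h'), cond_false]

theorem mem_cycles (l : List ℕ) : ∀ (m : ℕ), ∀ c ∈ cycles s t w l m,
    c.1 ∈ l ∧ c.2 = trace s t w c.1 100 c.1 1 := by
  induction l with
  | nil => simp [cycles]
  | cons x l ih =>
    intro m c hc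
    rw [cycles, forced_eq] at hc
    cases h : m.testBit x
    · rw [h, cond_false, List.mem_cons] at hc
      rcases hc with rfl | hc
      · exact ⟨List.mem_cons_self, rfl⟩
      · exact ⟨List.mem_cons_of_mem _ (ih _ c hc).1, (ih _ c hc).2⟩
    · rw [h, cond_true] at hc
      exact ⟨List.mem_cons_of_mem _ (ih _ c hc).1, (ih _ c hc).2⟩

theorem exists_mem_cycles (l : List ℕ) : ∀ m : ℕ, ∀ x ∈ l, m.testBit x = true ∨
    ∃ c ∈ cycles s t w l m, x = c.1 ∨ x ∈ c.2.1.map Prod.fst := by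
  induction l with
  | nil => simp
  | cons y l ih =>
    intro m x hx
    rw [cycles, forced_eq]
    cases h : m.testBit y
    · rw [cond_false]
      rcases List.mem_cons.1 hx with rfl | hx
      · exact .inr ⟨_, List.mem_cons_self, .inl rfl⟩
      · rcases ih (addVisited m (trace s t w y 100 y 1).1) x hx with h' | ⟨c, hc, hxc⟩
        · rcases (testBit_addVisited _ _ _).1 h' with h' | h'
          · exact .inl h'
          · exact .inr ⟨_, List.mem_cons_self, .inr h'⟩
        · exact .inr ⟨c, List.mem_cons_of_mem _ hc, hxc⟩
    · rw [cond_true]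
      rcases List.mem_cons.1 hx with rfl | hx
      · exact .inl h
      · exact ih m x hx

/-- The walk follows every section over a set of numbers which is closed under the two maps. -/
theorem trace_section {X : Type*} [MulAction G X] {Q : ℕ → Prop} {H : ℕ → X}
    (hs : ∀ x, Q x → Q (s x)) (ht : ∀ x, Q x → Q (t x)) (h1 : ∀ x, Q x → H (s x) = H x)
    (h2 : ∀ x, Q x → H (t x) = w x • H x) (a : X) : ∀ (n x : ℕ) (g : G), Q x → H x = g • a →
    (∀ e ∈ (trace s t w x₀ n x g).1, Q e.1 ∧ H e.1 = e.2 • a) ∧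
      ∀ W ∈ (trace s t w x₀ n x g).2, H x₀ = W • a := by
  intro n
  induction n with
  | zero => intro x g _ _; simp [trace]
  | succ n ih =>
    intro x g hx hg
    have hy : H (s x) = g • a := (h1 x hx).trans hg
    have hz : H (t (s x)) = (w (s x) * g) • a := by rw [h2 _ (hs x hx), hy, mul_smul]
    rw [trace_succ]
    split_ifs with h
    · refine ⟨?_, ?_⟩
      · intro e he
        rcases List.mem_cons.1 he with rfl | he
        · exact ⟨hx, hg⟩
        · rw [List.mem_singleton.1 he]
          exact ⟨hs x hx, hy⟩
      · intro W hW
        rw [← Option.some.inj hW, ← hz, h]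
    · obtain ⟨i1, i2⟩ := ih (t (s x)) (w (s x) * g) (ht _ (hs x hx)) hz
      refine ⟨?_, i2⟩
      intro e he
      rcases List.mem_cons.1 he with rfl | he
      · exact ⟨hx, hg⟩
      · rcases List.mem_cons.1 he with rfl | he
        · exact ⟨hs x hx, hy⟩
        · exact i1 e he

/-- The recorded walk is closed under `s`. It is closed under `t`, with holonomies, except at its
first entry and at the entry from which `t` leads back to `x₀`. Inverse weights at the ends of each
`t`-step allow steps to be read backwards. -/
theorem trace_closed {S : ℕ → Prop} (hs : ∀ x, S x → S (s x)) (ht : ∀ x, S x → S (t x))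
    (hss : ∀ x, S x → s (s x) = x) (htt : ∀ x, S x → t (t x) = x)
    (hw : ∀ x, S x → w (t x) = (w x)⁻¹) : ∀ (n x : ℕ) (g W : G), S x →
    (trace s t w x₀ n x g).2 = some W →
    (x, g) ∈ (trace s t w x₀ n x g).1 ∧
    (∀ e ∈ (trace s t w x₀ n x g).1, S e.1 ∧ (s e.1, e.2) ∈ (trace s t w x₀ n x g).1) ∧
    (∀ e ∈ (trace s t w x₀ n x g).1, (t e.1, w e.1 * e.2) ∈ (trace s t w x₀ n x g).1 ∨
      e = (x, g) ∨ (t e.1 = x₀ ∧ w e.1 * e.2 = W)) ∧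
    ∃ e ∈ (trace s t w x₀ n x g).1, t e.1 = x₀ ∧ w e.1 * e.2 = W := by
  intro n
  induction n with
  | zero => intro x g W _ h; simp [trace] at h
  | succ n ih =>
    intro x g W hx hW
    rw [trace_succ] at hW ⊢
    have hy := hs x hx
    split_ifs at hW ⊢ with h
    · have hW := Option.some.inj hW
      refine ⟨List.mem_cons_self, ?_, ?_, (s x, g), by simp, h, hW⟩
      · intro e he
        rcases List.mem_cons.1 he with rfl | he
        · exact ⟨hx, by simp⟩
        · rw [List.mem_singleton.1 he]
          exact ⟨hy, by simp [hss x hx]⟩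
      · intro e he
        rcases List.mem_cons.1 he with rfl | he
        · exact .inr (.inl rfl)
        · rw [List.mem_singleton.1 he]
          exact .inr (.inr ⟨h, hW⟩)
    · obtain ⟨i1, i2, i3, e₀, he₀, hh⟩ := ih (t (s x)) (w (s x) * g) W (ht _ hy) hW
      refine ⟨List.mem_cons_self, ?_, ?_, e₀,
        List.mem_cons_of_mem _ (List.mem_cons_of_mem _ he₀), hh⟩
      · intro e he
        rcases List.mem_cons.1 he with rfl | he
        · exact ⟨hx, by simp⟩
        · rcases List.mem_cons.1 he with rfl | he
          · exact ⟨hy, by simp [hss x hx]⟩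
          · exact ⟨(i2 e he).1, List.mem_cons_of_mem _ (List.mem_cons_of_mem _ (i2 e he).2)⟩
      · intro e he
        rcases List.mem_cons.1 he with rfl | he
        · exact .inr (.inl rfl)
        · rcases List.mem_cons.1 he with rfl | he
          · exact .inl (List.mem_cons_of_mem _ (List.mem_cons_of_mem _ i1))
          · rcases i3 e he with h' | rfl | h'
            · exact .inl (List.mem_cons_of_mem _ (List.mem_cons_of_mem _ h'))
            · refine .inl (List.mem_cons_of_mem _ ?_)
              simp only [htt _ hy, hw _ hy, inv_mul_cancel_left]
              exact List.mem_cons_self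
            · exact .inr (.inr h')

/-- A closed walk is closed under the two maps, with the holonomy if its own holonomy is trivial. -/
theorem trace_closed_self {S : ℕ → Prop} (hs : ∀ x, S x → S (s x)) (ht : ∀ x, S x → S (t x))
    (hss : ∀ x, S x → s (s x) = x) (htt : ∀ x, S x → t (t x) = x)
    (hw : ∀ x, S x → w (t x) = (w x)⁻¹) {n : ℕ} {W : G} (hx : S x₀)
    (hW : (trace s t w x₀ n x₀ 1).2 = some W) :
    (x₀, 1) ∈ (trace s t w x₀ n x₀ 1).1 ∧
    (∀ e ∈ (trace s t w x₀ n x₀ 1).1, (s e.1, e.2) ∈ (trace s t w x₀ n x₀ 1).1) ∧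
    (∀ e ∈ (trace s t w x₀ n x₀ 1).1, t e.1 ∈ (trace s t w x₀ n x₀ 1).1.map Prod.fst) ∧
    (W = 1 → ∀ e ∈ (trace s t w x₀ n x₀ 1).1,
      (t e.1, w e.1 * e.2) ∈ (trace s t w x₀ n x₀ 1).1) := by
  obtain ⟨h1, h2, h3, e₀, he₀, h4, h5⟩ := trace_closed hs ht hss htt hw n x₀ 1 W hx hW
  have h6 : t x₀ = e₀.1 := by rw [← h4, htt _ (h2 e₀ he₀).1]
  refine ⟨h1, fun e he => (h2 e he).2, fun e he => ?_, fun hW1 e he => ?_⟩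
  · rcases h3 e he with h | rfl | ⟨h, -⟩
    · exact List.mem_map_of_mem (f := Prod.fst) h
    · change t x₀ ∈ _
      rw [h6]
      exact List.mem_map_of_mem (f := Prod.fst) he₀
    · rw [h]
      exact List.mem_map_of_mem (f := Prod.fst) h1
  · rcases h3 e he with h | rfl | ⟨h, h'⟩
    · exact h
    · change (t x₀, w x₀ * 1) ∈ _
      have : w x₀ * 1 = e₀.2 := by
        rw [mul_one, ← h4, hw _ (h2 e₀ he₀).1, inv_eq_of_mul_eq_one_right (h5.trans hW1)]
      rw [this, h6]
      exact he₀
    · rw [h, h', hW1]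
      exact h1

end Trace

/-- A two-layer diagram with numbered vertices and crossings: the passage along the strands and the
passage through sides and crossings for either marker, with the holonomies. -/
structure StateTable (G : Type*) where
  size : ℕ
  numCrossings : ℕ
  strand : ℕ → ℕ
  turnZero : ℕ → ℕ
  turnInfinity : ℕ → ℕ
  crossing : ℕ → ℕ
  weight : ℕ → G

namespace StateTable

variable {G : Type*} [Group G] (M : StateTable G)

def turn (T : List Bool) (x : ℕ) : ℕ :=
  bif T.getD (M.crossing x) false then M.turnInfinity x else M.turnZero x

/-- The circles of a state with their holonomies. -/
def circles (T : List Bool) : List (ℕ × List (ℕ × G) × Option G) :=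
  cycles M.strand (M.turn T) M.weight (List.range M.size) 0

/-- All circles are closed, and they meet each vertex once. -/
def check (T : List Bool) : Bool :=
  (M.circles T).all (fun c => c.2.2.isSome) &&
    ((M.circles T).map fun c : ℕ × List (ℕ × G) × Option G => c.2.1.length).sum.beq M.size

def isFlat [DecidableEq G] (c : ℕ × List (ℕ × G) × Option G) : Bool := decide (c.2.2 = some 1)

/-- The number of flat circles and the number of all circles. -/
def counts [DecidableEq G] (T : List Bool) : ℕ × ℕ :=
  (((M.circles T).filter isFlat).length, (M.circles T).length)

variable {F : PolygonSurface} {D : Layered F}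

/-- The table describes the diagram. -/
structure Models (D : Layered F) (ρ : Holonomy F G) (num : D.Vertex → ℕ)
    (cr : D.Crossing ≃ Fin M.numCrossings) : Prop where
  inj : Function.Injective num
  mem : ∀ x, x < M.size ↔ ∃ v, num v = x
  strand : ∀ v, M.strand (num v) = num (D.strand v)
  flip : ∀ p, M.turnZero (num (.inl p)) = num (.inl (D.count.flip p)) ∧
    M.turnInfinity (num (.inl p)) = num (.inl (D.count.flip p))
  crossing : ∀ g, M.crossing (num (.inr g)) = cr (D.crossingOf g)
  turn_top : ∀ g : D.Germ, D.top g.1.1 → M.turnZero (num (.inr g)) = num (.inr g.prev) ∧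
    M.turnInfinity (num (.inr g)) = num (.inr g.next)
  turn_not_top : ∀ g : D.Germ, ¬ D.top g.1.1 → M.turnZero (num (.inr g)) = num (.inr g.next) ∧
    M.turnInfinity (num (.inr g)) = num (.inr g.prev)
  weight_point : ∀ p, M.weight (num (.inl p)) = ρ.side p.1
  weight_germ : ∀ g, M.weight (num (.inr g)) = 1

/-- The markers of a state in the order of the crossings. -/
def bits {n : ℕ} (cr : D.Crossing ≃ Fin n) (σ : D.State) : List Bool :=
  List.ofFn fun i => σ (cr.symm i)

theorem getD_bits {n : ℕ} (cr : D.Crossing ≃ Fin n) (σ : D.State) (c : D.Crossing) :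
    (bits cr σ).getD (cr c) false = σ c := by
  simp [bits]

namespace Models

variable {M} {ρ : Holonomy F G} {num : D.Vertex → ℕ} {cr : D.Crossing ≃ Fin M.numCrossings}

theorem turn (h : M.Models D ρ num cr) (σ : D.State) (v : D.Vertex) :
    M.turn (bits cr σ) (num v) = num (Layered.outerTurn σ.full v) := by
  unfold StateTable.turn
  rcases v with p | g
  · rw [(h.flip p).1, (h.flip p).2, Bool.cond_self]
    rfl
  · rw [h.crossing, getD_bits]
    have hf : σ.full (D.crossingOf g) = some (σ (D.crossingOf g)) := rfl
    by_cases ht : D.top g.1.1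
    · rw [(h.turn_top g ht).1, (h.turn_top g ht).2]
      cases hb : σ (D.crossingOf g)
      · rw [cond_false, Layered.outerTurn, Layered.smooth_prev hf (by simp [hb, ht])]
      · rw [cond_true, Layered.outerTurn, Layered.smooth_next hf (by simp [hb, ht])]
    · rw [(h.turn_not_top g ht).1, (h.turn_not_top g ht).2]
      cases hb : σ (D.crossingOf g)
      · rw [cond_false, Layered.outerTurn, Layered.smooth_next hf (by simp [hb, ht])]
      · rw [cond_true, Layered.outerTurn, Layered.smooth_prev hf (by simp [hb, ht])]

/-- The numbers of the vertices of a circle. -/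
def On (num : D.Vertex → ℕ) {σ : D.State} (κ : D.Component σ) (x : ℕ) : Prop :=
  ∃ v, num v = x ∧ Quotient.mk (D.componentSetoid σ) v = κ

theorem component_strand (σ : D.State) (v : D.Vertex) :
    Quotient.mk (D.componentSetoid σ) (D.strand v) = Quotient.mk (D.componentSetoid σ) v :=
  Quotient.sound ((Layered.componentSetoid_iff _ _).2 (Alternating.symm (.left v)))

theorem component_outerTurn (σ : D.State) (v : D.Vertex) :
    Quotient.mk (D.componentSetoid σ) (Layered.outerTurn σ.full v) =
      Quotient.mk (D.componentSetoid σ) v :=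
  Quotient.sound ((Layered.componentSetoid_iff _ _).2 (Alternating.symm (.right v)))

theorem on_strand (h : M.Models D ρ num cr) {σ : D.State} {κ : D.Component σ} {x : ℕ}
    (hx : On num κ x) : On num κ (M.strand x) := by
  obtain ⟨v, rfl, hv⟩ := hx
  exact ⟨D.strand v, (h.strand v).symm, (component_strand σ v).trans hv⟩

theorem on_turn (h : M.Models D ρ num cr) {σ : D.State} {κ : D.Component σ} {x : ℕ}
    (hx : On num κ x) : On num κ (M.turn (bits cr σ) x) := by
  obtain ⟨v, rfl, hv⟩ := hx
  exact ⟨_, (h.turn σ v).symm, (component_outerTurn σ v).trans hv⟩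

theorem weight_turn (h : M.Models D ρ num cr) (σ : D.State) (v : D.Vertex) :
    M.weight (M.turn (bits cr σ) (num v)) = (M.weight (num v))⁻¹ := by
  rw [h.turn]
  rcases v with p | g
  · rw [Layered.outerTurn, h.weight_point, h.weight_point, ← ρ.side_glue]
    rfl
  · rw [Layered.outerTurn, h.weight_germ, h.weight_germ, inv_one]

section Circles

variable {σ : D.State}

theorem trace_facts (h : M.Models D ρ num cr) (hc : M.check (bits cr σ) = true)
    {c : ℕ × List (ℕ × G) × Option G} (hm : c ∈ M.circles (bits cr σ)) :
    ∃ W v, c.2.2 = some W ∧ num v = c.1 ∧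
    c.2 = trace M.strand (M.turn (bits cr σ)) M.weight c.1 100 c.1 1 ∧
    (c.1, 1) ∈ c.2.1 ∧ (∀ e ∈ c.2.1, (M.strand e.1, e.2) ∈ c.2.1) ∧
    (∀ e ∈ c.2.1, M.turn (bits cr σ) e.1 ∈ c.2.1.map Prod.fst) ∧
    (W = 1 → ∀ e ∈ c.2.1, (M.turn (bits cr σ) e.1, M.weight e.1 * e.2) ∈ c.2.1) := by
  have h1 := mem_cycles _ _ _ hm
  have hS : c.1 < M.size := List.mem_range.1 h1.1
  have h2 : c.2.2.isSome := by
    unfold check at hc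
    rw [Bool.and_eq_true, List.all_eq_true] at hc
    exact hc.1 c hm
  obtain ⟨W, hW⟩ := Option.isSome_iff_exists.1 h2
  obtain ⟨v, hv⟩ := (h.mem _).1 hS
  refine ⟨W, v, hW, hv, h1.2, ?_⟩
  rw [h1.2] at hW ⊢
  have hex : ∀ {P : ℕ → Prop}, (∀ v, P (num v)) → ∀ x, x < M.size → P x := by
    intro P hP x hx
    obtain ⟨v, rfl⟩ := (h.mem _).1 hx
    exact hP v
  refine trace_closed_self (S := fun x => x < M.size) ?_ ?_ ?_ ?_ ?_ hS hW
  · exact hex fun v => by rw [h.strand]; exact (h.mem _).2 ⟨_, rfl⟩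
  · exact hex fun v => by rw [h.turn]; exact (h.mem _).2 ⟨_, rfl⟩
  · exact hex fun v => by rw [h.strand, h.strand, Layered.strand_strand]
  · exact hex fun v => by rw [h.turn, h.turn, Layered.outerTurn_outerTurn]
  · exact hex fun v => h.weight_turn σ v

/-- The walk cannot leave the circle on which it starts, and being closed under both maps it
exhausts this circle. -/
theorem mem_support_iff (h : M.Models D ρ num cr) (hc : M.check (bits cr σ) = true)
    {c : ℕ × List (ℕ × G) × Option G} (hm : c ∈ M.circles (bits cr σ)) {v₀ : D.Vertex}
    (hv₀ : num v₀ = c.1) (x : ℕ) : x ∈ c.2.1.map Prod.fst ↔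
      On num (Quotient.mk (D.componentSetoid σ) v₀) x := by
  obtain ⟨W, -, -, -, h1, h2, h3, h4, -⟩ := h.trace_facts hc hm
  constructor
  · intro hx
    obtain ⟨e, he, rfl⟩ := List.mem_map.1 hx
    rw [h1] at he
    -- With values in a one-point set, following sections means only that the walk stays on the
    -- circle.
    exact ((trace_section (s := M.strand) (t := M.turn (bits cr σ)) (w := M.weight)
      (Q := On num (Quotient.mk (D.componentSetoid σ) v₀)) (X := PUnit.{1})
      (H := fun _ => PUnit.unit)
      (fun x => h.on_strand) (fun x => h.on_turn) (fun _ _ => rfl) (fun _ _ => rfl)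
      PUnit.unit 100 c.1 1 ⟨v₀, hv₀, rfl⟩ rfl).1 e he).1
  · rintro ⟨v, rfl, hv⟩
    have hcl : ∀ x ∈ c.2.1.map Prod.fst, M.strand x ∈ c.2.1.map Prod.fst ∧
        M.turn (bits cr σ) x ∈ c.2.1.map Prod.fst := by
      intro x hx
      obtain ⟨e, he, rfl⟩ := List.mem_map.1 hx
      exact ⟨List.mem_map_of_mem (f := Prod.fst) (h3 e he), h4 e he⟩
    have := ((Layered.componentSetoid_iff _ _).1 (Quotient.exact hv)).map_eq
      (f := fun v => num v ∈ c.2.1.map Prod.fst)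
      (fun v => propext ⟨fun hx => by
          rw [← Layered.strand_strand v, ← h.strand]; exact (hcl _ hx).1,
        fun hx => by rw [← h.strand]; exact (hcl _ hx).1⟩)
      (fun v => propext ⟨fun hx => by
          rw [← Layered.outerTurn_outerTurn σ.full v, ← h.turn]; exact (hcl _ hx).2,
        fun hx => by rw [← h.turn]; exact (hcl _ hx).2⟩)
    rw [this, hv₀]
    exact List.mem_map_of_mem (f := Prod.fst) h2

/-- Turns the numerical part of `check` into disjointness: walks that cover all vertices and have
the right total length visit each vertex once. -/
theorem nodup_of_length {l : List ℕ} {n : ℕ} (h : ∀ x < n, x ∈ l) (hl : l.length = n) :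
    l.Nodup := by
  have h1 : (List.range n).Subperm l :=
    List.subperm_of_subset List.nodup_range fun x hx => h x (List.mem_range.1 hx)
  exact (h1.perm_of_length_le (by rw [hl, List.length_range])).nodup_iff.1 List.nodup_range

theorem exists_circle (h : M.Models D ρ num cr) (hc : M.check (bits cr σ) = true)
    (x : ℕ) (hx : x < M.size) : ∃ c ∈ M.circles (bits cr σ), x ∈ c.2.1.map Prod.fst := by
  rcases exists_mem_cycles (s := M.strand) (t := M.turn (bits cr σ)) (w := M.weight)
    (List.range M.size) 0 x (List.mem_range.2 hx) with h' | ⟨c, hm, h' | h'⟩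
  · simp at h'
  · obtain ⟨W, v, -, -, -, h2, -⟩ := h.trace_facts hc hm
    exact ⟨c, hm, h' ▸ List.mem_map_of_mem (f := Prod.fst) h2⟩
  · exact ⟨c, hm, h'⟩

theorem nodup_circles (h : M.Models D ρ num cr) (hc : M.check (bits cr σ) = true) :
    ((M.circles (bits cr σ)).flatMap fun c => c.2.1.map Prod.fst).Nodup := by
  refine nodup_of_length (n := M.size) (fun x hx => List.mem_flatMap.2 (h.exists_circle hc x hx)) ?_
  unfold check at hc
  rw [Bool.and_eq_true] at hc
  rw [List.length_flatMap, ← Nat.eq_of_beq_eq_true hc.2]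
  simp

/-- The circle of a closed walk. -/
noncomputable def circleOf [Nonempty D.Vertex] (num : D.Vertex → ℕ) (σ : D.State)
    (c : ℕ × List (ℕ × G) × Option G) : D.Component σ :=
  Quotient.mk (D.componentSetoid σ) (Function.invFun num c.1)

theorem invFun_num [Nonempty D.Vertex] (h : M.Models D ρ num cr)
    (hc : M.check (bits cr σ) = true) {c : ℕ × List (ℕ × G) × Option G}
    (hm : c ∈ M.circles (bits cr σ)) : num (Function.invFun num c.1) = c.1 := by
  obtain ⟨W, v, -, hv, -⟩ := h.trace_facts hc hm
  exact Function.invFun_eq ⟨v, hv⟩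

theorem exists_circleOf [Nonempty D.Vertex] (h : M.Models D ρ num cr)
    (hc : M.check (bits cr σ) = true) (κ : D.Component σ) :
    ∃ c ∈ M.circles (bits cr σ), circleOf num σ c = κ := by
  obtain ⟨v, rfl⟩ := Quotient.exists_rep κ
  obtain ⟨c, hm, hx⟩ := h.exists_circle hc (num v) ((h.mem _).2 ⟨v, rfl⟩)
  obtain ⟨v', hv', h'⟩ := (h.mem_support_iff hc hm (h.invFun_num hc hm) _).1 hx
  rw [h.inj hv'] at h'
  exact ⟨c, hm, h'.symm⟩

theorem nodup_circleOf [Nonempty D.Vertex] (h : M.Models D ρ num cr)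
    (hc : M.check (bits cr σ) = true) :
    ((M.circles (bits cr σ)).map (circleOf num σ)).Nodup := by
  rw [List.Nodup, List.pairwise_map]
  refine (List.nodup_flatMap.1 (h.nodup_circles hc)).2.imp_of_mem ?_
  intro c c' hm hm' hd he
  have h1 := (h.mem_support_iff hc hm' (h.invFun_num hc hm') c'.1).2 ⟨_, h.invFun_num hc hm', rfl⟩
  have h2 := (h.mem_support_iff hc hm (h.invFun_num hc hm) c'.1).2
    ⟨_, h.invFun_num hc hm', he.symm⟩
  exact hd h2 h1

theorem card_component [Nonempty D.Vertex] (h : M.Models D ρ num cr)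
    (hc : M.check (bits cr σ) = true) :
    Nat.card (D.Component σ) = (M.circles (bits cr σ)).length := by
  classical
  have h1 : Set.univ = (((M.circles (bits cr σ)).map (circleOf num σ)).toFinset : Set (D.Component σ)) := by
    ext κ
    simpa using (h.exists_circleOf hc κ)
  rw [← Set.ncard_univ, h1, Set.ncard_coe_finset, List.toFinset_card_of_nodup (h.nodup_circleOf hc),
    List.length_map]

theorem mu_eq [Nonempty D.Vertex] [DecidableEq G] (h : M.Models D ρ num cr)
    (hc : M.check (bits cr σ) = true)
    (hI : ∀ c ∈ M.circles (bits cr σ), D.InessentialComponent σ (circleOf num σ c) ↔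
      c.2.2 = some 1) : D.mu σ = ((M.circles (bits cr σ)).filter isFlat).length := by
  classical
  have h1 : {κ | D.InessentialComponent σ κ} =
      ((((M.circles (bits cr σ)).filter isFlat).map (circleOf num σ)).toFinset : Set (D.Component σ)) := by
    ext κ
    simp only [Set.mem_ofPred_eq, List.coe_toFinset, List.mem_map, List.mem_filter, isFlat,
      decide_eq_true_eq]
    constructor
    · intro hκ
      obtain ⟨c, hm, rfl⟩ := h.exists_circleOf hc κ
      exact ⟨c, ⟨hm, (hI c hm).1 hκ⟩, rfl⟩
    · rintro ⟨c, ⟨hm, h'⟩, rfl⟩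
      exact (hI c hm).2 h'
  change Nat.card {κ | D.InessentialComponent σ κ} = _
  rw [Nat.card_coe_set_eq, h1, Set.ncard_coe_finset, List.toFinset_card_of_nodup, List.length_map]
  exact (h.nodup_circleOf hc).sublist (List.filter_sublist.map _)

end Circles

end Models

end StateTable

/-! ### Sections and holonomies of the walks around circles. -/

namespace StateTable

variable {F : PolygonSurface} {D : Layered F}

namespace Models

variable {G : Type*} [Group G] {M : StateTable G} {ρ : Holonomy F G} {num : D.Vertex → ℕ}
  {cr : D.Crossing ≃ Fin M.numCrossings} {σ : D.State}

/-- A function on the vertices which is a section over a circle shows that it is flat. -/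
theorem flat_of_section [Nonempty D.Vertex] (h : M.Models D ρ num cr)
    (hc : M.check (bits cr σ) = true) {c : ℕ × List (ℕ × G) × Option G}
    (hm : c ∈ M.circles (bits cr σ)) (H : D.Vertex → G)
    (h1 : ∀ v, Quotient.mk (D.componentSetoid σ) v = circleOf num σ c → H (D.strand v) = H v)
    (h2 : ∀ g : D.Germ, Quotient.mk (D.componentSetoid σ) (.inr g) = circleOf num σ c →
      H (Layered.outerTurn σ.full (.inr g)) = H (.inr g))
    (h3 : ∀ p : D.Point, Quotient.mk (D.componentSetoid σ) (.inl p) = circleOf num σ c →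
      H (.inl (D.count.flip p)) = ρ.side p.1 * H (.inl p)) : c.2.2 = some 1 := by
  obtain ⟨W, -, hW, -, hct, -⟩ := h.trace_facts hc hm
  have hnum := h.invFun_num hc hm
  set v₀ := Function.invFun num c.1 with hv₀
  -- Following the section once around the circle gives `H v₀ = W * H v₀`, so the holonomy `W` is
  -- trivial.
  have key := (trace_section (s := M.strand) (t := M.turn (bits cr σ)) (w := M.weight)
    (Q := On num (circleOf num σ c)) (H := fun x => H (Function.invFun num x))
    (fun x => h.on_strand) (fun x => h.on_turn)
    (by
      rintro x ⟨v, rfl, hv⟩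
      rw [h.strand, Function.leftInverse_invFun h.inj, Function.leftInverse_invFun h.inj]
      exact h1 v hv)
    (by
      rintro x ⟨v, rfl, hv⟩
      rw [h.turn, Function.leftInverse_invFun h.inj, Function.leftInverse_invFun h.inj]
      rcases v with p | g
      · rw [h.weight_point]
        exact h3 p hv
      · rw [h.weight_germ, one_smul]
        exact h2 g hv) (H v₀) 100 c.1 1 ⟨v₀, hnum, rfl⟩ (one_smul G _).symm).2 W
        (by rw [← hct, hW]; rfl)
  have key : H v₀ = W * H v₀ := key
  rw [hW]
  exact congrArg some (mul_right_cancel ((one_mul _).trans key)).symm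

/-- The holonomies of a flat circle are a section. -/
theorem exists_section_of_flat (h : M.Models D ρ num cr) [Nonempty D.Vertex]
    (hc : M.check (bits cr σ) = true) {c : ℕ × List (ℕ × G) × Option G}
    (hm : c ∈ M.circles (bits cr σ)) (hW1 : c.2.2 = some 1) :
    ∃ H : D.Vertex → G,
      (∀ v, Quotient.mk (D.componentSetoid σ) v = circleOf num σ c → H (D.strand v) = H v) ∧
      (∀ g : D.Germ, Quotient.mk (D.componentSetoid σ) (.inr g) = circleOf num σ c →
        H (Layered.outerTurn σ.full (.inr g)) = H (.inr g)) ∧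
      ∀ p : D.Point, Quotient.mk (D.componentSetoid σ) (.inl p) = circleOf num σ c →
        H (.inl (D.count.flip p)) = ρ.side p.1 * H (.inl p) := by
  obtain ⟨W, -, hW, -, -, -, h3, -, h5⟩ := h.trace_facts hc hm
  have h5 := h5 (Option.some.inj (hW.symm.trans hW1))
  have hnd : (c.2.1.map Prod.fst).Nodup := (List.nodup_flatMap.1 (h.nodup_circles hc)).1 c hm
  have hf : ∃ f : ℕ → G, ∀ e ∈ c.2.1, f e.1 = e.2 := by
    classical
    refine ⟨fun x => if hx : ∃ e ∈ c.2.1, e.1 = x then hx.choose.2 else 1, fun e he => ?_⟩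
    have hx : ∃ e' ∈ c.2.1, e'.1 = e.1 := ⟨e, he, rfl⟩
    change (if hx : ∃ e' ∈ c.2.1, e'.1 = e.1 then hx.choose.2 else 1) = _
    rw [dif_pos hx, List.inj_on_of_nodup_map hnd hx.choose_spec.1 he hx.choose_spec.2]
  obtain ⟨f, hf⟩ := hf
  have hon : ∀ v, Quotient.mk (D.componentSetoid σ) v = circleOf num σ c →
      ∃ e ∈ c.2.1, e.1 = num v := by
    intro v hv
    exact List.mem_map.1 ((h.mem_support_iff hc hm (h.invFun_num hc hm) (num v)).2 ⟨v, rfl, hv⟩)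
  have ht : ∀ v, Quotient.mk (D.componentSetoid σ) v = circleOf num σ c →
      f (num (Layered.outerTurn σ.full v)) = M.weight (num v) * f (num v) := by
    intro v hv
    obtain ⟨e, he, hev⟩ := hon v hv
    rw [← h.turn, ← hev, hf e he]
    exact hf _ (h5 e he)
  refine ⟨fun v => f (num v), fun v hv => ?_, fun g hg => ?_, fun p hp => ?_⟩
  · obtain ⟨e, he, hev⟩ := hon v hv
    change f (num (D.strand v)) = f (num v)
    rw [← h.strand, ← hev, hf e he]
    exact hf _ (h3 e he)
  · change f (num _) = f (num _)
    rw [ht _ hg, h.weight_germ, one_mul]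
  · rw [← h.weight_point]
    exact ht _ hp

end Models

end StateTable

/-! ### Inessential circles of a smoothed diagram and their sections. -/

namespace Layered

variable {F : PolygonSurface} {D : Layered F} {σ : D.State}

/-- A section over the curves of an essential circle extends to the germs on it. -/
theorem exists_extension {G : Type*} [Group G] {ρ : Holonomy F G} {K : Curves F}
    {e : K.Point → D.Point} (he : D.IsSmoothedEmb σ K e) {h : K.Point → G}
    (hs : K.IsSection ρ h) : ∃ H : D.Vertex → G, (∀ v, H (D.strand v) = H v) ∧
      (∀ g : D.Germ, H (outerTurn σ.full (.inr g)) = H (.inr g)) ∧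
      ∀ p ∈ Set.range e, H (.inl (D.count.flip p)) = ρ.side p.1 * H (.inl p) := by
  classical
  set H : D.Vertex → G := fun v =>
    if hv : ∃ x : K.Point, D.Joined σ (.inl (e x)) v then h hv.choose else 1 with hH
  have hc := (isSmoothedEmb_iff.1 he).2
  have h1 : ∀ x v, D.Joined σ (.inl (e x)) v → H v = h x := by
    intro x v hx
    have hv : ∃ x : K.Point, D.Joined σ (.inl (e x)) v := ⟨x, hx⟩
    simp only [hH, dif_pos hv]
    rcases eq_or_eq_mate (Relation.EqvGen.trans _ _ _ hv.choose_spec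
      (Relation.EqvGen.symm _ _ hx)) with h' | h'
    · rw [he.1.injective h']
    · rw [← hc] at h'
      rw [he.1.injective h', hs.chord]
  have h2 : ∀ v w, D.Joined σ v w → H v = H w := by
    intro v w hvw
    by_cases hv : ∃ x : K.Point, D.Joined σ (.inl (e x)) v
    · obtain ⟨x, hx⟩ := hv
      rw [h1 x v hx, h1 x w (Relation.EqvGen.trans _ _ _ hx hvw)]
    · have hw : ¬ ∃ x : K.Point, D.Joined σ (.inl (e x)) w := fun ⟨x, hx⟩ =>
        hv ⟨x, Relation.EqvGen.trans _ _ _ hx (Relation.EqvGen.symm _ _ hvw)⟩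
      simp only [hH, dif_neg hv, dif_neg hw]
  refine ⟨H, fun v => (h2 _ _ (joined_strand σ v)).symm,
    fun g => (h2 _ _ (joined_innerTurn σ (.inr g))).symm, ?_⟩
  rintro _ ⟨x, rfl⟩
  rw [← he.1.2.2, h1 _ _ (Relation.EqvGen.refl _), h1 _ _ (Relation.EqvGen.refl _), hs.flip,
    he.1.2.1, smul_eq_mul]

/-- A circle of a smoothed diagram is inessential if there is a section over it. -/
theorem inessential_of_section {α : Type*} (ρ : Holonomy F (FreeGroup α))
    (letter : Fin F.sides → α × Bool) (h1 : ∀ p : D.Point, ρ.side p.1 = FreeGroup.mk [letter p.1])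
    (h2 : ∀ p q : D.Point, letter p.1 = letter q.1 → p.1 = q.1) (κ : D.Component σ)
    (H : D.Vertex → FreeGroup α)
    (k1 : ∀ v, Quotient.mk (D.componentSetoid σ) v = κ → H (D.strand v) = H v)
    (k2 : ∀ g : D.Germ, Quotient.mk (D.componentSetoid σ) (.inr g) = κ →
      H (outerTurn σ.full (.inr g)) = H (.inr g))
    (k3 : ∀ p : D.Point, Quotient.mk (D.componentSetoid σ) (.inl p) = κ →
      H (.inl (D.count.flip p)) = ρ.side p.1 * H (.inl p)) : D.InessentialComponent σ κ := by
  classical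
  by_cases hp : ∃ p, D.componentOf σ p = κ
  · obtain ⟨p₀, hp₀⟩ := hp
    obtain ⟨K, e, he, hr⟩ := exists_smoothedEmb σ {p | D.componentOf σ p = κ}
      (fun p hp => (componentOf_flip p).trans hp) (fun p hp => (componentOf_mate p).trans hp)
    have hK : ∀ x, D.componentOf σ (e x) = κ := fun x => by
      have : e x ∈ Set.range e := ⟨x, rfl⟩
      rwa [hr] at this
    refine .inr ⟨K, e, he, hr, Curves.inessential_of_section ρ letter K ?_ ?_ ?_ ?_⟩
    · refine Curves.numComp_eq_one_iff.2 ⟨?_, fun p q => ?_⟩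
      · have : p₀ ∈ Set.range e := by rw [hr]; exact hp₀
        exact ⟨this.choose⟩
      · rw [linked_iff_componentOf_eq he, hK, hK]
    · intro p
      rw [← he.1.2.1]
      exact h1 _
    · intro p q
      rw [← he.1.2.1, ← he.1.2.1]
      exact h2 _ _
    · refine ⟨fun x => H (.inl (e x)), fun x => ?_, fun x => ?_⟩
      · have hj := ((joined_iff σ _ _).1 (he.2 x)).map_eq
          (f := fun v => if Quotient.mk (D.componentSetoid σ) v = κ then H v else 1)
          (fun v => by
            simp only [StateTable.Models.component_strand]
            split_ifs with hv
            · exact k1 v hv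
            · rfl)
          (fun v => by
            rcases v with p | g
            · rfl
            · have := StateTable.Models.component_outerTurn σ (.inr g)
              change (if Quotient.mk (D.componentSetoid σ) (outerTurn σ.full (.inr g)) = κ then
                H (outerTurn σ.full (.inr g)) else 1) = _
              simp only [this]
              split_ifs with hv
              · exact k2 g hv
              · rfl)
        have e1 : Quotient.mk (D.componentSetoid σ) (.inl (e x)) = κ := hK x
        have e2 : Quotient.mk (D.componentSetoid σ) (.inl (e (K.chord x))) = κ := hK _
        simp only [e1, e2, if_true] at hj
        exact hj.symm
      · rw [he.1.2.2, k3 _ (hK x), he.1.2.1, smul_eq_mul]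
  · exact .inl fun p hp' => hp ⟨p, hp'⟩

end Layered

namespace StateTable.Models

variable {F : PolygonSurface} {D : Layered F} {α : Type*} {M : StateTable (FreeGroup α)}
  {ρ : Holonomy F (FreeGroup α)} {num : D.Vertex → ℕ} {cr : D.Crossing ≃ Fin M.numCrossings}

/-- An inessential circle has a section in every flat bundle. Conversely, trivial holonomy around
the circle gives a section, and with distinct free letters on the sides that are met such a circle
can be pulled back to a small one. -/
theorem inessential_iff [Nonempty D.Vertex] (h : M.Models D ρ num cr)
    (letter : Fin F.sides → α × Bool) (h1 : ∀ p : D.Point, ρ.side p.1 = FreeGroup.mk [letter p.1])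
    (h2 : ∀ p q : D.Point, letter p.1 = letter q.1 → p.1 = q.1) {σ : D.State}
    (hc : M.check (bits cr σ) = true) {c : ℕ × List (ℕ × FreeGroup α) × Option (FreeGroup α)}
    (hm : c ∈ M.circles (bits cr σ)) :
    D.InessentialComponent σ (circleOf num σ c) ↔ c.2.2 = some 1 := by
  constructor
  · rintro (hp | ⟨K, e, he, hr, hK⟩)
    -- A circle that stays inside the polygon crosses no side, so a constant function is a section.
    · exact h.flat_of_section hc hm (fun _ => 1) (fun _ _ => rfl) (fun _ _ => rfl)
        fun p hp' => absurd hp' (hp p)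
    · obtain ⟨f, hf⟩ := hK.exists_section ρ
      obtain ⟨H, k1, k2, k3⟩ := Layered.exists_extension he hf
      exact h.flat_of_section hc hm H (fun v _ => k1 v) (fun g _ => k2 g) fun p hp =>
        k3 p (by rw [hr]; exact hp)
  · intro hW
    obtain ⟨H, k1, k2, k3⟩ := h.exists_section_of_flat hc hm hW
    exact Layered.inessential_of_section ρ letter h1 h2 _ H k1 k2 k3

/-- The numbers of inessential circles and of all circles are those found by the walks. -/
theorem counts_eq [DecidableEq α] [Nonempty D.Vertex] (h : M.Models D ρ num cr)
    (letter : Fin F.sides → α × Bool) (h1 : ∀ p : D.Point, ρ.side p.1 = FreeGroup.mk [letter p.1])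
    (h2 : ∀ p q : D.Point, letter p.1 = letter q.1 → p.1 = q.1) {σ : D.State}
    (hc : M.check (bits cr σ) = true) :
    M.counts (bits cr σ) = (D.mu σ, Nat.card (D.Component σ)) := by
  rw [h.card_component hc, h.mu_eq hc fun c hm => h.inessential_iff letter h1 h2 hc hm, counts]

end StateTable.Models

/-- The sum over all lists of `n` markers. -/
def sumLists (f : List Bool → ℤ) : ℕ → ℤ
  | 0 => f []
  | n + 1 => sumLists (fun T => f (false :: T)) n + sumLists (fun T => f (true :: T)) n

theorem sum_ofFn (n : ℕ) : ∀ f : List Bool → ℤ,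
    ∑ x : Fin n → Bool, f (List.ofFn x) = sumLists f n := by
  induction n with
  | zero => intro f; simp [sumLists]
  | succ n ih =>
    intro f
    rw [sumLists, ← ih, ← ih, ← Equiv.sum_comp (Fin.consEquiv fun _ => Bool), Fintype.sum_prod_type,
      Fintype.sum_bool, add_comm]
    simp [Fin.consEquiv]

theorem sum_states_eq {F : PolygonSurface} {D : Layered F} {n : ℕ} (cr : D.Crossing ≃ Fin n)
    (f : List Bool → ℤ) : ∑ σ : D.State, f (StateTable.bits cr σ) = sumLists f n := by
  rw [← sum_ofFn]
  exact Fintype.sum_equiv (cr.arrowCongr (Equiv.refl Bool)) _ _ fun σ => rfl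

/-! ## Numerical description of diagrams -/

/-- The numbers of the boundary points, in their order, with the matching by chords, the gluing and
the indicator of the upper layer. -/
structure Code where
  points : List ℕ
  chord : ℕ → ℕ
  flip : ℕ → ℕ
  top : ℕ → Bool

namespace Code

def cyc (x y z : ℕ) : Bool :=
  (x.blt y && y.blt z) || ((y.blt z && z.blt x) || (z.blt x && x.blt y))

/-- The number of a germ. -/
def germ (p q : ℕ) : ℕ := 100 * (p + 1) + q

variable (C : Code)

def cross (p q : ℕ) : Bool := cyc p q (C.chord p) && cyc (C.chord p) (C.chord q) p

def crossers (p : ℕ) : List ℕ := C.points.filter (C.cross p)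

def germs : List ℕ := C.points.flatMap fun p => (C.crossers p).map (germ p)

def vertices : List ℕ := C.points ++ C.germs

def strandPoint (p : ℕ) : ℕ :=
  match (C.crossers p).find? fun q => (C.crossers p).all fun w => !cyc p w q with
  | some q => germ p q
  | none => C.chord p

def strandGerm (p q : ℕ) : ℕ :=
  match (C.crossers p).find? fun l => cyc p l q &&
    (C.crossers p).all fun w => !(cyc p l w && cyc p w q) with
  | some l => germ (C.chord p) (C.chord l)
  | none => p

/-- The crossing of a germ on the upper strand. -/
def crossingTop (p q : ℕ) : ℕ :=
  bif p.blt (C.chord p) then germ p q else germ (C.chord p) (C.chord q)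

def crossing (p q : ℕ) : ℕ :=
  bif C.top p then C.crossingTop p q else C.crossingTop q (C.chord p)

/-- Extension of functions on points and on germs to all vertices. -/
def onVertices {α : Type*} (f : ℕ → α) (f' : ℕ → ℕ → α) (x : ℕ) : α :=
  -- Points have numbers below 100 and germs have numbers from 100 on, so division by 100 recovers
  -- the pair of a germ.
  bif x.blt 100 then f x else f' (x / 100 - 1) (x % 100)

def crossings : List ℕ := C.germs.filter
  (onVertices (fun _ => false) fun p _ => C.top p && p.blt (C.chord p))

def next (p q : ℕ) : ℕ := germ q (C.chord p)

def prev (p q : ℕ) : ℕ := germ (C.chord q) p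

/-- The `x`-th byte of a number. -/
def byte (t x : ℕ) : ℕ := (t >>> (8 * x)) % 256

/-- The number whose bytes are the values of a function. -/
def pack (f : ℕ → ℕ) : ℕ → List ℕ → ℕ
  | _, [] => 0
  | n, x :: l => f x <<< (8 * n) + pack f (n + 1) l

/-- A value above 255 would spill over in `pack`. Instead of excluding this, every byte of the
packed number is compared with the function. -/
def packed (f : ℕ → ℕ) (t : ℕ) : ℕ → List ℕ → Bool
  | _, [] => true
  | n, x :: l => (byte t n).beq (f x) && packed f t (n + 1) l

def strandAt : ℕ → ℕ := onVertices C.strandPoint C.strandGerm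
def zeroAt : ℕ → ℕ := onVertices C.flip fun p q => bif C.top p then C.prev p q else C.next p q
def infinityAt : ℕ → ℕ := onVertices C.flip fun p q => bif C.top p then C.next p q else C.prev p q
def crossingAt : ℕ → ℕ := onVertices (fun _ => 0) fun p q => C.crossings.idxOf (C.crossing p q)

/-- The table with given numbers for its functions. -/
def table {G : Type*} [Group G] (ρ : ℕ → G) (n m s z i c : ℕ) : StateTable G where
  size := n
  numCrossings := m
  strand := byte s
  turnZero := byte z
  turnInfinity := byte i
  crossing := byte c
  -- A point label is ten times its side plus its place on the side, so `p / 10` is the side. Germs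
  -- carry no holonomy.
  weight x := onVertices (fun p => ρ (p / 10)) (fun _ _ => 1) (C.vertices.getD x 0)

def index (f : ℕ → ℕ) (x : ℕ) : ℕ := C.vertices.idxOf (f x)

def checkTable (s z i c : ℕ) : Bool :=
  (packed (C.index C.strandAt) s 0 C.vertices && packed (C.index C.zeroAt) z 0 C.vertices) &&
    (packed (C.index C.infinityAt) i 0 C.vertices && packed C.crossingAt c 0 C.vertices)

def allLists (f : List Bool → Bool) : ℕ → Bool
  | 0 => f []
  | n + 1 => allLists (fun T => f (false :: T)) n && allLists (fun T => f (true :: T)) n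

/-- The number of the markers `∞`. -/
def ones (T : List Bool) : ℕ := (T.map Bool.toNat).sum

/-- The sum over the states of a function of the numbers of the markers `∞`, of the inessential
circles and of all circles. -/
def stateSum {G : Type*} [Group G] [DecidableEq G] (M : StateTable G) (f : ℕ → ℕ → ℕ → ℤ) : ℤ :=
  sumLists (fun T => f (ones T) (M.counts T).1 (M.counts T).2) M.numCrossings

def verifyTable {G : Type*} [Group G] [DecidableEq G] (M : StateTable G)
    (vals : List ((ℕ → ℕ → ℕ → ℤ) × ℤ)) : Bool :=
  allLists M.check M.numCrossings && vals.all fun v => decide (stateSum M v.1 = v.2)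

/-- The diagram has `m` crossings and the given sums over the states. -/
def verify {G : Type*} [Group G] [DecidableEq G] (ρ : ℕ → G) (m : ℕ)
    (vals : List ((ℕ → ℕ → ℕ → ℤ) × ℤ)) : Bool :=
  (C.points.all (·.blt 100) && C.crossings.length.beq m) &&
  -- `forced` has the numbers of the table evaluated once, before they enter the sums over all
  -- states.
  forced C.vertices.length fun n => forced (pack (C.index C.strandAt) 0 C.vertices) fun s =>
  forced (pack (C.index C.zeroAt) 0 C.vertices) fun z =>
  forced (pack (C.index C.infinityAt) 0 C.vertices) fun i =>
  forced (pack C.crossingAt 0 C.vertices) fun c =>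
    C.checkTable s z i c && verifyTable (C.table ρ n m s z i c) vals

theorem cyc_iff (x y z : ℕ) : cyc x y z = true ↔ CycNat x y z := by
  simp [cyc, CycNat]

theorem allLists_spec (n : ℕ) : ∀ f : List Bool → Bool, allLists f n = true →
    ∀ x : Fin n → Bool, f (List.ofFn x) = true := by
  induction n with
  | zero => intro f h x; simpa [allLists] using h
  | succ n ih =>
    intro f h x
    rw [allLists, Bool.and_eq_true] at h
    rw [List.ofFn_succ]
    cases x 0
    · exact ih _ h.1 _
    · exact ih _ h.2 _

theorem packed_spec {f : ℕ → ℕ} {t : ℕ} : ∀ {l : List ℕ} {n : ℕ}, packed f t n l = true →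
    ∀ i (hi : i < l.length), byte t (n + i) = f l[i]
  | [], _, _, _, hi => absurd hi (Nat.not_lt_zero _)
  | x :: l, n, h, i, hi => by
    rw [packed, Bool.and_eq_true] at h
    cases i with
    | zero => exact Nat.eq_of_beq_eq_true h.1
    | succ i =>
      rw [← Nat.succ_add_eq_add_succ]
      exact packed_spec h.2 i (Nat.lt_of_succ_lt_succ hi)

variable {C} {F : PolygonSurface} {D : Layered F}

/-- The code describes the diagram with the given numbers of the boundary points. -/
structure Describes (C : Code) (D : Layered F) (φ : D.Point → ℕ) : Prop where
  lt_iff : ∀ p q, φ p < φ q ↔ D.pos p < D.pos q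
  mem : ∀ x, x ∈ C.points ↔ ∃ p, φ p = x
  nodup : C.points.Nodup
  chord : ∀ p, C.chord (φ p) = φ (D.chord p)
  flip : ∀ p, C.flip (φ p) = φ (D.count.flip p)
  top : ∀ p, C.top (φ p) = true ↔ D.top p

/-- The number of a vertex. -/
def raw (φ : D.Point → ℕ) : D.Vertex → ℕ
  | .inl p => φ p
  | .inr g => germ (φ g.1.1) (φ g.1.2)

namespace Describes

variable {φ : D.Point → ℕ} (h : C.Describes D φ)

theorem inj (h : C.Describes D φ) : Function.Injective φ := by
  intro p q hpq
  have h1 := h.lt_iff p q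
  have h2 := h.lt_iff q p
  rw [hpq] at h1 h2
  refine D.pos_inj.1 ?_
  omega

theorem cyc_iff (h : C.Describes D φ) (p q r : D.Point) :
    cyc (φ p) (φ q) (φ r) = true ↔ CycNat (D.pos p) (D.pos q) (D.pos r) := by
  rw [Code.cyc_iff]
  simp only [CycNat, h.lt_iff]

theorem cross_iff (h : C.Describes D φ) (p q : D.Point) :
    C.cross (φ p) (φ q) = true ↔ D.toChordDiagram.Cross p q := by
  rw [cross, Bool.and_eq_true, h.chord, h.chord, h.cyc_iff, h.cyc_iff, D.cross_iff]

theorem mem_crossers (h : C.Describes D φ) (p : D.Point) (x : ℕ) :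
    x ∈ C.crossers (φ p) ↔ ∃ g : D.Germ, g.1.1 = p ∧ φ g.1.2 = x := by
  rw [crossers, List.mem_filter, h.mem]
  constructor
  · rintro ⟨⟨q, rfl⟩, hq⟩
    exact ⟨⟨(p, q), (h.cross_iff p q).1 hq⟩, rfl, rfl⟩
  · rintro ⟨g, rfl, rfl⟩
    exact ⟨⟨_, rfl⟩, (h.cross_iff _ _).2 g.2⟩

theorem mem_germs (h : C.Describes D φ) (x : ℕ) :
    x ∈ C.germs ↔ ∃ g : D.Germ, raw φ (.inr g) = x := by
  rw [germs, List.mem_flatMap]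
  constructor
  · rintro ⟨y, hy, hx⟩
    obtain ⟨p, rfl⟩ := (h.mem y).1 hy
    obtain ⟨z, hz, rfl⟩ := List.mem_map.1 hx
    obtain ⟨g, rfl, rfl⟩ := (h.mem_crossers p z).1 hz
    exact ⟨g, rfl⟩
  · rintro ⟨g, rfl⟩
    exact ⟨φ g.1.1, (h.mem _).2 ⟨_, rfl⟩,
      List.mem_map.2 ⟨_, (h.mem_crossers _ _).2 ⟨g, rfl, rfl⟩, rfl⟩⟩

theorem mem_vertices (h : C.Describes D φ) (x : ℕ) :
    x ∈ C.vertices ↔ ∃ v : D.Vertex, raw φ v = x := by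
  rw [vertices, List.mem_append, h.mem, h.mem_germs]
  constructor
  · rintro (⟨p, hp⟩ | ⟨g, hg⟩)
    exacts [⟨.inl p, hp⟩, ⟨.inr g, hg⟩]
  · rintro ⟨p | g, hv⟩
    exacts [.inl ⟨p, hv⟩, .inr ⟨g, hv⟩]

theorem onVertices_point {α : Type*} (hb : ∀ p, φ p < 100) (f : ℕ → α) (f' : ℕ → ℕ → α)
    (p : D.Point) : onVertices f f' (raw φ (.inl p)) = f (φ p) := by
  have : (φ p).blt 100 = true := by rw [Nat.blt_eq]; exact hb p
  rw [raw, onVertices, this, cond_true]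

theorem onVertices_germ {α : Type*} (hb : ∀ p, φ p < 100) (f : ℕ → α) (f' : ℕ → ℕ → α)
    (g : D.Germ) : onVertices f f' (raw φ (.inr g)) = f' (φ g.1.1) (φ g.1.2) := by
  have h1 := hb g.1.2
  have : (germ (φ g.1.1) (φ g.1.2)).blt 100 = false := by
    rw [← Bool.not_eq_true, Nat.blt_eq, germ]
    omega
  rw [raw, onVertices, this, cond_false]
  congr 1 <;> rw [germ] <;> omega

theorem raw_injective (h : C.Describes D φ) (hb : ∀ p, φ p < 100) :
    Function.Injective (raw φ) := by
  rintro (p | g) (q | g') hv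
  · exact congrArg _ (h.inj hv)
  · have := hb p
    simp only [raw, germ] at hv
    omega
  · have := hb q
    simp only [raw, germ] at hv
    omega
  · have h1 := hb g.1.2
    have h2 := hb g'.1.2
    simp only [raw, germ] at hv
    exact congrArg _ (Layered.Germ.ext (h.inj (by omega)) (h.inj (by omega)))

theorem find_point (h : C.Describes D φ) (g : D.Germ) :
    ((C.crossers (φ g.1.1)).all fun w => !cyc (φ g.1.1) w (φ g.1.2)) = true ↔
      ∀ w, ¬ D.Nearer w g := by
  rw [List.all_eq_true]
  constructor
  · intro h1 w hw
    have := h1 (φ w.1.2) ((h.mem_crossers _ _).2 ⟨w, hw.1, rfl⟩)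
    rw [Bool.not_eq_true', ← Bool.not_eq_true, h.cyc_iff] at this
    exact this ((Layered.nearer_iff w g).1 hw).2
  · intro h1 x hx
    obtain ⟨w, hw, rfl⟩ := (h.mem_crossers _ _).1 hx
    rw [Bool.not_eq_true', ← Bool.not_eq_true, h.cyc_iff]
    exact fun h2 => h1 w ((Layered.nearer_iff w g).2 ⟨hw, h2⟩)

theorem find_germ (h : C.Describes D φ) (l g : D.Germ) (hl : l.1.1 = g.1.1) :
    (cyc (φ g.1.1) (φ l.1.2) (φ g.1.2) && (C.crossers (φ g.1.1)).all fun w =>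
      !(cyc (φ g.1.1) (φ l.1.2) w && cyc (φ g.1.1) w (φ g.1.2))) = true ↔
      D.Nearer l g ∧ ∀ w, D.Nearer l w → ¬ D.Nearer w g := by
  rw [Bool.and_eq_true, h.cyc_iff, List.all_eq_true]
  constructor
  · rintro ⟨h0, h1⟩
    refine ⟨(Layered.nearer_iff l g).2 ⟨hl, h0⟩, fun w hlw hwg => ?_⟩
    have := h1 (φ w.1.2) ((h.mem_crossers _ _).2 ⟨w, hwg.1, rfl⟩)
    rw [Bool.not_eq_true', ← Bool.not_eq_true, Bool.and_eq_true, h.cyc_iff, h.cyc_iff] at this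
    exact this ⟨hwg.1 ▸ ((Layered.nearer_iff l w).1 hlw).2, ((Layered.nearer_iff w g).1 hwg).2⟩
  · rintro ⟨h0, h1⟩
    refine ⟨((Layered.nearer_iff l g).1 h0).2, fun x hx => ?_⟩
    obtain ⟨w, hw, rfl⟩ := (h.mem_crossers _ _).1 hx
    rw [Bool.not_eq_true', ← Bool.not_eq_true, Bool.and_eq_true, h.cyc_iff, h.cyc_iff]
    rintro ⟨h2, h3⟩
    exact h1 w ((Layered.nearer_iff l w).2 ⟨hl.trans hw.symm, hw.symm ▸ h2⟩)
      ((Layered.nearer_iff w g).2 ⟨hw, h3⟩)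

theorem strandAt_eq (h : C.Describes D φ) (hb : ∀ p, φ p < 100) (v : D.Vertex) :
    C.strandAt (raw φ v) = raw φ (D.strand v) := by
  have hv := Layered.strandAdj_strand v
  unfold strandAt
  rcases v with p | g
  · rw [onVertices_point hb, strandPoint]
    cases hf : (C.crossers (φ p)).find? fun q => (C.crossers (φ p)).all fun w => !cyc (φ p) w q with
    | some q =>
      obtain ⟨g, rfl, rfl⟩ := (h.mem_crossers _ _).1 (List.mem_of_find?_eq_some hf)
      have h0 := List.find?_some hf
      have := (h.find_point g).1 h0
      rw [Layered.strandAdj_iff.1 (.first g this)]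
      rfl
    | none =>
      rw [List.find?_eq_none] at hf
      generalize D.strand (.inl p) = w at hv
      cases hv with
      | bare p h' => exact h.chord p
      | first g h' =>
        exact absurd ((h.find_point g).2 h') (hf _ ((h.mem_crossers _ _).2 ⟨g, rfl, rfl⟩))
  · rw [onVertices_germ hb, strandGerm]
    cases hf : (C.crossers (φ g.1.1)).find? fun l => cyc (φ g.1.1) l (φ g.1.2) &&
      (C.crossers (φ g.1.1)).all fun w => !(cyc (φ g.1.1) l w && cyc (φ g.1.1) w (φ g.1.2)) with
    | some q =>
      obtain ⟨l, hl, rfl⟩ := (h.mem_crossers _ _).1 (List.mem_of_find?_eq_some hf)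
      have h0 := List.find?_some hf
      have := (h.find_germ l g hl).1 h0
      rw [Layered.strandAdj_iff.1 (.segment g l this.1 this.2)]
      change germ (C.chord (φ g.1.1)) (C.chord (φ l.1.2)) = germ (φ (D.chord l.1.1)) (φ (D.chord l.1.2))
      rw [h.chord, h.chord, hl]
    | none =>
      rw [List.find?_eq_none] at hf
      generalize D.strand (.inr g) = w at hv
      cases hv with
      | last g h' => rfl
      | segment g l h' hn =>
        exact absurd ((h.find_germ l g h'.1).2 ⟨h', hn⟩)
          (hf _ ((h.mem_crossers _ _).2 ⟨l, h'.1, rfl⟩))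

end Describes

end Code

namespace Code

variable {C : Code} {F : PolygonSurface} {D : Layered F} {φ : D.Point → ℕ}

namespace Describes

theorem blt_iff (h : C.Describes D φ) (p : D.Point) :
    (φ p).blt (C.chord (φ p)) = true ↔ D.count.Before p (D.chord p) := by
  rw [Nat.blt_eq, h.chord, h.lt_iff, StrandCount.before_iff]

theorem crossingTop_eq (h : C.Describes D φ) (g : D.Germ) (hg : D.top g.1.1) :
    C.crossingTop (φ g.1.1) (φ g.1.2) = raw φ (.inr (D.crossingOf g).1) := by
  unfold crossingTop Layered.crossingOf
  rw [dif_pos hg]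
  by_cases hb : D.count.Before g.1.1 (D.chord g.1.1)
  · rw [dif_pos hb, (h.blt_iff _).2 hb, cond_true]
    rfl
  · rw [dif_neg hb, Bool.eq_false_iff.2 (mt (h.blt_iff _).1 hb), cond_false, h.chord, h.chord]
    rfl

theorem crossing_eq (h : C.Describes D φ) (g : D.Germ) :
    C.crossing (φ g.1.1) (φ g.1.2) = raw φ (.inr (D.crossingOf g).1) := by
  unfold crossing
  by_cases hg : D.top g.1.1
  · rw [(h.top _).2 hg, cond_true, h.crossingTop_eq g hg]
  · rw [Bool.eq_false_iff.2 (mt (h.top _).1 hg), cond_false, h.chord,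
      ← Layered.crossingOf_next g]
    exact h.crossingTop_eq g.next (g.top_next.2 hg)

theorem mem_crossings (h : C.Describes D φ) (hb : ∀ p, φ p < 100) (x : ℕ) :
    x ∈ C.crossings ↔ ∃ c : D.Crossing, raw φ (.inr c.1) = x := by
  rw [crossings, List.mem_filter, h.mem_germs]
  constructor
  · rintro ⟨⟨g, rfl⟩, hg⟩
    rw [onVertices_germ hb, Bool.and_eq_true, h.top, h.blt_iff] at hg
    exact ⟨⟨g, hg⟩, rfl⟩
  · rintro ⟨c, rfl⟩
    refine ⟨⟨_, rfl⟩, ?_⟩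
    rw [onVertices_germ hb, Bool.and_eq_true, h.top, h.blt_iff]
    exact c.2

theorem nodup_germs (h : C.Describes D φ) (hb : ∀ p, φ p < 100) : C.germs.Nodup := by
  refine List.nodup_flatMap.2 ⟨fun x _ => ?_, ?_⟩
  · refine List.Nodup.map (fun a b hab => ?_) (h.nodup.filter _)
    simpa [germ] using hab
  · refine h.nodup.imp_of_mem ?_
    intro x y hx hy hxy z hz hz'
    obtain ⟨a, ha, rfl⟩ := List.mem_map.1 hz
    obtain ⟨b, hb', he⟩ := List.mem_map.1 hz'
    obtain ⟨p, rfl⟩ := (h.mem x).1 hx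
    obtain ⟨q, rfl⟩ := (h.mem y).1 hy
    obtain ⟨g, -, rfl⟩ := (h.mem_crossers _ _).1 ha
    obtain ⟨g', -, rfl⟩ := (h.mem_crossers _ _).1 hb'
    have h1 := hb g.1.2
    have h2 := hb g'.1.2
    simp only [germ] at he
    omega

/-- The numbers of the crossings. -/
noncomputable def crossingEquiv (h : C.Describes D φ) (hb : ∀ p, φ p < 100) :
    D.Crossing ≃ Fin C.crossings.length :=
  (Equiv.ofBijective (fun c : D.Crossing =>
      (⟨raw φ (.inr c.1), (h.mem_crossings hb _).2 ⟨c, rfl⟩⟩ : {x // x ∈ C.crossings}))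
    ⟨fun c c' hc => Subtype.ext (Sum.inr.inj (h.raw_injective hb (congrArg Subtype.val hc))),
      fun x => by
        obtain ⟨c, hc⟩ := (h.mem_crossings hb x.1).1 x.2
        exact ⟨c, Subtype.ext hc⟩⟩).trans
    (List.Nodup.getEquiv C.crossings ((h.nodup_germs hb).filter _)).symm

theorem getD_idxOf (h : C.Describes D φ) (v : D.Vertex) :
    C.vertices.getD (C.vertices.idxOf (raw φ v)) 0 = raw φ v := by
  have hm : C.vertices.idxOf (raw φ v) < C.vertices.length :=
    List.idxOf_lt_length_iff.2 ((h.mem_vertices _).2 ⟨v, rfl⟩)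
  rw [List.getD_eq_getElem _ _ hm, List.getElem_idxOf]

theorem packed_apply (h : C.Describes D φ) {f : ℕ → ℕ} {t : ℕ}
    (hp : packed f t 0 C.vertices = true) (v : D.Vertex) :
    byte t (C.vertices.idxOf (raw φ v)) = f (raw φ v) := by
  have hm : C.vertices.idxOf (raw φ v) < C.vertices.length :=
    List.idxOf_lt_length_iff.2 ((h.mem_vertices _).2 ⟨v, rfl⟩)
  have := packed_spec hp _ hm
  rwa [zero_add, List.getElem_idxOf] at this

/-- The table numbers vertices by their places in the list `vertices`, in which none is repeated.
The checked bytes then transfer strands, turns and crossings from the code to the diagram. -/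
theorem models {G : Type*} [Group G] (h : C.Describes D φ) (hb : ∀ p, φ p < 100) {s z i c : ℕ}
    (hc : C.checkTable s z i c = true) {ρ : Holonomy F G} {ρ' : ℕ → G}
    (hρ : ∀ p : D.Point, ρ' (φ p / 10) = ρ.side p.1) :
    (C.table ρ' C.vertices.length C.crossings.length s z i c).Models D ρ
      (fun v => C.vertices.idxOf (raw φ v)) (h.crossingEquiv hb) := by
  unfold checkTable at hc
  rw [Bool.and_eq_true, Bool.and_eq_true, Bool.and_eq_true] at hc
  obtain ⟨⟨h1, h2⟩, h3, h4⟩ := hc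
  have hnodup : C.vertices.Nodup := by
    refine List.nodup_append.2 ⟨h.nodup, h.nodup_germs hb, ?_⟩
    intro x hx y hy hxy
    obtain ⟨p, rfl⟩ := (h.mem x).1 hx
    obtain ⟨g, rfl⟩ := (h.mem_germs y).1 hy
    exact Sum.inl_ne_inr (h.raw_injective hb (a₁ := .inl p) (a₂ := .inr g) hxy)
  constructor
  · intro v w hvw
    have h5 : C.vertices.idxOf (raw φ v) = C.vertices.idxOf (raw φ w) := hvw
    have := h.getD_idxOf v
    rw [h5, h.getD_idxOf w] at this
    exact h.raw_injective hb this.symm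
  · intro x
    constructor
    · intro hx
      change x < C.vertices.length at hx
      obtain ⟨v, hv⟩ := (h.mem_vertices _).1 (List.getElem_mem hx)
      exact ⟨v, by rw [hv, hnodup.idxOf_getElem]⟩
    · rintro ⟨v, rfl⟩
      exact List.idxOf_lt_length_iff.2 ((h.mem_vertices _).2 ⟨v, rfl⟩)
  · intro v
    refine (h.packed_apply h1 v).trans ?_
    rw [index, h.strandAt_eq hb]
  · intro p
    constructor
    · refine (h.packed_apply h2 _).trans ?_
      rw [index, zeroAt, onVertices_point hb, h.flip]
      rfl
    · refine (h.packed_apply h3 _).trans ?_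
      rw [index, infinityAt, onVertices_point hb, h.flip]
      rfl
  · intro g
    refine (h.packed_apply h4 _).trans ?_
    rw [crossingAt, onVertices_germ hb, h.crossing_eq]
    rfl
  · intro g hg
    constructor
    · refine (h.packed_apply h2 _).trans ?_
      rw [index, zeroAt, onVertices_germ hb, (h.top _).2 hg, cond_true, prev, h.chord]
      rfl
    · refine (h.packed_apply h3 _).trans ?_
      rw [index, infinityAt, onVertices_germ hb, (h.top _).2 hg, cond_true, next, h.chord]
      rfl
  · intro g hg
    have hg := Bool.eq_false_iff.2 (mt (h.top _).1 hg)
    constructor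
    · refine (h.packed_apply h2 _).trans ?_
      rw [index, zeroAt, onVertices_germ hb, hg, cond_false, next, h.chord]
      rfl
    · refine (h.packed_apply h3 _).trans ?_
      rw [index, infinityAt, onVertices_germ hb, hg, cond_false, prev, h.chord]
      rfl
  · intro p
    change onVertices (fun p => ρ' (p / 10)) (fun _ _ => 1)
      (C.vertices.getD (C.vertices.idxOf (raw φ (.inl p))) 0) = _
    rw [h.getD_idxOf, onVertices_point hb, hρ]
  · intro g
    change onVertices (fun p => ρ' (p / 10)) (fun _ _ => 1)
      (C.vertices.getD (C.vertices.idxOf (raw φ (.inr g))) 0) = _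
    rw [h.getD_idxOf, onVertices_germ hb]

theorem iota_eq {n : ℕ} (cr : D.Crossing ≃ Fin n) (σ : D.State) :
    ones (StateTable.bits cr σ) = D.iota σ := by
  rw [ones, StateTable.bits, List.map_ofFn, List.sum_ofFn, Layered.iota, Finset.card_filter]
  refine (Fintype.sum_equiv cr _ _ fun c => ?_).symm
  rw [Function.comp, cr.symm_apply_apply]
  cases σ c <;> rfl

/-- A verified code determines the number of crossings and the sums over the states. -/
theorem verify_spec {α : Type*} [DecidableEq α] [Nonempty D.Point] (h : C.Describes D φ)
    {ρ : Holonomy F (FreeGroup α)} {ρ' : ℕ → FreeGroup α}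
    (hρ : ∀ p : D.Point, ρ' (φ p / 10) = ρ.side p.1)
    (letter : Fin F.sides → α × Bool) (h1 : ∀ p : D.Point, ρ.side p.1 = FreeGroup.mk [letter p.1])
    (h2 : ∀ p q : D.Point, letter p.1 = letter q.1 → p.1 = q.1) {m : ℕ}
    {vals : List ((ℕ → ℕ → ℕ → ℤ) × ℤ)} (hv : C.verify ρ' m vals = true) :
    Fintype.card D.Crossing = m ∧ ∀ v ∈ vals,
      ∑ σ : D.State, v.1 (D.iota σ) (D.mu σ) (Nat.card (D.Component σ)) = v.2 := by
  unfold verify at hv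
  simp only [forced_eq] at hv
  rw [Bool.and_eq_true, Bool.and_eq_true, Bool.and_eq_true, verifyTable, Bool.and_eq_true,
    List.all_eq_true, List.all_eq_true] at hv
  obtain ⟨⟨hb, hm⟩, hc, hl, hs⟩ := hv
  have hb : ∀ p, φ p < 100 := fun p => by
    have := hb (φ p) ((h.mem _).2 ⟨p, rfl⟩)
    rwa [Nat.blt_eq] at this
  have hm := Nat.eq_of_beq_eq_true hm
  subst hm
  have hM := h.models hb hc hρ
  have hcard : Fintype.card D.Crossing = C.crossings.length := by
    rw [Fintype.card_congr (h.crossingEquiv hb), Fintype.card_fin]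
  refine ⟨hcard, fun v hv => ?_⟩
  rw [← of_decide_eq_true (hs v hv), stateSum]
  refine Eq.trans ?_ (sum_states_eq (h.crossingEquiv hb) _)
  refine Finset.sum_congr rfl fun σ _ => ?_
  have := hM.counts_eq letter h1 h2 (σ := σ) (allLists_spec _ _ hl _)
  beta_reduce
  rw [iota_eq]
  exact (congrArg (fun x : ℕ × ℕ => v.1 (D.iota σ) x.1 x.2) this).symm

end Describes

end Code

/-! ## Curves given by their numbers of points on the sides -/

namespace Curves

variable {F : PolygonSurface}

/-- The curves have `ν s` points on side `s`, and their chords join side `s` with side `κ s`. -/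
structure HasShape (D : Curves F) (ν κ : ℕ → ℕ) : Prop where
  num : ∀ s, D.count.num s = ν s
  chord : ∀ p, ((D.chord p).1 : ℕ) = κ p.1

/-- The chords of the shape join different sides and do not cross. -/
structure IsShape (F : PolygonSurface) (ν κ : ℕ → ℕ) : Prop where
  num_glue : ∀ s, ν (F.glue s) = ν s
  lt : ∀ s < F.sides, 0 < ν s → κ s < F.sides
  invol : ∀ s < F.sides, 0 < ν s → κ (κ s) = s
  ne : ∀ s < F.sides, 0 < ν s → κ s ≠ s
  num_chord : ∀ s < F.sides, 0 < ν s → ν (κ s) = ν s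
  planar : ∀ s < F.sides, ∀ s' < F.sides, 0 < ν s → 0 < ν s' →
    ¬ (s < s' ∧ s' < κ s ∧ κ s < κ s')

variable {ν κ : ℕ → ℕ}

theorem HasShape.pos {D : Curves F} (h : D.HasShape ν κ) (p : D.Point) : 0 < ν p.1 := by
  rw [← h.num]
  exact Nat.zero_lt_of_lt p.2.isLt

/-- Two chords that join the same pair of sides cross unless they meet these sides in opposite
orders. -/
theorem HasShape.val_anti {D : Curves F} (h : D.HasShape ν κ) (hs : IsShape F ν κ)
    {p q : D.Point} (hpq : p.1 = q.1) (hv : p.2.val < q.2.val) :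
    (D.chord q).2.val < (D.chord p).2.val := by
  by_contra hle
  have h1 : (D.chord p).1 = (D.chord q).1 := by
    rw [Fin.ext_iff, h.chord, h.chord, hpq]
  have h2 : ((D.chord p).1 : ℕ) ≠ p.1 := by
    rw [h.chord]
    exact hs.ne _ p.1.isLt (h.pos p)
  have h3 : (D.chord p).2.val ≠ (D.chord q).2.val := fun he => by
    have := D.chord_injective (eq_of_side _ h1 he)
    rw [this] at hv
    exact lt_irrefl _ hv
  have b1 : D.count.Before p q := .inr ⟨hpq, hv⟩
  have b2 : D.count.Before (D.chord p) (D.chord q) := .inr ⟨h1, by omega⟩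
  refine D.noncrossing p q ?_
  rcases lt_or_gt_of_ne h2 with hlt | hlt
  · have b3 : D.count.Before (D.chord p) p := .inl hlt
    have b4 : D.count.Before (D.chord q) p := .inl (h1 ▸ hlt)
    exact ⟨.inr (.inr ⟨b3, b1⟩), .inl ⟨b2, b4⟩⟩
  · have b3 : D.count.Before p (D.chord p) := .inl hlt
    have b4 : D.count.Before q (D.chord p) := .inl (hpq ▸ hlt)
    exact ⟨.inl ⟨b1, b4⟩, .inr (.inr ⟨b3, b2⟩)⟩

/-- A strictly decreasing map between the points of two sides with equally many points is the
reversal. One induction from each end of the side gives the two inequalities. -/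
theorem HasShape.chord_val {D : Curves F} (h : D.HasShape ν κ) (hs : IsShape F ν κ)
    (p : D.Point) : (D.chord p).2.val + p.2.val + 1 = ν p.1 := by
  have hn : ∀ q : D.Point, (D.chord q).2.val < ν q.1 := fun q => by
    rw [← hs.num_chord _ q.1.isLt (h.pos q), ← h.chord, ← h.num]
    exact (D.chord q).2.isLt
  have h1 : ∀ (i : ℕ) (q : D.Point), q.2.val = i → (D.chord q).2.val + i < ν q.1 := by
    intro i
    induction i with
    | zero => intro q _; exact hn q
    | succ i ih =>
      intro q hq
      have := ih ⟨q.1, ⟨i, by omega⟩⟩ rfl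
      have := h.val_anti hs (p := ⟨q.1, ⟨i, by omega⟩⟩) (q := q) rfl (by simp only; omega)
      simp only at *
      omega
  have h2 : ∀ (k : ℕ) (q : D.Point), q.2.val + k + 1 = ν q.1 → k ≤ (D.chord q).2.val := by
    intro k
    induction k with
    | zero => intro q _; omega
    | succ k ih =>
      intro q hq
      have hlt : q.2.val + 1 < D.count.num q.1 := by have := h.num q.1; omega
      have := ih ⟨q.1, ⟨q.2.val + 1, hlt⟩⟩ (by simp only; omega)
      have := h.val_anti hs (p := q) (q := ⟨q.1, ⟨q.2.val + 1, hlt⟩⟩) rfl (by simp)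
      omega
  have h3 := h1 _ p rfl
  have h4 := p.2.isLt
  have h5 := h.num p.1
  have := h2 (ν p.1 - (p.2.val + 1)) p (by omega)
  omega

/-- Curves are determined by their shape. -/
theorem HasShape.eq {D D' : Curves F} (h : D.HasShape ν κ) (h' : D'.HasShape ν κ)
    (hs : IsShape F ν κ) : D = D' := by
  have hc := h.chord_val hs
  have hc' := h'.chord_val hs
  have k := h.chord
  have k' := h'.chord
  have hn : D.count.num = D'.count.num := funext fun s => by rw [h.num, h'.num]
  clear h h'
  obtain ⟨⟨⟨num, g⟩, chord, c1, c2⟩, hx⟩ := D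
  obtain ⟨⟨⟨num', g'⟩, chord', c1', c2'⟩, hx'⟩ := D'
  simp only at hn hc hc' k k'
  subst hn
  have : chord = chord' := funext fun p =>
    eq_of_side ⟨num, g⟩ (Fin.ext ((k p).trans (k' p).symm)) (by
      have := hc p
      have := hc' p
      omega)
  subst this
  rfl

/-- The curves of a shape. -/
def ofShape (hs : IsShape F ν κ) : Curves F where
  count := ⟨fun s => ν s, fun s => hs.num_glue s⟩
  chord p := ⟨⟨κ p.1, hs.lt _ p.1.isLt (Nat.zero_lt_of_lt p.2.isLt)⟩, ⟨ν p.1 - (p.2.val + 1), by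
    have := hs.num_chord _ p.1.isLt (Nat.zero_lt_of_lt p.2.isLt)
    have := p.2.isLt
    simp only at *
    omega⟩⟩
  chord_chord p := by
    have h0 := Nat.zero_lt_of_lt p.2.isLt
    refine eq_of_side _ (Fin.ext (hs.invol _ p.1.isLt h0)) ?_
    have := hs.num_chord _ p.1.isLt h0
    have := p.2.isLt
    simp only at *
    omega
  chord_ne p h := hs.ne _ p.1.isLt (Nat.zero_lt_of_lt p.2.isLt)
    (congrArg (fun q : StrandCount.Point _ => (q.1 : ℕ)) h)
  -- `planar` speaks of the linear order of the sides and crossing of the cyclic order of points, so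
  -- all choices of ends of the two chords are put in.
  noncrossing p q := by
    rintro ⟨h1, h2⟩
    have hp := Nat.zero_lt_of_lt p.2.isLt
    have hq := Nat.zero_lt_of_lt q.2.isLt
    have a1 := hs.planar _ p.1.isLt _ q.1.isLt hp hq
    have a2 := hs.planar _ q.1.isLt _ p.1.isLt hq hp
    have np := hs.num_chord _ p.1.isLt hp
    have a3 := hs.planar _ q.1.isLt _ (hs.lt _ p.1.isLt hp) hq (np ▸ hp)
    have nq := hs.num_chord _ q.1.isLt hq
    have a4 := hs.planar _ p.1.isLt _ (hs.lt _ q.1.isLt hq) hp (nq ▸ hq)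
    have a5 := hs.planar _ (hs.lt _ p.1.isLt hp) _ q.1.isLt (np ▸ hp) hq
    have a6 := hs.planar _ (hs.lt _ q.1.isLt hq) _ p.1.isLt (nq ▸ hq) hp
    have a7 := hs.planar _ (hs.lt _ q.1.isLt hq) _ (hs.lt _ p.1.isLt hp) (nq ▸ hq) (np ▸ hp)
    have a8 := hs.planar _ (hs.lt _ p.1.isLt hp) _ (hs.lt _ q.1.isLt hq) (np ▸ hp) (nq ▸ hq)
    have ip := hs.invol _ p.1.isLt hp
    have iq := hs.invol _ q.1.isLt hq
    have ep := hs.ne _ p.1.isLt hp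
    have eq := hs.ne _ q.1.isLt hq
    rw [ip] at a3 a5 a7 a8
    rw [iq] at a4 a6 a7 a8
    have lp := p.2.isLt
    have lq := q.2.isLt
    have hκ : (p.1 : ℕ) = q.1 → κ p.1 = κ q.1 ∧ ν p.1 = ν q.1 := fun h => by rw [h]; exact ⟨rfl, rfl⟩
    have hκ' : (p.1 : ℕ) = κ q.1 → κ p.1 = q.1 ∧ ν p.1 = ν q.1 := fun h => by
      rw [h]; exact ⟨iq, nq⟩
    have hκ₁ : (q.1 : ℕ) = κ p.1 → κ q.1 = p.1 ∧ ν q.1 = ν p.1 := fun h => by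
      rw [h]; exact ⟨ip, np⟩
    have hκ₂ : κ p.1 = κ q.1 → (p.1 : ℕ) = q.1 := fun h => by rw [← ip, h, iq]
    simp only [StrandCount.Cyc, StrandCount.Before, Fin.lt_def, Fin.ext_iff] at *
    omega

theorem ofShape_hasShape (hs : IsShape F ν κ) : (ofShape hs).HasShape ν κ :=
  ⟨fun _ => rfl, fun _ => rfl⟩

end Curves

/-- The code of a superposition of two curves: `P s` and `Q s` are the positions on side `s` of the
points of the first and of the second curve, and `κ` and `κ'` are the matchings of the sides by
their chords. -/
def Code.superposition (m : ℕ) (gl κ κ' : ℕ → ℕ) (P Q : ℕ → List ℕ) (lower : Bool) : Code where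
  points := (List.range m).flatMap fun s =>
    (List.range ((P s).length + (Q s).length)).map (10 * s + ·)
  chord x := bif (P (x / 10)).contains (x % 10)
    then 10 * κ (x / 10) + (P (κ (x / 10))).reverse.getD ((P (x / 10)).idxOf (x % 10)) 0
    else 10 * κ' (x / 10) + (Q (κ' (x / 10))).reverse.getD ((Q (x / 10)).idxOf (x % 10)) 0
  flip x := 10 * gl (x / 10) + ((P (x / 10)).length + (Q (x / 10)).length - (x % 10 + 1))
  top x := lower.xor ((P (x / 10)).contains (x % 10))

namespace Curves

variable {F : PolygonSurface} {D : Layered F} {X Y : Curves F}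

open Classical in
/-- The positions on a side of the points of a curve in a diagram. -/
noncomputable def positions (x : X.Point → D.Point) (s : ℕ) : List ℕ :=
  if h : s < F.sides then List.ofFn fun j : Fin (X.count.num ⟨s, h⟩) => (x ⟨⟨s, h⟩, j⟩).2.val
  else []

variable {x : X.Point → D.Point} {y : Y.Point → D.Point}

theorem positions_fin (x : X.Point → D.Point) (s : Fin F.sides) :
    positions x s = List.ofFn fun j : Fin (X.count.num s) => (x ⟨s, j⟩).2.val :=
  dif_pos s.isLt

theorem length_positions (x : X.Point → D.Point) (s : Fin F.sides) :
    (positions x s).length = X.count.num s := by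
  rw [positions_fin, List.length_ofFn]

theorem getElem_positions (x : X.Point → D.Point) (q : X.Point)
    (h : q.2.val < (positions x q.1).length) : (positions x q.1)[q.2.val] = (x q).2.val := by
  simp only [positions_fin, List.getElem_ofFn]

theorem side_val (hx : X.IsSubEmb D.toChordDiagram x) (q : X.Point) : ((x q).1 : ℕ) = q.1 :=
  congrArg Fin.val (hx.1.2.1 q)

theorem mem_positions (hx : X.IsSubEmb D.toChordDiagram x) (p : D.Point) :
    p.2.val ∈ positions x p.1 ↔ p ∈ Set.range x := by
  constructor
  · rw [positions_fin, List.mem_ofFn]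
    rintro ⟨j, hj⟩
    exact ⟨⟨p.1, j⟩, eq_of_side _ (hx.1.2.1 _) hj⟩
  · rintro ⟨q, rfl⟩
    rw [side_val hx, positions_fin, List.mem_ofFn]
    exact ⟨q.2, rfl⟩

theorem pairwise_positions (hx : X.IsSubEmb D.toChordDiagram x) (s : Fin F.sides) :
    (positions x s).Pairwise (· < ·) := by
  rw [positions_fin, List.pairwise_ofFn]
  intro i j hij
  have h1 : D.count.Before (x ⟨s, i⟩) (x ⟨s, j⟩) := hx.1.1 _ _ (.inr ⟨rfl, hij⟩)
  rcases h1 with h1 | h1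
  · rw [hx.1.2.1, hx.1.2.1] at h1
    exact absurd h1 (lt_irrefl _)
  · exact h1.2

theorem nodup_positions (hx : X.IsSubEmb D.toChordDiagram x) (s : Fin F.sides) :
    (positions x s).Nodup :=
  (pairwise_positions hx s).imp fun h => h.ne

theorem idxOf_positions (hx : X.IsSubEmb D.toChordDiagram x) (q : X.Point) :
    (positions x q.1).idxOf (x q).2.val = q.2.val := by
  have h : q.2.val < (positions x q.1).length := by
    rw [length_positions]
    exact q.2.isLt
  rw [← getElem_positions x q h, (nodup_positions hx q.1).idxOf_getElem]

/-- Two curves are superimposed. -/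
structure Superposed (D : Layered F) (x : X.Point → D.Point) (y : Y.Point → D.Point) : Prop where
  left : X.IsSubEmb D.toChordDiagram x
  right : Y.IsSubEmb D.toChordDiagram y
  compl : ∀ p, p ∈ Set.range y ↔ p ∉ Set.range x

namespace Superposed

theorem symm (h : Superposed D x y) : Superposed D y x :=
  ⟨h.right, h.left, fun p => by rw [h.compl]; tauto⟩

theorem perm (h : Superposed D x y) (s : Fin F.sides) :
    (positions x s ++ positions y s).Perm (List.range (D.count.num s)) := by
  rw [List.perm_ext_iff_of_nodup _ List.nodup_range]
  · intro i
    rw [List.mem_append, List.mem_range]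
    constructor
    · rintro (hi | hi)
      · rw [positions_fin, List.mem_ofFn] at hi
        obtain ⟨j, rfl⟩ := hi
        exact (x ⟨s, j⟩).2.isLt.trans_eq (congrArg D.count.num (h.left.1.2.1 _))
      · rw [positions_fin, List.mem_ofFn] at hi
        obtain ⟨j, rfl⟩ := hi
        exact (y ⟨s, j⟩).2.isLt.trans_eq (congrArg D.count.num (h.right.1.2.1 _))
    · intro hi
      have h1 := mem_positions h.left ⟨s, ⟨i, hi⟩⟩
      have h2 := mem_positions h.right ⟨s, ⟨i, hi⟩⟩
      have h3 := h.compl ⟨s, ⟨i, hi⟩⟩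
      simp only at h1 h2
      tauto
  · refine List.nodup_append.2 ⟨nodup_positions h.left s, nodup_positions h.right s, ?_⟩
    rintro i hi _ hj rfl
    rw [positions_fin, List.mem_ofFn] at hi hj
    obtain ⟨j, rfl⟩ := hi
    obtain ⟨j', hj'⟩ := hj
    have : y ⟨s, j'⟩ = x ⟨s, j⟩ := eq_of_side _ (by rw [h.left.1.2.1, h.right.1.2.1]) hj'
    exact (h.compl _).1 ⟨_, this⟩ ⟨_, rfl⟩

theorem num_eq (h : Superposed D x y) (s : Fin F.sides) :
    D.count.num s = (positions x s).length + (positions y s).length := by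
  rw [← List.length_append, (h.perm s).length_eq, List.length_range]

/-- The number of a point. -/
def label (p : D.Point) : ℕ := 10 * p.1 + p.2

theorem label_div {p : D.Point} (hp : p.2.val < 10) : label p / 10 = p.1 ∧ label p % 10 = p.2 := by
  unfold label
  omega

theorem chord_left {ν κ : ℕ → ℕ} (h : Superposed D x y) (hX : X.HasShape ν κ)
    (hs : IsShape F ν κ) (q : X.Point) : 10 * κ q.1 + (positions x (κ q.1)).reverse.getD
      ((positions x q.1).idxOf (x q).2.val) 0 = label (x (X.chord q)) := by
  have h1 := hX.chord_val hs q
  have h2 : (X.chord q).2.val < (positions x (X.chord q).1).length := by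
    rw [length_positions]
    exact (X.chord q).2.isLt
  have h3 : (positions x (X.chord q).1).length = ν q.1 := by
    rw [length_positions, hX.num, hX.chord, hs.num_chord _ q.1.isLt (hX.pos q)]
  have h4 : q.2.val < (positions x (X.chord q).1).reverse.length := by
    rw [List.length_reverse]
    omega
  rw [idxOf_positions h.left, label, side_val h.left, hX.chord, ← getElem_positions x _ h2, ← hX.chord,
    List.getD_eq_getElem _ _ h4, List.getElem_reverse]
  congr 2
  omega

variable {m : ℕ} {gl κ κ' ν ν' : ℕ → ℕ} {lower : Bool}

theorem describes (h : Superposed D x y) (hX : X.HasShape ν κ) (hsX : IsShape F ν κ)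
    (hY : Y.HasShape ν' κ') (hsY : IsShape F ν' κ') (hm : m ≤ F.sides)
    (hm' : ∀ s < F.sides, 0 < ν s + ν' s → s < m)
    (hgl : ∀ s : Fin F.sides, 0 < ν s + ν' s → (F.glue s : ℕ) = gl s)
    (h10 : ∀ s : Fin F.sides, ν s + ν' s ≤ 10)
    (htop : ∀ p, D.top p ↔ lower.xor (decide (p.2.val ∈ positions x p.1)) = true) :
    (Code.superposition m gl κ κ' (positions x) (positions y) lower).Describes D label := by
  have hnum : ∀ s : Fin F.sides, D.count.num s = ν s + ν' s := fun s => by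
    rw [h.num_eq, length_positions, length_positions, hX.num, hY.num]
  have hlt : ∀ p : D.Point, p.2.val < ν p.1 + ν' p.1 := fun p => by
    rw [← hnum]
    exact p.2.isLt
  have hlt10 : ∀ p : D.Point, p.2.val < 10 := fun p => (hlt p).trans_le (h10 p.1)
  have hlen : ∀ s : Fin F.sides, (positions x s).length + (positions y s).length = ν s + ν' s :=
    fun s => by rw [← h.num_eq, hnum]
  have hdiv : ∀ p : D.Point, label p / 10 = p.1 ∧ label p % 10 = p.2 := fun p =>
    label_div (hlt10 p)
  constructor
  · intro p q
    rw [← StrandCount.before_iff, StrandCount.Before, Fin.lt_def, Fin.ext_iff]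
    have := hlt10 p
    have := hlt10 q
    unfold label
    omega
  · intro i
    simp only [Code.superposition, List.mem_flatMap, List.mem_range, List.mem_map]
    constructor
    · rintro ⟨s, hs, j, hj, rfl⟩
      have hs' : s < F.sides := hs.trans_le hm
      have hj' : j < D.count.num ⟨s, hs'⟩ := by
        rw [h.num_eq]
        exact hj
      exact ⟨⟨⟨s, hs'⟩, ⟨j, hj'⟩⟩, rfl⟩
    · rintro ⟨p, rfl⟩
      exact ⟨p.1, hm' _ p.1.isLt (Nat.zero_lt_of_lt (hlt p)), p.2, by
        rw [hlen]; exact hlt p, rfl⟩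
  · refine List.nodup_flatMap.2 ⟨fun s _ => List.Nodup.map (fun a b hab => ?_) List.nodup_range, ?_⟩
    · simpa using hab
    · refine List.nodup_range.imp_of_mem ?_
      intro s t hs ht hst i hi hi'
      obtain ⟨a, ha, rfl⟩ := List.mem_map.1 hi
      obtain ⟨b, hb, hab⟩ := List.mem_map.1 hi'
      have h1 := h10 ⟨s, (List.mem_range.1 hs).trans_le hm⟩
      have h2 := h10 ⟨t, (List.mem_range.1 ht).trans_le hm⟩
      have h3 := hlen ⟨s, (List.mem_range.1 hs).trans_le hm⟩
      have h4 := hlen ⟨t, (List.mem_range.1 ht).trans_le hm⟩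
      rw [List.mem_range] at ha hb
      simp only at *
      omega
  · intro p
    simp only [Code.superposition, (hdiv p).1, (hdiv p).2]
    by_cases hp : p ∈ Set.range x
    · have hc : (positions x p.1).contains p.2.val = true :=
        List.contains_iff_mem.2 ((mem_positions h.left p).2 hp)
      rw [hc, cond_true]
      obtain ⟨q, rfl⟩ := hp
      rw [side_val h.left, h.chord_left hX hsX, h.left.2]
    · have hc : (positions x p.1).contains p.2.val = false := by
        rw [← Bool.not_eq_true, List.contains_iff_mem, mem_positions h.left]
        exact hp
      rw [hc, cond_false]
      obtain ⟨q, rfl⟩ := (h.compl p).2 hp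
      rw [side_val h.right, h.symm.chord_left hY hsY, h.right.2]
  · intro p
    simp only [Code.superposition, (hdiv p).1, (hdiv p).2]
    rw [label, StrandCount.flip_snd_val, ← h.num_eq]
    congr 2
    rw [StrandCount.flip_fst]
    exact (hgl _ (Nat.zero_lt_of_lt (hlt p))).symm
  · intro p
    simp only [Code.superposition, (hdiv p).1, (hdiv p).2, htop, List.contains_eq_mem]

end Superposed

end Curves

theorem List.eq_of_pairwise_lt {l l' : List ℕ} (h : l.Pairwise (· < ·)) (h' : l'.Pairwise (· < ·))
    (hm : ∀ x, x ∈ l ↔ x ∈ l') : l = l' :=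
  ((List.perm_ext_iff_of_nodup (h.imp fun h => h.ne) (h'.imp fun h => h.ne)).2 hm).eq_of_pairwise
    (fun _ _ _ _ h1 h2 => absurd (h1.trans h2) (lt_irrefl _)) h h'

namespace Curves.Superposed

variable {F : PolygonSurface} {D : Layered F} {X Y : Curves F} {x : X.Point → D.Point}
  {y : Y.Point → D.Point}

theorem positions_right (h : Superposed D x y) (s : Fin F.sides) : positions y s =
    (List.range ((positions x s).length + (positions y s).length)).filter
      fun i => !(positions x s).contains i := by
  refine List.eq_of_pairwise_lt (pairwise_positions h.right s)
    (List.pairwise_lt_range.filter _) fun i => ?_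
  have h1 := (h.perm s).mem_iff (a := i)
  have h2 := (List.nodup_append.1 ((h.perm s).nodup_iff.2 List.nodup_range)).2.2
  rw [List.mem_append, h.num_eq] at h1
  rw [List.mem_filter, ← h1, Bool.not_eq_true', ← Bool.not_eq_true, List.contains_iff_mem]
  constructor
  · exact fun hi => ⟨.inr hi, fun hi' => h2 i hi' i hi rfl⟩
  · tauto

theorem positions_of_num_eq_zero (h : Superposed D x y) {s : Fin F.sides}
    (hs : Y.count.num s = 0) : positions x s = List.range (X.count.num s) := by
  have h1 := h.symm.positions_right s
  have h2 : positions y s = [] := by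
    rw [← List.length_eq_zero_iff, length_positions, hs]
  rw [h1, h2, length_positions]
  simp

/-- The only freedom in superimposing a single curve is its place among the other points of a side.
The gluing reverses sides, so the place on the glued side is then fixed; this leaves finitely many
cases. -/
theorem positions_of_num_eq_one (h : Superposed D x y) {s : Fin F.sides}
    (hs : X.count.num s = 1) : ∃ i ≤ Y.count.num s, positions x s = [i] ∧
      positions x (F.glue s) = [Y.count.num s - i] := by
  have h1 : positions x s = [(x ⟨s, ⟨0, by omega⟩⟩).2.val] := by
    rw [positions_fin]
    refine List.ext_getElem (by simp [hs]) fun i hi _ => ?_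
    simp only [List.length_ofFn] at hi
    obtain rfl : i = 0 := by omega
    simp
  have h2 : (x ⟨s, ⟨0, by omega⟩⟩).2.val < D.count.num s :=
    (x ⟨s, ⟨0, by omega⟩⟩).2.isLt.trans_eq (congrArg D.count.num (h.left.1.2.1 _))
  have h3 : D.count.num s = 1 + Y.count.num s := by
    rw [h.num_eq, length_positions, length_positions, hs]
  have hg : X.count.num (F.glue s) = 1 := (X.count.num_glue s).trans hs
  have h4 : X.count.flip ⟨s, ⟨0, by omega⟩⟩ = ⟨F.glue s, ⟨0, by omega⟩⟩ :=
    eq_of_side _ rfl (by rw [StrandCount.flip_snd_val]; simp only; omega)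
  refine ⟨_, by omega, h1, ?_⟩
  rw [positions_fin]
  refine List.ext_getElem (by simp [hg]) fun i hi _ => ?_
  simp only [List.length_ofFn] at hi
  obtain rfl : i = 0 := by omega
  have h5 := h.left.1.2.2 ⟨s, ⟨0, by omega⟩⟩
  rw [h4] at h5
  simp only [List.getElem_ofFn, List.getElem_cons_zero]
  have h6 : (x ⟨F.glue s, ⟨0, by omega⟩⟩).2.val = D.count.num s - ((x ⟨s, ⟨0, by omega⟩⟩).2.val + 1) := by
    rw [h5, StrandCount.flip_snd_val]
    congr 1
    exact congrArg D.count.num (h.left.1.2.1 _)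
  rw [h6]
  omega

/-- The code of the superposition of the points in the positions `P` and `ν'` other points. -/
def _root_.Code.complementary (m : ℕ) (gl κ κ' ν' : ℕ → ℕ) (P : ℕ → List ℕ) (lower : Bool) :
    Code :=
  .superposition m gl κ κ' P (fun s => (List.range ((P s).length + ν' s)).filter fun i =>
    !(P s).contains i) lower

/-- The places of the first curve determine those of the second as their complement. A superposition
with known places thus has the complementary code, and the verified sums hold for it. -/
theorem verify_spec (h : Superposed D x y) {m : ℕ} {gl κ κ' ν ν' : ℕ → ℕ} {lower : Bool}
    (hX : X.HasShape ν κ) (hsX : IsShape F ν κ)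
    (hY : Y.HasShape ν' κ') (hsY : IsShape F ν' κ') (hm : m ≤ F.sides)
    (hm' : ∀ s, 0 < ν s + ν' s → s < m)
    (hgl : ∀ s : Fin F.sides, s.val < m → (F.glue s : ℕ) = gl s)
    (h10 : ∀ s : Fin F.sides, ν s + ν' s ≤ 10)
    (htop : ∀ p, D.top p ↔ (lower = true ↔ p ∉ Set.range x))
    {P : ℕ → List ℕ} (hP : ∀ s : Fin F.sides, s.val < m → positions x s = P s)
    (hPm : ∀ s, m ≤ s → P s = [])
    {ρ : Holonomy F (FreeGroup ℕ)} (letter : ℕ → ℕ × Bool)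
    (h1 : ∀ s : Fin F.sides, 0 < ν s + ν' s → ρ.side s = FreeGroup.mk [letter s])
    (h2 : ∀ s t : Fin F.sides, 0 < ν s + ν' s → 0 < ν t + ν' t → letter s = letter t → s = t)
    [Nonempty D.Point] {N : ℕ} {vals : List ((ℕ → ℕ → ℕ → ℤ) × ℤ)}
    (hv : (Code.complementary m gl κ κ' ν' P lower).verify
      (fun s => FreeGroup.mk [letter s]) N vals = true) :
    Fintype.card D.Crossing = N ∧ ∀ v ∈ vals,
      ∑ σ : D.State, v.1 (D.iota σ) (D.mu σ) (Nat.card (D.Component σ)) = v.2 := by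
  have hP' : positions x = P := funext fun s => by
    by_cases hs : s < m
    · exact hP ⟨s, hs.trans_le hm⟩ hs
    · rw [hPm s (by omega)]
      by_cases hs' : s < F.sides
      · rw [← List.length_eq_zero_iff, show positions x s = positions x (⟨s, hs'⟩ : Fin _) from rfl,
          length_positions, hX.num]
        by_contra h0
        exact hs (hm' s (by simp only at h0; omega))
      · exact dif_neg hs'
  have hQ' : positions y = fun s => (List.range ((P s).length + ν' s)).filter fun i =>
      !(P s).contains i := funext fun s => by
    by_cases hs' : s < F.sides
    · have := h.positions_right ⟨s, hs'⟩
      simp only [length_positions y ⟨s, hs'⟩, hY.num, hP'] at this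
      exact this
    · have : ν' s = 0 := by
        by_contra h0
        have := hm' s (by omega)
        omega
      rw [this, hPm s (by omega)]
      exact dif_neg hs'
  have hd := h.describes (m := m) (gl := gl) (lower := lower) hX hsX hY hsY hm (fun s _ => hm' s)
    (fun s hs => hgl s (hm' s hs)) h10 (fun p => by
      rw [htop, ← mem_positions h.left]
      cases lower <;> simp)
  rw [hP', hQ'] at hd
  have hused : ∀ p : D.Point, 0 < ν p.1 + ν' p.1 := fun p => by
    rw [← hX.num, ← hY.num, ← length_positions x, ← length_positions y, ← h.num_eq]
    exact Nat.zero_lt_of_lt p.2.isLt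
  have hlt10 : ∀ p : D.Point, p.2.val < 10 := fun p => by
    have := h10 p.1
    rw [← hX.num, ← hY.num, ← length_positions x, ← length_positions y, ← h.num_eq] at this
    exact p.2.isLt.trans_le this
  refine hd.verify_spec (ρ := ρ) (fun p => ?_) (fun s => letter s) (fun p => h1 _ (hused p))
    (fun p q => h2 _ _ (hused p) (hused q)) hv
  rw [(label_div (hlt10 p)).1, h1 _ (hused p)]

end Curves.Superposed

/-! ## Flat bundles over the standard surfaces -/

section StandardHolonomy

variable {G : Type*} [Group G] (g : ℕ) (a b c : ℕ → G)

/-- The holonomy of the initial part of the boundary word. -/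
def wordHolonomy : ℕ → G
  | 0 => 1
  | m + 1 => if m < g then b m * (a m)⁻¹ * (b m)⁻¹ * a m * wordHolonomy m
      else c (m - g) * wordHolonomy m

def sideHolonomy (s : ℕ) : G :=
  if s < 4 * g then
    if s % 4 = 0 then a (s / 4) else if s % 4 = 1 then b (s / 4)
    else if s % 4 = 2 then (a (s / 4))⁻¹ else (b (s / 4))⁻¹
  else if s % 2 = 0 then c ((s - 4 * g) / 2) else (c ((s - 4 * g) / 2))⁻¹

/-- Partial products along the boundary word, arranged so that each turn around the ordinary vertex
multiplies by the holonomy of the crossed side. Values at the holes are immaterial, and all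
conditions but the triviality of the whole word are built in. -/
def cornerHolonomy (s : ℕ) : G :=
  if s < 4 * g then
    if s % 4 = 0 then wordHolonomy g a b c (s / 4)
    else if s % 4 = 1 then (a (s / 4))⁻¹ * (b (s / 4))⁻¹ * a (s / 4) * wordHolonomy g a b c (s / 4)
    else if s % 4 = 2 then (b (s / 4))⁻¹ * a (s / 4) * wordHolonomy g a b c (s / 4)
    else a (s / 4) * wordHolonomy g a b c (s / 4)
  else wordHolonomy g a b c (g + (s - 4 * g) / 2)

/-- The flat bundle with given holonomies across the sides. -/
def standardHolonomy (r : ℕ) (h : wordHolonomy g a b c (g + r) = 1) :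
    Holonomy (standardSurface g r) G where
  side s := sideHolonomy g a b c s
  side_glue s := by
    change sideHolonomy g a b c (standardGlue g s) = _
    by_cases h1 : s.val < 4 * g
    · have h4 : s.val % 4 = 0 ∨ s.val % 4 = 1 ∨ s.val % 4 = 2 ∨ s.val % 4 = 3 := by omega
      rcases h4 with h4 | h4 | h4 | h4
      · rw [show standardGlue g s = s.val + 2 by unfold standardGlue; split_ifs <;> omega]
        unfold sideHolonomy
        rw [if_pos (by omega), if_neg (by omega), if_neg (by omega),
          if_pos (by omega), if_pos h1, if_pos h4, show (s.val + 2) / 4 = s.val / 4 by omega]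
      · rw [show standardGlue g s = s.val + 2 by unfold standardGlue; split_ifs <;> omega]
        unfold sideHolonomy
        rw [if_pos (by omega), if_neg (by omega), if_neg (by omega),
          if_neg (by omega), if_pos h1, if_neg (by omega), if_pos h4,
          show (s.val + 2) / 4 = s.val / 4 by omega]
      · rw [show standardGlue g s = s.val - 2 by unfold standardGlue; split_ifs <;> omega]
        unfold sideHolonomy
        rw [if_pos (by omega), if_pos (by omega), if_pos h1,
          if_neg (by omega), if_neg (by omega), if_pos h4,
          show (s.val - 2) / 4 = s.val / 4 by omega, inv_inv]
      · rw [show standardGlue g s = s.val - 2 by unfold standardGlue; split_ifs <;> omega]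
        unfold sideHolonomy
        rw [if_pos (by omega), if_neg (by omega), if_pos (by omega),
          if_pos h1, if_neg (by omega), if_neg (by omega), if_neg (by omega),
          show (s.val - 2) / 4 = s.val / 4 by omega, inv_inv]
    · by_cases h2 : s.val % 2 = 0
      · rw [show standardGlue g s = s.val + 1 by unfold standardGlue; split_ifs <;> omega]
        unfold sideHolonomy
        rw [if_neg (by omega), if_neg (by omega), if_neg h1, if_pos h2,
          show (s.val + 1 - 4 * g) / 2 = (s.val - 4 * g) / 2 by omega]
      · rw [show standardGlue g s = s.val - 1 by unfold standardGlue; split_ifs <;> omega]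
        unfold sideHolonomy
        rw [if_neg (by omega), if_pos (by omega), if_neg h1, if_neg h2,
          show (s.val - 1 - 4 * g) / 2 = (s.val - 4 * g) / 2 by omega, inv_inv]
  corner s := cornerHolonomy g a b c s
  corner_turn s hs := by
    have hr := s.isLt
    change s.val < 4 * g + 2 * r at hr
    have hh : ¬ (4 * g ≤ s.val ∧ s.val % 2 = 1) := hs
    -- After the last side the turn returns to corner `0`. The value there agrees with the next
    -- partial product because the whole word has trivial holonomy.
    have hlast : ∀ n, n = 4 * g + 2 * r →
        cornerHolonomy g a b c 0 = cornerHolonomy g a b c n := by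
      rintro n rfl
      have : cornerHolonomy g a b c 0 = 1 := by
        rcases Nat.eq_zero_or_pos g with h0 | h0
        · rw [cornerHolonomy, if_neg (by omega), show g + (0 - 4 * g) / 2 = 0 by omega]
          rfl
        · rw [cornerHolonomy, if_pos (by omega), if_pos rfl]
          rfl
      rw [this, cornerHolonomy, if_neg (by omega),
        show g + (4 * g + 2 * r - 4 * g) / 2 = g + r by omega, h]
    have hturn : cornerHolonomy g a b c ((standardSurface g r).turn s) =
        cornerHolonomy g a b c (standardGlue g s + 1) := by
      rw [PolygonSurface.turn, finRotate_val]
      change cornerHolonomy g a b c (if standardGlue g s + 1 = 4 * g + 2 * r then 0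
        else standardGlue g s + 1) = _
      split_ifs with hw
      · exact hlast _ hw
      · rfl
    rw [hturn]
    unfold standardGlue
    by_cases h1 : s.val < 4 * g
    · have h4 : s.val % 4 = 0 ∨ s.val % 4 = 1 ∨ s.val % 4 = 2 ∨ s.val % 4 = 3 := by omega
      unfold sideHolonomy
      rcases h4 with h4 | h4 | h4 | h4
      · rw [if_pos h1, if_pos (by omega), if_pos h1, if_pos h4]
        unfold cornerHolonomy
        rw [if_pos (by omega), if_neg (by omega), if_neg (by omega), if_neg (by omega), if_pos h1,
          if_pos h4, show (s.val + 2 + 1) / 4 = s.val / 4 by omega]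
      · rw [if_pos h1, if_pos (by omega), if_pos h1, if_neg (by omega), if_pos h4]
        have hw : cornerHolonomy g a b c (s.val + 2 + 1) =
            wordHolonomy g a b c (s.val / 4 + 1) := by
          unfold cornerHolonomy
          split_ifs
          · rw [show (s.val + 2 + 1) / 4 = s.val / 4 + 1 by omega]
          · omega
          · omega
          · omega
          · rw [show g + (s.val + 2 + 1 - 4 * g) / 2 = s.val / 4 + 1 by omega]
        rw [hw, wordHolonomy, if_pos (by omega)]
        unfold cornerHolonomy
        rw [if_pos h1, if_neg (by omega), if_pos h4]
        simp only [mul_assoc]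
      · rw [if_pos h1, if_neg (by omega), if_pos h1, if_neg (by omega), if_neg (by omega),
          if_pos h4]
        unfold cornerHolonomy
        rw [if_pos (by omega), if_neg (by omega), if_pos (by omega), if_pos h1, if_neg (by omega),
          if_neg (by omega), if_pos h4, show (s.val - 2 + 1) / 4 = s.val / 4 by omega]
        simp only [mul_assoc]
      · rw [if_pos h1, if_neg (by omega), if_pos h1, if_neg (by omega), if_neg (by omega),
          if_neg (by omega)]
        unfold cornerHolonomy
        rw [if_pos (by omega), if_neg (by omega), if_neg (by omega), if_pos (by omega), if_pos h1,
          if_neg (by omega), if_neg (by omega), if_neg (by omega),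
          show (s.val - 2 + 1) / 4 = s.val / 4 by omega]
        simp only [mul_assoc]
    · rw [if_neg h1, if_pos (by omega)]
      unfold cornerHolonomy sideHolonomy
      rw [if_neg (by omega), if_neg h1, if_pos (by omega), if_neg h1,
        show g + (s.val + 1 + 1 - 4 * g) / 2 = g + (s.val - 4 * g) / 2 + 1 by omega, wordHolonomy,
        if_neg (by omega), show g + (s.val - 4 * g) / 2 - g = (s.val - 4 * g) / 2 by omega]

theorem standardHolonomy_side {r : ℕ} (h : wordHolonomy g a b c (g + r) = 1)
    (s : Fin (standardSurface g r).sides) :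
    (standardHolonomy g a b c r h).side s = sideHolonomy g a b c s := rfl

end StandardHolonomy

/-! ## Parallel curves along a route -/

/-- A closed curve which runs from side `a` to side `b`, crosses to side `c`, runs to side `d` and
crosses back to side `a`; its second half may coincide with the first. -/
structure Route (F : PolygonSurface) (a b c d : ℕ) : Prop where
  lt : b < F.sides
  order : a < b ∧ (a = c ∧ b = d ∨ a < d ∧ d < c ∧ c < b)
  glue : ∀ s : Fin F.sides, (s.val = b → (F.glue s : ℕ) = c) ∧ (s.val = c → (F.glue s : ℕ) = b) ∧
    (s.val = d → (F.glue s : ℕ) = a) ∧ (s.val = a → (F.glue s : ℕ) = d)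

namespace Route

/-- The sides that are met. -/
def Meets (a b c d s : ℕ) : Prop := s = a ∨ s = b ∨ s = c ∨ s = d

instance (a b c d s : ℕ) : Decidable (Meets a b c d s) := inferInstanceAs (Decidable (_ ∨ _))

/-- The numbers of points of `n` parallel curves. -/
def num (a b c d n s : ℕ) : ℕ := if Meets a b c d s then n else 0

def partner (a b c d s : ℕ) : ℕ :=
  if s = a then b else if s = b then a else if s = c then d else if s = d then c else s

variable {F : PolygonSurface} {a b c d : ℕ}

theorem num_pos {n s : ℕ} (h : 0 < num a b c d n s) : Meets a b c d s ∧ num a b c d n s = n := by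
  unfold num at *
  split_ifs at * <;> simp_all

theorem meets_glue (h : Route F a b c d) (s : Fin F.sides) :
    Meets a b c d (F.glue s) ↔ Meets a b c d s := by
  have h1 := h.glue s
  have h2 := h.glue (F.glue s)
  rw [F.glue_glue] at h2
  unfold Meets
  omega

theorem partner_cases (h : Route F a b c d) {s : ℕ} (hs : Meets a b c d s) :
    (s = a ∧ partner a b c d s = b) ∨ (s = b ∧ partner a b c d s = a) ∨
      (s = c ∧ partner a b c d s = d) ∨ (s = d ∧ partner a b c d s = c) := by
  have := h.order
  unfold partner
  unfold Meets at hs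
  split_ifs <;> omega

theorem meets_partner (h : Route F a b c d) {s : ℕ} (hs : Meets a b c d s) :
    Meets a b c d (partner a b c d s) := by
  have := h.partner_cases hs
  unfold Meets
  omega

theorem partner_partner (h : Route F a b c d) {s : ℕ} (hs : Meets a b c d s) :
    partner a b c d (partner a b c d s) = s := by
  have h1 := h.partner_cases hs
  have h2 := h.partner_cases (h.meets_partner hs)
  have := h.order
  omega

theorem isShape (h : Route F a b c d) (n : ℕ) :
    Curves.IsShape F (num a b c d n) (partner a b c d) := by
  have ho := h.order
  have hl := h.lt
  constructor
  · intro s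
    unfold num
    simp only [h.meets_glue]
  · intro s _ hs
    have := h.partner_cases (num_pos hs).1
    omega
  · intro s _ hs
    exact h.partner_partner (num_pos hs).1
  · intro s _ hs
    have := h.partner_cases (num_pos hs).1
    omega
  · intro s _ hs
    unfold num
    rw [if_pos (h.meets_partner (num_pos hs).1), if_pos (num_pos hs).1]
  · intro s _ s' _ hs hs'
    have h1 := h.partner_cases (num_pos hs).1
    have h2 := h.partner_cases (num_pos hs').1
    omega

/-- Parallel curves along a route. -/
def curves (h : Route F a b c d) (n : ℕ) : Curves F := Curves.ofShape (h.isShape n)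

theorem hasShape (h : Route F a b c d) (n : ℕ) :
    (h.curves n).HasShape (num a b c d n) (partner a b c d) := Curves.ofShape_hasShape _

variable {D : Curves F} {n : ℕ}

theorem meets (hD : D.HasShape (num a b c d n) (partner a b c d)) (p : D.Point) :
    Meets a b c d p.1 := (num_pos (hD.pos p)).1

theorem num_eq (hD : D.HasShape (num a b c d n) (partner a b c d)) (p : D.Point) :
    D.count.num p.1 = n := by
  rw [hD.num, (num_pos (hD.pos p)).2]

/-- The number of the strand through a point. -/
def strand (a c n : ℕ) (s i : ℕ) : ℕ := if s = a ∨ s = c then i else n - (i + 1)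

theorem strand_chord (h : Route F a b c d) (hD : D.HasShape (num a b c d n) (partner a b c d))
    (p : D.Point) : strand a c n (D.chord p).1 (D.chord p).2.val = strand a c n p.1 p.2.val := by
  have h1 := hD.chord_val (h.isShape n) p
  have h2 := h.partner_cases (meets hD p)
  have h3 := h.order
  rw [(num_pos (hD.pos p)).2] at h1
  rw [hD.chord]
  unfold strand
  split_ifs <;> omega

theorem strand_flip (h : Route F a b c d) (hD : D.HasShape (num a b c d n) (partner a b c d))
    (p : D.Point) :
    strand a c n (D.count.flip p).1 (D.count.flip p).2.val = strand a c n p.1 p.2.val := by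
  have h1 := D.count.flip_snd_val p
  have h2 := h.glue p.1
  have h3 := h.order
  have h4 := meets hD p
  have h5 := p.2.isLt
  have h6 := num_eq hD p
  have h7 : ((D.count.flip p).1 : ℕ) = F.glue p.1 := rfl
  unfold strand
  unfold Meets at h4
  split_ifs <;> omega

theorem eq_of_strand (h : Route F a b c d) (hD : D.HasShape (num a b c d n) (partner a b c d))
    {p q : D.Point} (hs : p.1 = q.1)
    (he : strand a c n p.1 p.2.val = strand a c n q.1 q.2.val) : p = q := by
  refine Curves.eq_of_side _ hs ?_
  have h1 := p.2.isLt
  have h2 := q.2.isLt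
  have h3 := num_eq hD p
  have h4 := num_eq hD q
  have h5 := congrArg Fin.val hs
  unfold strand at he
  split_ifs at he <;> omega

/-- Every point on the route is linked to a point on its first side. -/
theorem exists_linked (h : Route F a b c d) (hD : D.HasShape (num a b c d n) (partner a b c d))
    (p : D.Point) : ∃ q : D.Point, q.1.val = a ∧ D.Linked p q ∧
      strand a c n q.1 q.2.val = strand a c n p.1 p.2.val := by
  have key : ∀ p : D.Point, p.1.val = b ∨ p.1.val = a → ∃ q : D.Point, q.1.val = a ∧
      D.Linked p q ∧ strand a c n q.1 q.2.val = strand a c n p.1 p.2.val := by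
    rintro p (hp | hp)
    · refine ⟨D.chord p, ?_, Alternating.left _, h.strand_chord hD p⟩
      have := h.partner_cases (meets hD p)
      have := h.order
      rw [hD.chord]
      omega
    · exact ⟨p, hp, Alternating.refl _, rfl⟩
  have key2 : ∀ p : D.Point, p.1.val = c → ∃ q : D.Point, q.1.val = a ∧
      D.Linked p q ∧ strand a c n q.1 q.2.val = strand a c n p.1 p.2.val := by
    intro p hp
    obtain ⟨q, hq1, hq2, hq3⟩ := key (D.count.flip p) (.inl ((h.glue p.1).2.1 hp))
    exact ⟨q, hq1, (Alternating.right _).trans hq2, hq3.trans (h.strand_flip hD p)⟩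
  rcases meets hD p with hp | hp | hp | hp
  · exact key p (.inr hp)
  · exact key p (.inl hp)
  · exact key2 p hp
  · obtain ⟨q, hq1, hq2, hq3⟩ := key (D.count.flip p) (.inr ((h.glue p.1).2.2.1 hp))
    exact ⟨q, hq1, (Alternating.right _).trans hq2, hq3.trans (h.strand_flip hD p)⟩

theorem linked_iff (h : Route F a b c d) (hD : D.HasShape (num a b c d n) (partner a b c d))
    (p q : D.Point) : D.Linked p q ↔
      strand a c n p.1 p.2.val = strand a c n q.1 q.2.val := by
  constructor
  · exact fun hpq => Alternating.map_eq (f := fun p : D.Point => strand a c n p.1 p.2.val)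
      (h.strand_chord hD) (h.strand_flip hD) hpq
  · intro he
    obtain ⟨p', hp1, hp2, hp3⟩ := h.exists_linked hD p
    obtain ⟨q', hq1, hq2, hq3⟩ := h.exists_linked hD q
    obtain rfl := h.eq_of_strand hD (Fin.ext (hp1.trans hq1.symm)) (hp3.trans (he.trans hq3.symm))
    exact hp2.trans hq2.symm

theorem numComp_eq (h : Route F a b c d) (hD : D.HasShape (num a b c d n) (partner a b c d)) :
    D.numComp = n := by
  have h1 : a < F.sides := h.order.1.trans h.lt
  have h2 : D.count.num ⟨a, h1⟩ = n := by
    rw [hD.num, num, if_pos (.inl rfl)]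
  rw [← Nat.card_fin n]
  refine (Nat.card_congr (Equiv.ofBijective (fun i : Fin n => (Quotient.mk D.linkedSetoid
    ⟨⟨a, h1⟩, Fin.cast h2.symm i⟩ : D.Comp)) ⟨fun i j hij => ?_, fun x => ?_⟩)).symm
  · have := (h.linked_iff hD _ _).1 (Quotient.exact hij)
    simpa [strand, Fin.ext_iff] using this
  · induction x using Quotient.inductionOn with
    | h p =>
      obtain ⟨q, hq1, hq2, -⟩ := h.exists_linked hD p
      obtain ⟨⟨s, hs⟩, i⟩ := q
      obtain rfl : s = a := hq1
      exact ⟨Fin.cast h2 i, (Quotient.sound hq2).symm⟩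

variable {G : Type*} [Group G]

/-- The curves have no sections if the holonomy along the route is not trivial. -/
theorem section_eq_none (h : Route F a b c d) (hD : D.HasShape (num a b c d n) (partner a b c d))
    {ρ : Holonomy F G} (hρ : ∀ s t : Fin F.sides, s.val = b → t.val = d → ρ.side t * ρ.side s ≠ 1)
    {f : D.Point → Option G} (hf : D.IsSection ρ f) (p : D.Point) : f p = none := by
  have key : ∀ p : D.Point, p.1.val = a → f p = none := by
    intro p hp
    have h1 : (D.chord p).1.val = b := by
      have := h.partner_cases (meets hD p)
      have := h.order
      rw [hD.chord]
      omega
    have h2 : (D.count.flip (D.chord p)).1.val = c := (h.glue _).1 h1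
    have h3 : (D.chord (D.count.flip (D.chord p))).1.val = d := by
      have := h.partner_cases (meets hD (D.count.flip (D.chord p)))
      have := h.order
      rw [hD.chord]
      omega
    have h4 : (D.count.flip (D.chord (D.count.flip (D.chord p)))).1.val = a := (h.glue _).2.2.1 h3
    have h5 : D.count.flip (D.chord (D.count.flip (D.chord p))) = p :=
      h.eq_of_strand hD (Fin.ext (h4.trans hp.symm))
        (by rw [h.strand_flip hD, h.strand_chord hD, h.strand_flip hD, h.strand_chord hD])
    -- Going once along the whole route multiplies the value by the holonomy, which acts on `G`
    -- without fixed points unless it is trivial; only `none` can return to itself.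
    have h6 : f p = (ρ.side (D.chord (D.count.flip (D.chord p))).1 * ρ.side (D.chord p).1) • f p := by
      conv_lhs => rw [← h5]
      rw [hf.flip, hf.chord, hf.flip, hf.chord, mul_smul]
    cases hp' : f p with
    | none => rfl
    | some x =>
      rw [hp'] at h6
      exact absurd (mul_eq_right.1 (Option.some_injective _ h6).symm) (hρ _ _ h1 h3)
  obtain ⟨q, hq1, hq2, -⟩ := h.exists_linked hD p
  exact (hf.congr_linked (h' := fun _ => none) ⟨fun _ => rfl, fun _ => rfl⟩ hq2).2 (key q hq1)

/-- The curves have a section if the holonomy along the route is trivial. -/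
theorem exists_section (h : Route F a b c d) (hD : D.HasShape (num a b c d n) (partner a b c d))
    {ρ : Holonomy F G} (hac : a ≠ c)
    (hρ : ∀ s t : Fin F.sides, s.val = b → t.val = d → ρ.side t * ρ.side s = 1) :
    ∃ f : D.Point → G, D.IsSection ρ f := by
  have ho := h.order
  have hb := h.lt
  refine ⟨fun p => if p.1.val = a ∨ p.1.val = b then 1 else ρ.side ⟨b, hb⟩, fun p => ?_, fun p => ?_⟩
  · have h1 := h.partner_cases (meets hD p)
    have h2 := hD.chord p
    have h3 : ((D.chord p).1.val = a ∨ (D.chord p).1.val = b) ↔ (p.1.val = a ∨ p.1.val = b) := by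
      omega
    simp only [h3]
  · have h1 := h.glue p.1
    have hg := ρ.side_glue p.1
    have h2 := hρ ⟨b, hb⟩ ⟨d, by omega⟩ rfl rfl
    rw [StrandCount.flip_fst]
    rcases meets hD p with hp | hp | hp | hp
    · rw [if_neg (by omega), if_pos (.inl hp), smul_eq_mul, mul_one]
      have h3 : F.glue p.1 = ⟨d, by omega⟩ := Fin.ext (h1.2.2.2 hp)
      rw [h3] at hg
      rw [eq_inv_of_mul_eq_one_left h2, inv_inj] at hg
      exact hg
    · rw [if_neg (by omega), if_pos (.inr hp), smul_eq_mul, mul_one, show p.1 = ⟨b, hb⟩ from Fin.ext hp]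
    · rw [if_pos (.inr (h1.2.1 hp)), if_neg (by omega), smul_eq_mul]
      rw [show F.glue p.1 = ⟨b, hb⟩ from Fin.ext (h1.2.1 hp)] at hg
      rw [hg, mul_inv_cancel]
    · rw [if_pos (.inl (h1.2.2.1 hp)), if_neg (by omega), smul_eq_mul,
        show p.1 = ⟨d, by omega⟩ from Fin.ext hp, h2]

/-- Curves whose chords follow the route are parallel curves. -/
theorem hasShape_of_chord (h : Route F a b c d) (hm : ∀ p : D.Point, Meets a b c d p.1)
    (hc : ∀ p : D.Point, ((D.chord p).1 : ℕ) = partner a b c d p.1) (hn : D.numComp = n) :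
    D.HasShape (num a b c d n) (partner a b c d) := by
  have hl := h.lt
  have ho := h.order
  -- Chords inject the points of a side into those of its partner, so partners have equally many
  -- points. The gluing of `b` to `c` carries the equality over to the other pair.
  have key : ∀ s t : Fin F.sides, t.val = partner a b c d s → D.count.num s ≤ D.count.num t := by
    intro s t hst
    have h1 : ∀ i : Fin (D.count.num s), (D.chord ⟨s, i⟩).1 = t := fun i =>
      Fin.ext ((hc ⟨s, i⟩).trans hst.symm)
    have := Fintype.card_le_of_injective
      (fun i : Fin (D.count.num s) => Fin.cast (congrArg D.count.num (h1 i)) (D.chord ⟨s, i⟩).2)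
      fun i j hij => by
        have h3 : D.chord ⟨s, i⟩ = D.chord ⟨s, j⟩ := Curves.eq_of_side _ ((h1 i).trans (h1 j).symm)
          (by simpa [Fin.ext_iff] using hij)
        simpa using D.chord_injective h3
    simpa using this
  have hp : ∀ s t, s = a ∧ t = b ∨ s = b ∧ t = a ∨ s = c ∧ t = d ∨ s = d ∧ t = c →
      t = partner a b c d s := by
    intro s t hst
    have := h.partner_cases (s := s) (by unfold Meets; omega)
    omega
  let A : Fin F.sides := ⟨a, by omega⟩
  let B : Fin F.sides := ⟨b, by omega⟩
  let C : Fin F.sides := ⟨c, by omega⟩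
  let E : Fin F.sides := ⟨d, by omega⟩
  have h1 := key A B (hp _ _ (by simp [A, B]))
  have h2 := key B A (hp _ _ (by simp [A, B]))
  have h3 := key C E (hp _ _ (by simp [C, E]))
  have h4 := key E C (hp _ _ (by simp [C, E]))
  have h5 : D.count.num B = D.count.num C := by
    rw [← D.count.num_glue C, show F.glue C = B from Fin.ext ((h.glue C).2.1 rfl)]
  have hD : D.HasShape (num a b c d (D.count.num A)) (partner a b c d) := by
    refine ⟨fun s => ?_, hc⟩
    unfold num
    split_ifs with hs
    · rcases hs with hs | hs | hs | hs
      · rw [show s = A from Fin.ext hs]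
      · rw [show s = B from Fin.ext hs]; omega
      · rw [show s = C from Fin.ext hs]; omega
      · rw [show s = E from Fin.ext hs]; omega
    · by_contra h0
      exact hs (hm ⟨s, ⟨0, Nat.pos_of_ne_zero h0⟩⟩)
  rwa [← hn, h.numComp_eq hD]

end Route

/-! ## Curves without sections -/

namespace ChordDiagram

variable {F : PolygonSurface} {G : Type*} [Group G]

/-- A flat bundle has no sections over any component of the curves. -/
def Sectionless (D : ChordDiagram F) (ρ : Holonomy F G) : Prop :=
  ∀ f : D.Point → Option G, D.IsSection ρ f → ∀ p, f p = none

variable {D : ChordDiagram F} {ρ : Holonomy F G}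

theorem isSection_none (D : ChordDiagram F) (ρ : Holonomy F G) :
    D.IsSection ρ fun _ => (none : Option G) := ⟨fun _ => rfl, fun _ => rfl⟩

open Classical in
/-- A section over a union of components extends by `none`. -/
theorem isSection_of_closed {f : D.Point → G} {R : D.Point → Prop}
    (hc : ∀ p, R (D.chord p) ↔ R p) (hf : ∀ p, R (D.count.flip p) ↔ R p)
    (h1 : ∀ p, R p → f (D.chord p) = f p) (h2 : ∀ p, R p → f (D.count.flip p) = ρ.side p.1 • f p) :
    D.IsSection ρ fun p => if R p then some (f p) else none := by
  refine ⟨fun p => ?_, fun p => ?_⟩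
  · simp only [hc]
    split_ifs with h
    · rw [h1 p h]
    · rfl
  · simp only [hf]
    split_ifs with h
    · rw [h2 p h]
      rfl
    · rfl

/-- Otherwise the constant `1` would be a section over the component. This forces components to meet
certain sides and so bounds the size of representatives from below. -/
theorem Sectionless.exists_side_ne_one (h : D.Sectionless ρ) (p : D.Point) :
    ∃ q, D.Linked p q ∧ ρ.side q.1 ≠ 1 := by
  classical
  by_contra! hp
  have := h _ (isSection_of_closed (f := fun _ => 1) (R := D.Linked p)
    (fun q => ⟨fun h => h.trans (Alternating.left _).symm, fun h => h.trans (Alternating.left _)⟩)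
    (fun q => ⟨fun h => h.trans (Alternating.right _).symm, fun h => h.trans (Alternating.right _)⟩)
    (fun q _ => rfl) (fun q hq => by rw [hp q hq, one_smul])) p
  rw [if_pos (show D.Linked p p from Alternating.refl p)] at this
  exact Option.some_ne_none _ this

end ChordDiagram

namespace Curves

variable {F : PolygonSurface} {G : Type*} [Group G] {D D' : Curves F} {ρ : Holonomy F G}

/-- With values in `Option G` a section over one component extends to all by `none`. Having no
section over any component then means that there is only one section in all, which isotopy
preserves. -/
theorem Isotopic.sectionless (hi : D.Isotopic D') (h : D.Sectionless ρ) : D'.Sectionless ρ := by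
  obtain ⟨e⟩ := hi.sections (X := Option G) ρ
  have hs : Subsingleton {f : D.Point → Option G // D.IsSection ρ f} :=
    ⟨fun f f' => Subtype.ext (funext fun p => (h _ f.2 p).trans (h _ f'.2 p).symm)⟩
  have hs' := e.symm.injective.subsingleton
  intro f hf p
  exact congrFun (congrArg Subtype.val (Subsingleton.elim (⟨f, hf⟩ : {f : D'.Point → Option G //
    D'.IsSection ρ f}) ⟨_, D'.isSection_none ρ⟩)) p

theorem _root_.ChordDiagram.Sectionless.not_inessential (h : D.Sectionless ρ) {K : Curves F}
    {e : K.Point → D.Point} (he : K.IsSubEmb D.toChordDiagram e) : ¬ K.Inessential := by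
  classical
  intro hK
  obtain ⟨f, hf⟩ := hK.exists_section ρ
  obtain ⟨⟨p⟩, -⟩ := Curves.numComp_eq_one_iff.1 hK.numComp_eq_one
  haveI : Nonempty K.Point := ⟨p⟩
  have hx : ∀ x, Function.invFun e (e x) = x := Function.leftInverse_invFun he.1.injective
  have hmem : ∀ t : D.Point → D.Point, (∀ q, t (t q) = q) →
      (∀ x, ∃ y, e y = t (e x)) → ∀ q, t q ∈ Set.range e ↔ q ∈ Set.range e := by
    intro t ht hy q
    constructor
    · rintro ⟨x, hx⟩
      rw [← ht q, ← hx]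
      exact hy x
    · rintro ⟨x, rfl⟩
      exact hy x
  have := h _ (ChordDiagram.isSection_of_closed (R := fun q => q ∈ Set.range e)
    (f := fun q => f (Function.invFun e q))
    (hmem _ D.chord_chord fun x => ⟨_, he.2 x⟩) (hmem _ D.count.flip_flip fun x => ⟨_, he.1.2.2 x⟩)
    (by rintro _ ⟨x, rfl⟩; simp only [← he.2, hx, hf.chord])
    (by rintro _ ⟨x, rfl⟩; simp only [← he.1.2.2, hx, hf.flip, he.1.2.1])) (e p)
  rw [if_pos ⟨p, rfl⟩] at this
  exact Option.some_ne_none _ this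

/-- Curves without sections as a curve system. -/
def toSystem (D : Curves F) (h : D.Sectionless ρ) : CurveSystem F :=
  ⟨D, fun _ _ he => h.not_inessential he⟩

end Curves

namespace CurveSystem

variable {F : PolygonSurface}

theorem ext_curves {A B : CurveSystem F} (h : A.toCurves = B.toCurves) : A = B := by
  cases A
  cases B
  cases h
  rfl

/-- The components of a curve system have no sections in a free group on the sides that they meet. -/
theorem sectionless {α : Type*} (S : CurveSystem F) (ρ : Holonomy F (FreeGroup α))
    (letter : Fin F.sides → α × Bool) (h1 : ∀ p : S.Point, ρ.side p.1 = FreeGroup.mk [letter p.1])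
    (h2 : ∀ p q : S.Point, letter p.1 = letter q.1 → p.1 = q.1) : S.Sectionless ρ := by
  intro f hf p
  by_contra hp
  have hchord : ∀ q, S.Linked p q → S.Linked p (S.chord q) := fun q h => h.trans (Alternating.left q)
  have hflip : ∀ q, S.Linked p q → S.Linked p (S.count.flip q) := fun q h =>
    h.trans (Alternating.right q)
  obtain ⟨K, e, he, hr, hc⟩ := Curves.exists_of_pairing S.count {q | S.Linked p q} hflip S.chord
    hchord (fun q _ => S.chord_chord q) (fun q _ => S.chord_ne q) fun q _ q' _ => S.noncrossing q q'
  have hmem : ∀ x, S.Linked p (e x) := fun x => (Set.ext_iff.1 hr _).1 ⟨x, rfl⟩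
  have hsub : K.IsSubEmb S.toChordDiagram e := ⟨he, hc⟩
  obtain ⟨x₀, hx₀⟩ : p ∈ Set.range e := by
    rw [hr]
    exact Alternating.refl p
  have hne : ∀ x, f (e x) ≠ none := fun x hx =>
    hp ((hf.congr_linked (S.isSection_none ρ) (hmem x)).2 hx)
  refine S.essential K e hsub (Curves.inessential_of_section ρ letter K ?_
    (fun x => by rw [← he.2.1 x, h1]) (fun x y => by rw [← he.2.1 x, ← he.2.1 y]; exact h2 _ _)
    ⟨fun x => (f (e x)).get (Option.isSome_iff_ne_none.2 (hne x)), fun x => ?_, fun x => ?_⟩)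
  · refine Curves.numComp_eq_one_iff.2 ⟨⟨x₀⟩, fun x y => ?_⟩
    exact (ChordDiagram.linked_iff_of_isSubEmb hsub x y).1 ((hmem x).symm.trans (hmem y))
  · have := hf.chord (e x)
    rw [← hc] at this
    simp only [this]
  · have := hf.flip (e x)
    rw [← he.2.2, he.2.1] at this
    refine Option.some_injective _ ?_
    rw [Option.some_get, this, smul_eq_mul]
    conv_lhs => rw [← Option.some_get (Option.isSome_iff_ne_none.2 (hne x))]
    rfl

end CurveSystem

namespace Route

variable {F : PolygonSurface} {a b c d : ℕ}

open Classical in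
/-- Curves without sections, the chords of which return to their side or follow the route, are
isotopic to parallel curves along the route. -/
theorem isotopic_of_chord (h : Route F a b c d) {G : Type*} [Group G] {ρ : Holonomy F G} :
    ∀ D : Curves F, D.Sectionless ρ → (∀ p : D.Point, Meets a b c d p.1) →
    (∀ p : D.Point, (D.chord p).1 = p.1 ∨ ((D.chord p).1 : ℕ) = partner a b c d p.1) →
    D.Isotopic (h.curves D.numComp) := by
  intro D
  induction hn : Fintype.card D.Point using Nat.strong_induction_on generalizing D with
  | _ n ih =>
    intro hs hm hc
    by_cases hex : ∃ p : D.Point, (D.chord p).1 = p.1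
    · obtain ⟨p, hp⟩ := hex
      obtain ⟨p, q, hpq, hv, hcp⟩ := D.exists_adjacent hp
      -- If the strand also returned beyond the side, the four points would form a small circle,
      -- over which there is a section.
      have hne : D.chord (D.count.flip p) ≠ D.count.flip q := by
        intro hf
        have hcq : D.chord q = p := by rw [← hcp, D.chord_chord]
        have hfq : D.chord (D.count.flip q) = D.count.flip p := by rw [← hf, D.chord_chord]
        have hne1 : D.count.flip p ≠ p := D.count.flip_ne p
        have hclosed : ∀ t : D.Point → D.Point, (∀ z, t (t z) = z) → ∀ Q : D.Point → Prop,
            (∀ z, Q z → Q (t z)) → ∀ z, Q (t z) ↔ Q z :=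
          fun t ht Q hQ z => ⟨fun hz => by simpa [ht] using hQ _ hz, hQ z⟩
        have hside : (D.count.flip p).1 ≠ p.1 := by
          rw [StrandCount.flip_fst]
          exact F.glue_ne _
        have := hs _ (ChordDiagram.isSection_of_closed (D := D.toChordDiagram)
          (R := fun z => z = p ∨ z = q ∨ z = D.count.flip p ∨ z = D.count.flip q)
          (f := fun z => if z.1 = p.1 then 1 else ρ.side p.1)
          (hclosed _ D.chord_chord (fun z => z = p ∨ z = q ∨ z = D.count.flip p ∨
            z = D.count.flip q) (by
            rintro z (rfl | rfl | rfl | rfl)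
            · exact .inr (.inl hcp)
            · exact .inl hcq
            · exact .inr (.inr (.inr hf))
            · exact .inr (.inr (.inl hfq))))
          (hclosed _ D.count.flip_flip (fun z => z = p ∨ z = q ∨ z = D.count.flip p ∨
            z = D.count.flip q) (by
            rintro z (rfl | rfl | rfl | rfl)
            · exact .inr (.inr (.inl rfl))
            · exact .inr (.inr (.inr rfl))
            · exact .inl (D.count.flip_flip _)
            · exact .inr (.inl (D.count.flip_flip _))))
          (by
            rintro z (rfl | rfl | rfl | rfl)
            · rw [hcp, hpq]
            · rw [hcq, hpq]
            · rw [hf, StrandCount.flip_fst, StrandCount.flip_fst, hpq]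
            · rw [hfq, StrandCount.flip_fst, StrandCount.flip_fst, hpq])
          (by
            rintro z (rfl | rfl | rfl | rfl)
            · rw [if_neg hside, if_pos rfl, smul_eq_mul, mul_one]
            · rw [if_neg (by rw [StrandCount.flip_fst, ← hpq]; exact hside), if_pos hpq.symm, hpq,
                smul_eq_mul, mul_one]
            · rw [D.count.flip_flip, if_pos rfl, if_neg hside, StrandCount.flip_fst, ρ.side_glue,
                smul_eq_mul, inv_mul_cancel]
            · rw [D.count.flip_flip, if_pos hpq.symm,
                if_neg (by rw [StrandCount.flip_fst, ← hpq]; exact hside), StrandCount.flip_fst,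
                ρ.side_glue, hpq, smul_eq_mul, inv_mul_cancel])) p
        rw [if_pos (.inl rfl)] at this
        exact Option.some_ne_none _ this
      obtain ⟨D', hD', e, he, hes, hep⟩ := D.exists_finger hpq hv hcp hne
      have hi : D.Isotopic D' := .rel _ _ (Or.inl hD')
      rw [hi.numComp_eq]
      refine .trans _ _ _ hi (ih _ (hn ▸ Curves.card_lt_of_embedding he hep) D' rfl
        (hi.sectionless hs) (fun x => by rw [← hes]; exact hm _) fun x => ?_)
      obtain ⟨p', q', h1, -, -, -, e', he', -, hx⟩ := hD'
      -- On the route a chord leads from a side to itself or to its partner. Two such steps combine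
      -- to a step of the same kind, so the joined strand still satisfies the hypothesis.
      have hcl : ∀ {s t u : Fin F.sides}, (t = s ∨ t.val = partner a b c d s) →
          (u = s ∨ u.val = partner a b c d s) → Meets a b c d s → u = t ∨ u.val = partner a b c d t := by
        rintro s t u (rfl | ht) (rfl | hu) hs
        · exact .inl rfl
        · exact .inr hu
        · refine .inr ?_
          rw [ht, h.partner_partner hs]
        · exact .inl (Fin.ext (hu.trans ht.symm))
      have h2 : (D.count.flip q').1 = (D.count.flip p').1 := by
        rw [StrandCount.flip_fst, StrandCount.flip_fst, h1]
      obtain ⟨hx1, hx2, hx3⟩ := hx x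
      rw [← he'.2.1, ← he'.2.1 x]
      by_cases k1 : D.chord (e' x) = D.count.flip p'
      · rw [hx1 k1]
        refine hcl (s := (D.count.flip p').1) ?_ ?_ (hm _)
        · rw [← D.chord_chord (e' x), k1]
          exact hc _
        · rw [← h2]
          exact hc _
      · by_cases k2 : D.chord (e' x) = D.count.flip q'
        · rw [hx2 k2]
          refine hcl (s := (D.count.flip p').1) ?_ (hc _) (hm _)
          rw [← D.chord_chord (e' x), k2, ← h2]
          exact hc _
        · rw [hx3 k1 k2]
          exact hc _
    · push Not at hex
      have := h.hasShape_of_chord hm (fun p => (hc p).resolve_left (hex p)) rfl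
      rw [this.eq (h.hasShape _) (h.isShape _)]
      rw [h.numComp_eq (h.hasShape _)]
      exact .refl _

/-- Essential curves whose chords return to their side or follow the route. -/
theorem eq_mk_of_chord (h : Route F a b c d) {G α : Type*} [Group G] {ρ : Holonomy F G}
    (hρ : ∀ n, (h.curves n).Sectionless ρ) {ρ' : Holonomy F (FreeGroup α)}
    (letter : ℕ → α × Bool)
    (h1 : ∀ s : Fin F.sides, Meets a b c d s → ρ'.side s = FreeGroup.mk [letter s])
    (h2 : ∀ s t : ℕ, Meets a b c d s → Meets a b c d t → letter s = letter t → s = t)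
    (S : CurveSystem F) (hm : ∀ p : S.Point, Meets a b c d p.1)
    (hc : ∀ p : S.Point, (S.chord p).1 = p.1 ∨ ((S.chord p).1 : ℕ) = partner a b c d p.1) :
    Quotient.mk (CurveSystem.isotopy F) S =
      Quotient.mk (CurveSystem.isotopy F) ((h.curves S.numComp).toSystem (hρ _)) :=
  Quotient.sound (h.isotopic_of_chord S.toCurves (S.sectionless ρ' (fun s => letter s)
    (fun p => h1 _ (hm p)) fun p q hpq => Fin.ext (h2 _ _ (hm p) (hm q) hpq)) hm hc)

theorem card_curves_le (h : Route F a b c d) (n : ℕ) :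
    Fintype.card (h.curves n).Point ≤ ({a, b, c, d} : Finset ℕ).card * n := by
  have h1 : Fintype.card (h.curves n).Point = ∑ s : Fin F.sides, num a b c d n s := by
    rw [Fintype.card_sigma]
    refine Finset.sum_congr rfl fun s _ => ?_
    rw [Fintype.card_fin, (h.hasShape n).num]
  rw [h1]
  unfold num
  rw [Finset.sum_ite, Finset.sum_const_zero, add_zero, Finset.sum_const, smul_eq_mul]
  refine Nat.mul_le_mul_right _ (Finset.card_le_card_of_injOn Fin.val (fun s hs => ?_)
    Fin.val_injective.injOn)
  have := (Finset.mem_filter.1 hs).2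
  simpa [Meets] using this

end Route

namespace Curves

variable {F : PolygonSurface} {D : Curves F}

open Classical in
-- Equality in a sum of lower bounds forces equality in each term: no component of a shortest
-- representative has points to spare.
theorem card_linked_eq {m : ℕ} (hle : ∀ p : D.Point, m ≤ (Finset.univ.filter (D.Linked p)).card)
    (hcard : Fintype.card D.Point ≤ m * D.numComp) (p : D.Point) :
    (Finset.univ.filter (D.Linked p)).card = m := by
  haveI : Fintype D.Comp := Fintype.ofFinite _
  have hf : ∀ p, (Finset.univ.filter fun q => (Quotient.mk D.linkedSetoid q : D.Comp) =
      Quotient.mk D.linkedSetoid p) = Finset.univ.filter (D.Linked p) := fun p => by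
    refine Finset.filter_congr fun q _ => ?_
    rw [Quotient.eq]
    exact ⟨Alternating.symm, Alternating.symm⟩
  have h1 := Finset.card_eq_sum_card_fiberwise (s := (Finset.univ : Finset D.Point))
    (t := (Finset.univ : Finset D.Comp)) (f := fun q => Quotient.mk D.linkedSetoid q)
    fun _ _ => Finset.mem_coe.2 (Finset.mem_univ _)
  have h2 : ∀ c ∈ (Finset.univ : Finset D.Comp), m ≤ (Finset.univ.filter fun q =>
      (Quotient.mk D.linkedSetoid q : D.Comp) = c).card := by
    intro c _
    induction c using Quotient.inductionOn with
    | h p => rw [hf]; exact hle p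
  have h3 : ∑ _c : D.Comp, m = m * D.numComp := by
    rw [Finset.sum_const, Finset.card_univ, smul_eq_mul, mul_comm, ChordDiagram.numComp, Nat.card_eq_fintype_card]
  have h4 := (Finset.sum_eq_sum_iff_of_le h2).1 (le_antisymm (Finset.sum_le_sum h2) (by
    rw [h3, ← h1]
    exact hcard)) (Quotient.mk D.linkedSetoid p) (Finset.mem_univ _)
  rw [hf] at h4
  exact h4.symm

end Curves

/-- Commutators vanish in an abelian group, so handles impose no condition and only the product over
the holes remains. -/
theorem wordHolonomy_comm {G : Type*} [CommGroup G] (g : ℕ) (a b c : ℕ → G) (m : ℕ) :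
    wordHolonomy g a b c m = ∏ i ∈ Finset.range (m - g), c i := by
  induction m with
  | zero => simp [wordHolonomy]
  | succ m ih =>
    rw [wordHolonomy, ih]
    split_ifs with h
    · rw [show m + 1 - g = 0 by omega, show m - g = 0 by omega, mul_right_comm (b m),
        mul_inv_cancel, one_mul, inv_mul_cancel, one_mul]
    · rw [show m + 1 - g = m - g + 1 by omega, Finset.prod_range_succ, mul_comm]

theorem wordHolonomy_eq {G : Type*} [Group G] (g : ℕ) (a b c : ℕ → G) {m₀ m : ℕ} (hm : m₀ ≤ m)
    (ha : ∀ i, m₀ ≤ i → a i = 1) (hb : ∀ i, m₀ ≤ i → b i = 1)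
    (hc : ∀ i, m₀ ≤ i + g → c i = 1) : wordHolonomy g a b c m = wordHolonomy g a b c m₀ := by
  induction m, hm using Nat.le_induction with
  | base => rfl
  | succ m hm ih =>
    rw [wordHolonomy, ih, ha m hm, hb m hm]
    split_ifs with h
    · simp
    · rw [hc _ (by omega), one_mul]

/-! ### Shortest representatives of curves along a handle. -/

section PositiveGenus

variable {g r : ℕ}

theorem route_torus (hg : 1 ≤ g) {e : ℕ} (he : e < 2) :
    Route (standardSurface g r) e (e + 2) e (e + 2) where
  lt := show e + 2 < 4 * g + 2 * r by omega
  order := by omega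
  glue s := by
    change (_ → standardGlue g s = _) ∧ (_ → standardGlue g s = _) ∧ (_ → standardGlue g s = _) ∧
      (_ → standardGlue g s = _)
    unfold standardGlue
    split_ifs <;> omega

/-- The bundle over the surface with the holonomies `x` and `y` along the first handle. -/
def handleHolonomy (x y : Multiplicative ℤ) : Holonomy (standardSurface g r) (Multiplicative ℤ) :=
  standardHolonomy g (Pi.mulSingle 0 x) (Pi.mulSingle 0 y) 1 r (by rw [wordHolonomy_comm]; simp)

theorem sectionless_torus (hg : 1 ≤ g) {e : ℕ} (he : e < 2) (n : ℕ) :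
    ((route_torus (r := r) hg he).curves n).Sectionless
      (handleHolonomy (if e = 0 then .ofAdd 1 else 1) (if e = 0 then 1 else .ofAdd 1)) := by
  refine fun f hf => (route_torus hg he).section_eq_none ((route_torus hg he).hasShape n)
    (fun s t hs ht => ?_) hf
  -- The two halves of this route coincide, so the square of the holonomy appears; it is nontrivial
  -- because the integers have no torsion.
  rw [handleHolonomy, standardHolonomy_side, standardHolonomy_side, hs, ht, sideHolonomy]
  rcases (show e = 0 ∨ e = 1 by omega) with rfl | rfl
  · rw [if_pos (by omega)]
    simp [Pi.mulSingle]
    decide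
  · rw [if_pos (by omega)]
    simp [Pi.mulSingle]
    decide

theorem side_of_handleHolonomy (hg : 1 ≤ g) {e : ℕ} (he : e < 2) {s : Fin (standardSurface g r).sides}
    (hs : (handleHolonomy (if e = 0 then .ofAdd 1 else 1) (if e = 0 then 1 else .ofAdd 1) :
      Holonomy (standardSurface g r) _).side s ≠ 1) : s.val = e ∨ s.val = e + 2 := by
  by_contra! hne
  apply hs
  rw [handleHolonomy, standardHolonomy_side, sideHolonomy]
  have hv : ∀ (x : Multiplicative ℤ) (i : ℕ), (Pi.mulSingle 0 x : ℕ → Multiplicative ℤ) i =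
      if i = 0 then x else 1 := fun x i => Pi.mulSingle_apply _ _ _
  simp only [hv, Pi.one_apply]
  split_ifs <;> first | rfl | (exfalso; omega)

/-- The representatives with the fewest points of parallel curves around the first handle. -/
theorem hasShape_of_isotopic_torus (hg : 1 ≤ g) {e : ℕ} (he : e < 2) {n : ℕ}
    {A : Curves (standardSurface g r)} (hi : A.Isotopic ((route_torus hg he).curves n))
    (hcard : Fintype.card A.Point ≤ Fintype.card ((route_torus (r := r) hg he).curves n).Point) :
    A.HasShape (Route.num e (e + 2) e (e + 2) n) (Route.partner e (e + 2) e (e + 2)) := by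
  classical
  have hR := route_torus (r := r) hg he
  have hn : A.numComp = n := hi.numComp_eq.trans (hR.numComp_eq (hR.hasShape n))
  have hs := Curves.Isotopic.sectionless (hi.symm _ _) (sectionless_torus (r := r) hg he n)
  -- Every component has to cross the edge with nontrivial holonomy, which gives two points on it. A
  -- shortest representative has no others, so each chord joins the two copies of one point of the
  -- surface.
  have hex : ∀ p : A.Point, ∃ q, A.Linked p q ∧ (q.1.val = e ∨ q.1.val = e + 2) := fun p => by
    obtain ⟨q, h1, h2⟩ := hs.exists_side_ne_one p
    exact ⟨q, h1, side_of_handleHolonomy hg he h2⟩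
  have hsub : ∀ p q : A.Point, A.Linked p q →
      ({q, A.count.flip q} : Finset A.Point) ⊆ Finset.univ.filter (A.Linked p) := by
    intro p q hpq z hz
    rw [Finset.mem_insert, Finset.mem_singleton] at hz
    rw [Finset.mem_filter]
    rcases hz with rfl | rfl
    · exact ⟨Finset.mem_univ _, hpq⟩
    · exact ⟨Finset.mem_univ _, hpq.trans (Alternating.right _)⟩
  have htwo : ∀ q : A.Point, ({q, A.count.flip q} : Finset A.Point).card = 2 := fun q =>
    Finset.card_pair (A.count.flip_ne q).symm
  have hcl := Curves.card_linked_eq (m := 2) (D := A) (fun p => by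
    obtain ⟨q, h1, -⟩ := hex p
    rw [← htwo q]
    exact Finset.card_le_card (hsub p q h1)) (by
    have := hR.card_curves_le n
    rw [show ({e, e + 2, e, e + 2} : Finset ℕ) = {e, e + 2} by ext; simp,
      Finset.card_pair (by omega)] at this
    rw [hn]
    exact hcard.trans this)
  have hmem : ∀ p q z : A.Point, A.Linked p q → A.Linked p z → z = q ∨ z = A.count.flip q := by
    intro p q z hq hz
    have := Finset.eq_of_subset_of_card_le (hsub p q hq) (by rw [hcl, htwo])
    simpa [← this] using (Finset.mem_filter.2 ⟨Finset.mem_univ z, hz⟩ :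
      z ∈ Finset.univ.filter (A.Linked p))
  have hchord : ∀ p : A.Point, A.chord p = A.count.flip p := fun p =>
    (hmem p p _ (Alternating.refl p) (Alternating.left p)).resolve_left (A.chord_ne p)
  have hside : ∀ p : A.Point, p.1.val = e ∨ p.1.val = e + 2 := by
    intro p
    obtain ⟨q, h1, h2⟩ := hex p
    rcases hmem p q p h1 (Alternating.refl p) with h3 | h3
    · rwa [h3]
    · rw [h3, StrandCount.flip_fst]
      have := hR.glue q.1
      omega
  refine hR.hasShape_of_chord (fun p => ?_) (fun p => ?_) hn
  · have := hside p
    unfold Route.Meets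
    omega
  · rw [hchord, StrandCount.flip_fst]
    have h1 := hR.glue p.1
    have h2 := hside p
    unfold Route.partner
    split_ifs <;> omega

end PositiveGenus

/-! ### Curves around two holes of a sphere. -/

section GenusZero

variable {r : ℕ}

/-- Sides `2j` and `2j + 1` are the two copies of the edge ending at hole `j`; crossing the edges of
`j` and `k` once each gives a curve around these two holes. -/
theorem route_sphere {j k : ℕ} (hjk : j < k) (hk : k < r) :
    Route (standardSurface 0 r) (2 * j) (2 * k + 1) (2 * k) (2 * j + 1) where
  lt := show 2 * k + 1 < 4 * 0 + 2 * r by omega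
  order := by omega
  glue s := by
    change (_ → standardGlue 0 s = _) ∧ (_ → standardGlue 0 s = _) ∧ (_ → standardGlue 0 s = _) ∧
      (_ → standardGlue 0 s = _)
    unfold standardGlue
    split_ifs <;> omega

theorem glue_sphere (s : Fin (standardSurface 0 r).sides) :
    ((standardSurface 0 r).glue s : ℕ) = if s.val % 2 = 0 then s.val + 1 else s.val - 1 := by
  change standardGlue 0 s = _
  unfold standardGlue
  rw [if_neg (by omega)]

theorem sideHolonomy_sphere {G : Type*} [Group G] (a b c : ℕ → G) (s : ℕ) :
    sideHolonomy 0 a b c s = if s % 2 = 0 then c (s / 2) else (c (s / 2))⁻¹ := by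
  rw [sideHolonomy, if_neg (by omega)]
  simp

/-- The bundle with opposite holonomies around two holes. -/
def holeHolonomy {j k : ℕ} (hj : j < r) (hk : k < r) :
    Holonomy (standardSurface 0 r) (Multiplicative ℤ) :=
  standardHolonomy 0 1 1 (Pi.mulSingle j (.ofAdd 1) * Pi.mulSingle k (.ofAdd (-1))) r (by
    rw [wordHolonomy_comm]
    simp [Finset.prod_mul_distrib, Finset.prod_pi_mulSingle', hj, hk])

theorem side_of_holeHolonomy {j k : ℕ} {hj : j < r} {hk : k < r}
    {s : Fin (standardSurface 0 r).sides} (hs : (holeHolonomy hj hk).side s ≠ 1) :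
    s.val / 2 = j ∨ s.val / 2 = k := by
  by_contra! hne
  apply hs
  rw [holeHolonomy, standardHolonomy_side, sideHolonomy_sphere]
  simp [hne]

/-- The curve separates hole `i` from hole `l`. Only one of the two opposite generators is enclosed,
so the holonomy along the curve is nontrivial. -/
theorem sectionless_sphere {j k i l : ℕ} (hjk : j < k) (hk : k < r) (hi : i < r) (hl : l < r)
    (h1 : i = j ∨ i = k) (h2 : l ≠ j ∧ l ≠ k) (n : ℕ) :
    ((route_sphere hjk hk).curves n).Sectionless (holeHolonomy hi hl) := by
  refine fun f hf => (route_sphere hjk hk).section_eq_none ((route_sphere hjk hk).hasShape n)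
    (fun s t hs ht => ?_) hf
  rw [holeHolonomy, standardHolonomy_side, standardHolonomy_side, hs, ht, sideHolonomy_sphere,
    sideHolonomy_sphere, if_neg (by omega), if_neg (by omega),
    show (2 * j + 1) / 2 = j by omega, show (2 * k + 1) / 2 = k by omega]
  rcases h1 with rfl | rfl
  · simp [h2.1.symm, h2.2.symm, hjk.ne']
  · simp [h2.1.symm, h2.2.symm, hjk.ne]

end GenusZero

/-! ### Shortest representatives on a sphere with holes. -/

section GenusZero

variable {r : ℕ} {A : Curves (standardSurface 0 r)}

theorem side_flip_sphere (p : A.Point) :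
    ((A.count.flip p).1 : ℕ) = if p.1.val % 2 = 0 then p.1.val + 1 else p.1.val - 1 :=
  glue_sphere p.1

theorem exists_even_sphere {p q : A.Point} (h : A.Linked p q) :
    ∃ u : A.Point, A.Linked p u ∧ u.1.val = 2 * (q.1.val / 2) := by
  by_cases h0 : q.1.val % 2 = 0
  · exact ⟨q, h, by omega⟩
  · refine ⟨A.count.flip q, h.trans (Alternating.right _), ?_⟩
    rw [side_flip_sphere, if_neg h0]
    omega

theorem card_of_sides {u v : A.Point} {j k : ℕ} (hjk : j < k) (hu : u.1.val = 2 * j)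
    (hv : v.1.val = 2 * k) [DecidableEq A.Point] :
    ({u, A.count.flip u, v, A.count.flip v} : Finset A.Point).card = 4 := by
  have h1 := side_flip_sphere u
  have h2 := side_flip_sphere v
  rw [if_pos (by omega)] at h1 h2
  have hne : ∀ {p q : A.Point}, p.1.val ≠ q.1.val → p ≠ q := fun h he => h (by rw [he])
  rw [Finset.card_insert_of_notMem, Finset.card_insert_of_notMem, Finset.card_pair]
  · exact (A.count.flip_ne v).symm
  · simp only [Finset.mem_insert, Finset.mem_singleton, not_or]
    exact ⟨hne (by omega), hne (by omega)⟩
  · simp only [Finset.mem_insert, Finset.mem_singleton, not_or]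
    exact ⟨(A.count.flip_ne u).symm, hne (by omega), hne (by omega)⟩

theorem subset_linked [DecidableEq A.Point] {p u v : A.Point} [DecidablePred (A.Linked p)]
    (hu : A.Linked p u) (hv : A.Linked p v) :
    ({u, A.count.flip u, v, A.count.flip v} : Finset A.Point) ⊆ Finset.univ.filter (A.Linked p) := by
  intro z hz
  simp only [Finset.mem_insert, Finset.mem_singleton] at hz
  refine Finset.mem_filter.2 ⟨Finset.mem_univ _, ?_⟩
  rcases hz with rfl | rfl | rfl | rfl
  · exact hu
  · exact hu.trans (Alternating.right _)
  · exact hv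
  · exact hv.trans (Alternating.right _)

/-- The component of `p` meets exactly the sides of the route around two holes. -/
structure Encircles (A : Curves (standardSurface 0 r)) (p u v : A.Point) (j k : ℕ) : Prop where
  left : u.1.val = 2 * j
  right : v.1.val = 2 * k
  chord_left : A.chord u = A.count.flip v
  chord_right : A.chord v = A.count.flip u
  mem : ∀ z, A.Linked p z → z = u ∨ z = A.count.flip u ∨ z = v ∨ z = A.count.flip v

open Classical in
theorem exists_encircles {p q q' : A.Point} {j k : ℕ} (hjk : j < k)
    (hp : (Finset.univ.filter (A.Linked p)).card = 4) (hq : A.Linked p q) (hq' : A.Linked p q')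
    (hj : q.1.val / 2 = j) (hk : q'.1.val / 2 = k) : ∃ u v, Encircles A p u v j k := by
  obtain ⟨u, hu, hu'⟩ := exists_even_sphere hq
  obtain ⟨v, hv, hv'⟩ := exists_even_sphere hq'
  rw [hj] at hu'
  rw [hk] at hv'
  have hT := Finset.eq_of_subset_of_card_le (subset_linked hu hv)
    (by rw [hp, card_of_sides hjk hu' hv'])
  have hmem : ∀ z, A.Linked p z → z = u ∨ z = A.count.flip u ∨ z = v ∨ z = A.count.flip v := by
    intro z hz
    have := (Finset.ext_iff.1 hT z).2 (Finset.mem_filter.2 ⟨Finset.mem_univ _, hz⟩)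
    simpa using this
  have hfu := side_flip_sphere u
  have hfv := side_flip_sphere v
  rw [if_pos (by omega)] at hfu hfv
  have hne : ∀ {x y : A.Point}, x.1.val ≠ y.1.val → x ≠ y := fun h he => h (by rw [he])
  -- Of the three possible partners of `u`, its own copy across the edge would close a component
  -- without `v`, and `v` would lead to crossing chords. Only the copy of `v` remains.
  have hcu : A.chord u = A.count.flip v := by
    rcases hmem _ (hu.trans (Alternating.left _)) with h | h | h | h
    · exact absurd h (A.chord_ne u)
    · have h' : A.chord (A.count.flip u) = u := by rw [← h, A.chord_chord]
      have := Alternating.map_eq (s := A.chord) (t := A.count.flip)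
        (f := fun z : A.Point => z = u ∨ z = A.count.flip u)
        (fun z => propext ⟨by
          rintro (hz | hz)
          · exact .inr (by rw [← h, ← hz, A.chord_chord])
          · exact .inl (by rw [← h', ← hz, A.chord_chord]), by
          rintro (rfl | rfl)
          · exact .inr h
          · exact .inl h'⟩)
        (fun z => propext ⟨by
          rintro (hz | hz)
          · exact .inr (by rw [← hz, A.count.flip_flip])
          · exact .inl (A.count.flip_injective hz), by
          rintro (rfl | rfl)
          · exact .inr rfl
          · exact .inl (A.count.flip_flip _)⟩) (hu.symm.trans hv)
      rcases (iff_of_eq this).1 (.inl rfl) with h3 | h3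
      · exact absurd h3 (hne (by omega))
      · exact absurd h3 (hne (by omega))
    · have h3 : A.chord (A.count.flip u) = A.count.flip v := by
        rcases hmem _ ((hu.trans (Alternating.right _)).trans (Alternating.left _)) with h4 | h4 | h4 | h4
        · have := A.chord_injective (h4.trans (h ▸ A.chord_chord u).symm)
          exact absurd this (hne (by omega))
        · exact absurd h4 (A.chord_ne _)
        · have := A.chord_injective (h4.trans h.symm)
          exact absurd this (A.count.flip_ne u)
        · exact h4
      refine absurd ?_ (A.noncrossing u (A.count.flip u))
      have b1 : A.count.Before u (A.count.flip u) := .inl (Fin.lt_def.2 (by omega))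
      have b2 : A.count.Before (A.count.flip u) v := .inl (Fin.lt_def.2 (by omega))
      have b3 : A.count.Before v (A.count.flip v) := .inl (Fin.lt_def.2 (by omega))
      have b4 : A.count.Before u v := .inl (Fin.lt_def.2 (by omega))
      refine ⟨?_, ?_⟩
      · rw [h]
        exact .inl ⟨b1, b2⟩
      · rw [h, h3]
        exact .inr (.inr ⟨b4, b3⟩)
    · exact h
  refine ⟨u, v, hu', hv', hcu, ?_, hmem⟩
  rcases hmem _ (hv.trans (Alternating.left _)) with h | h | h | h
  · have : v = A.count.flip v := A.chord_injective (h.trans (hcu ▸ A.chord_chord u).symm)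
    exact absurd this.symm (A.count.flip_ne v)
  · exact h
  · exact absurd h (A.chord_ne v)
  · have := A.chord_injective (h.trans hcu.symm)
    exact absurd this (hne (by omega))

theorem Encircles.partner {p u v z : A.Point} {j k : ℕ} (h : Encircles A p u v j k) (hjk : j < k)
    (hk : k < r) (hz : A.Linked p z) :
    Route.Meets (2 * j) (2 * k + 1) (2 * k) (2 * j + 1) z.1 ∧
      ((A.chord z).1 : ℕ) = Route.partner (2 * j) (2 * k + 1) (2 * k) (2 * j + 1) z.1 := by
  have h1 := side_flip_sphere u
  have h2 := side_flip_sphere v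
  have h3 := h.left
  have h4 := h.right
  rw [if_pos (by omega)] at h1 h2
  have hm : Route.Meets (2 * j) (2 * k + 1) (2 * k) (2 * j + 1) z.1 := by
    unfold Route.Meets
    rcases h.mem z hz with rfl | rfl | rfl | rfl <;> omega
  refine ⟨hm, ?_⟩
  have h5 := (route_sphere hjk hk).partner_cases hm
  have h6 : A.chord (A.count.flip v) = u := by rw [← h.chord_left, A.chord_chord]
  have h7 : A.chord (A.count.flip u) = v := by rw [← h.chord_right, A.chord_chord]
  rcases h.mem z hz with rfl | rfl | rfl | rfl
  · rw [h.chord_left]; omega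
  · rw [h7]; omega
  · rw [h.chord_right]; omega
  · rw [h6]; omega

/-- The components of a representative with the fewest points of parallel curves around the first
hole and another one. -/
theorem exists_encircles_of_isotopic (hr : 4 ≤ r) {k n : ℕ} (hk : k = 1 ∨ k = 2)
    (hi : A.Isotopic ((route_sphere (r := r) (j := 0) (k := k) (by omega) (by omega)).curves n))
    (hcard : Fintype.card A.Point ≤ Fintype.card
      ((route_sphere (r := r) (j := 0) (k := k) (by omega) (by omega)).curves n).Point)
    (p : A.Point) : (∃ u v, Encircles A p u v 0 k) ∨
      r = 4 ∧ ∃ u v, Encircles A p u v (3 - k) 3 := by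
  classical
  have hR := route_sphere (r := r) (j := 0) (k := k) (by omega) (by omega)
  have hn : A.numComp = n := hi.numComp_eq.trans (hR.numComp_eq (hR.hasShape n))
  have hex : ∀ p : A.Point, ∀ i l, i < r → l < r → (i = 0 ∨ i = k) → (l ≠ 0 ∧ l ≠ k) →
      ∃ q, A.Linked p q ∧ (q.1.val / 2 = i ∨ q.1.val / 2 = l) := by
    intro p i l hi' hl h1 h2
    obtain ⟨q, h3, h4⟩ := (Curves.Isotopic.sectionless (hi.symm _ _) (sectionless_sphere
      (by omega) (by omega) hi' hl h1 h2 n)).exists_side_ne_one p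
    exact ⟨q, h3, side_of_holeHolonomy h4⟩
  -- `M p i` says that the component of `p` crosses the edge of hole `i`. For every pair of a hole
  -- among `0, k` and one outside, at least one of the two edges is crossed; so the component
  -- crosses both edges of `0, k` or all the other edges.
  let M (p : A.Point) (i : ℕ) : Prop := ∃ q, A.Linked p q ∧ q.1.val / 2 = i
  have hM : ∀ p, (M p 0 ∧ M p k) ∨ ∀ l < r, l ≠ 0 → l ≠ k → M p l := by
    intro p
    by_cases h0 : M p 0 ∧ M p k
    · exact .inl h0
    · refine .inr fun l hl h1 h2 => ?_
      rw [not_and_or] at h0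
      rcases h0 with h0 | h0
      · obtain ⟨q, h3, h4⟩ := hex p 0 l (by omega) hl (.inl rfl) ⟨h1, h2⟩
        exact ⟨q, h3, h4.resolve_left fun h => h0 ⟨q, h3, h⟩⟩
      · obtain ⟨q, h3, h4⟩ := hex p k l (by omega) hl (.inr rfl) ⟨h1, h2⟩
        exact ⟨q, h3, h4.resolve_left fun h => h0 ⟨q, h3, h⟩⟩
  have hM2 : ∀ p, ∃ i l, i < l ∧ M p i ∧ M p l := by
    intro p
    rcases hM p with h | h
    · exact ⟨0, k, by omega, h.1, h.2⟩
    · exact ⟨3 - k, 3, by omega, h _ (by omega) (by omega) (by omega),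
        h _ (by omega) (by omega) (by omega)⟩
  have hcl := Curves.card_linked_eq (m := 4) (D := A) (fun p => by
    obtain ⟨i, l, hil, ⟨q, h1, h2⟩, ⟨q', h3, h4⟩⟩ := hM2 p
    obtain ⟨u, hu, hu'⟩ := exists_even_sphere h1
    obtain ⟨v, hv, hv'⟩ := exists_even_sphere h3
    rw [← card_of_sides hil (hu'.trans (by rw [h2])) (hv'.trans (by rw [h4]))]
    exact Finset.card_le_card (subset_linked hu hv)) (by
    have h1 := hR.card_curves_le n
    have h2 : ({2 * 0, 2 * k + 1, 2 * k, 2 * 0 + 1} : Finset ℕ).card ≤ 4 := Finset.card_le_four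
    rw [hn]
    exact hcard.trans (h1.trans (Nat.mul_le_mul_right _ h2))) p
  rcases hM p with ⟨⟨q, h1, h2⟩, ⟨q', h3, h4⟩⟩ | h
  · exact .inl (exists_encircles (by omega) hcl h1 h3 h2 h4)
  · obtain ⟨q, h1, h2⟩ := h (3 - k) (by omega) (by omega) (by omega)
    obtain ⟨q', h3, h4⟩ := h 3 (by omega) (by omega) (by omega)
    obtain ⟨u, v, huv⟩ := exists_encircles (by omega) hcl h1 h3 h2 h4
    -- A component with four points crosses only two edges, so crossing all edges other than those
    -- of `0, k` leaves room for exactly four holes.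
    refine .inr ⟨?_, u, v, huv⟩
    by_contra hr4
    obtain ⟨z, hz1, hz2⟩ := h 4 (by omega) (by omega) (by omega)
    have h5 := (huv.partner (by omega) (by omega) hz1).1
    unfold Route.Meets at h5
    omega

/-- The bundle with given holonomies around the first three holes and the inverse of their product
around the fourth. -/
def fourHoleHolonomy {G : Type*} [Group G] (hr : 4 ≤ r) (x y z : G) :
    Holonomy (standardSurface 0 r) G :=
  standardHolonomy 0 1 1 (fun i => if i = 0 then x else if i = 1 then y else if i = 2 then z
    else if i = 3 then (z * y * x)⁻¹ else 1) r (by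
    rw [wordHolonomy_eq 0 1 1 _ (m₀ := 4) (by omega) (fun _ _ => rfl) (fun _ _ => rfl)
      fun i hi => by rw [if_neg (by omega), if_neg (by omega), if_neg (by omega), if_neg (by omega)]]
    simp [wordHolonomy, mul_assoc])

theorem side_fourHoleHolonomy {G : Type*} [Group G] (hr : 4 ≤ r) (x y z : G)
    (s : Fin (standardSurface 0 r).sides) : (fourHoleHolonomy hr x y z).side s =
      if s.val = 0 then x else if s.val = 1 then x⁻¹ else if s.val = 2 then y
      else if s.val = 3 then y⁻¹ else if s.val = 4 then z else if s.val = 5 then z⁻¹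
      else if s.val = 6 then (z * y * x)⁻¹ else if s.val = 7 then z * y * x else 1 := by
  rw [fourHoleHolonomy, standardHolonomy_side, sideHolonomy_sphere]
  generalize s.val = t
  obtain _ | _ | _ | _ | _ | _ | _ | _ | t := t
  iterate 8 simp
  rw [show (t + 8) / 2 = t / 2 + 4 by omega]
  simp

/-- Parallel curves around the first and the third hole have unique representatives with the
fewest points. -/
theorem hasShape_of_isotopic_sphere (hr : 4 ≤ r) {n : ℕ}
    (hi : A.Isotopic ((route_sphere (r := r) (j := 0) (k := 2) (by omega) (by omega)).curves n))
    (hcard : Fintype.card A.Point ≤ Fintype.card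
      ((route_sphere (r := r) (j := 0) (k := 2) (by omega) (by omega)).curves n).Point) :
    A.HasShape (Route.num 0 5 4 1 n) (Route.partner 0 5 4 1) := by
  have hR := route_sphere (r := r) (j := 0) (k := 2) (by omega) (by omega)
  have hn : A.numComp = n := hi.numComp_eq.trans (hR.numComp_eq (hR.hasShape n))
  have key : ∀ p : A.Point, ∃ u v, Encircles A p u v 0 2 := by
    intro p
    refine (exists_encircles_of_isotopic hr (.inr rfl) hi hcard p).resolve_right ?_
    rintro ⟨-, u, v, huv⟩
    -- Two noncommuting transpositions. The holonomies `x, y, x⁻¹` around the first three holes are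
    -- trivial along the curve around the first and third hole, but not along the candidate at the
    -- second and fourth, which is thereby excluded.
    let x : Equiv.Perm (Fin 3) := Equiv.swap 0 1
    let y : Equiv.Perm (Fin 3) := Equiv.swap 1 2
    obtain ⟨f, hf⟩ := hR.exists_section (hR.hasShape n) (ρ := fourHoleHolonomy hr x y x⁻¹)
      (by omega) (fun s t hs ht => by
        rw [side_fourHoleHolonomy, side_fourHoleHolonomy]
        simp [hs, ht])
    obtain ⟨e⟩ := Curves.Isotopic.sections (X := Equiv.Perm (Fin 3)) hi (fourHoleHolonomy hr x y x⁻¹)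
    obtain ⟨f', hf'⟩ := e.symm ⟨f, hf⟩
    have h1 : f' u = (fourHoleHolonomy hr x y x⁻¹).side v.1 • f' v := by
      rw [← hf'.flip, ← huv.chord_left, hf'.chord]
    have h2 : f' v = (fourHoleHolonomy hr x y x⁻¹).side u.1 • f' u := by
      rw [← hf'.flip, ← huv.chord_right, hf'.chord]
    rw [h2, smul_smul, smul_eq_mul, right_eq_mul, side_fourHoleHolonomy, side_fourHoleHolonomy,
      huv.left, huv.right] at h1
    exact absurd h1 (by decide)
  refine hR.hasShape_of_chord (fun p => ?_) (fun p => ?_) hn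
  · obtain ⟨u, v, huv⟩ := key p
    exact (huv.partner (by omega) (by omega) (Alternating.refl p)).1
  · obtain ⟨u, v, huv⟩ := key p
    exact (huv.partner (by omega) (by omega) (Alternating.refl p)).2

/-- The representatives with the fewest points of the curve around the first two holes. -/
theorem hasShape_of_isotopic_sphere_one (hr : 4 ≤ r)
    (hi : A.Isotopic ((route_sphere (r := r) (j := 0) (k := 1) (by omega) (by omega)).curves 1))
    (hcard : Fintype.card A.Point ≤ Fintype.card
      ((route_sphere (r := r) (j := 0) (k := 1) (by omega) (by omega)).curves 1).Point) :
    A.HasShape (Route.num 0 3 2 1 1) (Route.partner 0 3 2 1) ∨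
      A.HasShape (Route.num 4 7 6 5 1) (Route.partner 4 7 6 5) := by
  have hR := route_sphere (r := r) (j := 0) (k := 1) (by omega) (by omega)
  have hn : A.numComp = 1 := hi.numComp_eq.trans (hR.numComp_eq (hR.hasShape 1))
  obtain ⟨⟨p⟩, hl⟩ := Curves.numComp_eq_one_iff.1 hn
  rcases exists_encircles_of_isotopic hr (.inl rfl) hi hcard p with ⟨u, v, huv⟩ | ⟨-, u, v, huv⟩
  · exact .inl (hR.hasShape_of_chord
      (fun q => (huv.partner (by omega) (by omega) (hl p q)).1)
      (fun q => (huv.partner (by omega) (by omega) (hl p q)).2) hn)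
  · exact .inr ((route_sphere (r := r) (j := 2) (k := 3) (by omega) (by omega)).hasShape_of_chord
      (fun q => (huv.partner (by omega) (by omega) (hl p q)).1)
      (fun q => (huv.partner (by omega) (by omega) (hl p q)).2) hn)

end GenusZero

/-! ### Superpositions and smoothings of curves along routes. -/

namespace Layered

variable {F : PolygonSurface} {D : Layered F}

/-- Either curve of an overlay can be taken as the first curve of the superposition. -/
theorem exists_superposed {A B : CurveSystem F} {lower : Bool}
    (h : bif lower then D.IsOverlay B A else D.IsOverlay A B) :
    ∃ (x : A.Point → D.Point) (y : B.Point → D.Point), Curves.Superposed D x y ∧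
      ∀ p, D.top p ↔ (lower = true ↔ p ∉ Set.range x) := by
  cases lower
  · obtain ⟨x, y, hx, hy, hxr, hyr⟩ := h
    exact ⟨x, y, ⟨hx, hy, fun p => by rw [hxr, hyr]; rfl⟩, fun p => by rw [hxr]; simp⟩
  · obtain ⟨y, x, hy, hx, hyr, hxr⟩ := h
    exact ⟨x, y, ⟨hx, hy, fun p => by rw [hxr, hyr]; simp⟩, fun p => by rw [hxr]; simp⟩

end Layered

namespace Route

/-- Positions of a single curve along a route. -/
def onePosition (a b c d i i' j j' s : ℕ) : List ℕ :=
  if s = a then [i] else if s = d then [i'] else if s = c then [j] else if s = b then [j'] else []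

/-- The code of a single curve along a route superimposed with `n` parallel curves along another
route, in the surface of genus `g₀`. -/
def code (g₀ m a b c d a' b' c' d' n : ℕ) (lower : Bool) (i j : ℕ) : Code :=
  .complementary m (standardGlue g₀) (partner a b c d) (partner a' b' c' d') (num a' b' c' d' n)
    (onePosition a b c d i (num a' b' c' d' n a - i) j (num a' b' c' d' n c - j)) lower

variable {g g₀ r : ℕ} {D : Layered (standardSurface g r)} {a b c d a' b' c' d' m n : ℕ}

theorem num_le (a b c d n s : ℕ) : num a b c d n s ≤ n := by
  unfold num
  split_ifs <;> omega

/-- The places `i` and `j` of the single curve on sides `a` and `c` determine the superposition, so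
verifying all of them covers every overlay. -/
theorem verify_spec {X Y : Curves (standardSurface g r)} {x : X.Point → D.Point}
    {y : Y.Point → D.Point} (h : Curves.Superposed D x y)
    (hR : Route (standardSurface g r) a b c d) (hR' : Route (standardSurface g r) a' b' c' d')
    (hX : X.HasShape (num a b c d 1) (partner a b c d))
    (hY : Y.HasShape (num a' b' c' d' n) (partner a' b' c' d')) (hn : n ≤ 9)
    {lower : Bool} (htop : ∀ p, D.top p ↔ (lower = true ↔ p ∉ Set.range x))
    (hm : m ≤ 4 * g + 2 * r) (hgl : ∀ s < m, standardGlue g s = standardGlue g₀ s)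
    (hm' : ∀ s, Meets a b c d s ∨ Meets a' b' c' d' s → s < m)
    {ρ : Holonomy (standardSurface g r) (FreeGroup ℕ)} (letter : ℕ → ℕ × Bool)
    (h1 : ∀ s : Fin (standardSurface g r).sides, Meets a b c d s ∨ Meets a' b' c' d' s →
      ρ.side s = FreeGroup.mk [letter s])
    (h2 : ∀ s t : ℕ, Meets a b c d s ∨ Meets a' b' c' d' s → Meets a b c d t ∨ Meets a' b' c' d' t →
      letter s = letter t → s = t)
    {N : ℕ → ℕ → ℕ} {vals : List ((ℕ → ℕ → ℕ → ℤ) × ℤ)}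
    (hv : ∀ i ≤ num a' b' c' d' n a, ∀ j ≤ num a' b' c' d' n c,
      (code g₀ m a b c d a' b' c' d' n lower i j).verify
        (fun s => FreeGroup.mk [letter s]) (N i j) vals = true) :
    (∃ i j, Fintype.card D.Crossing = N i j) ∧ ∀ v ∈ vals,
      ∑ σ : D.State, v.1 (D.iota σ) (D.mu σ) (Nat.card (D.Component σ)) = v.2 := by
  have ho := hR.order
  have hl := hR.lt
  have hA : a < (standardSurface g r).sides := by omega
  have hC : c < (standardSurface g r).sides := by omega
  have hg := hR.glue
  have hnum : ∀ s : Fin (standardSurface g r).sides, Meets a b c d s → X.count.num s = 1 :=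
    fun s hs => by rw [hX.num, num, if_pos hs]
  obtain ⟨i, hi, hi1, hi2⟩ := h.positions_of_num_eq_one (s := ⟨a, hA⟩) (hnum _ (.inl rfl))
  obtain ⟨j, hj, hj1, hj2⟩ := h.positions_of_num_eq_one (s := ⟨c, hC⟩)
    (hnum _ (.inr (.inr (.inl rfl))))
  rw [hY.num] at hi hj hi2 hj2
  rw [(hg ⟨a, hA⟩).2.2.2 rfl] at hi2
  rw [(hg ⟨c, hC⟩).2.1 rfl] at hj2
  simp only at hi hj hi1 hj1 hi2 hj2
  have hpos : ∀ s, 0 < num a b c d 1 s + num a' b' c' d' n s →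
      Meets a b c d s ∨ Meets a' b' c' d' s := by
    intro s hs
    unfold num at hs
    by_contra! hne
    rw [if_neg hne.1, if_neg hne.2] at hs
    omega
  have : Nonempty D.Point := ⟨x ⟨⟨a, hA⟩, ⟨0, by rw [hnum _ (.inl rfl)]; omega⟩⟩⟩
  have hP : ∀ s : Fin (standardSurface g r).sides, s.val < m → Curves.positions x s =
      onePosition a b c d i (num a' b' c' d' n a - i) j (num a' b' c' d' n c - j) s := by
    intro s _
    unfold onePosition
    split_ifs with k1 k2 k3 k4
    · rw [k1, hi1]
    · rw [k2, hi2]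
    · rw [k3, hj1]
    · rw [k4, hj2]
    · rw [← List.length_eq_zero_iff, Curves.length_positions, hX.num, num, if_neg]
      unfold Meets
      omega
  have := h.verify_spec (m := m) (gl := standardGlue g₀) hX (hR.isShape 1) hY (hR'.isShape n) hm
    (fun s hs => hm' s (hpos s hs)) (fun s hs => hgl s hs)
    (fun s => by have := num_le a b c d 1 s; have := num_le a' b' c' d' n s; omega) htop hP
    (fun s hs => by
      have : ¬ Meets a b c d s := fun h => absurd (hm' s (.inl h)) (by omega)
      unfold Meets at this
      unfold onePosition
      rw [if_neg (by omega), if_neg (by omega), if_neg (by omega), if_neg (by omega)]) letter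
    (fun s hs => h1 s (hpos s hs)) (fun s t hs ht hst => Fin.ext (h2 _ _ (hpos s hs) (hpos t ht) hst))
    (hv i hi j hj)
  exact ⟨⟨i, j, this.1⟩, this.2⟩

end Route

namespace Layered

variable {F : PolygonSurface} {D : Layered F} {a b c d : ℕ}

/-- The arcs of the smoothings of a diagram whose chords follow a route also follow the route, or
return to their side. -/
theorem side_mate (h : Route F a b c d) (hm : ∀ p : D.Point, Route.Meets a b c d p.1)
    (hc : ∀ p : D.Point, ((D.chord p).1 : ℕ) = Route.partner a b c d p.1) (σ : D.State)
    (p : D.Point) : (mate σ p).1 = p.1 ∨ ((mate σ p).1 : ℕ) = Route.partner a b c d p.1 := by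
  -- The route passes the polygon in two families of parallel chords, which coincide when `a = c`.
  -- Chords that cross belong to one family, so smoothed arcs do not change between families.
  let cl (p : D.Point) : Prop := p.1.val = a ∨ p.1.val = b
  have ho := h.order
  have hchord : ∀ p, cl (D.chord p) ↔ cl p := by
    intro p
    have h1 := h.partner_cases (hm p)
    have h2 := hc p
    simp only [cl]
    omega
  have hcross : ∀ p q, D.toChordDiagram.Cross p q → (cl p ↔ cl q) := by
    intro p q hpq
    have h1 := h.partner_cases (hm p)
    have h2 := hc p
    have h3 := h.partner_cases (hm q)
    have h4 := hc q
    obtain ⟨h5, h6⟩ := hpq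
    simp only [StrandCount.Cyc, StrandCount.Before, Fin.lt_def, Fin.ext_iff] at h5 h6
    simp only [cl]
    omega
  have hj := ((joined_iff σ _ _).1 (joined_mate σ p)).map_eq (f := fun v => cl (direction v))
    (fun v => propext (by
      have hs := strandAdj_strand v
      generalize D.strand v = w at hs
      cases hs with
      | bare p h => exact hchord p
      | first g h => exact Iff.rfl
      | last g h => exact Iff.rfl
      | segment g l hl hn =>
        change cl (D.chord l.1.1) ↔ cl g.1.1
        rw [hl.1, hchord]))
    (fun v => propext (by
      rcases v with p | g
      · exact Iff.rfl
      · change cl (smooth σ.full g).1.1 ↔ cl g.1.1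
        unfold smooth
        split
        · exact hchord _
        · split_ifs
          · exact (hcross _ _ g.2).symm
          · exact (hchord _).trans (hcross _ _ g.2).symm))
  have hj : cl p ↔ cl (mate σ p) := iff_of_eq hj
  have h1 := h.partner_cases (hm p)
  have h2 := h.partner_cases (hm (mate σ p))
  simp only [cl] at hj
  rw [Fin.ext_iff]
  omega

end Layered

namespace Route

/-- The contribution to the multiplicity of `j` parallel curves. -/
def multiplicity (j _ f c : ℕ) : ℤ := if c = f + j then (-2) ^ f else 0

/-- Indicates states with more than `j` essential circles. A vanishing sum of these nonnegative
numbers rules such states out. -/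
def excess (j _ f c : ℕ) : ℤ := if c ≤ f + j then 0 else 1

/-- The multiplicities in the product of a curve and `n` parallel ones. -/
def multiplicities (n : ℕ) : List ((ℕ → ℕ → ℕ → ℤ) × ℤ) :=
  (excess (n + 1), 0) :: (List.range (n + 2)).map fun j =>
    (multiplicity j, if j = n + 1 then 1 else 0)

variable {F : PolygonSurface} {a b c d : ℕ} (k : Type*) [CommRing k] [Algebra ℚ k]

/-- Smoothing parallel strands yields arcs that again follow the route, so every state consists of
parallel curves and inessential circles. The multiplicity of `i` parallel curves is a finite sum
over states, given as `1` for `i = n + 1` and `0` otherwise. -/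
theorem starLambda_zero (h : Route F a b c d) {G α : Type*} [Group G] {ρ : Holonomy F G}
    (hρ : ∀ n, (h.curves n).Sectionless ρ) {ρ' : Holonomy F (FreeGroup α)}
    (letter : ℕ → α × Bool)
    (h1 : ∀ s : Fin F.sides, Meets a b c d s → ρ'.side s = FreeGroup.mk [letter s])
    (h2 : ∀ s t : ℕ, Meets a b c d s → Meets a b c d t → letter s = letter t → s = t) {n : ℕ}
    (huniq : ∀ (i : ℕ) (A : CurveSystem F), A.toCurves.Isotopic (h.curves i) →
      Fintype.card A.Point ≤ Fintype.card (h.curves i).Point → A = (h.curves i).toSystem (hρ i))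
    (hD : ∀ D : Layered F, D.IsOverlay ((h.curves 1).toSystem (hρ 1))
      ((h.curves n).toSystem (hρ n)) → Even (Fintype.card D.Crossing) ∧ ∀ v ∈ multiplicities n,
        ∑ σ : D.State, v.1 (D.iota σ) (D.mu σ) (Nat.card (D.Component σ)) = v.2) :
    starLambda k F 0 (((h.curves 1).toSystem (hρ 1)).toModule k)
      (((h.curves n).toSystem (hρ n)).toModule k) =
      ((h.curves (n + 1)).toSystem (hρ (n + 1))).toModule k := by
  obtain ⟨D, ⟨A, B, hA, hB, hA', hB', hAB⟩, hstar⟩ := exists_starCoeff k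
    (Quotient.mk (CurveSystem.isotopy F) ((h.curves 1).toSystem (hρ 1)))
    (Quotient.mk (CurveSystem.isotopy F) ((h.curves n).toSystem (hρ n)))
  have eA := huniq 1 A (Quotient.exact hA) (hA' ((h.curves 1).toSystem (hρ 1)) rfl)
  have eB := huniq n B (Quotient.exact hB) (hB' ((h.curves n).toSystem (hρ n)) rfl)
  subst eA eB
  obtain ⟨heven, hv⟩ := hD D hAB
  have hpt : ∀ p : D.Point, Meets a b c d p.1 ∧ ((D.chord p).1 : ℕ) = partner a b c d p.1 := by
    obtain ⟨x, y, hx, hy, hxr, hyr⟩ := hAB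
    have key : ∀ {i : ℕ} {z : (h.curves i).Point → D.Point},
        (h.curves i).IsSubEmb D.toChordDiagram z → ∀ p, Meets a b c d (z p).1 ∧
          ((D.chord (z p)).1 : ℕ) = partner a b c d (z p).1 := by
      intro i z hz p
      rw [← hz.2, hz.1.2.1, hz.1.2.1]
      exact ⟨meets (h.hasShape i) p, (h.hasShape i).chord p⟩
    intro p
    by_cases hp : D.top p
    · obtain ⟨q, rfl⟩ := (Set.ext_iff.1 hxr p).2 hp
      exact key hx q
    · obtain ⟨q, rfl⟩ := (Set.ext_iff.1 hyr p).2 hp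
      exact key hy q
  have hres : ∀ σ : D.State, ∃ j, Nat.card (D.Component σ) = D.mu σ + j ∧
      D.resolved k σ = ((h.curves j).toSystem (hρ j)).toModule k := by
    intro σ
    obtain ⟨S, hS, hr⟩ := D.resolved_eq k σ
    refine ⟨S.numComp, hS.mu_add_numComp.symm, ?_⟩
    obtain ⟨e, he, -⟩ := hS
    rw [Layered.isSmoothedEmb_iff] at he
    rw [hr, h.eq_mk_of_chord hρ letter h1 h2 S (fun p => by rw [← he.1.2.1]; exact (hpt _).1)
      fun p => by
        rw [← he.1.2.1, ← he.1.2.1 p, he.2]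
        exact Layered.side_mate h (fun p => (hpt p).1) (fun p => (hpt p).2) σ _]
    rfl
  choose j hj hjr using hres
  -- The vanishing sum of `excess` bounds the number of parallel curves, so the finitely many listed
  -- multiplicities account for all states.
  have hle : ∀ σ, j σ ≤ n + 1 := by
    intro σ
    have hs := hv _ (List.mem_cons_self ..)
    simp only [excess] at hs
    have := (Finset.sum_eq_zero_iff_of_nonneg fun σ _ => by split_ifs <;> norm_num).1 hs
    by_contra hlt
    have h0 := ite_eq_left_iff.1 (this σ (Finset.mem_univ _))
    exact one_ne_zero (h0 (by have := hj σ; omega))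
  have hm : ∀ i < n + 2, ∑ σ : D.State, (multiplicity i 0 (D.mu σ) (Nat.card (D.Component σ)) : ℤ) =
      if i = n + 1 then 1 else 0 := fun i hi =>
    hv (multiplicity i, if i = n + 1 then 1 else 0)
      (List.mem_cons_of_mem _ (List.mem_map.2 ⟨i, List.mem_range.2 hi, rfl⟩))
  rw [CurveSystem.toModule, CurveSystem.toModule, starLambda_single, hstar, Layered.bracket_zero,
    heven.neg_one_pow, one_smul]
  have hstate : ∀ σ : D.State, (-2 : k) ^ D.mu σ • D.resolved k σ = ∑ i ∈ Finset.range (n + 2),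
      ((multiplicity i 0 (D.mu σ) (Nat.card (D.Component σ)) : ℤ) : k) •
        ((h.curves i).toSystem (hρ i)).toModule k := by
    intro σ
    rw [Finset.sum_eq_single (j σ)]
    · rw [multiplicity, if_pos (hj σ), hjr]
      push_cast
      rfl
    · intro i _ hi
      rw [multiplicity, if_neg (by have := hj σ; omega), Int.cast_zero, zero_smul]
    · intro hi
      exact absurd (Finset.mem_range.2 (by have := hle σ; omega)) hi
  rw [Finset.sum_congr rfl fun σ _ => hstate σ, Finset.sum_comm]
  rw [Finset.sum_congr rfl fun i hi => by
    rw [← Finset.sum_smul, ← Int.cast_sum, hm i (Finset.mem_range.1 hi)]]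
  rw [Finset.sum_eq_single (n + 1)]
  · rw [if_pos rfl, Int.cast_one, one_smul, CurveSystem.toModule]
  · intro i _ hi
    rw [if_neg hi, Int.cast_zero, zero_smul]
  · intro hi
    exact absurd (Finset.mem_range.2 (by omega)) hi

end Route

/-! ## The order of the second coefficient of the star product -/

/-- Curves `b n` whose products with the curve `γ` show the loop correction. -/
structure TestCurves (k : Type*) [CommRing k] [Algebra ℚ k] {F : PolygonSurface}
    (γ : CurveSystem F) (b : ℕ → CurveSystem F) (M : ℕ → ℤ) : Prop where
  numComp_eq : ∀ n, (b n).numComp = n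
  mul : ∀ n ≤ 2, starLambda k F 0 ((b 1).toModule k) ((b n).toModule k) = (b (n + 1)).toModule k
  unique : ∀ n (B : CurveSystem F), B.toCurves.Isotopic (b n).toCurves → B.size ≤ (b n).size →
    B = b n
  sums : ∀ n ≤ 3, ∀ A : CurveSystem F, A.toCurves.Isotopic γ.toCurves → A.size ≤ γ.size →
    ∀ (D : Layered F) (lower : Bool), (bif lower then D.IsOverlay (b n) A else D.IsOverlay A (b n)) →
      Fintype.card D.Crossing = 2 * n ∧ D.signSum = 8 * n * (-2) ^ n ∧ D.loopSum = M n
  family : IsThreePartFamily fun S => b S.card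
  ne_zero : M 3 + 6 * M 2 + 12 * M 1 + 8 * M 0 ≠ 0

namespace TestCurves

variable {k : Type*} [CommRing k] [Algebra ℚ k] {F : PolygonSurface} {γ : CurveSystem F}
  {b : ℕ → CurveSystem F} {M : ℕ → ℤ}

theorem trivialCharacter_curves (h : TestCurves k γ b M) (n : ℕ) :
    trivialCharacter k F ((b n).toModule k) = (-2) ^ n := by
  rw [CurveSystem.toModule, Layered.trivialCharacter_single]
  exact congrArg _ (h.numComp_eq n)

/-- The diagram behind the star product is unknown, but the test curves have a unique shortest
representative. For `γ` the state sums are given for all representatives that are no larger. -/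
theorem trivialCharacter_starCoeff (h : TestCurves k γ b M) {n : ℕ} (hn : n ≤ 3) (lower : Bool) :
    trivialCharacter k F (bif lower
      then starCoeff k 2 (Quotient.mk (CurveSystem.isotopy F) (b n))
        (Quotient.mk (CurveSystem.isotopy F) γ)
      else starCoeff k 2 (Quotient.mk (CurveSystem.isotopy F) γ)
        (Quotient.mk (CurveSystem.isotopy F) (b n))) =
      oneHalf k * (8 * n * (-2) ^ n) + 2 * (M n : k) := by
  have key : ∃ (A : CurveSystem F) (D : Layered F), A.toCurves.Isotopic γ.toCurves ∧
      A.size ≤ γ.size ∧ (bif lower then D.IsOverlay (b n) A else D.IsOverlay A (b n)) ∧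
      (bif lower
        then starCoeff k 2 (Quotient.mk (CurveSystem.isotopy F) (b n))
          (Quotient.mk (CurveSystem.isotopy F) γ)
        else starCoeff k 2 (Quotient.mk (CurveSystem.isotopy F) γ)
          (Quotient.mk (CurveSystem.isotopy F) (b n))) = D.bracket k 2 := by
    cases lower
    · obtain ⟨D, ⟨A, B, hA, hB, hA', hB', hAB⟩, hs⟩ := exists_starCoeff k
        (Quotient.mk (CurveSystem.isotopy F) γ) (Quotient.mk (CurveSystem.isotopy F) (b n))
      have e := h.unique n B (Quotient.exact hB) (hB' (b n) rfl)
      exact ⟨A, D, Quotient.exact hA, hA' γ rfl, e ▸ hAB, hs 2⟩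
    · obtain ⟨D, ⟨B, A, hB, hA, hB', hA', hAB⟩, hs⟩ := exists_starCoeff k
        (Quotient.mk (CurveSystem.isotopy F) (b n)) (Quotient.mk (CurveSystem.isotopy F) γ)
      have e := h.unique n B (Quotient.exact hB) (hB' (b n) rfl)
      exact ⟨A, D, Quotient.exact hA, hA' γ rfl, e ▸ hAB, hs 2⟩
  obtain ⟨A, D, h1, h2, h3, h4⟩ := key
  obtain ⟨h5, h6, h7⟩ := h.sums n hn A h1 h2 D lower h3
  rw [h4, Layered.trivialCharacter_bracket_two, h5, h6, h7, (even_two_mul n).neg_one_pow, one_mul]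
  push_cast
  rfl

/-- Order at most two would make the double commutator with `b 1` a multiplication. At the trivial
character this is a recurrence for the values at `b 0, …, b 3`; the marker terms satisfy it and the
loop sums do not. -/
theorem not_isDiffOp (h : TestCurves k γ b M) [Nontrivial k] (lower : Bool)
    {f : CurveModule k F →ₗ[k] CurveModule k F}
    (hf : ∀ n, f ((b n).toModule k) = bif lower
      then starCoeff k 2 (Quotient.mk (CurveSystem.isotopy F) (b n))
        (Quotient.mk (CurveSystem.isotopy F) γ)
      else starCoeff k 2 (Quotient.mk (CurveSystem.isotopy F) γ)
        (Quotient.mk (CurveSystem.isotopy F) (b n))) :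
    ¬ IsDiffOp (starLambda k F 0) 2 f := by
  have := algebraRat.charZero k
  intro hop
  obtain ⟨z, hz⟩ := hop ((b 1).toModule k) ((b 1).toModule k)
  have hv : ∀ n ≤ 3, trivialCharacter k F (f ((b n).toModule k)) =
      oneHalf k * (8 * n * (-2) ^ n) + 2 * (M n : k) := fun n hn => by
    rw [hf, h.trivialCharacter_starCoeff hn]
  -- The double commutator applied to `b n`, evaluated with the value `-2` of `b 1`: the
  -- coefficients `1, 4, 4` are those of `(X + 2)²`.
  have hx : ∀ n ≤ 1, trivialCharacter k F (f ((b (n + 2)).toModule k)) +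
      4 * trivialCharacter k F (f ((b (n + 1)).toModule k)) +
      4 * trivialCharacter k F (f ((b n).toModule k)) = trivialCharacter k F z * (-2) ^ n := by
    intro n hn
    have h1 := congrArg (trivialCharacter k F) (LinearMap.congr_fun hz ((b n).toModule k))
    simp only [LinearMap.sub_apply, LinearMap.comp_apply, h.mul n (by omega),
      h.mul (n + 1) (by omega), map_sub, trivialCharacter_mul, h.trivialCharacter_curves] at h1
    linear_combination h1
  have h0 := hx 0 (by omega)
  have h1 := hx 1 (by omega)
  rw [hv _ (by omega), hv _ (by omega), hv _ (by omega)] at h0 h1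
  have h2 := two_mul_oneHalf k
  -- Adding twice the relation for `n = 0` to the one for `n = 1` eliminates `z`. It gives the
  -- coefficients of `(X + 2)³`, which annihilate the marker terms `4 n (-2)^n`.
  have h3 : ((2 * (M 3 + 6 * M 2 + 12 * M 1 + 8 * M 0) : ℤ) : k) = 0 := by
    push_cast at h0 h1 ⊢
    linear_combination h1 + 2 * h0
  rw [Int.cast_eq_zero] at h3
  exact h.ne_zero (by omega)

/-- A term depends only on the size of `S`, so the character turns the alternating sum into a
binomial sum with coefficients of `(X + 2)³`, which is `-2 (M 3 + 6 M 2 + 12 M 1 + 8 M 0)`. -/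
theorem sum_loopTerm_ne_zero (h : TestCurves k γ b M) [Nontrivial k]
    {D : Finset (Fin 3) → Layered F} (hD : ∀ S, (D S).IsOverlay γ (b S.card)) :
    ∑ S : Finset (Fin 3), (-1 : k) ^ S.card •
      starLambda k F 0 ((b Sᶜ.card).toModule k) ((D S).loopTerm k) ≠ 0 := by
  have := algebraRat.charZero k
  intro h0
  have h1 := congrArg (trivialCharacter k F) h0
  have h2 : ∀ S : Finset (Fin 3), trivialCharacter k F ((-1 : k) ^ S.card •
      starLambda k F 0 ((b Sᶜ.card).toModule k) ((D S).loopTerm k)) =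
      (-1) ^ S.card * ((-2) ^ (3 - S.card) * (2 * (M S.card : k))) := by
    intro S
    obtain ⟨h5, -, h7⟩ := h.sums S.card (card_finset_fin_le S) γ (.refl _) le_rfl (D S) false (hD S)
    rw [map_smul, smul_eq_mul, trivialCharacter_mul, h.trivialCharacter_curves,
      Layered.trivialCharacter_loopTerm, h5, h7, (even_two_mul _).neg_one_pow, one_mul,
      Finset.card_compl, Fintype.card_fin]
  rw [map_sum, Finset.sum_congr rfl fun S _ => h2 S, map_zero, ← Finset.powerset_univ,
    Finset.sum_powerset_apply_card fun i =>
      (-1 : k) ^ i * ((-2) ^ (3 - i) * (2 * (M i : k)))] at h1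
  simp only [Finset.card_univ, Fintype.card_fin, Finset.sum_range_succ, Finset.sum_range_zero,
    Nat.choose, nsmul_eq_mul] at h1
  have h3 : ((2 * (M 3 + 6 * M 2 + 12 * M 1 + 8 * M 0) : ℤ) : k) = 0 := by
    push_cast at h1 ⊢
    linear_combination -h1
  rw [Int.cast_eq_zero] at h3
  exact h.ne_zero (by omega)

end TestCurves

namespace Route

variable {F : PolygonSurface} {a b c d : ℕ}

theorem strand_lt {n s i : ℕ} (hi : i < n) : strand a c n s i < n := by
  unfold strand
  split_ifs <;> omega

theorem strand_strand {n s i : ℕ} (hi : i < n) :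
    strand a c n s (strand a c n s i) = i := by
  unfold strand
  split_ifs <;> omega

/-- Parallel curves, each of which is a part. -/
theorem isThreePartFamily (h : Route F a b c d) {G : Type*} [Group G] {ρ : Holonomy F G}
    (hρ : ∀ n, (h.curves n).Sectionless ρ) :
    IsThreePartFamily fun S => (h.curves S.card).toSystem (hρ _) := by
  have hlt : ∀ {n : ℕ} (p : (h.curves n).Point), strand a c n p.1 p.2.val < n := fun p =>
    strand_lt (p.2.isLt.trans_eq (num_eq (h.hasShape _) p))
  have hu : (Finset.univ : Finset (Fin 3)).card = 3 := rfl
  let color (p : (h.curves (Finset.univ : Finset (Fin 3)).card).Point) : Fin 3 :=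
    ⟨strand a c _ p.1 p.2.val, hlt p⟩
  refine ⟨color, fun p => Fin.ext (h.strand_chord (h.hasShape _) p),
    fun p => Fin.ext (h.strand_flip (h.hasShape _) p), fun S => ?_⟩
  -- The strands of the smaller family are assigned, in increasing order, to the colors in `S`.
  let J (p : (h.curves S.card).Point) : Fin 3 :=
    S.orderEmbOfFin rfl ⟨strand a c S.card p.1 p.2.val, hlt p⟩
  have hnum : ∀ p : (h.curves S.card).Point,
      (h.curves (Finset.univ : Finset (Fin 3)).card).count.num p.1 = 3 := fun p => by
    rw [(h.hasShape _).num, num, if_pos (meets (h.hasShape _) p), hu]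
  let e (p : (h.curves S.card).Point) : (h.curves (Finset.univ : Finset (Fin 3)).card).Point :=
    ⟨p.1, ⟨strand a c 3 p.1 (J p), (strand_lt (J p).isLt).trans_eq (hnum p).symm⟩⟩
  have hcolor : ∀ p, color (e p) = J p := fun p => Fin.ext (strand_strand (J p).isLt)
  have hJ : ∀ p q : (h.curves S.card).Point, strand a c S.card p.1 p.2.val =
      strand a c S.card q.1 q.2.val → J p = J q := fun p q hpq => by
    simp only [J, hpq]
  have heq : ∀ p q, p.1 = q.1 → color p = color q → p = q := fun p q h1 h2 =>
    h.eq_of_strand (h.hasShape _) h1 (congrArg Fin.val h2)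
  have hc : ∀ p, e ((h.curves S.card).chord p) = (h.curves _).chord (e p) := fun p => by
    refine heq _ _ (Fin.ext ?_) ?_
    · exact ((h.hasShape _).chord p).trans ((h.hasShape _).chord (e p)).symm
    · rw [hcolor, hJ _ p (h.strand_chord (h.hasShape _) p), ← hcolor]
      exact (Fin.ext (h.strand_chord (h.hasShape _) (e p))).symm
  have hf : ∀ p, e ((h.curves S.card).count.flip p) = (h.curves _).count.flip (e p) := fun p => by
    refine heq _ _ rfl ?_
    rw [hcolor, hJ _ p (h.strand_flip (h.hasShape _) p), ← hcolor]
    exact (Fin.ext (h.strand_flip (h.hasShape _) (e p))).symm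
  refine ⟨e, ⟨⟨fun p q hpq => ?_, fun _ => rfl, hf⟩, hc⟩, ?_⟩
  · rcases hpq with hpq | ⟨h1, h2⟩
    · exact .inl hpq
    · refine .inr ⟨h1, ?_⟩
      have h3 : ∀ q : (h.curves S.card).Point, q.2.val < S.card := fun q =>
        q.2.isLt.trans_eq (num_eq (h.hasShape _) q)
      have h4 := h3 p
      have h5 := h3 q
      have h1' := congrArg Fin.val h1
      have hm : ∀ i j : Fin S.card, (S.orderEmbOfFin rfl i < S.orderEmbOfFin rfl j ↔ i < j) :=
        fun i j => (S.orderEmbOfFin rfl).lt_iff_lt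
      have k1 := hm ⟨_, hlt p⟩ ⟨_, hlt q⟩
      have k2 := hm ⟨_, hlt q⟩ ⟨_, hlt p⟩
      rw [Fin.lt_def, Fin.lt_def] at k1 k2
      have j1 := (J p).isLt
      have j2 := (J q).isLt
      change strand a c 3 p.1 (J p) < strand a c 3 q.1 (J q)
      change (J p).val < (J q).val ↔ strand a c S.card p.1 p.2.val < strand a c S.card q.1 q.2.val at k1
      change (J q).val < (J p).val ↔ strand a c S.card q.1 q.2.val < strand a c S.card p.1 p.2.val at k2
      unfold strand at *
      split_ifs at * <;> omega
  · ext p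
    constructor
    · rintro ⟨q, rfl⟩
      exact (congrArg (· ∈ S) (hcolor q)).mpr (S.orderEmbOfFin_mem rfl _)
    · intro hp
      have hp : color p ∈ S := hp
      obtain ⟨i, hi⟩ : color p ∈ Set.range (S.orderEmbOfFin rfl) := by
        rw [S.range_orderEmbOfFin]
        exact hp
      have hn : (h.curves S.card).count.num p.1 = S.card := by
        rw [(h.hasShape _).num, num, if_pos (meets (h.hasShape _) p)]
      let q : (h.curves S.card).Point :=
        ⟨p.1, ⟨strand a c S.card p.1 i, (strand_lt i.isLt).trans_eq hn.symm⟩⟩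
      refine ⟨q, heq _ _ rfl ?_⟩
      rw [hcolor, ← hi]
      exact congrArg _ (Fin.ext (strand_strand i.isLt))

end Route

namespace Layered

variable {F : PolygonSurface} {D : Layered F}

def loopWeight (_ f c : ℕ) : ℤ := f * (-2) ^ c

/-- For `m` crossings the difference `ζ - ι` is `m - 2ι`. -/
def signWeight (m i _ c : ℕ) : ℤ := ((m : ℤ) - 2 * i) ^ 2 * (-2) ^ c

/-- The state sums of the diagrams of a curve with `n` test curves. -/
def testSums (M : ℕ → ℤ) (n : ℕ) : List ((ℕ → ℕ → ℕ → ℤ) × ℤ) :=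
  [(signWeight (2 * n), 8 * n * (-2) ^ n), (loopWeight, M n)]

theorem of_testSums {M : ℕ → ℤ} {n : ℕ} (hc : Fintype.card D.Crossing = 2 * n)
    (h : ∀ v ∈ testSums M n,
      ∑ σ : D.State, v.1 (D.iota σ) (D.mu σ) (Nat.card (D.Component σ)) = v.2) :
    Fintype.card D.Crossing = 2 * n ∧ D.signSum = 8 * n * (-2) ^ n ∧ D.loopSum = M n := by
  refine ⟨hc, ?_, h (loopWeight, M n) (by simp [testSums])⟩
  refine Eq.trans ?_ (h (signWeight (2 * n), 8 * n * (-2) ^ n) (by simp [testSums]))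
  refine Finset.sum_congr rfl fun σ _ => ?_
  have := D.zeta_add_iota σ
  simp only [signWeight]
  rw [← hc, ← this]
  push_cast
  ring

end Layered

/-! ## Positive genus -/

def handleLetter (s : ℕ) : ℕ × Bool := (s % 2, Nat.blt s 2)

def handleLoops (n : ℕ) : ℤ := if n = 2 then 4 else if n = 3 then -8 else 0

/-- Two parallel curves and `n` parallel curves on a torus, the former on the sides `0` and `2`. -/
def handleCode (n : ℕ) (lower : Bool) : Code :=
  .complementary 4 (standardGlue 1) (Route.partner 0 2 0 2) (Route.partner 1 3 1 3)
    (Route.num 1 3 1 3 n) (fun s => List.range (Route.num 0 2 0 2 2 s)) lower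

set_option maxRecDepth 100000 in
theorem verify_handleCode : ∀ n ≤ 3, ∀ lower, (handleCode n lower).verify
    (fun s => FreeGroup.mk [handleLetter s]) (2 * n) (Layered.testSums handleLoops n) = true := by
  decide +kernel

set_option maxRecDepth 100000 in
theorem verify_handle_parallel : ∀ n ≤ 2, ∀ i ≤ n, ∀ j ≤ n,
    (Route.code 1 4 1 3 1 3 1 3 1 3 n false i j).verify
      (fun s => FreeGroup.mk [handleLetter s]) 0 (Route.multiplicities n) = true := by
  decide +kernel

section PositiveGenus

variable {g r : ℕ}

/-- The bundle with free holonomies along the first handle. -/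
def freeHandleHolonomy (hg : 1 ≤ g) (hr : 2 ≤ g + r) {G : Type*} [Group G] (x y : G) :
    Holonomy (standardSurface g r) G :=
  -- The commutator of `x` and `y` is absorbed by a second handle, or by the first hole if the genus
  -- is one. This leaves `x` and `y` free, and it is where a further handle or a hole is needed.
  standardHolonomy g (fun i => if i = 0 then x else if i = 1 then y⁻¹ else 1)
    (fun i => if i = 0 then y else if i = 1 then x⁻¹ else 1)
    (fun i => if i = 0 ∧ g = 1 then (y * x⁻¹ * y⁻¹ * x)⁻¹ else 1) r (by
    rw [wordHolonomy_eq _ _ _ _ hr (fun i hi => by rw [if_neg (by omega), if_neg (by omega)])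
      (fun i hi => by rw [if_neg (by omega), if_neg (by omega)])
      (fun i hi => by rw [if_neg (by omega)])]
    rw [wordHolonomy, wordHolonomy, wordHolonomy, if_pos (by omega : 0 < g)]
    by_cases h : g = 1
    · rw [if_neg (by omega)]
      simp [h, mul_assoc]
    · rw [if_pos (by omega)]
      simp [mul_assoc])

theorem side_freeHandleHolonomy (hg : 1 ≤ g) (hr : 2 ≤ g + r)
    (s : Fin (standardSurface g r).sides) (hs : s.val < 4) :
    (freeHandleHolonomy hg hr (FreeGroup.of 0) (FreeGroup.of 1)).side s =
      FreeGroup.mk [handleLetter s] := by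
  rw [freeHandleHolonomy, standardHolonomy_side, sideHolonomy, if_pos (by omega)]
  rcases (by omega : s.val = 0 ∨ s.val = 1 ∨ s.val = 2 ∨ s.val = 3) with h | h | h | h <;>
    rw [h] <;> rfl

theorem handleLetter_injective {s t : ℕ} (hs : s < 4) (ht : t < 4)
    (h : handleLetter s = handleLetter t) : s = t := by
  interval_cases s <;> interval_cases t <;> first | rfl | exact absurd h (by decide)

/-- Two parallel copies are taken for `γ`: with one copy, which meets every test curve once, each
state is a single circle of intersection number `±1` with a test curve, and no inessential circle
appears. The curves `γ` and `b n` meet different sides, so their superposition is unique; for `b 1`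
and `b n` all shuffles are verified. -/
theorem testCurves_torus (k : Type*) [CommRing k] [Algebra ℚ k] (hg : 1 ≤ g) (hr : 2 ≤ g + r) :
    TestCurves k
      (((route_torus (r := r) hg (e := 0) (by omega)).curves 2).toSystem
        (sectionless_torus hg (by omega) 2))
      (fun n => ((route_torus (r := r) hg (e := 1) (by omega)).curves n).toSystem
        (sectionless_torus hg (by omega) n)) handleLoops := by
  have hR : Route (standardSurface g r) 1 3 1 3 := route_torus hg (by omega)
  have hR' : Route (standardSurface g r) 0 2 0 2 := route_torus hg (by omega)
  have hglue : ∀ s < 4, standardGlue g s = standardGlue 1 s := by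
    intro s hs
    unfold standardGlue
    split_ifs <;> omega
  have huniq : ∀ (n : ℕ) (B : CurveSystem (standardSurface g r)), B.toCurves.Isotopic (hR.curves n) →
      B.size ≤ Fintype.card (hR.curves n).Point →
        B = (hR.curves n).toSystem (sectionless_torus hg (by omega) n) := fun n B h1 h2 =>
    CurveSystem.ext_curves ((hasShape_of_isotopic_torus hg (by omega) h1 h2).eq (hR.hasShape n)
      (hR.isShape n))
  have hlt : ∀ s, Route.Meets 1 3 1 3 s → s < 4 := fun s hs => by
    unfold Route.Meets at hs
    omega
  have hlt' : ∀ s, Route.Meets 0 2 0 2 s → s < 4 := fun s hs => by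
    unfold Route.Meets at hs
    omega
  refine ⟨fun n => hR.numComp_eq (hR.hasShape n), fun n hn => ?_, huniq,
    fun n hn A h1 h2 D lower hD => ?_, hR.isThreePartFamily _, by decide⟩
  · refine hR.starLambda_zero k _ (ρ' := freeHandleHolonomy hg hr (FreeGroup.of 0) (FreeGroup.of 1))
      handleLetter (fun s hs => side_freeHandleHolonomy hg hr s (hlt s hs))
      (fun s t hs ht => handleLetter_injective (hlt s hs) (hlt t ht)) huniq fun D hD => ?_
    obtain ⟨x, y, hxy, htop⟩ := Layered.exists_superposed (lower := false) hD
    obtain ⟨⟨i, j, hc⟩, hv⟩ := Route.verify_spec (g₀ := 1) (m := 4) hxy hR hR (hR.hasShape 1)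
      (hR.hasShape n) (by omega) htop (by omega) hglue (fun s hs => hs.elim (hlt s) (hlt s)) handleLetter
      (fun s hs => side_freeHandleHolonomy hg hr s (hs.elim (hlt s) (hlt s)))
      (fun s t hs ht => handleLetter_injective (hs.elim (hlt s) (hlt s)) (ht.elim (hlt t) (hlt t)))
      (N := fun _ _ => 0) (fun i hi j hj => verify_handle_parallel n hn i
        (hi.trans (Route.num_le ..)) j (hj.trans (Route.num_le ..)))
    exact ⟨hc ▸ Even.zero, hv⟩
  · have hA : A.HasShape (Route.num 0 2 0 2 2) (Route.partner 0 2 0 2) :=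
      hasShape_of_isotopic_torus hg (by omega) h1 h2
    obtain ⟨x, y, hxy, htop⟩ := Layered.exists_superposed hD
    have hAnum : ∀ s, A.count.num s = Route.num 0 2 0 2 2 s := hA.num
    have : Nonempty D.Point := ⟨x ⟨⟨0, by change 0 < 4 * g + 2 * r; omega⟩, ⟨0, by
      rw [hAnum]; exact Nat.zero_lt_two⟩⟩⟩
    have hpos : ∀ s, 0 < Route.num 0 2 0 2 2 s + Route.num 1 3 1 3 n s → s < 4 := by
      intro s hs
      unfold Route.num at hs
      by_contra! hne
      rw [if_neg fun h => by have := hlt' s h; omega, if_neg fun h => by have := hlt s h; omega] at hs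
      omega
    have := hxy.verify_spec (m := 4) (gl := standardGlue 1)
      (P := fun s => List.range (Route.num 0 2 0 2 2 s)) hA (hR'.isShape 2) (hR.hasShape n)
      (hR.isShape n) (by change 4 ≤ 4 * g + 2 * r; omega) hpos (fun s hs => hglue s hs)
      (fun s => by
        have := Route.num_le 0 2 0 2 2 s
        have := Route.num_le 1 3 1 3 n s
        omega) htop (fun s hs => by
        by_cases h0 : Route.num 1 3 1 3 n s = 0
        · rw [hxy.positions_of_num_eq_zero (((hR.hasShape n).num s).trans h0), hAnum]
        · have h3 : Route.num 0 2 0 2 2 s = 0 := by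
            have := (Route.num_pos (Nat.pos_of_ne_zero h0)).1
            unfold Route.Meets at this
            rw [Route.num, if_neg]
            unfold Route.Meets
            omega
          have h4 : Curves.positions x s = [] := by
            rw [← List.length_eq_zero_iff, Curves.length_positions, hAnum, h3]
          rw [h4, h3]
          rfl)
      (fun s hs => by
        rw [Route.num, if_neg fun h => by have := hlt' s h; omega]
        rfl) handleLetter
      (fun s hs => side_freeHandleHolonomy hg hr s (hpos s hs))
      (fun s t hs ht hst => Fin.ext (handleLetter_injective (hpos s hs) (hpos t ht) hst))
      (verify_handleCode n hn lower)
    exact Layered.of_testSums this.1 this.2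

end PositiveGenus

/-! ## Genus zero -/

def holeLetter (s : ℕ) : ℕ × Bool := (s / 2, Nat.beq (s % 2) 0)

def holeLoops (n : ℕ) : ℤ := if n = 2 then -16 else if n = 3 then 32 else 0

set_option maxRecDepth 100000 in
theorem verify_hole_left : ∀ n ≤ 3, ∀ lower, ∀ i ≤ Route.num 0 5 4 1 n 0,
    ∀ j ≤ Route.num 0 5 4 1 n 2, (Route.code 0 8 0 3 2 1 0 5 4 1 n lower i j).verify
      (fun s => FreeGroup.mk [holeLetter s]) (2 * n) (Layered.testSums holeLoops n) = true := by
  decide +kernel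

set_option maxRecDepth 100000 in
theorem verify_hole_right : ∀ n ≤ 3, ∀ lower, ∀ i ≤ Route.num 0 5 4 1 n 4,
    ∀ j ≤ Route.num 0 5 4 1 n 6, (Route.code 0 8 4 7 6 5 0 5 4 1 n lower i j).verify
      (fun s => FreeGroup.mk [holeLetter s]) (2 * n) (Layered.testSums holeLoops n) = true := by
  decide +kernel

set_option maxRecDepth 100000 in
theorem verify_hole_parallel : ∀ n ≤ 2, ∀ i ≤ n, ∀ j ≤ n,
    (Route.code 0 8 0 5 4 1 0 5 4 1 n false i j).verify
      (fun s => FreeGroup.mk [holeLetter s]) (2 * (i - j + (j - i)))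
      (Route.multiplicities n) = true := by
  decide +kernel

section GenusZero

variable {r : ℕ}

/-- The bundle with free holonomies around the first three holes. -/
def freeLeftHolonomy (hr : 4 ≤ r) : Holonomy (standardSurface 0 r) (FreeGroup ℕ) :=
  fourHoleHolonomy hr (.of 0) (.of 1) (.of 2)

/-- The bundle with free holonomies around three of the first four holes. -/
def freeRightHolonomy (hr : 4 ≤ r) : Holonomy (standardSurface 0 r) (FreeGroup ℕ) :=
  -- The second hole, whose edge is not crossed by the curves in question, absorbs the product, so
  -- that the fourth hole gets a free letter.
  fourHoleHolonomy hr (.of 0) ((FreeGroup.of 2)⁻¹ * (FreeGroup.of 3)⁻¹ * (FreeGroup.of 0)⁻¹) (.of 2)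

theorem side_freeLeftHolonomy (hr : 4 ≤ r) (s : Fin (standardSurface 0 r).sides) (hs : s.val < 6) :
    (freeLeftHolonomy hr).side s = FreeGroup.mk [holeLetter s] := by
  rw [freeLeftHolonomy, side_fourHoleHolonomy]
  generalize s.val = t at hs
  interval_cases t <;> rfl

theorem side_freeRightHolonomy (hr : 4 ≤ r) (s : Fin (standardSurface 0 r).sides) (hs : s.val < 8)
    (h2 : s.val ≠ 2) (h3 : s.val ≠ 3) :
    (freeRightHolonomy hr).side s = FreeGroup.mk [holeLetter s] := by
  rw [freeRightHolonomy, side_fourHoleHolonomy]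
  rw [show (FreeGroup.of 2 * ((FreeGroup.of 2)⁻¹ * (FreeGroup.of 3)⁻¹ * (FreeGroup.of 0)⁻¹) *
    FreeGroup.of 0 : FreeGroup ℕ) = (FreeGroup.of 3)⁻¹ by group]
  generalize s.val = t at *
  interval_cases t <;> first | rfl | contradiction

theorem holeLetter_injective {s t : ℕ} (h : holeLetter s = holeLetter t) : s = t := by
  obtain ⟨h1, h2⟩ := Prod.ext_iff.1 h
  simp only [holeLetter] at h1 h2
  have h3 : s % 2 = 0 ↔ t % 2 = 0 := by rw [← Nat.beq_eq, h2, Nat.beq_eq]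
  omega

/-- On a sphere with four holes a curve around the first two holes also surrounds the last two, so
there may be two shortest representatives of `γ`. Each is treated with free letters at the holes
whose edges it or the test curves cross. -/
theorem testCurves_sphere (k : Type*) [CommRing k] [Algebra ℚ k] (hr : 4 ≤ r) :
    TestCurves k
      (((route_sphere (r := r) (j := 0) (k := 1) (by omega) (by omega)).curves 1).toSystem
        (sectionless_sphere (i := 0) (l := 2) (by omega) (by omega) (by omega) (by omega) (by omega)
          (by omega) 1))
      (fun n => ((route_sphere (r := r) (j := 0) (k := 2) (by omega) (by omega)).curves n).toSystem
        (sectionless_sphere (i := 0) (l := 1) (by omega) (by omega) (by omega) (by omega) (by omega)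
          (by omega) n)) holeLoops := by
  have hR : Route (standardSurface 0 r) 0 5 4 1 := route_sphere (j := 0) (k := 2) (by omega) (by omega)
  have hL : Route (standardSurface 0 r) 0 3 2 1 := route_sphere (j := 0) (k := 1) (by omega) (by omega)
  have hL' : Route (standardSurface 0 r) 4 7 6 5 :=
    route_sphere (j := 2) (k := 3) (by omega) (by omega)
  have hρ : ∀ n, (hR.curves n).Sectionless (holeHolonomy (r := r) (j := 0) (k := 1) (by omega)
      (by omega)) := fun n => sectionless_sphere (j := 0) (k := 2) (by omega) (by omega) (by omega) (by omega)
        (by omega) (by omega) n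
  have huniq : ∀ (n : ℕ) (B : CurveSystem (standardSurface 0 r)), B.toCurves.Isotopic (hR.curves n) →
      B.size ≤ Fintype.card (hR.curves n).Point → B = (hR.curves n).toSystem (hρ n) :=
    fun n B h1 h2 => CurveSystem.ext_curves ((hasShape_of_isotopic_sphere hr h1 h2).eq
      (hR.hasShape n) (hR.isShape n))
  have hlt : ∀ s, Route.Meets 0 5 4 1 s → s < 6 := fun s hs => by
    unfold Route.Meets at hs
    omega
  have hltL : ∀ s, Route.Meets 0 3 2 1 s ∨ Route.Meets 0 5 4 1 s → s < 6 := fun s hs => by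
    unfold Route.Meets at hs
    omega
  have hltL' : ∀ s, Route.Meets 4 7 6 5 s ∨ Route.Meets 0 5 4 1 s → s < 8 ∧ s ≠ 2 ∧ s ≠ 3 :=
    fun s hs => by
      unfold Route.Meets at hs
      omega
  refine ⟨fun n => hR.numComp_eq (hR.hasShape n), fun n hn => ?_, huniq,
    fun n hn A h1 h2 D lower hD => ?_, hR.isThreePartFamily hρ, by decide⟩
  · refine hR.starLambda_zero k hρ (ρ' := freeLeftHolonomy hr)
      holeLetter (fun s hs => side_freeLeftHolonomy hr s (hlt s hs))
      (fun s t _ _ => holeLetter_injective) huniq fun D hD => ?_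
    obtain ⟨x, y, hxy, htop⟩ := Layered.exists_superposed (lower := false) hD
    obtain ⟨⟨i, j, hc⟩, hv⟩ := Route.verify_spec (g₀ := 0) (m := 8) hxy hR hR (hR.hasShape 1)
      (hR.hasShape n) (by omega) htop (by omega) (fun _ _ => rfl)
      (fun s hs => (hs.elim (hlt s) (hlt s)).trans (by omega)) holeLetter
      (fun s hs => side_freeLeftHolonomy hr s (hs.elim (hlt s) (hlt s)))
      (fun s t _ _ => holeLetter_injective)
      (N := fun i j => 2 * (i - j + (j - i))) (fun i hi j hj => verify_hole_parallel n hn i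
        (hi.trans (Route.num_le ..)) j (hj.trans (Route.num_le ..)))
    exact ⟨hc ▸ even_two_mul _, hv⟩
  · obtain ⟨x, y, hxy, htop⟩ := Layered.exists_superposed hD
    rcases hasShape_of_isotopic_sphere_one hr h1 h2 with hA | hA
    · obtain ⟨⟨_, _, hc⟩, hv⟩ := Route.verify_spec (g₀ := 0) (m := 8) hxy hL hR hA
        (hR.hasShape n) (by omega) htop (by omega) (fun _ _ => rfl)
        (fun s hs => (hltL s hs).trans (by omega)) holeLetter
        (fun s hs => side_freeLeftHolonomy hr s (hltL s hs)) (fun s t _ _ => holeLetter_injective)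
        (N := fun _ _ => 2 * n) (verify_hole_left n hn lower)
      exact Layered.of_testSums hc hv
    · obtain ⟨⟨_, _, hc⟩, hv⟩ := Route.verify_spec (g₀ := 0) (m := 8) hxy hL' hR hA
        (hR.hasShape n) (by omega) htop (by omega) (fun _ _ => rfl)
        (fun s hs => (hltL' s hs).1) holeLetter
        (fun s hs => side_freeRightHolonomy hr s (hltL' s hs).1 (hltL' s hs).2.1 (hltL' s hs).2.2)
        (fun s t _ _ => holeLetter_injective)
        (N := fun _ _ => 2 * n) (verify_hole_right n hn lower)
      exact Layered.of_testSums hc hv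

end GenusZero

namespace TestCurves

variable {k : Type*} [CommRing k] [Algebra ℚ k] {F : PolygonSurface} {γ : CurveSystem F}
  {b : ℕ → CurveSystem F} {M : ℕ → ℤ} [Nontrivial k]

theorem not_isDiffOp_left (h : TestCurves k γ b M) : ¬ IsDiffOp (starLambda k F 0) 2
    (starLambda k F 2 (Finsupp.single (Quotient.mk (CurveSystem.isotopy F) γ) 1)) :=
  h.not_isDiffOp false fun n => by
    rw [CurveSystem.toModule, starLambda_single, cond_false]

theorem not_isDiffOp_right (h : TestCurves k γ b M) : ¬ IsDiffOp (starLambda k F 0) 2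
    ((starLambda k F 2).flip (Finsupp.single (Quotient.mk (CurveSystem.isotopy F) γ) 1)) :=
  h.not_isDiffOp true fun n => by
    rw [LinearMap.flip_apply, CurveSystem.toModule, starLambda_single, cond_true]

end TestCurves

theorem exists_testCurves (k : Type*) [CommRing k] [Algebra ℚ k] {g r : ℕ} (hF : 3 < 3 * g + r) :
    ∃ (γ : CurveSystem (standardSurface g r)) (b : ℕ → CurveSystem (standardSurface g r))
      (M : ℕ → ℤ), TestCurves k γ b M := by
  rcases Nat.eq_zero_or_pos g with h | hg
  · subst h
    exact ⟨_, _, _, testCurves_sphere k (by omega)⟩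
  · exact ⟨_, _, _, testCurves_torus k hg (by omega)⟩

theorem mainTheorem8 (k : Type*) [CommRing k] [Nontrivial k] [Algebra ℚ k] (g r : ℕ)
    (hF : 3 < 3 * g + r) :
    -- `λ_2` restricted to either variable is not a differential operator of order at most two
    (∃ γ : CurveClass (standardSurface g r),
      ¬ IsDiffOp (starLambda k (standardSurface g r) 0) 2
        (starLambda k (standardSurface g r) 2 (Finsupp.single γ 1))) ∧
    (∃ γ : CurveClass (standardSurface g r),
      ¬ IsDiffOp (starLambda k (standardSurface g r) 0) 2
        ((starLambda k (standardSurface g r) 2).flip (Finsupp.single γ 1))) ∧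
    -- the second order term of the bracket is the principal term plus the loop correction term
    (∀ D : Layered (standardSurface g r),
      D.bracket k 2 = D.principalTerm k Finset.univ + D.loopTerm k) ∧
    -- the principal term satisfies the commutator condition of order two on diagrams
    (∀ (D : Layered (standardSurface g r)) (color : D.Point → Fin 3),
      (∀ p, color (D.chord p) = color p) → (∀ p, color (D.count.flip p) = color p) →
      ∑ S : Finset (Fin 3), (-1 : k) ^ S.card • D.principalTerm k (D.crossingsOn color S) = 0) ∧
    -- the loop correction term does not
    (∃ (G : CurveSystem (standardSurface g r))
      (N : Finset (Fin 3) → CurveSystem (standardSurface g r))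
      (D : Finset (Fin 3) → Layered (standardSurface g r)),
      IsThreePartFamily N ∧ (∀ S, (D S).IsOverlay G (N S)) ∧
      ∑ S : Finset (Fin 3), (-1 : k) ^ S.card •
        starLambda k (standardSurface g r) 0 ((N Sᶜ).toModule k) ((D S).loopTerm k) ≠ 0) := by
  obtain ⟨γ, b, M, h⟩ := exists_testCurves k hF
  -- Any superpositions will do, since the loop sums are known for every overlay.
  choose D hD using fun S : Finset (Fin 3) => Layered.exists_isOverlay γ (b S.card)
  exact ⟨⟨_, h.not_isDiffOp_left⟩, ⟨_, h.not_isDiffOp_right⟩, fun D => D.bracket_two k,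
    fun D color _ _ => D.sum_principalTerm k color, γ, fun S => b S.card, D, h.family, hD,
    h.sum_loopTerm_ne_zero hD⟩
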